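/- Let $n\ge 3$ and let $M$ be an even integral lattice of signature $(2,n)$, with bilinear form extended to $M_{\mathbb C}$. Put $|Z|^2=\tfrac12 Z\cdot\overline Z$, let $\mathcal D=\{[Z]\in\mathbb P(M_{\mathbb C}) : Z\cdot Z=0,\ Z\cdot\overline Z>0\}^+$ be one of the two components, and let $\Gamma$ be a finite index subgroup of the group $\mathrm O^+(M)$ of isometries of $M$ preserving $\mathcal D$. Let $\mathcal L$ be the tautological line bundle, with fibre $\mathbb CZ$ at $[Z]$, and $\mathcal E=\mathcal L^\perp/\mathcal L$, with fibre $Z^\perp/\mathbb CZ$ and the induced non-degenerate pairing $\mathrm{tr}:\mathcal E\otimes\mathcal E\to\mathcal O$. Sections of $\mathcal L^k\otimes\mathcal E^{\otimes s}$ are identified with multi-differentials $F=\sum_I F_I\,dZ_{i_1}\otimes\cdots\otimes dZ_{i_s}$ on the affine cone over $\mathcal D$ with $F_I$ homogeneous of degree $-k$, whose contractions with $\sum_i Z_i\partial_{Z_i}$ vanish, modulo $d(Z\cdot Z)$. On smooth sections let $$\mathsf L(F)=\sum_{I,j}\frac{\partial F_I}{\partial\overline Z_j}\,dZ_I\otimes\big(|Z|^2dZ_j-Z_j\,\partial(|Z|^2)\big),\qquad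 \mathsf L:\mathcal L^k\otimes\mathcal E^{\otimes s}\to\mathcal L^{k-1}\otimes\mathcal E^{\otimes(s+1)},$$ and for a section $f$ of $\mathcal L^{\ell}$ let $\mathsf R(f)=|Z|^{-2\ell}\partial(|Z|^{2\ell}f)$. Fix $\ell>0$ and a non-zero modular form $f$ of weight $\ell$ and rank $0$ for $\Gamma$, that is, a $\Gamma$-invariant holomorphic section of $\mathcal L^\ell$, and let $\mathcal H=\{f=0\}\subset\mathcal D$ (the form $f$ may vanish to higher order). For $e\in\mathbb Z$ a smooth section $F$ over $\mathcal D\setminus\mathcal H$ has pole order $\le e$ along $\mathcal H$ if $h^eF$ extends to a smooth section over $U$ for every open $U$ and every reduced local equation $h$ of $\mathcal H$ on $U$. For $k\in\mathbb Z$, $s\ge 0$: * $\mathsf{Mod}^{\log}_{k,s}(\Gamma)$ is the space of $\Gamma$-invariant meromorphic sections of $\mathcal L^k\otimes\mathcal E^{\otimes s}$ with pole of order $\le k$ along $\mathcal H$ and no other poles. * $\mathsf{AHMod}^{\log}_{k,s}(\Gamma)$ is the space of $\Gamma$-invariant smooth sections $F$ of $\mathcal L^k\otimes\mathcal E^{\otimes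 s}$ over $\mathcal D\setminus\mathcal H$ such that $\mathsf L^dF=0$ for some $d$ and $\mathsf L^d(F)$ has pole order $\le k-d$ along $\mathcal H$ for all $d\ge 0$. Let $\mathsf{Mod}^{\log}_{k-d,s+d}(\Gamma)^{S_d}\subset\mathsf{Mod}^{\log}_{k-d,s+d}(\Gamma)$ be the subspace of forms invariant under permutations of the last $d$ tensor factors, let $G=\frac1\ell\,\mathsf R(f)/f$, and let $\langle F_d,G^{\otimes d}\rangle$ denote the contraction, by $\mathrm{tr}$, of the last $d$ factors of $F_d$ with the factors of $G^{\otimes d}$. Then there is an isomorphism of complex vector spaces $$\bigoplus_{d=0}^{k}\mathsf{Mod}^{\log}_{k-d,s+d}(\Gamma)^{S_d}\ \xrightarrow{\ \cong\ }\ \mathsf{AHMod}^{\log}_{k,s}(\Gamma)$$ whose restriction to the $d$-th summand is $F_d\mapsto\langle F_d,G^{\otimes d}\rangle$ (for $k<0$ the direct sum is empty, so that $\mathsf{AHMod}^{\log}_{k,s}(\Gamma)=0$). -/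

import Mathlib

open scoped ContDiff Topology DirectSum

noncomputable section

namespace OrthogonalForms

/-! ### The lattice, the affine cone and the second Hodge bundle -/

/-- The complexification `M_ℂ` of a lattice `M = ℤ^{n+2}`. -/
abbrev V (n : ℕ) : Type := Fin (n + 2) → ℂ

/-- An even integral lattice of signature `(2,n)`, given by its Gram matrix in a `ℤ`-basis. -/
structure EvenLattice (n : ℕ) where
  gram : Matrix (Fin (n + 2)) (Fin (n + 2)) ℤ
  symm : gram.IsSymm
  even : ∀ x : Fin (n + 2) → ℤ, Even (x ⬝ᵥ gram.mulVec x)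
  sig_pos : sigPos (gram.map (Int.cast : ℤ → ℝ)).toQuadraticForm' = 2
  sig_neg : sigNeg (gram.map (Int.cast : ℤ → ℝ)).toQuadraticForm' = n

namespace EvenLattice

variable {n : ℕ} (M : EvenLattice n)

/-- The `ℂ`-bilinear pairing `Z · W` on `M_ℂ`. -/
def pair : LinearMap.BilinForm ℂ (V n) :=
  Matrix.toBilin' (M.gram.map (Int.cast : ℤ → ℂ))

/-- `|Z|² = ½ Z · Z̄` (a real number, here viewed in `ℂ`). -/
def normSq (Z : V n) : ℂ := M.pair Z (star Z) / 2

/-- `{Z ∈ M_ℂ : Z · Z = 0, Z · Z̄ > 0}`, the union of the two components of the affine cone. -/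
def isotropicPositive : Set (V n) :=
  {Z | M.pair Z Z = 0 ∧ 0 < (M.pair Z (star Z)).re}

/-- The hyperplane `Z^⊥`. -/
def perp (Z : V n) : Submodule ℂ (V n) := LinearMap.ker (M.pair Z)

/-- The fibre `Z^⊥ / ℂ Z` of the second Hodge bundle `𝓔`. -/
abbrev E (Z : V n) : Type :=
  ↥(M.perp Z) ⧸ ((ℂ ∙ Z).comap (M.perp Z).subtype)

/-- The class in `Z^⊥ / ℂ Z` of a vector of `Z^⊥`. -/
abbrev cls (Z : V n) : ↥(M.perp Z) →ₗ[ℂ] M.E Z :=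
  ((ℂ ∙ Z).comap (M.perp Z).subtype).mkQ

lemma pair_comm (Z W : V n) : M.pair Z W = M.pair W Z := by
  have h : (M.gram.map (Int.cast : ℤ → ℂ)).IsSymm := M.symm.map _
  simp only [pair, Matrix.toBilin'_apply']
  rw [Matrix.dotProduct_mulVec, ← Matrix.mulVec_transpose, h.eq, dotProduct_comm]

lemma mem_perp {Z w : V n} : w ∈ M.perp Z ↔ M.pair Z w = 0 := LinearMap.mem_ker

lemma gram_det_ne_zero : (M.gram.map (Int.cast : ℤ → ℂ)).det ≠ 0 := by
  have hR : (M.gram.map (Int.cast : ℤ → ℝ)).det ≠ 0 := by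
    intro h0
    obtain ⟨x, hx, hx0⟩ := Matrix.exists_mulVec_eq_zero_iff.mpr h0
    set Q := (M.gram.map (Int.cast : ℤ → ℝ)).toQuadraticForm' with hQ
    have hsum := QuadraticForm.sigPos_add_sigNeg_add_radical (Q := Q)
    rw [M.sig_pos, M.sig_neg] at hsum
    have hfin : Module.finrank ℝ Q.radical = 0 := by
      simp at hsum; omega
    have hQa : ∀ y, Q y = y ⬝ᵥ (M.gram.map (Int.cast : ℤ → ℝ)).mulVec y := fun y => by
      simp [hQ, Matrix.toQuadraticForm', Matrix.toLinearMap₂'_apply']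
    have hsym : ((M.gram.map (Int.cast : ℤ → ℝ))).IsSymm := M.symm.map _
    have hmem : x ∈ Q.radical := by
      refine ⟨by rw [hQa, hx0, dotProduct_zero], LinearMap.ext fun y => ?_⟩
      have h1 : x ⬝ᵥ (M.gram.map (Int.cast : ℤ → ℝ)).mulVec y = 0 := by
        rw [Matrix.dotProduct_mulVec, ← Matrix.mulVec_transpose, hsym.eq, hx0, zero_dotProduct]
      simp only [QuadraticMap.polarBilin_apply_apply, QuadraticMap.polar, hQa,
        Matrix.mulVec_add, add_dotProduct, dotProduct_add, hx0, h1, dotProduct_zero]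
      simp
    rw [Submodule.finrank_eq_zero] at hfin
    rw [hfin] at hmem
    exact hx (by simpa using hmem)
  intro h0
  apply hR
  have h1 : ((M.gram.det : ℤ) : ℂ) = 0 := by
    rw [← h0]; exact Int.cast_det M.gram
  have h2 : M.gram.det = 0 := by exact_mod_cast h1
  have h3 : ((M.gram.det : ℤ) : ℝ) = (M.gram.map (Int.cast : ℤ → ℝ)).det := Int.cast_det M.gram
  rw [← h3, h2]; simp

lemma pair_nondegenerate : M.pair.Nondegenerate :=
  LinearMap.BilinForm.nondegenerate_toBilin'_iff_det_ne_zero.mpr M.gram_det_ne_zero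

/-- The trace pairing `tr : 𝓔 ⊗ 𝓔 → 𝒪` on the fibre over `Z`, induced by the pairing of `M_ℂ`. -/
def tr (Z : V n) : LinearMap.BilinForm ℂ (M.E Z) :=
  Submodule.liftQ _
    { toFun := fun v => Submodule.liftQ _ ((M.pair (v : V n)).comp (M.perp Z).subtype) (by
        intro w hw
        obtain ⟨c, hc⟩ := Submodule.mem_span_singleton.mp hw
        have hv : M.pair Z (v : V n) = 0 := v.2
        change M.pair (v : V n) (w : V n) = 0
        have hc' : c • Z = (w : V n) := hc
        rw [← hc', map_smul, M.pair_comm, hv, smul_zero])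
      map_add' := by
        intro v v'
        refine Submodule.linearMap_qext _ (LinearMap.ext fun w => ?_)
        simp
      map_smul' := by
        intro c v
        refine Submodule.linearMap_qext _ (LinearMap.ext fun w => ?_)
        simp }
    (by
      intro w hw
      obtain ⟨c, hc⟩ := Submodule.mem_span_singleton.mp hw
      have hc' : c • Z = (w : V n) := hc
      refine Submodule.linearMap_qext _ (LinearMap.ext fun v => ?_)
      have hv : M.pair Z (v : V n) = 0 := v.2
      change M.pair (w : V n) (v : V n) = 0
      rw [← hc', map_smul, LinearMap.smul_apply, hv, smul_zero])

lemma tr_cls (Z : V n) (v w : M.perp Z) : M.tr Z (M.cls Z v) (M.cls Z w) = M.pair v w := rfl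

lemma tr_nondegenerate (Z : V n) : (M.tr Z).Nondegenerate := by
  have key : ∀ x : M.E Z, (∀ y, M.tr Z x y = 0) → x = 0 := by
    intro x hx
    obtain ⟨v, rfl⟩ := Submodule.mkQ_surjective _ x
    have hrefl : M.pair.IsRefl := fun a b h => by rw [M.pair_comm, h]
    have h1 : (v : V n) ∈ M.pair.orthogonal (M.pair.orthogonal (ℂ ∙ Z)) := by
      intro w hw
      have hw' : M.pair Z w = 0 := hw Z (Submodule.mem_span_singleton_self Z)
      have := hx (M.cls Z ⟨w, hw'⟩)
      rw [M.tr_cls] at this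
      change M.pair w v = 0
      rw [M.pair_comm]; exact this
    rw [LinearMap.BilinForm.orthogonal_orthogonal M.pair_nondegenerate hrefl] at h1
    exact (Submodule.Quotient.mk_eq_zero _).mpr h1
  refine ⟨key, fun x hx => key x fun y => ?_⟩
  obtain ⟨v, rfl⟩ := Submodule.mkQ_surjective _ x
  obtain ⟨w, rfl⟩ := Submodule.mkQ_surjective _ y
  have := hx (M.cls Z w)
  rw [M.tr_cls] at this ⊢
  rw [M.pair_comm]; exact this

/-- The linear map `Z^⊥ / ℂ Z → M_ℂ`, `w ↦ |Z|² w - ½ (w · Z̄) Z`; its `k`-th coordinate is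
the form `|Z|² dZ_k - Z_k ∂(|Z|²)`. -/
def horiz (Z : V n) : M.E Z →ₗ[ℂ] V n :=
  Submodule.liftQ _
    ((M.normSq Z • LinearMap.id - (LinearMap.toSpanSingleton ℂ (V n) Z).comp
      ((1 / 2 : ℂ) • M.pair (star Z))).comp (M.perp Z).subtype)
    (by
      intro w hw
      obtain ⟨c, hc⟩ := Submodule.mem_span_singleton.mp hw
      have hc' : c • Z = (w : V n) := hc
      simp only [LinearMap.mem_ker, LinearMap.comp_apply, Submodule.subtype_apply, ← hc',
        LinearMap.sub_apply, LinearMap.smul_apply, LinearMap.id_apply, map_smul,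
        LinearMap.toSpanSingleton_apply, M.pair_comm (star Z) Z, normSq]
      simp only [smul_smul, ← sub_smul]
      rw [show c * (M.pair Z (star Z) / 2 - 1 / 2 * M.pair Z (star Z)) = 0 by ring, zero_smul])

/-- The representative in `{Z, Z̄}^⊥` of a class in `Z^⊥ / ℂ Z` (for `|Z|² ≠ 0`):
`w ↦ w - (w · Z̄) / (Z · Z̄) Z`. -/
def orthRep (Z : V n) : M.E Z →ₗ[ℂ] V n := (M.normSq Z)⁻¹ • M.horiz Z

lemma horiz_cls (Z : V n) (w : M.perp Z) :
    M.horiz Z (M.cls Z w) = M.normSq Z • (w : V n) - (1 / 2 * M.pair (star Z) w) • Z := by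
  simp [horiz, cls, LinearMap.toSpanSingleton_apply]

/-! ### Sections of `𝓔^{⊗ s}` over subsets of the affine cone

By the trace pairing `𝓔 ≅ 𝓔^∨`, an element of the fibre `(Z^⊥ / ℂ Z)^{⊗ s}` is a multilinear form in
`s` vectors of `Z^⊥ / ℂ Z`.  As `Z^⊥` is the tangent space of the cone at `Z`, a section is the same
as a multi-differential `∑ F_I dZ_I` on the cone, taken modulo `d(Z²)`, whose contractions with
the radial vector field vanish.  The weight is recorded separately through the homogeneity. -/

/-- (Not necessarily continuous) sections of `𝓔^{⊗ s}` over a subset `Ω` of the affine cone. -/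
abbrev Sec (Ω : Set (V n)) (s : ℕ) : Type :=
  (Z : Ω) → MultilinearMap ℂ (fun _ : Fin s => M.E (Z : V n)) ℂ

variable {M} {Ω : Set (V n)} {s : ℕ}

/-- The multilinear form `∑_I c_I dZ_I` on `M_ℂ`, `dZ_I = dZ_{i_1} ⊗ ⋯ ⊗ dZ_{i_s}`. -/
def form (c : (Fin s → Fin (n + 2)) → ℂ) : MultilinearMap ℂ (fun _ : Fin s => V n) ℂ :=
  ∑ I, c I • (MultilinearMap.mkPiAlgebra ℂ (Fin s) ℂ).compLinearMap (fun r => LinearMap.proj (I r))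

lemma form_apply (c : (Fin s → Fin (n + 2)) → ℂ) (w : Fin s → V n) :
    form c w = ∑ I, c I * ∏ r, w r (I r) := by
  simp [form]

/-- `F = ∑_I c_I dZ_I` on `Ω ∩ U`. -/
def Represents (F : M.Sec Ω s) (U : Set (V n)) (c : (Fin s → Fin (n + 2)) → V n → ℂ) : Prop :=
  ∀ Z : Ω, (Z : V n) ∈ U → ∀ w : Fin s → M.perp (Z : V n),
    F Z (fun r => M.cls Z (w r)) = form (fun I => c I Z) (fun r => (w r : V n))

/-- A section is smooth (`𝕜 = ℝ`), resp. holomorphic (`𝕜 = ℂ`), if it is locally of the form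
`∑_I F_I dZ_I` with smooth, resp. holomorphic, coefficient functions `F_I`. -/
def IsRegular (𝕜 : Type) [RCLike 𝕜] [NormedAlgebra 𝕜 ℂ] (F : M.Sec Ω s) : Prop :=
  ∀ Z : Ω, ∃ U : Set (V n), IsOpen U ∧ (Z : V n) ∈ U ∧
    ∃ c : (Fin s → Fin (n + 2)) → V n → ℂ, (∀ I, ContDiffOn 𝕜 ∞ (c I) U) ∧ Represents F U c

lemma Represents.mono {F : M.Sec Ω s} {U U' : Set (V n)} {c} (h : Represents F U c)
    (hU : U' ⊆ U) : Represents F U' c := fun Z hZ w => h Z (hU hZ) w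

lemma Represents.add {F G : M.Sec Ω s} {U : Set (V n)} {c d} (h : Represents F U c)
    (h' : Represents G U d) : Represents (F + G) U (c + d) := by
  intro Z hZ w
  have h1 := h Z hZ w
  have h2 := h' Z hZ w
  simp only [Pi.add_apply, add_apply, h1, h2, form_apply, add_mul,
    Finset.sum_add_distrib]

lemma Represents.smul {F : M.Sec Ω s} {U : Set (V n)} {c} (a : ℂ) (h : Represents F U c) :
    Represents (a • F) U (a • c) := by
  intro Z hZ w
  have h1 := h Z hZ w
  simp only [Pi.smul_apply, smul_apply, h1, form_apply, smul_eq_mul,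
    Finset.mul_sum, mul_assoc]

section
variable {𝕜 : Type} [RCLike 𝕜] [NormedAlgebra 𝕜 ℂ]

lemma IsRegular.zero : IsRegular 𝕜 (0 : M.Sec Ω s) := fun _ =>
  ⟨Set.univ, isOpen_univ, trivial, 0, fun _ => contDiffOn_const, fun Z _ w => by
    simp [form_apply]⟩

lemma IsRegular.add {F G : M.Sec Ω s} (hF : IsRegular 𝕜 F) (hG : IsRegular 𝕜 G) :
    IsRegular 𝕜 (F + G) := by
  intro Z
  obtain ⟨U, hU, hZU, c, hc, hr⟩ := hF Z
  obtain ⟨U', hU', hZU', c', hc', hr'⟩ := hG Z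
  exact ⟨U ∩ U', hU.inter hU', ⟨hZU, hZU'⟩, c + c',
    fun I => ((hc I).mono Set.inter_subset_left).add ((hc' I).mono Set.inter_subset_right),
    (hr.mono Set.inter_subset_left).add (hr'.mono Set.inter_subset_right)⟩

lemma IsRegular.smul {F : M.Sec Ω s} (a : ℂ) (hF : IsRegular 𝕜 F) : IsRegular 𝕜 (a • F) := by
  intro Z
  obtain ⟨U, hU, hZU, c, hc, hr⟩ := hF Z
  exact ⟨U, hU, hZU, a • c, fun I => contDiffOn_const.mul (hc I), hr.smul a⟩

end

variable (M Ω s) in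
/-- The smooth sections `𝓐(Ω, 𝓔^{⊗ s})`. -/
def smoothSec : Submodule ℂ (M.Sec Ω s) where
  carrier := {F | IsRegular ℝ F}
  add_mem' := IsRegular.add
  zero_mem' := IsRegular.zero
  smul_mem' := fun a _ h => IsRegular.smul a h

/-! ### Wirtinger derivatives and the lowering operator -/

/-- `∂g / ∂Z̄_k` at `Z`. -/
def dbar (g : V n → ℂ) (Z : V n) (k : Fin (n + 2)) : ℂ :=
  (fderiv ℝ g Z (Pi.single k 1) + Complex.I * fderiv ℝ g Z (Pi.single k Complex.I)) / 2

/-- `∂g / ∂Z_k` at `Z`. -/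
def dhol (g : V n → ℂ) (Z : V n) (k : Fin (n + 2)) : ℂ :=
  (fderiv ℝ g Z (Pi.single k 1) - Complex.I * fderiv ℝ g Z (Pi.single k Complex.I)) / 2

variable (M) in
/-- The coefficients of
`∑_{I,k} ∂F_I/∂Z̄_k dZ_I ⊗ (|Z|² dZ_k - Z_k ∂(|Z|²))`, where `∂(|Z|²) = ½ ∑ g_{ab} Z̄_b dZ_a`. -/
def lowerCoeff (c : (Fin s → Fin (n + 2)) → V n → ℂ) (J : Fin (s + 1) → Fin (n + 2)) (Z : V n) : ℂ :=
  M.normSq Z * dbar (c (Fin.init J)) Z (J (Fin.last s)) -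
    (∑ k, dbar (c (Fin.init J)) Z k * Z k) *
      (1 / 2 * ∑ b, (M.gram (J (Fin.last s)) b : ℂ) * star (Z b))

variable (M) in
/-- `Ω` is an open subset of the affine cone (with both components). -/
def IsConeOpen (Ω : Set (V n)) : Prop :=
  Ω ⊆ M.isotropicPositive ∧ ∀ Z ∈ Ω, ∀ᶠ Y in 𝓝 Z, M.pair Y Y = 0 → Y ∈ Ω

/-- Coefficient functions of a smooth or holomorphic section near `Z`. -/
def IsRegular.coeff {𝕜 : Type} [RCLike 𝕜] [NormedAlgebra 𝕜 ℂ] {F : M.Sec Ω s}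
    (hF : IsRegular 𝕜 F) (Z : Ω) : (Fin s → Fin (n + 2)) → V n → ℂ :=
  (hF Z).choose_spec.2.2.choose

section LoweringFacts

lemma pair_apply (Z W : V n) : M.pair Z W = ∑ a, ∑ b, Z a * (M.gram a b : ℂ) * W b := by
  simp [pair, Matrix.toBilin'_apply]

lemma pair_star (Z W : V n) : M.pair (star Z) (star W) = star (M.pair Z W) := by
  simp [pair_apply, star_sum]

lemma normSq_ne_zero {Z : V n} (hZ : Z ∈ M.isotropicPositive) : M.normSq Z ≠ 0 := by
  intro h
  have : M.pair Z (star Z) = 0 := by simpa [normSq] using h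
  have h2 := hZ.2
  rw [this] at h2
  simp at h2

variable (M) in
/-- The pairing as a continuous bilinear map. -/
def pairL : V n →L[ℂ] V n →L[ℂ] ℂ :=
  LinearMap.toContinuousLinearMap
    ((LinearMap.toContinuousLinearMap : (V n →ₗ[ℂ] ℂ) ≃ₗ[ℂ] (V n →L[ℂ] ℂ)).toLinearMap ∘ₗ M.pair)

lemma pairL_apply (Z W : V n) : M.pairL Z W = M.pair Z W := rfl

/-- The derivative `∂̄ g` at `Z` in the direction `u`. -/
def dbarDir (g : V n → ℂ) (Z u : V n) : ℂ :=
  (fderiv ℝ g Z u + Complex.I * fderiv ℝ g Z (Complex.I • u)) / 2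

lemma eq_sum_real (u : V n) : u = ∑ k, ((u k).re • (Pi.single k 1 : V n) +
    (u k).im • (Pi.single k Complex.I : V n)) := by
  ext j
  simp only [Finset.sum_apply, Pi.add_apply, Pi.smul_apply, Pi.single_apply]
  rw [Finset.sum_eq_single j]
  · simp [Complex.re_add_im]
  · intro b _ hb
    simp [hb.symm]
  · simp

lemma dbarDir_eq (g : V n → ℂ) (Z u : V n) :
    dbarDir g Z u = ∑ k, star (u k) * dbar g Z k := by
  have h1 : fderiv ℝ g Z u = ∑ k, ((u k).re * fderiv ℝ g Z (Pi.single k 1) +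
      (u k).im * fderiv ℝ g Z (Pi.single k Complex.I)) := by
    conv_lhs => rw [eq_sum_real u]
    simp
  have h2 : fderiv ℝ g Z (Complex.I • u) = ∑ k, (-(u k).im * fderiv ℝ g Z (Pi.single k 1) +
      (u k).re * fderiv ℝ g Z (Pi.single k Complex.I)) := by
    conv_lhs => rw [eq_sum_real (Complex.I • u)]
    simp
  rw [dbarDir, h1, h2, Finset.mul_sum, ← Finset.sum_add_distrib, Finset.sum_div]
  refine Finset.sum_congr rfl fun k _ => ?_
  have h3 : star (u k) = (u k).re - (u k).im * Complex.I := by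
    apply Complex.ext <;> simp
  rw [h3, dbar]
  linear_combination ((u k).im * fderiv ℝ g Z (Pi.single k Complex.I)) / 2 * Complex.I_sq

/-- Antiholomorphic derivatives in tangent directions of a relation which holds on the cone. -/
lemma sum_dbarDir_eq_zero {ι : Type*} [Fintype ι] {Z : V n} (hZ : Z ∈ M.isotropicPositive)
    (c A : ι → V n → ℂ) (hc : ∀ i, DifferentiableAt ℝ (c i) Z)
    (hA : ∀ i, DifferentiableAt ℂ (A i) Z)
    (h : ∀ᶠ Y in 𝓝 Z, M.pair Y Y = 0 → ∑ i, c i Y * A i Y = 0)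
    (u : V n) (hu : M.pair Z u = 0) : ∑ i, dbarDir (c i) Z u * A i Z = 0 := by
  have hZZ : M.pair Z (star Z) ≠ 0 := by
    intro h0
    have h2 := hZ.2
    rw [h0] at h2
    simp at h2
  set a : V n → ℂ := fun Y => (2 * M.pair Y (star Z))⁻¹ with ha
  set ρ : V n → V n := fun Y => Y - (M.pair Y Y * a Y) • star Z with hρ
  have hlin : ∀ W Y : V n, HasFDerivAt (fun Y => M.pair Y W) (M.pairL.flip W) Y := fun W Y =>
    (M.pairL.flip W).hasFDerivAt
  have hda : DifferentiableAt ℂ a Z := by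
    refine DifferentiableAt.inv ((hlin _ _).differentiableAt.const_mul 2) ?_
    simpa using hZZ
  obtain ⟨a', ha'⟩ := hda
  have hq : HasFDerivAt (fun Y => M.pair Y Y) (M.pairL.flip Z + M.pairL Z) Z := by
    have := M.pairL.hasFDerivAt_of_bilinear (hasFDerivAt_id Z) (hasFDerivAt_id Z)
    refine HasFDerivAt.congr_fderiv (f := fun Y => M.pair Y Y) this ?_
    ext v
    simp [add_comm]
  have hρ' := (hasFDerivAt_id (𝕜 := ℂ) Z).sub ((hq.mul ha').smul_const (star Z))
  change HasFDerivAt ρ _ Z at hρ'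
  set R := (ContinuousLinearMap.id ℂ (V n) -
    (M.pair Z Z • a' + a Z • (M.pairL.flip Z + M.pairL Z)).smulRight (star Z)) with hR
  have hRv : ∀ v : V n, M.pair Z v = 0 → R v = v := by
    intro v hv
    have hv' : M.pair v Z = 0 := by rw [M.pair_comm]; exact hv
    simp [hR, hZ.1, pairL_apply, hv, hv']
  have hρZ : ρ Z = Z := by simp [hρ, hZ.1]
  have hcont : ContinuousAt ρ Z := hρ'.continuousAt
  have hne : ∀ᶠ Y in 𝓝 Z, M.pair Y (star Z) ≠ 0 :=
    (hlin (star Z) Z).continuousAt.eventually_ne hZZ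
  have hquad : ∀ Y, M.pair Y (star Z) ≠ 0 → M.pair (ρ Y) (ρ Y) = 0 := by
    intro Y hY
    have hs : M.pair (star Z) (star Z) = 0 := by rw [pair_star, hZ.1, star_zero]
    simp only [hρ, map_sub, LinearMap.sub_apply, map_smul, LinearMap.smul_apply, hs,
      smul_eq_mul, M.pair_comm (star Z) Y, ha]
    field_simp
    ring
  have hzero : (fun Y => ∑ i, c i (ρ Y) * A i (ρ Y)) =ᶠ[𝓝 Z] fun _ => 0 := by
    have h' : ∀ᶠ Y in 𝓝 (ρ Z), M.pair Y Y = 0 → ∑ i, c i Y * A i Y = 0 := by rwa [hρZ]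
    filter_upwards [hcont.eventually h', hne] with Y hY hY'
    exact hY (hquad Y hY')
  have hρR : HasFDerivAt (𝕜 := ℝ) ρ (R.restrictScalars ℝ) Z := hρ'.restrictScalars ℝ
  have hder : HasFDerivAt (𝕜 := ℝ) (fun Y => ∑ i, c i (ρ Y) * A i (ρ Y))
      (∑ i, (c i Z • ((fderiv ℂ (A i) Z).comp R).restrictScalars ℝ +
        A i Z • (fderiv ℝ (c i) Z).comp (R.restrictScalars ℝ))) Z := by
    refine HasFDerivAt.fun_sum fun i _ => ?_
    have h1 : HasFDerivAt (𝕜 := ℝ) (fun Y => c i (ρ Y))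
        ((fderiv ℝ (c i) Z).comp (R.restrictScalars ℝ)) Z := by
      refine HasFDerivAt.comp Z ?_ hρR
      rw [hρZ]; exact (hc i).hasFDerivAt
    have h2 : HasFDerivAt (𝕜 := ℂ) (fun Y => A i (ρ Y)) ((fderiv ℂ (A i) Z).comp R) Z := by
      refine HasFDerivAt.comp Z ?_ hρ'
      rw [hρZ]; exact (hA i).hasFDerivAt
    have h3 := h1.fun_mul (h2.restrictScalars ℝ)
    simp only [hρZ] at h3
    exact h3
  have hD := hder.unique ((hasFDerivAt_const (0 : ℂ) Z).congr_of_eventuallyEq hzero)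
  have hIu : M.pair Z (Complex.I • u) = 0 := by rw [map_smul, hu, smul_zero]
  have e1 := congrArg (fun L => L u) hD
  have e2 := congrArg (fun L => L (Complex.I • u)) hD
  simp only [sum_apply, add_apply, smul_apply,
    ContinuousLinearMap.coe_restrictScalars', ContinuousLinearMap.comp_apply, hRv u hu,
    hRv _ hIu, smul_eq_mul, zero_apply, map_smul] at e1 e2
  have e3 : ∑ i, dbarDir (c i) Z u * A i Z =
      (∑ i, (c i Z * (fderiv ℂ (A i) Z) u + A i Z * (fderiv ℝ (c i) Z) u) +
        Complex.I * ∑ i, (c i Z * (Complex.I * (fderiv ℂ (A i) Z) u) +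
          A i Z * (fderiv ℝ (c i) Z) (Complex.I • u))) / 2 := by
    rw [Finset.mul_sum, ← Finset.sum_add_distrib, Finset.sum_div]
    refine Finset.sum_congr rfl fun i _ => ?_
    rw [dbarDir]
    linear_combination (-(c i Z) * (fderiv ℂ (A i) Z) u) / 2 * Complex.I_sq
  rw [e3, e1, e2]
  simp

lemma form_lowerCoeff (c : (Fin s → Fin (n + 2)) → V n → ℂ) (Z : V n) (w : Fin (s + 1) → V n) :
    form (fun J => M.lowerCoeff c J Z) w = ∑ I : Fin s → Fin (n + 2),
      dbarDir (c I) Z (star (M.normSq Z • w (Fin.last s) -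
        (1 / 2 * M.pair (star Z) (w (Fin.last s))) • Z)) * ∏ r, w r.castSucc (I r) := by
  rw [form_apply, ← (Fin.snocEquiv (fun _ : Fin (s + 1) => Fin (n + 2))).sum_comp,
    Fintype.sum_prod_type, Finset.sum_comm]
  refine Finset.sum_congr rfl fun I _ => ?_
  have hinit : ∀ x : Fin (n + 2), Fin.init ((Fin.snocEquiv (fun _ : Fin (s + 1) => Fin (n + 2)))
      (x, I)) = I := fun x => Fin.init_snoc (α := fun _ => Fin (n + 2)) x I
  simp only [hinit, lowerCoeff]
  simp only [Fin.snocEquiv_apply, Fin.snoc_last, Fin.prod_univ_castSucc,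
    Fin.snoc_castSucc, dbarDir_eq]
  rw [pair_apply]
  simp only [Pi.star_apply, star_star, Pi.sub_apply, Pi.smul_apply, smul_eq_mul]
  have hg : ∀ a b, (M.gram a b : ℂ) = M.gram b a := fun a b => by rw [M.symm.apply]
  have : ∀ P : ℂ, ∑ x, (M.normSq Z * dbar (c I) Z x - (∑ k, dbar (c I) Z k * Z k) *
      (1 / 2 * ∑ b, (M.gram x b : ℂ) * star (Z b))) * (P * w (Fin.last s) x) =
      (∑ k, (M.normSq Z * w (Fin.last s) k - 1 / 2 * (∑ a, ∑ b, star (Z a) * (M.gram a b : ℂ) *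
        w (Fin.last s) b) * Z k) * dbar (c I) Z k) * P := by
    intro P
    simp only [sub_mul, Finset.sum_sub_distrib]
    congr 1
    · rw [Finset.sum_mul]
      exact Finset.sum_congr rfl fun k _ => by ring
    · rw [Finset.sum_comm (f := fun a b => star (Z a) * (M.gram a b : ℂ) * w (Fin.last s) b)]
      have h1 : ∀ x, ∑ a, star (Z a) * (M.gram a x : ℂ) * w (Fin.last s) x =
          (∑ b, (M.gram x b : ℂ) * star (Z b)) * w (Fin.last s) x := by
        intro x
        rw [Finset.sum_mul]
        exact Finset.sum_congr rfl fun b _ => by rw [hg x b]; ring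
      simp only [h1]
      have h2 : ∀ k, 1 / 2 * (∑ x, (∑ b, (M.gram x b : ℂ) * star (Z b)) * w (Fin.last s) x) * Z k *
          dbar (c I) Z k = (1 / 2 * (∑ x, (∑ b, (M.gram x b : ℂ) * star (Z b)) *
            w (Fin.last s) x)) * (dbar (c I) Z k * Z k) := fun k => by ring
      simp only [h2, ← Finset.mul_sum]
      generalize ∑ k, dbar (c I) Z k * Z k = D
      rw [Finset.mul_sum, Finset.sum_mul, Finset.sum_mul]
      exact Finset.sum_congr rfl fun x _ => by ring
  exact this _

/-- The lowering operator does not depend on the local coefficient functions, nor on the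
representatives in `Z^⊥` of classes in `Z^⊥ / ℂ Z`. -/
lemma form_lowerCoeff_congr (hΩ : M.IsConeOpen Ω) {F : M.Sec Ω s} (Z : Ω) {U U' : Set (V n)}
    (hU : U ∈ 𝓝 (Z : V n)) (hU' : U' ∈ 𝓝 (Z : V n)) {c d : (Fin s → Fin (n + 2)) → V n → ℂ}
    (hc : ∀ I, DifferentiableAt ℝ (c I) Z) (hd : ∀ I, DifferentiableAt ℝ (d I) Z)
    (hFc : Represents F U c) (hFd : Represents F U' d)
    (w : Fin (s + 1) → V n) (hw : ∀ r, M.pair Z (w r) = 0) (t : Fin (s + 1) → ℂ) :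
    form (fun J => M.lowerCoeff c J Z) w =
      form (fun J => M.lowerCoeff d J Z) (fun r => w r + t r • (Z : V n)) := by
  have hZ := hΩ.1 Z.2
  have hZZ : M.pair (Z : V n) (star (Z : V n)) ≠ 0 := by
    intro h0
    have h2 := hZ.2
    rw [h0] at h2
    simp at h2
  rw [form_lowerCoeff, form_lowerCoeff]
  have hlast : M.normSq Z • (w (Fin.last s) + t (Fin.last s) • (Z : V n)) -
        (1 / 2 * M.pair (star Z) (w (Fin.last s) + t (Fin.last s) • (Z : V n))) • (Z : V n) =
      M.normSq Z • w (Fin.last s) - (1 / 2 * M.pair (star Z) (w (Fin.last s))) • (Z : V n) := by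
    simp only [map_add, map_smul, normSq, M.pair_comm (star (Z : V n)) Z, smul_eq_mul]
    module
  rw [hlast]
  set h := M.normSq Z • w (Fin.last s) - (1 / 2 * M.pair (star Z) (w (Fin.last s))) • (Z : V n)
    with hh
  have hperp : M.pair (Z : V n) (star h) = 0 := by
    have h1 : M.pair (star (Z : V n)) h = 0 := by
      simp only [hh, map_sub, map_smul, normSq, M.pair_comm (star (Z : V n)) Z, smul_eq_mul]
      ring
    have h2 := pair_star (M := M) (star (Z : V n)) h
    rwa [star_star, h1, star_zero] at h2
  set P : V n → V n → V n := fun m Y => m - (M.pair Y m * (M.pair Y (star (Z : V n)))⁻¹) •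
    star (Z : V n) with hP
  have hlin : ∀ W Y : V n, DifferentiableAt ℂ (fun Y => M.pair Y W) Y := fun W Y =>
    (M.pairL.flip W).differentiableAt
  have hPd : ∀ m, DifferentiableAt ℂ (P m) Z := fun m =>
    (differentiableAt_const m).sub
      (((hlin m Z).mul ((hlin _ Z).inv hZZ)).smul_const _)
  have hPZ : ∀ r, P (w r) Z = w r := fun r => by simp [hP, hw r]
  set A : (Fin s → Fin (n + 2)) → V n → ℂ := fun I Y => ∏ r, P (w r.castSucc) Y (I r) with hA
  set B : (Fin s → Fin (n + 2)) → V n → ℂ :=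
    fun I Y => - ∏ r, (P (w r.castSucc) Y + t r.castSucc • Y) (I r) with hB
  have hAd : ∀ I, DifferentiableAt ℂ (A I) Z := fun I => by
    simp only [hA]
    have hr : ∀ r : Fin s, DifferentiableAt ℂ (fun Y => P (w r.castSucc) Y (I r)) Z := fun r =>
      differentiableAt_pi.mp (hPd _) (I r)
    exact (HasFDerivAt.finsetProd fun r _ => (hr r).hasFDerivAt).differentiableAt
  have hBd : ∀ I, DifferentiableAt ℂ (B I) Z := fun I => by
    simp only [hB]
    have hr : ∀ r : Fin s, DifferentiableAt ℂ
        (fun Y => (P (w r.castSucc) Y + t r.castSucc • Y) (I r)) Z := fun r =>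
      differentiableAt_pi.mp ((hPd _).add (differentiableAt_id.const_smul (t r.castSucc))) (I r)
    exact (HasFDerivAt.finsetProd fun r _ => (hr r).hasFDerivAt).differentiableAt.neg
  have key := sum_dbarDir_eq_zero (M := M) (ι := (Fin s → Fin (n + 2)) ⊕ (Fin s → Fin (n + 2)))
    hZ (Sum.elim c d) (Sum.elim A B)
    (by rintro (I | I); exacts [hc I, hd I]) (by rintro (I | I); exacts [hAd I, hBd I])
    (by
      have hne : ∀ᶠ Y in 𝓝 (Z : V n), M.pair Y (star (Z : V n)) ≠ 0 :=
        (hlin (star (Z : V n)) Z).continuousAt.eventually_ne hZZ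
      filter_upwards [hΩ.2 Z Z.2, hU, hU', hne] with Y h1 h2 h3 h4 h5
      have hY := h1 h5
      have hp : ∀ m, M.pair Y (P m Y) = 0 := fun m => by
        simp only [hP, map_sub, map_smul, smul_eq_mul]
        field_simp
        ring
      have hp' : ∀ r : Fin s, M.pair Y (P (w r.castSucc) Y + t r.castSucc • Y) = 0 := fun r => by
        rw [map_add, hp, map_smul, h5, smul_zero, add_zero]
      have e1 := hFc ⟨Y, hY⟩ h2 (fun r => ⟨P (w r.castSucc) Y, hp _⟩)
      have e2 := hFd ⟨Y, hY⟩ h3 (fun r => ⟨P (w r.castSucc) Y + t r.castSucc • Y, hp' r⟩)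
      have e3 : (fun r : Fin s => M.cls Y ⟨P (w r.castSucc) Y, hp _⟩) =
          (fun r : Fin s => M.cls Y ⟨P (w r.castSucc) Y + t r.castSucc • Y, hp' r⟩) := by
        funext r
        refine (Submodule.Quotient.eq _).mpr ?_
        refine Submodule.mem_span_singleton.mpr ⟨-t r.castSucc, ?_⟩
        simp
      have e4 := e1.symm.trans ((congrArg (F ⟨Y, hY⟩) e3).trans e2)
      rw [form_apply, form_apply] at e4
      simp only [Fintype.sum_sum_type, Sum.elim_inl, Sum.elim_inr, hA, hB, mul_neg,
        Finset.sum_neg_distrib]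
      exact (sub_eq_zero.mpr e4))
    (star h) hperp
  simp only [Fintype.sum_sum_type, Sum.elim_inl, Sum.elim_inr, hA, hB, mul_neg,
    Finset.sum_neg_distrib, hPZ] at key
  exact sub_eq_zero.mp key

/-- The set `{Z · Z = 0, Z · Z̄ > 0}` is locally connected. -/
lemma exists_preconnected_nhds {Z : V n} (hZQ : Z ∈ M.isotropicPositive) :
    ∃ T : Set (V n), IsPreconnected T ∧ Z ∈ T ∧ T ⊆ M.isotropicPositive ∧
      ∀ᶠ Y in 𝓝 Z, M.pair Y Y = 0 → Y ∈ T := by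
  have hZZ : M.pair Z (star Z) ≠ 0 := by
    intro h0
    have h2 := hZQ.2
    rw [h0] at h2
    simp at h2
  have hpair : ∀ g h : V n → V n, Continuous g → Continuous h →
      Continuous fun Y : V n => M.pair (g Y) (h Y) := by
    intro g h hg hh
    simp only [pair_apply]
    fun_prop
  obtain ⟨ρ, hρ⟩ : ∃ ρ : V n → V n,
      ρ = fun Y => Y - (M.pair Y Y * (2 * M.pair Y (star Z))⁻¹) • star Z := ⟨_, rfl⟩
  have hcY : Continuous fun Y : V n => M.pair Y (star Z) :=
    hpair (fun Y => Y) (fun _ => star Z) continuous_id continuous_const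
  have hcYY : Continuous fun Y : V n => M.pair Y Y :=
    hpair (fun Y => Y) (fun Y => Y) continuous_id continuous_id
  have hρc : ∀ Y, M.pair Y (star Z) ≠ 0 → ContinuousAt ρ Y := by
    intro Y hY
    have h1 : ContinuousAt (fun Y : V n => 2 * M.pair Y (star Z)) Y :=
      (continuous_const.mul hcY).continuousAt
    have h2 : ContinuousAt (fun Y : V n => M.pair Y Y * (2 * M.pair Y (star Z))⁻¹) Y :=
      hcYY.continuousAt.mul (h1.inv₀ (mul_ne_zero two_ne_zero hY))
    have h3 : ContinuousAt (fun Y : V n => (M.pair Y Y * (2 * M.pair Y (star Z))⁻¹) • star Z) Y :=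
      h2.smul continuousAt_const
    rw [hρ]
    exact continuousAt_id.sub h3
  have hρfix : ∀ Y, M.pair Y Y = 0 → ρ Y = Y := fun Y hY => by simp [hρ, hY]
  have hquad : ∀ Y, M.pair Y (star Z) ≠ 0 → M.pair (ρ Y) (ρ Y) = 0 := by
    intro Y hY
    have hs : M.pair (star Z) (star Z) = 0 := by rw [pair_star, hZQ.1, star_zero]
    simp only [hρ, map_sub, LinearMap.sub_apply, map_smul, LinearMap.smul_apply, hs,
      smul_eq_mul, M.pair_comm (star Z) Y]
    field_simp
    ring
  have hpos : ∀ᶠ Y in 𝓝 Z, 0 < (M.pair (ρ Y) (star (ρ Y))).re := by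
    have hG : Continuous fun W : V n => (M.pair W (star W)).re :=
      Complex.continuous_re.comp (hpair (fun Y => Y) (fun Y => star Y) continuous_id continuous_star)
    have hc : ContinuousAt (fun Y => (M.pair (ρ Y) (star (ρ Y))).re) Z :=
      ContinuousAt.comp (g := fun W : V n => (M.pair W (star W)).re) hG.continuousAt (hρc Z hZZ)
    refine hc.eventually (lt_mem_nhds ?_)
    change 0 < (M.pair (ρ Z) (star (ρ Z))).re
    rw [hρfix Z hZQ.1]; exact hZQ.2
  obtain ⟨ε, hε, hball⟩ := Metric.eventually_nhds_iff_ball.mp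
    (hpos.and (hcY.continuousAt.eventually_ne hZZ))
  have hconv : IsPreconnected (Metric.ball Z ε) := by
    have : Convex ℝ (Metric.ball Z ε) := convex_ball Z ε
    exact this.isPreconnected
  have hpre : IsPreconnected (ρ '' Metric.ball Z ε) :=
    hconv.image ρ fun Y hY => (hρc Y (hball Y hY).2).continuousWithinAt
  refine ⟨ρ '' Metric.ball Z ε, hpre, ⟨Z, Metric.mem_ball_self hε, hρfix Z hZQ.1⟩, ?_, ?_⟩
  · rintro _ ⟨Y, hY, rfl⟩
    exact ⟨hquad Y (hball Y hY).2, (hball Y hY).1⟩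
  · filter_upwards [Metric.ball_mem_nhds Z hε] with Y hY hYY
    exact ⟨Y, hY, hρfix Y hYY⟩

end LoweringFacts

lemma IsRegular.coeff_spec {𝕜 : Type} [RCLike 𝕜] [NormedAlgebra 𝕜 ℂ] {F : M.Sec Ω s}
    (hF : IsRegular 𝕜 F) (Z : Ω) : ∃ U : Set (V n), IsOpen U ∧ (Z : V n) ∈ U ∧
      (∀ I, ContDiffOn 𝕜 ∞ (hF.coeff Z I) U) ∧ Represents F U (hF.coeff Z) :=
  ⟨_, (hF Z).choose_spec.1, (hF Z).choose_spec.2.1, (hF Z).choose_spec.2.2.choose_spec⟩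

/-- The lowering operator `𝖫 = |Z|² (id ⊗ φ) ∘ ∂̄`: if `F = ∑_I F_I dZ_I` near `Z`, then
`𝖫 F = ∑_{I,k} ∂F_I/∂Z̄_k dZ_I ⊗ (|Z|² dZ_k - Z_k ∂(|Z|²))`. -/
def lowerFun (F : M.Sec Ω s) (hF : IsRegular ℝ F) : M.Sec Ω (s + 1) := fun Z =>
  (form (fun J => M.lowerCoeff (hF.coeff Z) J Z)).compLinearMap (fun _ => M.orthRep Z)

/-- The formula for `𝖫 F` holds for every local expression `F = ∑_I F_I dZ_I`. -/
lemma lowerFun_represents (hΩ : M.IsConeOpen Ω) {F : M.Sec Ω s} (hF : IsRegular ℝ F)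
    {U : Set (V n)} (hU : IsOpen U) {c : (Fin s → Fin (n + 2)) → V n → ℂ}
    (hc : ∀ I, ContDiffOn ℝ ∞ (c I) U) (hFc : Represents F U c) :
    Represents (lowerFun F hF) U (M.lowerCoeff c) := by
  intro Z hZU w
  obtain ⟨U', hU', hZU', hc', hr'⟩ := hF.coeff_spec Z
  have hns := normSq_ne_zero (hΩ.1 Z.2)
  rw [form_lowerCoeff_congr hΩ Z (hU.mem_nhds hZU) (hU'.mem_nhds hZU')
    (fun I => ((hc I).contDiffAt (hU.mem_nhds hZU)).differentiableAt (by simp))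
    (fun I => ((hc' I).contDiffAt (hU'.mem_nhds hZU')).differentiableAt (by simp))
    hFc hr' (fun r => (w r : V n)) (fun r => (w r).2)
    (fun r => -((M.normSq Z)⁻¹ * (1 / 2 * M.pair (star Z) (w r))))]
  simp only [lowerFun, MultilinearMap.compLinearMap_apply]
  congr 1
  funext r
  simp only [orthRep, LinearMap.smul_apply, horiz_cls, neg_smul, sub_eq_add_neg]
  rw [smul_add, smul_neg, smul_smul, smul_smul, inv_mul_cancel₀ hns, one_smul]

lemma contDiffOn_dbar {g : V n → ℂ} {U : Set (V n)} (hU : IsOpen U) (hg : ContDiffOn ℝ ∞ g U)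
    (k : Fin (n + 2)) : ContDiffOn ℝ ∞ (fun Z => dbar g Z k) U := by
  have h := hg.fderiv_of_isOpen (m := ∞) hU (by simp)
  exact ((h.clm_apply contDiffOn_const).add
    (contDiffOn_const.mul (h.clm_apply contDiffOn_const))).div_const 2

lemma contDiffOn_lowerCoeff {c : (Fin s → Fin (n + 2)) → V n → ℂ} {U : Set (V n)} (hU : IsOpen U)
    (hc : ∀ I, ContDiffOn ℝ ∞ (c I) U) (J : Fin (s + 1) → Fin (n + 2)) :
    ContDiffOn ℝ ∞ (M.lowerCoeff c J) U := by
  have hcoord : ∀ k, ContDiff ℝ ∞ (fun Z : V n => Z k) := fun k => contDiff_apply ℝ ℂ k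
  have hstar : ∀ k, ContDiff ℝ ∞ (fun Z : V n => star (Z k)) := fun k =>
    Complex.conjCLE.contDiff.comp (hcoord k)
  have hns : ContDiff ℝ ∞ (M.normSq : V n → ℂ) := by
    have : (M.normSq : V n → ℂ) =
        fun Z => (∑ a, ∑ b, Z a * (M.gram a b : ℂ) * star (Z b)) / 2 := by
      funext Z; simp [normSq, pair_apply]
    rw [this]
    exact (ContDiff.sum fun a _ => ContDiff.sum fun b _ =>
      ((hcoord a).mul contDiff_const).mul (hstar b)).div_const 2
  refine ((hns.contDiffOn).mul (contDiffOn_dbar hU (hc _) _)).sub (ContDiffOn.mul ?_ ?_)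
  · exact ContDiffOn.sum fun k _ => (contDiffOn_dbar hU (hc _) k).mul (hcoord k).contDiffOn
  · exact (contDiff_const.mul (ContDiff.sum fun b _ =>
      contDiff_const.mul (hstar b))).contDiffOn

lemma isRegular_lowerFun (hΩ : M.IsConeOpen Ω) {F : M.Sec Ω s} (hF : IsRegular ℝ F) :
    IsRegular ℝ (lowerFun F hF) := by
  intro Z
  obtain ⟨U, hU, hZU, c, hc, hr⟩ := hF Z
  exact ⟨U, hU, hZU, M.lowerCoeff c, contDiffOn_lowerCoeff hU hc,
    lowerFun_represents hΩ hF hU hc hr⟩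

lemma Represents.ext_at {F G : M.Sec Ω s} {U U' : Set (V n)} {c d} (hF : Represents F U c)
    (hG : Represents G U' d) (Z : Ω) (hZ : (Z : V n) ∈ U) (hZ' : (Z : V n) ∈ U')
    (h : ∀ I, c I Z = d I Z) : F Z = G Z := by
  refine MultilinearMap.ext fun x => ?_
  choose w hw using fun r => Submodule.mkQ_surjective _ (x r)
  have : x = fun r => M.cls Z (w r) := funext fun r => (hw r).symm
  rw [this, hF Z hZ w, hG Z hZ' w]
  simp only [h]

/-- The lowering operator on smooth sections over an open subset of the cone. -/
def lower (hΩ : M.IsConeOpen Ω) (s : ℕ) : M.smoothSec Ω s →ₗ[ℂ] M.smoothSec Ω (s + 1) where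
  toFun F := ⟨lowerFun F.1 F.2, isRegular_lowerFun hΩ F.2⟩
  map_add' F G := by
    refine Subtype.ext (funext fun Z => ?_)
    obtain ⟨U, hU, hZU, c, hc, hr⟩ := F.2 Z
    obtain ⟨U', hU', hZU', d, hd, hr'⟩ := G.2 Z
    have hc' : ∀ I, ContDiffOn ℝ ∞ (c I) (U ∩ U') := fun I => (hc I).mono Set.inter_subset_left
    have hd' : ∀ I, ContDiffOn ℝ ∞ (d I) (U ∩ U') := fun I => (hd I).mono Set.inter_subset_right
    have e1 := lowerFun_represents hΩ F.2 hU hc hr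
    have e2 := lowerFun_represents hΩ G.2 hU' hd hr'
    have e3 := lowerFun_represents hΩ (F + G).2 (hU.inter hU') (c := c + d)
      (fun I => (hc' I).add (hd' I))
      ((hr.mono Set.inter_subset_left).add (hr'.mono Set.inter_subset_right))
    refine e3.ext_at ((e1.mono Set.inter_subset_left).add (e2.mono Set.inter_subset_right)) Z
      ⟨hZU, hZU'⟩ ⟨hZU, hZU'⟩ fun J => ?_
    have hadd : ∀ k, dbar (c (Fin.init J) + d (Fin.init J)) Z k =
        dbar (c (Fin.init J)) Z k + dbar (d (Fin.init J)) Z k := by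
      intro k
      have h1 := ((hc (Fin.init J)).contDiffAt (hU.mem_nhds hZU)).differentiableAt
        (show (∞ : WithTop ℕ∞) ≠ 0 by simp)
      have h2 := ((hd (Fin.init J)).contDiffAt (hU'.mem_nhds hZU')).differentiableAt
        (show (∞ : WithTop ℕ∞) ≠ 0 by simp)
      simp only [dbar, fderiv_add h1 h2, add_apply]
      ring
    simp only [lowerCoeff, Pi.add_apply, hadd, add_mul, Finset.sum_add_distrib]
    ring
  map_smul' a F := by
    refine Subtype.ext (funext fun Z => ?_)
    obtain ⟨U, hU, hZU, c, hc, hr⟩ := F.2 Z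
    have e1 := lowerFun_represents hΩ F.2 hU hc hr
    have e3 := lowerFun_represents hΩ (a • F).2 hU (c := a • c)
      (fun I => contDiffOn_const.mul (hc I)) (hr.smul a)
    refine e3.ext_at (e1.smul a) Z hZU hZU fun J => ?_
    have hsm : ∀ k, dbar (a • c (Fin.init J)) Z k = a * dbar (c (Fin.init J)) Z k := by
      intro k
      have h1 := ((hc (Fin.init J)).contDiffAt (hU.mem_nhds hZU)).differentiableAt
        (show (∞ : WithTop ℕ∞) ≠ 0 by simp)
      simp only [dbar, fderiv_const_smul h1 a, smul_apply, smul_eq_mul]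
      ring
    simp only [lowerCoeff, Pi.smul_apply, hsm, smul_eq_mul, mul_assoc, ← Finset.mul_sum]
    ring

/-- The iterates `𝖫^d`. -/
def lowerIter (hΩ : M.IsConeOpen Ω) (s : ℕ) :
    (d : ℕ) → M.smoothSec Ω s →ₗ[ℂ] M.smoothSec Ω (s + d)
  | 0 => LinearMap.id
  | d + 1 => lower hΩ (s + d) ∘ₗ lowerIter hΩ s d

/-- `F` is almost-holomorphic (of some depth `< d`): `𝖫^d F = 0` for some `d`. -/
def IsAlmostHolomorphic (hΩ : M.IsConeOpen Ω) (F : M.smoothSec Ω s) : Prop :=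
  ∃ d, lowerIter hΩ s d F = 0

end EvenLattice

/-! ### The period domain, the modular group and modular forms -/

/-- An even lattice of signature `(2,n)` together with the choice of one of the two components of
`{Z · Z = 0, Z · Z̄ > 0}`, given by a point of that component. -/
structure PeriodDomain (n : ℕ) extends EvenLattice n where
  base : V n
  base_mem : base ∈ toEvenLattice.isotropicPositive

namespace PeriodDomain

open EvenLattice

variable {n : ℕ}

/-- The action of `GL_{n+2}(ℤ)` on `M_ℂ`. -/
def act (γ : GL (Fin (n + 2)) ℤ) (Z : V n) : V n :=
  ((γ : Matrix (Fin (n + 2)) (Fin (n + 2)) ℤ).map (Int.cast : ℤ → ℂ)).mulVec Z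

lemma act_mul (γ δ : GL (Fin (n + 2)) ℤ) (Z : V n) : act (γ * δ) Z = act γ (act δ Z) := by
  simp [act, Matrix.map_mul_intCast]

lemma act_one (Z : V n) : act (1 : GL (Fin (n + 2)) ℤ) Z = Z := by
  simp [act]

variable (D : PeriodDomain n)

/-- The affine cone `Aff(𝓓)` over the period domain `𝓓`. -/
def cone : Set (V n) := connectedComponentIn D.isotropicPositive D.base

/-- The group `O⁺(M)` of isometries of `M` which preserve the component. -/
def orthogonalGroup : Subgroup (GL (Fin (n + 2)) ℤ) where
  carrier := {γ | (γ : Matrix (Fin (n + 2)) (Fin (n + 2)) ℤ).transpose * D.gram * γ = D.gram ∧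
    act γ '' D.cone = D.cone}
  one_mem' := by
    refine ⟨by simp, ?_⟩
    have : (act (1 : GL (Fin (n + 2)) ℤ) : V n → V n) = id := funext act_one
    rw [this, Set.image_id]
  mul_mem' := by
    rintro γ δ ⟨h1, h2⟩ ⟨h3, h4⟩
    refine ⟨?_, ?_⟩
    · rw [Units.val_mul, Matrix.transpose_mul]
      calc _ = (δ : Matrix (Fin (n + 2)) (Fin (n + 2)) ℤ).transpose *
            ((γ : Matrix (Fin (n + 2)) (Fin (n + 2)) ℤ).transpose * D.gram * γ) * δ := by
            simp only [Matrix.mul_assoc]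
        _ = D.gram := by rw [h1, h3]
    · have : (act (γ * δ) : V n → V n) = act γ ∘ act δ := funext (act_mul γ δ)
      rw [this, Set.image_comp, h4, h2]
  inv_mem' := by
    rintro γ ⟨h1, h2⟩
    have hγ : (γ : Matrix (Fin (n + 2)) (Fin (n + 2)) ℤ) * (γ⁻¹ : GL (Fin (n + 2)) ℤ) = 1 := by
      rw [← Units.val_mul, mul_inv_cancel, Units.val_one]
    refine ⟨?_, ?_⟩
    · have hγt : ((γ⁻¹ : GL (Fin (n + 2)) ℤ) : Matrix (Fin (n + 2)) (Fin (n + 2)) ℤ).transpose *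
          (γ : Matrix (Fin (n + 2)) (Fin (n + 2)) ℤ).transpose = 1 := by
        rw [← Matrix.transpose_mul, hγ, Matrix.transpose_one]
      calc _ = ((γ⁻¹ : GL (Fin (n + 2)) ℤ) : Matrix (Fin (n + 2)) (Fin (n + 2)) ℤ).transpose *
            ((γ : Matrix (Fin (n + 2)) (Fin (n + 2)) ℤ).transpose * D.gram * γ) *
              (γ⁻¹ : GL (Fin (n + 2)) ℤ) := by rw [h1]
        _ = (((γ⁻¹ : GL (Fin (n + 2)) ℤ) : Matrix (Fin (n + 2)) (Fin (n + 2)) ℤ).transpose *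
            (γ : Matrix (Fin (n + 2)) (Fin (n + 2)) ℤ).transpose) * D.gram *
              ((γ : Matrix (Fin (n + 2)) (Fin (n + 2)) ℤ) * (γ⁻¹ : GL (Fin (n + 2)) ℤ)) := by
            simp only [Matrix.mul_assoc]
        _ = D.gram := by rw [hγt, hγ, Matrix.one_mul, Matrix.mul_one]
    · have h3 : (act γ⁻¹ ∘ act γ : V n → V n) = id := funext fun Z => by
        rw [Function.comp_apply, ← act_mul, inv_mul_cancel, act_one]; rfl
      calc act γ⁻¹ '' D.cone = act γ⁻¹ '' (act γ '' D.cone) := by rw [h2]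
        _ = D.cone := by rw [← Set.image_comp, h3, Set.image_id]

variable {D}

section Predicates

variable {Ω : Set (V n)} {s : ℕ}

/-- `F` has weight `k`, i.e. is a section of `𝓛^k ⊗ 𝓔^{⊗ s}`: it is homogeneous of degree `-k`
on the affine cone. -/
def HasWeight (k : ℤ) (F : D.Sec Ω s) : Prop :=
  ∀ (a : ℂ) (Z Z' : Ω), a ≠ 0 → (Z' : V n) = a • (Z : V n) →
    ∀ (w : Fin s → D.perp (Z : V n)) (w' : Fin s → D.perp (Z' : V n)),
      (∀ r, (w' r : V n) = w r) →
        F Z' (fun r => D.cls Z' (w' r)) = a ^ (-k) * F Z (fun r => D.cls Z (w r))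

/-- `F` is `Γ`-invariant: `γ^* F = F` for all `γ ∈ Γ`. -/
def IsInvariant (Γ : Subgroup D.orthogonalGroup) (F : D.Sec Ω s) : Prop :=
  ∀ γ ∈ Γ, ∀ Z Z' : Ω, (Z' : V n) = act γ (Z : V n) →
    ∀ (w : Fin s → D.perp (Z : V n)) (w' : Fin s → D.perp (Z' : V n)),
      (∀ r, (w' r : V n) = act γ (w r : V n)) →
        F Z' (fun r => D.cls Z' (w' r)) = F Z (fun r => D.cls Z (w r))

lemma HasWeight.add {k : ℤ} {F G : D.Sec Ω s} (hF : HasWeight k F) (hG : HasWeight k G) :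
    HasWeight k (F + G) := fun a Z Z' ha h w w' hw => by
  simp only [Pi.add_apply, add_apply, hF a Z Z' ha h w w' hw, hG a Z Z' ha h w w' hw, mul_add]

lemma HasWeight.smul {k : ℤ} {F : D.Sec Ω s} (c : ℂ) (hF : HasWeight k F) :
    HasWeight k (c • F) := fun a Z Z' ha h w w' hw => by
  simp only [Pi.smul_apply, smul_apply, hF a Z Z' ha h w w' hw, smul_eq_mul]; ring

lemma HasWeight.zero {k : ℤ} : HasWeight k (0 : D.Sec Ω s) := fun a Z Z' ha h w w' hw => by simp

lemma IsInvariant.add {Γ : Subgroup D.orthogonalGroup} {F G : D.Sec Ω s}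
    (hF : IsInvariant Γ F) (hG : IsInvariant Γ G) : IsInvariant Γ (F + G) :=
  fun γ hγ Z Z' h w w' hw => by
    simp only [Pi.add_apply, add_apply, hF γ hγ Z Z' h w w' hw, hG γ hγ Z Z' h w w' hw]

lemma IsInvariant.smul {Γ : Subgroup D.orthogonalGroup} {F : D.Sec Ω s} (c : ℂ)
    (hF : IsInvariant Γ F) : IsInvariant Γ (c • F) :=
  fun γ hγ Z Z' h w w' hw => by
    simp only [Pi.smul_apply, smul_apply, hF γ hγ Z Z' h w w' hw]

lemma IsInvariant.zero {Γ : Subgroup D.orthogonalGroup} : IsInvariant Γ (0 : D.Sec Ω s) :=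
  fun γ hγ Z Z' h w w' hw => by simp

end Predicates

/-- The space `Mod_{k,s}(Γ)` of (holomorphic) modular forms of weight `k` and rank `s`. -/
def Mod (Γ : Subgroup D.orthogonalGroup) (k : ℤ) (s : ℕ) : Submodule ℂ (D.Sec D.cone s) where
  carrier := {F | IsRegular ℂ F ∧ HasWeight k F ∧ IsInvariant Γ F}
  add_mem' h h' := ⟨h.1.add h'.1, h.2.1.add h'.2.1, h.2.2.add h'.2.2⟩
  zero_mem' := ⟨IsRegular.zero, HasWeight.zero, IsInvariant.zero⟩
  smul_mem' a _ h := ⟨h.1.smul a, h.2.1.smul a, h.2.2.smul a⟩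

variable {Γ : Subgroup D.orthogonalGroup} {l : ℤ}

/-- The value at `Z` of a modular form of rank `0`. -/
def value (f : Mod Γ l 0) (Z : D.cone) : ℂ := (f : D.Sec D.cone 0) Z (fun r => r.elim0)

/-- The (affine cone over the) vanishing locus `𝓗` of `f`. -/
def zeroLocus (f : Mod Γ l 0) : Set (V n) := {Z | ∃ h : Z ∈ D.cone, value f ⟨Z, h⟩ = 0}

/-- The (affine cone over the) complement `𝓓 ∖ 𝓗`. -/
def compl (f : Mod Γ l 0) : Set (V n) := D.cone \ zeroLocus f

lemma value_ne_zero (f : Mod Γ l 0) (Z : compl f) : value f ⟨Z, Z.2.1⟩ ≠ 0 :=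
  fun h => Z.2.2 ⟨Z.2.1, h⟩

lemma isConeOpen_cone : D.IsConeOpen D.cone := by
  refine ⟨connectedComponentIn_subset _ _, fun Z hZ => ?_⟩
  obtain ⟨T, hT, hZT, hTQ, hev⟩ :=
    exists_preconnected_nhds (connectedComponentIn_subset _ _ hZ : Z ∈ D.isotropicPositive)
  have hcomp : T ⊆ D.cone := by
    have h1 : T ⊆ connectedComponentIn D.isotropicPositive Z :=
      hT.subset_connectedComponentIn hZT hTQ
    have h2 : connectedComponentIn D.isotropicPositive D.base =
        connectedComponentIn D.isotropicPositive Z := connectedComponentIn_eq hZ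
    unfold cone
    rw [h2]; exact h1
  filter_upwards [hev] with Y hY hYY
  exact hcomp (hY hYY)

lemma isConeOpen_compl (f : Mod Γ l 0) : D.IsConeOpen (compl f) := by
  refine ⟨fun Z hZ => isConeOpen_cone.1 hZ.1, fun Z hZ => ?_⟩
  obtain ⟨U, hU, hZU, c, hc, hr⟩ := f.2.1 ⟨Z, hZ.1⟩
  set I₀ : Fin 0 → Fin (n + 2) := fun r => r.elim0
  have hval : ∀ (Y : V n) (hY : Y ∈ D.cone), Y ∈ U → value f ⟨Y, hY⟩ = c I₀ Y := by
    intro Y hY hYU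
    have h := hr ⟨Y, hY⟩ hYU (fun r => r.elim0)
    have h0 : ∀ I : Fin 0 → Fin (n + 2), I = I₀ := fun I => funext fun r => r.elim0
    rw [form_apply, Fintype.sum_eq_single I₀ fun I hI => absurd (h0 I) hI] at h
    simp only [Finset.univ_eq_empty, Finset.prod_empty, mul_one] at h
    rw [← h, value]
    congr 1
    funext r
    exact r.elim0
  have hne : c I₀ Z ≠ 0 := by
    rw [← hval Z hZ.1 hZU]
    exact value_ne_zero f ⟨Z, hZ⟩
  have hcont : ContinuousAt (c I₀) Z := ((hc I₀).continuousOn).continuousAt (hU.mem_nhds hZU)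
  filter_upwards [isConeOpen_cone.2 Z hZ.1, hcont.eventually_ne hne, hU.mem_nhds hZU]
    with Y h1 h2 h3 h4
  refine ⟨h1 h4, fun ⟨h5, h6⟩ => h2 ?_⟩
  rw [← hval Y h5 h3, h6]

/-! ### Poles along `𝓗` and logarithmic forms -/

/-- `h` is a holomorphic function on the open subset `U` of the cone which vanishes exactly on
`𝓗 ∩ U`, and there to first order (its differential along the cone is non-zero on a dense subset
of `𝓗 ∩ U`): a reduced local equation of `𝓗`. -/
def IsLocalEquation (f : Mod Γ l 0) (U : Set (V n)) (h : V n → ℂ) : Prop :=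
  DifferentiableOn ℂ h U ∧
  (∀ Z ∈ D.cone ∩ U, h Z = 0 ↔ Z ∈ zeroLocus f) ∧
  zeroLocus f ∩ U ⊆
    closure {Z ∈ zeroLocus f ∩ U | ∃ u ∈ D.perp Z, fderiv ℂ h Z u ≠ 0}

/-- `F` has pole order `≤ e` along `𝓗`: for every reduced local equation `h` of `𝓗` on an open
subset `U`, the section `h^e F` extends to a section over all of `U`, which is smooth (`𝕜 = ℝ`),
resp. holomorphic (`𝕜 = ℂ`).  For `e < 0` this is a condition of vanishing along `𝓗`. -/
def HasPoleOrderLE (𝕜 : Type) [RCLike 𝕜] [NormedAlgebra 𝕜 ℂ] (f : Mod Γ l 0) {s : ℕ}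
    (e : ℤ) (F : D.Sec (compl f) s) : Prop :=
  ∀ (U : Set (V n)) (h : V n → ℂ), IsOpen U → IsLocalEquation f U h →
    ∃ F' : D.Sec (D.cone ∩ U) s, IsRegular 𝕜 F' ∧
      ∀ (Z : V n) (h₁ : Z ∈ D.cone ∩ U) (h₂ : Z ∈ compl f), F' ⟨Z, h₁⟩ = (h Z) ^ e • F ⟨Z, h₂⟩

section PoleFacts

variable {𝕜 : Type} [RCLike 𝕜] [NormedAlgebra 𝕜 ℂ] {f : Mod Γ l 0} {s : ℕ} {e : ℤ}

lemma HasPoleOrderLE.add {F G : D.Sec (compl f) s} (hF : HasPoleOrderLE 𝕜 f e F)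
    (hG : HasPoleOrderLE 𝕜 f e G) : HasPoleOrderLE 𝕜 f e (F + G) := fun U h hU hh => by
  obtain ⟨F', h1, h2⟩ := hF U h hU hh
  obtain ⟨G', h3, h4⟩ := hG U h hU hh
  exact ⟨F' + G', h1.add h3, fun Z a b => by
    rw [Pi.add_apply, Pi.add_apply, h2 Z a b, h4 Z a b, smul_add]⟩

lemma HasPoleOrderLE.smul {F : D.Sec (compl f) s} (a : ℂ) (hF : HasPoleOrderLE 𝕜 f e F) :
    HasPoleOrderLE 𝕜 f e (a • F) := fun U h hU hh => by
  obtain ⟨F', h1, h2⟩ := hF U h hU hh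
  exact ⟨a • F', h1.smul a, fun Z h₁ h₂ => by
    rw [Pi.smul_apply, Pi.smul_apply, h2 Z h₁ h₂, smul_comm]⟩

lemma HasPoleOrderLE.zero : HasPoleOrderLE 𝕜 f e (0 : D.Sec (compl f) s) := fun _ _ _ _ =>
  ⟨0, IsRegular.zero, fun Z h₁ h₂ => by simp⟩

end PoleFacts

/-- The space `Mod^log_{k,s}(Γ)` of logarithmic modular forms on `(𝓓, 𝓗)`: meromorphic
`Γ`-invariant sections of `𝓛^k ⊗ 𝓔^{⊗ s}` with a pole of order `≤ k` along `𝓗` and no other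
poles. -/
def LogMod (f : Mod Γ l 0) (k : ℤ) (s : ℕ) : Submodule ℂ (D.Sec (compl f) s) where
  carrier := {F | IsRegular ℂ F ∧ HasWeight k F ∧ IsInvariant Γ F ∧ HasPoleOrderLE ℂ f k F}
  add_mem' h h' := ⟨h.1.add h'.1, h.2.1.add h'.2.1, h.2.2.1.add h'.2.2.1, h.2.2.2.add h'.2.2.2⟩
  zero_mem' := ⟨IsRegular.zero, HasWeight.zero, IsInvariant.zero, HasPoleOrderLE.zero⟩
  smul_mem' a _ h := ⟨h.1.smul a, h.2.1.smul a, h.2.2.1.smul a, h.2.2.2.smul a⟩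

/-- The subspace `Mod^log_{k,s+d}(Γ)^{S_d}` of forms of rank `s + d` which are invariant under the
permutations of the last `d` factors. -/
def LogModSym (f : Mod Γ l 0) (k : ℤ) (s d : ℕ) : Submodule ℂ (D.Sec (compl f) (s + d)) where
  carrier := {F | F ∈ LogMod f k (s + d) ∧
    ∀ (Z : compl f) (w : Fin s → D.E (Z : V n)) (v : Fin d → D.E (Z : V n))
      (σ : Equiv.Perm (Fin d)), F Z (Fin.append w (v ∘ σ)) = F Z (Fin.append w v)}
  add_mem' h h' := ⟨add_mem h.1 h'.1, fun Z w v σ => by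
    simp only [Pi.add_apply, add_apply, h.2 Z w v σ, h'.2 Z w v σ]⟩
  zero_mem' := ⟨zero_mem _, fun Z w v σ => rfl⟩
  smul_mem' a _ h := ⟨Submodule.smul_mem _ a h.1, fun Z w v σ => by
    simp only [Pi.smul_apply, smul_apply, h.2 Z w v σ]⟩

/-- The space `AHMod^log_{k,s}(Γ)` of logarithmic almost-holomorphic modular forms on `(𝓓, 𝓗)`:
smooth sections `F` of `𝓛^k ⊗ 𝓔^{⊗ s}` over `𝓓 ∖ 𝓗` which are almost-holomorphic and
`Γ`-invariant, such that `𝖫^d F` has a pole of order `≤ k - d` along `𝓗` for all `d ≥ 0`. -/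
def LogAHMod (f : Mod Γ l 0) (k : ℤ) (s : ℕ) : Submodule ℂ (D.smoothSec (compl f) s) where
  carrier := {F | IsAlmostHolomorphic (isConeOpen_compl f) F ∧
    HasWeight k (F : D.Sec (compl f) s) ∧ IsInvariant Γ (F : D.Sec (compl f) s) ∧
    ∀ d : ℕ, HasPoleOrderLE ℝ f (k - d)
      (lowerIter (isConeOpen_compl f) s d F : D.Sec (compl f) (s + d))}
  add_mem' := by
    rintro F G ⟨⟨d, hd⟩, h2, h3, h4⟩ ⟨⟨d', hd'⟩, h2', h3', h4'⟩
    have hmono : ∀ (H : D.smoothSec (compl f) s) (a b : ℕ), a ≤ b →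
        lowerIter (isConeOpen_compl f) s a H = 0 → lowerIter (isConeOpen_compl f) s b H = 0 := by
      intro H a b hab ha
      induction b, hab using Nat.le_induction with
      | base => exact ha
      | succ b _ ih => rw [lowerIter, LinearMap.comp_apply, ih, map_zero]
    refine ⟨⟨max d d', ?_⟩, h2.add h2', h3.add h3', fun j => ?_⟩
    · rw [map_add, hmono F _ _ (le_max_left _ _) hd, hmono G _ _ (le_max_right _ _) hd', add_zero]
    · rw [map_add]; exact (h4 j).add (h4' j)
  zero_mem' := ⟨⟨0, map_zero _⟩, HasWeight.zero, IsInvariant.zero, fun d => by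
    rw [map_zero]; exact HasPoleOrderLE.zero⟩
  smul_mem' := by
    rintro a F ⟨⟨d, hd⟩, h2, h3, h4⟩
    refine ⟨⟨d, by rw [map_smul, hd, smul_zero]⟩, h2.smul a, h3.smul a, fun j => ?_⟩
    rw [map_smul]; exact (h4 j).smul a

/-! ### The logarithmic derivative `G` and the contraction pairing -/

/-- The raising operator `𝖱 f = |Z|^{-2l} ∂ (|Z|^{2l} f)` on modular forms of weight `l` and rank
`0`, as a linear form on the fibres `Z^⊥ / ℂ Z`.  The derivative is evaluated on vectors tangent to
the cone, so it does not depend on the coefficient function representing `f` near `Z`. -/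
def raise (f : Mod Γ l 0) (Z : D.cone) : Module.Dual ℂ (D.E (Z : V n)) :=
  (∑ k, ((D.normSq (Z : V n)) ^ (-l) *
    dhol (fun Y => D.normSq Y ^ l * f.2.1.coeff Z (fun r => r.elim0) Y) Z k) •
      (LinearMap.proj k : V n →ₗ[ℂ] ℂ)) ∘ₗ D.orthRep Z

/-- `G = 𝖱(f) / (l f)`, a section of `𝓛 ⊗ 𝓔` over `𝓓 ∖ 𝓗`. -/
def logDeriv (f : Mod Γ l 0) (Z : compl f) : Module.Dual ℂ (D.E (Z : V n)) :=
  ((l : ℂ) * value f ⟨Z, Z.2.1⟩)⁻¹ • raise f ⟨Z, Z.2.1⟩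

/-- The tensor power `G^{⊗ d}` of a linear form. -/
def tensorPow {E : Type*} [AddCommGroup E] [Module ℂ E] (G : Module.Dual ℂ E) (d : ℕ) :
    MultilinearMap ℂ (fun _ : Fin d => E) ℂ :=
  (MultilinearMap.mkPiAlgebra ℂ (Fin d) ℂ).compLinearMap (fun _ => G)

lemma append_update {E : Type*} {s t : ℕ} [DecidableEq (Fin s)] (w : Fin s → E) (v : Fin t → E)
    (i : Fin s) (z : E) : Fin.append (Function.update w i z) v =
      Function.update (Fin.append w v) (Fin.castAdd t i) z := by
  funext j
  refine Fin.addCases (fun j => ?_) (fun j => ?_) j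
  · by_cases h : j = i
    · subst h; simp
    · have h' : Fin.castAdd t j ≠ Fin.castAdd t i := fun e => h (Fin.castAdd_injective s t e)
      simp [Function.update_of_ne, h, h']
  · have h' : Fin.natAdd s j ≠ Fin.castAdd t i := by
      intro e
      have := congrArg Fin.val e
      simp at this
      omega
    simp [Function.update_of_ne, h']

/-- Inserting vectors in the last `t` arguments. -/
def insertLast {E : Type*} [AddCommGroup E] [Module ℂ E] {s t : ℕ}
    (F : MultilinearMap ℂ (fun _ : Fin (s + t) => E) ℂ) (v : Fin t → E) :
    MultilinearMap ℂ (fun _ : Fin s => E) ℂ where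
  toFun w := F (Fin.append w v)
  map_update_add' := by
    intro _ w i x y
    rw [append_update, append_update, append_update]
    exact F.map_update_add _ _ _ _
  map_update_smul' := by
    intro _ w i c x
    rw [append_update, append_update]
    exact F.map_update_smul _ _ _ _

/-- The pairing `⟨F, T⟩ = tr_{(s+1,s+t+1),…,(s+t,s+2t)} (F ⊗ T)` of an element of `E^{⊗ (s+t)}` and an
element of `E^{⊗ t}`, contracting the last `t` factors through a non-degenerate symmetric form
`B` on `E`; tensors are viewed as multilinear forms, so that the contraction is the sum over a basis
and its `B`-dual basis. -/
def pairing {E : Type*} [AddCommGroup E] [Module ℂ E] [FiniteDimensional ℂ E]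
    (B : LinearMap.BilinForm ℂ E) (hB : B.Nondegenerate) {s t : ℕ}
    (F : MultilinearMap ℂ (fun _ : Fin (s + t) => E) ℂ)
    (T : MultilinearMap ℂ (fun _ : Fin t => E) ℂ) : MultilinearMap ℂ (fun _ : Fin s => E) ℂ :=
  ∑ I : Fin t → Fin (Module.finrank ℂ E),
    T (fun r => B.dualBasis hB (Module.finBasis ℂ E) (I r)) •
      insertLast F (fun r => Module.finBasis ℂ E (I r))

/-- The section `⟨F, G^{⊗ d}⟩` of rank `s`, for `F` of rank `s + d`. -/
def pairLogDeriv (f : Mod Γ l 0) {s d : ℕ} (F : D.Sec (compl f) (s + d)) : D.Sec (compl f) s :=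
  fun Z => pairing (D.tr Z) (D.tr_nondegenerate Z) (F Z) (tensorPow (logDeriv f Z) d)

end PeriodDomain
end OrthogonalForms

end

/-!
An almost-holomorphic form is recovered from its iterated images under `𝖫`. The vector dual to `G`
is the sum of a holomorphic vector field and of `Z̄ / (2|Z|²)`, so that `𝖫(G)` is half the trace
pairing. Hence, for `F` holomorphic and symmetric in its last `d` arguments, `𝖫⟨F, G^{⊗ d}⟩` is a
nonzero multiple of `⟨F, G^{⊗ (d - 1)}⟩` (`lowerFun_contr`); so `𝖫^d⟨F, G^{⊗ d}⟩` is a nonzero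
multiple of `F`, and `𝖫^{d+1}` annihilates `⟨F, G^{⊗ d}⟩`. Conversely, if `𝖫^{d+1} F = 0`, then
`𝖫^d F` is holomorphic, because `𝖫` is `∂̄` in the horizontal directions, and homogeneity takes
care of the radial one; and `𝖫^d F` is symmetric in its last `d` arguments, because
antiholomorphic derivatives commute (`lowerIter_mem_logModSym`). So the sum of the contraction
maps is triangular with respect to the filtration by the kernels of the `𝖫^d`, with isomorphisms
on the diagonal. It is bijective as soon as `𝖫^d F`, which has weight `k - d`, vanishes for
`d > k` (`bijective_toModule_contrMap`).

It remains to see that there are no forms of negative weight.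

A form of weight `k ≤ 0` with pole order at most `k` along `𝓗` extends holomorphically to the
whole cone (`exists_extension_of_poleOrder`). The pole condition gives the extension near the
points where `𝓗` has a reduced equation with nonzero differential along a fixed direction. By the
argument principle the lines in this direction which meet `𝓗` near a given point only in such
points are dense (`exists_line_unique_zeros`), and a Cauchy integral over circles in these lines
which avoid `𝓗` defines the extension everywhere (`exists_extension_of_reduced`).

Holomorphic forms `F` of negative weight vanish by the maximum principle. A rational subspace of
signature `(2,1)` on which the quadratic form does not represent zero cuts out a disc in `𝓓`, on
which the isometries in `Γ` that preserve the subspace and fix its orthogonal complement act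
cocompactly (`exists_isMaxOn_frames`; the compactness comes from Minkowski's theorem and the
finiteness of the set of integral matrices of bounded size). Along this disc, `𝓔` is the sum of
the tangent line and the constant orthogonal complement of the subspace, so the components of `F`
in an orthonormal frame have bounded absolute value, and attain their maximum; by homogeneity each
of them is a holomorphic function of a disc parameter `t`, divided by a positive power of
`1 - |t|²`, which forces the maximum to be zero (`ev_frame_eq_zero`). As `n ≥ 3`, suitable congruences
modulo an integer on an integral basis exclude zeros of the quadratic form on its span
(`exists_anisotropic_residue`). So the points of such discs are dense (`exists_frameVec_approx`),
and `F = 0` (`eq_zero_of_mem_mod`).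
-/

namespace OrthogonalForms

section ComplexAnalysis

open Metric Set Complex Filter

variable {E : Type*} [NormedAddCommGroup E] [NormedSpace ℂ E]

lemma norm_fderiv_le_of_closedBall_subset {φ : E → ℂ} {W : Set E} (hW : IsOpen W)
    (hφ : DifferentiableOn ℂ φ W) {X : E} {r C : ℝ} (hr : 0 < r) (hX : closedBall X r ⊆ W)
    (hC : ∀ Y ∈ closedBall X r, ‖φ Y‖ ≤ C) : ‖fderiv ℂ φ X‖ ≤ C / r := by
  have hC0 : 0 ≤ C := (norm_nonneg _).trans (hC X (mem_closedBall_self hr.le))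
  refine ContinuousLinearMap.opNorm_le_bound _ (by positivity) fun v => ?_
  rcases eq_or_ne v 0 with rfl | hv
  · simp
  have hv' : 0 < ‖v‖ := norm_pos_iff.mpr hv
  have hmem : ∀ ζ ∈ closedBall (0 : ℂ) (r / ‖v‖), X + ζ • v ∈ closedBall X r := fun ζ hζ => by
    rw [mem_closedBall_zero_iff, le_div_iff₀ hv'] at hζ
    simpa [norm_smul] using hζ
  have hd : ∀ ζ ∈ closedBall (0 : ℂ) (r / ‖v‖),
      DifferentiableAt ℂ (fun ζ : ℂ => φ (X + ζ • v)) ζ := fun ζ hζ => by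
    have h1 := (hφ.differentiableAt (hW.mem_nhds (hX (hmem ζ hζ))))
    exact DifferentiableAt.comp ζ h1 (by fun_prop)
  have hder : deriv (fun ζ : ℂ => φ (X + ζ • v)) 0 = fderiv ℂ φ X v := by
    have h1 := (hφ.differentiableAt (hW.mem_nhds (hX (mem_closedBall_self hr.le)))).hasFDerivAt
    have h2 : HasDerivAt (fun ζ : ℂ => X + ζ • v) v 0 := by
      simpa using ((hasDerivAt_id (0 : ℂ)).smul_const v).const_add X
    have h1' : HasFDerivAt φ (fderiv ℂ φ X) (X + (0 : ℂ) • v) := by simpa using h1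
    exact (h1'.comp_hasDerivAt (0 : ℂ) h2).deriv
  have hdc : DiffContOnCl ℂ (fun ζ : ℂ => φ (X + ζ • v)) (ball 0 (r / ‖v‖)) :=
    DifferentiableOn.diffContOnCl_ball (U := closedBall (0 : ℂ) (r / ‖v‖))
      (fun ζ hζ => (hd ζ hζ).differentiableWithinAt) subset_rfl
  have := Complex.norm_deriv_le_of_forall_mem_sphere_norm_le (by positivity) hdc
    (C := C) fun ζ hζ => hC _ (hmem ζ (sphere_subset_closedBall hζ))
  rw [hder] at this
  calc ‖fderiv ℂ φ X v‖ ≤ C / (r / ‖v‖) := this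
    _ = C / r * ‖v‖ := by field_simp

/-- A circle integral of a holomorphic function of several variables over translates of a circle
is a holomorphic function of the translation. -/
lemma differentiableOn_circleIntegral [FiniteDimensional ℂ E] {φ : E → ℂ} {W B : Set E}
    (hW : IsOpen W) (hφ : DifferentiableOn ℂ φ W) (v : E) {c : ℂ} {R : ℝ} (hR : 0 ≤ R)
    {a : ℂ → ℂ} (ha : ContinuousOn a (sphere c R))
    (h : ∀ Y ∈ B, ∀ ζ ∈ sphere c R, Y + ζ • v ∈ W) :
    DifferentiableOn ℂ (fun Y => ∮ ζ in C(c, R), a ζ * φ (Y + ζ • v)) B := by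
  intro Y₀ hY₀
  refine DifferentiableAt.differentiableWithinAt ?_
  have : ProperSpace E := FiniteDimensional.proper ℂ E
  set K : Set E := (fun ζ : ℂ => Y₀ + ζ • v) '' sphere c R with hK
  have hKc : IsCompact K := (isCompact_sphere c R).image (by fun_prop)
  have hKW : K ⊆ W := by rintro _ ⟨ζ, hζ, rfl⟩; exact h Y₀ hY₀ ζ hζ
  obtain ⟨δ, hδ, hδW⟩ := hKc.exists_cthickening_subset_open hW hKW
  have hcomp : IsCompact (cthickening δ K) := hKc.cthickening
  obtain ⟨M, hM⟩ := hcomp.exists_bound_of_continuousOn (hφ.continuousOn.mono hδW)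
  have hcirc : ∀ θ : ℝ, circleMap c R θ ∈ sphere c R := fun θ => circleMap_mem_sphere c hR θ
  have hball : ∀ Y ∈ ball Y₀ (δ / 2), ∀ θ : ℝ,
      closedBall (Y + circleMap c R θ • v) (δ / 2) ⊆ cthickening δ K := by
    intro Y hY θ X hX
    refine mem_cthickening_of_dist_le X (Y₀ + circleMap c R θ • v) δ K
      ⟨_, hcirc θ, rfl⟩ ?_
    have h1 : dist X (Y + circleMap c R θ • v) ≤ δ / 2 := hX
    have h2 : dist (Y + circleMap c R θ • v) (Y₀ + circleMap c R θ • v) < δ / 2 := by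
      simpa using hY
    linarith [dist_triangle X (Y + circleMap c R θ • v) (Y₀ + circleMap c R θ • v)]
  have hmemW : ∀ Y ∈ ball Y₀ (δ / 2), ∀ θ : ℝ, Y + circleMap c R θ • v ∈ W := fun Y hY θ =>
    hδW (hball Y hY θ (mem_closedBall_self (by positivity)))
  set b : ℝ → ℂ := fun θ => deriv (circleMap c R) θ * a (circleMap c R θ) with hb
  have hbc : Continuous b := by
    refine Continuous.mul ?_ (ha.comp_continuous (continuous_circleMap c R) hcirc)
    have : deriv (circleMap c R) = fun θ => circleMap 0 R θ * I := funext fun θ =>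
      deriv_circleMap c R θ
    rw [this]
    exact (continuous_circleMap 0 R).mul continuous_const
  have hrew : (fun Y => ∮ ζ in C(c, R), a ζ * φ (Y + ζ • v)) =
      fun Y => ∫ θ in (0 : ℝ)..2 * Real.pi, b θ * φ (Y + circleMap c R θ • v) := by
    funext Y
    simp only [circleIntegral, hb, smul_eq_mul, mul_assoc]
  rw [hrew]
  have hFc : ∀ Y ∈ ball Y₀ (δ / 2), Continuous fun θ => b θ * φ (Y + circleMap c R θ • v) := by
    intro Y hY
    exact hbc.mul (hφ.continuousOn.comp_continuous
      (continuous_const.add ((continuous_circleMap c R).smul continuous_const)) (hmemW Y hY))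
  have key := intervalIntegral.hasFDerivAt_integral_of_dominated_of_fderiv_le (𝕜 := ℂ)
    (μ := MeasureTheory.volume) (a := 0) (b := 2 * Real.pi)
    (F := fun Y θ => b θ * φ (Y + circleMap c R θ • v))
    (F' := fun Y θ => b θ • fderiv ℂ φ (Y + circleMap c R θ • v)) (x₀ := Y₀)
    (bound := fun θ => ‖b θ‖ * (M / (δ / 2)))
    (s := ball Y₀ (δ / 2)) (ball_mem_nhds _ (by positivity)) ?_ ?_ ?_ ?_ ?_ ?_
  · exact key.differentiableAt
  · filter_upwards [ball_mem_nhds Y₀ (half_pos hδ)] with Y hY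
    exact (hFc Y hY).aestronglyMeasurable
  · exact (hFc Y₀ (mem_ball_self (by positivity))).intervalIntegrable _ _
  · borelize E
    have h1 : Measurable fun θ => fderiv ℂ φ (Y₀ + circleMap c R θ • v) :=
      (measurable_fderiv ℂ φ).comp
        (continuous_const.add ((continuous_circleMap c R).smul continuous_const)).measurable
    have : ProperSpace (E →L[ℂ] ℂ) := FiniteDimensional.proper ℂ _
    exact hbc.aestronglyMeasurable.smul h1.aestronglyMeasurable
  · refine Eventually.of_forall fun θ _ Y hY => ?_
    rw [norm_smul]
    refine mul_le_mul_of_nonneg_left ?_ (norm_nonneg _)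
    exact norm_fderiv_le_of_closedBall_subset hW hφ (half_pos hδ)
      ((hball Y hY θ).trans hδW) fun X hX => hM X (hball Y hY θ hX)
  · exact (hbc.norm.mul continuous_const).intervalIntegrable _ _
  · refine Eventually.of_forall fun θ _ Y hY => ?_
    have h1 := (hφ.differentiableAt (hW.mem_nhds (hmemW Y hY θ))).hasFDerivAt
    have h2 : HasFDerivAt (fun Y : E => Y + circleMap c R θ • v)
        (ContinuousLinearMap.id ℂ E) Y := (hasFDerivAt_id Y).add_const _
    exact (HasFDerivAt.comp Y h1 h2).const_mul (b θ)

lemma deriv_line {φ : E → ℂ} {X v : E} {ζ : ℂ} (hφ : DifferentiableAt ℂ φ (X + ζ • v)) :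
    HasDerivAt (fun ζ : ℂ => φ (X + ζ • v)) (fderiv ℂ φ (X + ζ • v) v) ζ := by
  have h2 : HasDerivAt (fun ζ : ℂ => X + ζ • v) v ζ := by
    simpa using ((hasDerivAt_id ζ).smul_const v).const_add X
  exact hφ.hasFDerivAt.comp_hasDerivAt ζ h2

lemma eventually_closedBall_line_subset {W : Set E} (hW : IsOpen W) {Y₀ : E} (hY₀ : Y₀ ∈ W)
    (v : E) : ∃ r > 0, ∀ᶠ Y in 𝓝 Y₀, ∀ ζ ∈ closedBall (0 : ℂ) r, Y + ζ • v ∈ W := by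
  have hc : ContinuousAt (fun p : ℂ × E => p.2 + p.1 • v) (0, Y₀) := by fun_prop
  have h1 : ∀ᶠ p in 𝓝 ((0 : ℂ), Y₀), p.2 + p.1 • v ∈ W :=
    hc.eventually (hW.mem_nhds (by simpa using hY₀))
  rw [nhds_prod_eq] at h1
  obtain ⟨pa, ha, pb, hb, hab⟩ := Filter.eventually_prod_iff.mp h1
  obtain ⟨ε, hε, hball⟩ := Metric.eventually_nhds_iff_ball.mp ha
  exact ⟨ε / 2, half_pos hε, hb.mono fun Y hY ζ hζ =>
    hab (hball ζ (closedBall_subset_ball (by linarith) hζ)) hY⟩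

lemma differentiableOn_fderiv_apply [FiniteDimensional ℂ E] {φ : E → ℂ} {W : Set E}
    (hW : IsOpen W) (hφ : DifferentiableOn ℂ φ W) (v : E) :
    DifferentiableOn ℂ (fun Y => fderiv ℂ φ Y v) W := by
  intro Y₀ hY₀
  refine DifferentiableAt.differentiableWithinAt ?_
  obtain ⟨r, hr, hev⟩ := eventually_closedBall_line_subset hW hY₀ v
  obtain ⟨ε, hε, hball⟩ := Metric.eventually_nhds_iff_ball.mp hev
  have h1 := differentiableOn_circleIntegral (B := ball Y₀ ε) hW hφ v hr.le
    (c := 0) (a := fun ζ => (2 * Real.pi * I)⁻¹ * ((ζ - 0) ^ 2)⁻¹) (by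
      refine ContinuousOn.mul continuousOn_const (ContinuousOn.inv₀ (by fun_prop) ?_)
      intro ζ hζ h0
      have : ζ = 0 := by simpa using h0
      rw [this] at hζ
      simp at hζ
      linarith)
    fun Y hY ζ hζ => hball Y hY ζ (sphere_subset_closedBall hζ)
  refine (h1.differentiableAt (ball_mem_nhds Y₀ hε)).congr_of_eventuallyEq ?_
  filter_upwards [ball_mem_nhds Y₀ hε] with Y hY
  have hY0 : Y ∈ W := by simpa using hball Y hY 0 (mem_closedBall_self hr.le)
  have hop : IsOpen ((fun ζ : ℂ => Y + ζ • v) ⁻¹' W) := hW.preimage (by fun_prop)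
  have h2 := two_pi_I_inv_smul_circleIntegral_sub_sq_inv_smul_of_differentiable hop
    (f := fun ζ : ℂ => φ (Y + ζ • v)) (c := 0) (w₀ := 0) (R := r)
    (fun ζ hζ => hball Y hY ζ hζ)
    (fun ζ hζ => (deriv_line (hφ.differentiableAt (hW.mem_nhds
      hζ))).differentiableAt.differentiableWithinAt)
    (mem_ball_self hr)
  have h3 : deriv (fun ζ : ℂ => φ (Y + ζ • v)) 0 = fderiv ℂ φ Y v := by
    have := deriv_line (φ := φ) (X := Y) (v := v) (ζ := 0)
      (by simpa using hφ.differentiableAt (hW.mem_nhds hY0))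
    simpa using this.deriv
  rw [← h3, ← h2]
  simp only [smul_eq_mul, mul_assoc]
  rw [← circleIntegral.integral_const_mul]

/-- Osgood's lemma: complex differentiable functions of several variables are smooth. -/
lemma contDiffOn_of_differentiableOn [FiniteDimensional ℂ E] {φ : E → ℂ} {W : Set E}
    (hW : IsOpen W) (hφ : DifferentiableOn ℂ φ W) : ContDiffOn ℂ ∞ φ W := by
  refine contDiffOn_infty.mpr fun n => ?_
  induction n generalizing φ with
  | zero => exact contDiffOn_zero.mpr hφ.continuousOn
  | succ n ih =>
    push_cast
    refine (contDiffOn_succ_iff_fderiv_of_isOpen hW).mpr ⟨hφ, by simp, ?_⟩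
    exact contDiffOn_clm_apply.mpr fun v => ih (differentiableOn_fderiv_apply hW hφ v)

/-! ### Functions of one complex variable -/

/-- Isolated singularities which are removable one at a time are removable simultaneously. -/
lemma exists_differentiableAt_of_punctured {q : ℂ → ℂ} {S : Set ℂ}
    (h : ∀ ζ ∈ S, ∃ g : ℂ → ℂ, AnalyticAt ℂ g ζ ∧ q =ᶠ[𝓝[≠] ζ] g) :
    ∃ Q : ℂ → ℂ, (∀ ζ ∈ S, DifferentiableAt ℂ Q ζ) ∧
      (∀ ζ ∈ S, ContinuousAt q ζ → Q ζ = q ζ) := by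
  have hlim : ∀ ζ g, ContinuousAt g ζ → q =ᶠ[𝓝[≠] ζ] g → limUnder (𝓝[≠] ζ) q = g ζ :=
    fun ζ g hg hqg => ((hg.tendsto.mono_left nhdsWithin_le_nhds).congr' hqg.symm).limUnder_eq
  refine ⟨fun ζ => limUnder (𝓝[≠] ζ) q, fun ζ hζ => ?_, fun ζ hζ hc =>
    hlim ζ q hc (EventuallyEq.refl _ _)⟩
  obtain ⟨g, hg, hqg⟩ := h ζ hζ
  refine hg.differentiableAt.congr_of_eventuallyEq ?_
  have h1 := (eventually_nhdsWithin_iff.mp hqg).eventually_nhds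
  filter_upwards [h1, hg.eventually_analyticAt] with z hz hgz
  by_cases hzζ : z = ζ
  · rw [hzζ]; exact hlim ζ g hg.continuousAt hqg
  · refine hlim z g hgz.continuousAt ?_
    have h2 : ∀ᶠ x in 𝓝 z, x ≠ ζ := isOpen_ne.mem_nhds hzζ
    exact (hz.and h2).filter_mono nhdsWithin_le_nhds |>.mono fun x hx => hx.1 hx.2

lemma circleIntegral_eq_zero_of_punctured {q : ℂ → ℂ} {c : ℂ} {R : ℝ} (hR : 0 ≤ R)
    (h : ∀ ζ ∈ closedBall c R, ∃ g : ℂ → ℂ, AnalyticAt ℂ g ζ ∧ q =ᶠ[𝓝[≠] ζ] g)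
    (hc : ∀ ζ ∈ sphere c R, ContinuousAt q ζ) : (∮ ζ in C(c, R), q ζ) = 0 := by
  obtain ⟨Q, hQ, hQq⟩ := exists_differentiableAt_of_punctured h
  rw [← circleIntegral.integral_congr hR fun ζ hζ =>
    hQq ζ (sphere_subset_closedBall hζ) (hc ζ hζ)]
  exact Complex.circleIntegral_eq_zero_of_differentiable_on_off_countable hR countable_empty
    (fun ζ hζ => (hQ ζ hζ).continuousAt.continuousWithinAt)
    fun ζ hζ => hQ ζ (ball_subset_closedBall hζ.1)

lemma circleIntegral_center_of_punctured {q : ℂ → ℂ} {c : ℂ} {R : ℝ} (hR : 0 < R)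
    (h : ∀ ζ ∈ closedBall c R, ∃ g : ℂ → ℂ, AnalyticAt ℂ g ζ ∧ q =ᶠ[𝓝[≠] ζ] g)
    (hc : ∀ ζ ∈ sphere c R, ContinuousAt q ζ) (hqc : ContinuousAt q c) :
    (∮ ζ in C(c, R), (2 * Real.pi * I)⁻¹ * (ζ - c)⁻¹ * q ζ) = q c := by
  obtain ⟨Q, hQ, hQq⟩ := exists_differentiableAt_of_punctured h
  have h1 : (∮ ζ in C(c, R), (2 * Real.pi * I)⁻¹ * (ζ - c)⁻¹ * q ζ) =
      ∮ ζ in C(c, R), (2 * Real.pi * I)⁻¹ * ((ζ - c)⁻¹ • Q ζ) :=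
    circleIntegral.integral_congr hR.le fun ζ hζ => by
      simp only [smul_eq_mul, mul_assoc, hQq ζ (sphere_subset_closedBall hζ) (hc ζ hζ)]
  rw [h1, circleIntegral.integral_const_mul,
    Complex.circleIntegral_sub_center_inv_smul_of_differentiable_on_off_countable hR
      countable_empty (fun ζ hζ => (hQ ζ hζ).continuousAt.continuousWithinAt)
      fun ζ hζ => hQ ζ (ball_subset_closedBall hζ.1),
    hQq c (mem_closedBall_self hR.le) hqc, smul_eq_mul, ← mul_assoc, inv_mul_cancel₀, one_mul]
  simp [Real.pi_ne_zero, I_ne_zero]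

/-- The logarithmic derivative near a zero of order `m`. -/
lemma exists_logDeriv_eq {p : ℂ → ℂ} {b : ℂ} (hp : AnalyticAt ℂ p b)
    (hne : ¬∀ᶠ z in 𝓝 b, p z = 0) :
    ∃ (m : ℕ) (g : ℂ → ℂ), AnalyticAt ℂ g b ∧ g b ≠ 0 ∧ (m = 0 ↔ p b ≠ 0) ∧
      ∀ᶠ z in 𝓝[≠] b, deriv p z / p z = m / (z - b) + deriv g z / g z := by
  obtain ⟨m, g, hg, hgb, hpg⟩ := hp.exists_eventuallyEq_pow_smul_nonzero_iff.mpr hne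
  refine ⟨m, g, hg, hgb, ?_, ?_⟩
  · have := hpg.self_of_nhds
    rw [this]
    simp [hgb]
  · have h1 := hpg.eventually_nhds
    have h2 := hg.continuousAt.eventually_ne hgb
    refine eventually_nhdsWithin_iff.mpr ?_
    filter_upwards [h1, h2, hg.eventually_analyticAt] with z hz hgz hga hzb
    have hzb' : z - b ≠ 0 := sub_ne_zero.mpr hzb
    have hd : HasDerivAt p (m * (z - b) ^ (m - 1) * g z + (z - b) ^ m * deriv g z) z := by
      have e1 : HasDerivAt (fun z => (z - b) ^ m) (m * (z - b) ^ (m - 1)) z := by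
        simpa using ((hasDerivAt_id z).sub_const b).fun_pow m
      exact (e1.mul hga.differentiableAt.hasDerivAt).congr_of_eventuallyEq
        (hz.mono fun y hy => by simpa using hy)
    rw [hd.deriv, hz.self_of_nhds]
    rcases m with _ | m
    · simp
    · simp only [Nat.add_sub_cancel, smul_eq_mul]
      field_simp
      ring

lemma not_eventually_eq_zero_of_ne_zero {p : ℂ → ℂ} {c : ℂ} {R : ℝ}
    (hp : ∀ z ∈ closedBall c R, AnalyticAt ℂ p z) {w : ℂ} (hw : w ∈ closedBall c R)
    (hpw : p w ≠ 0) {b : ℂ} (hb : b ∈ closedBall c R) : ¬∀ᶠ z in 𝓝 b, p z = 0 := fun h0 =>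
  hpw (AnalyticOnNhd.eqOn_zero_of_preconnected_of_eventuallyEq_zero (f := p) hp
    (convex_closedBall c R).isPreconnected hb h0 hw)

/-- The argument principle, with weights `φ`: the integral of `φ p' / p` is the sum of the values
of `φ` at the zeros of `p`, counted with multiplicity. -/
lemma exists_circleIntegral_logDeriv {p : ℂ → ℂ} {c : ℂ} {R : ℝ} (hR : 0 < R)
    (hp : ∀ z ∈ closedBall c R, AnalyticAt ℂ p z) (hs : ∀ z ∈ sphere c R, p z ≠ 0) :
    ∃ (S : Finset ℂ) (m : ℂ → ℕ), (∀ z, z ∈ S ↔ z ∈ closedBall c R ∧ p z = 0) ∧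
      (∀ z ∈ S, 1 ≤ m z) ∧ ∀ φ : ℂ → ℂ, Differentiable ℂ φ →
        (∮ z in C(c, R), φ z * (deriv p z / p z)) = 2 * Real.pi * I * ∑ z ∈ S, m z * φ z := by
  obtain ⟨w, hw⟩ : (sphere c R).Nonempty := NormedSpace.sphere_nonempty.mpr hR.le
  have hne : ∀ b ∈ closedBall c R, ¬∀ᶠ z in 𝓝 b, p z = 0 := fun b hb =>
    not_eventually_eq_zero_of_ne_zero hp (sphere_subset_closedBall hw) (hs w hw) hb
  have hfin : {z | z ∈ closedBall c R ∧ p z = 0}.Finite := by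
    by_contra hinf
    obtain ⟨b, hb, hacc⟩ := Set.Infinite.exists_accPt_of_subset_isCompact hinf
      (isCompact_closedBall c R) fun z hz => hz.1
    have h1 := (accPt_iff_frequently_nhdsNE).mp hacc
    rcases (hp b hb).eventually_eq_zero_or_eventually_ne_zero with h | h
    · exact hne b hb h
    · exact h1 (h.mono fun z hz hz' => hz hz'.2)
  choose! m g hg hgb hm hlog using fun b (hb : b ∈ closedBall c R) =>
    exists_logDeriv_eq (hp b hb) (hne b hb)
  refine ⟨hfin.toFinset, m, fun z => by simp, fun z hz => ?_, fun φ hφ => ?_⟩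
  · have hz' : z ∈ closedBall c R ∧ p z = 0 := by simpa using hz
    exact Nat.one_le_iff_ne_zero.mpr fun h0 => (hm z hz'.1).mp h0 hz'.2
  have hball : ∀ z ∈ hfin.toFinset, z ∈ ball c R := fun z hz => by
    have hz' : z ∈ closedBall c R ∧ p z = 0 := by simpa using hz
    rcases (mem_closedBall.mp hz'.1).lt_or_eq with h | h
    · exact h
    · exact absurd hz'.2 (hs z h)
  have hcs : ∀ z ∈ sphere c R, ContinuousAt (fun z => φ z * (deriv p z / p z)) z := fun z hz =>
    hφ.continuous.continuousAt.mul
      ((hp z (sphere_subset_closedBall hz)).deriv.continuousAt.div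
        (hp z (sphere_subset_closedBall hz)).continuousAt (hs z hz))
  have hcr : ∀ z ∈ sphere c R, ∀ a ∈ hfin.toFinset,
      ContinuousAt (fun z => m a * φ a * (z - a)⁻¹) z := fun z hz a ha => by
    refine continuousAt_const.mul (ContinuousAt.inv₀ (by fun_prop) (sub_ne_zero.mpr ?_))
    rintro rfl
    have := hball z ha
    rw [mem_ball, mem_sphere.mp hz] at this
    exact lt_irrefl _ this
  have h0 := circleIntegral_eq_zero_of_punctured
    (q := fun z => φ z * (deriv p z / p z) - ∑ a ∈ hfin.toFinset, m a * φ a * (z - a)⁻¹)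
    (c := c) hR.le (fun b hb => by
      have hrest : ∀ T : Finset ℂ, b ∉ T →
          AnalyticAt ℂ (fun z => ∑ a ∈ T, m a * φ a * (z - a)⁻¹) b := fun T hT => by
        refine Finset.analyticAt_fun_sum _ fun a ha => ?_
        refine analyticAt_const.mul (AnalyticAt.inv (analyticAt_id.sub analyticAt_const) ?_)
        exact sub_ne_zero.mpr fun h => hT (h ▸ ha)
      have hφa : AnalyticAt ℂ φ b := hφ.analyticAt b
      have hds : AnalyticAt ℂ (dslope φ b) b := by
        have : DifferentiableOn ℂ (dslope φ b) univ :=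
          (differentiableOn_dslope univ_mem).mpr hφ.differentiableOn
        exact this.analyticAt univ_mem
      refine ⟨fun z => m b * dslope φ b z + φ z * (deriv (g b) z / g b z) -
        ∑ a ∈ hfin.toFinset.erase b, m a * φ a * (z - a)⁻¹, ?_, ?_⟩
      · exact ((analyticAt_const.mul hds).add
          (hφa.mul ((hg b hb).deriv.div (hg b hb) (hgb b hb)))).sub
            (hrest _ (Finset.notMem_erase b _))
      · filter_upwards [hlog b hb, self_mem_nhdsWithin] with z hz hzb
        have hzb' : z - b ≠ 0 := sub_ne_zero.mpr hzb
        have hsum : ∑ a ∈ hfin.toFinset, m a * φ a * (z - a)⁻¹ =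
            m b * φ b * (z - b)⁻¹ +
              ∑ a ∈ hfin.toFinset.erase b, m a * φ a * (z - a)⁻¹ := by
          by_cases hbS : b ∈ hfin.toFinset
          · exact (Finset.add_sum_erase _ (fun a => m a * φ a * (z - a)⁻¹) hbS).symm
          · have hpb : p b ≠ 0 := fun h => hbS (by simpa using ⟨hb, h⟩)
            rw [Finset.erase_eq_of_notMem hbS, (hm b hb).mpr hpb]
            simp
        rw [hz, hsum, dslope_of_ne _ hzb, slope_def_field]
        field_simp
        ring)
    (fun z hz => (hcs z hz).sub (tendsto_finsetSum _ fun a ha => hcr z hz a ha))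
  have hi1 : CircleIntegrable (fun z => φ z * (deriv p z / p z)) c R :=
    ContinuousOn.circleIntegrable hR.le fun z hz => (hcs z hz).continuousWithinAt
  have hi2 : ∀ a ∈ hfin.toFinset, CircleIntegrable (fun z => m a * φ a * (z - a)⁻¹) c R :=
    fun a ha => ContinuousOn.circleIntegrable hR.le fun z hz =>
      (hcr z hz a ha).continuousWithinAt
  have hi3 : CircleIntegrable (fun z => ∑ a ∈ hfin.toFinset, m a * φ a * (z - a)⁻¹) c R :=
    ContinuousOn.circleIntegrable hR.le fun z hz =>
      ContinuousAt.continuousWithinAt (tendsto_finsetSum _ fun a ha => hcr z hz a ha)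
  rw [circleIntegral.integral_sub hi1 hi3, sub_eq_zero] at h0
  rw [h0, circleIntegral.integral_fun_sum hi2, Finset.mul_sum]
  refine Finset.sum_congr rfl fun a ha => ?_
  rw [circleIntegral.integral_const_mul, circleIntegral.integral_sub_inv_of_mem_ball (hball a ha)]
  ring

end ComplexAnalysis

section DivisorGeometry

open Metric Set Complex Filter

variable {E : Type*} [NormedAddCommGroup E] [NormedSpace ℂ E]

/-! ### Zeros of a holomorphic function of several variables along parallel lines -/

lemma analyticAt_line {φ : E → ℂ} {W : Set E} (hW : IsOpen W) (hφ : DifferentiableOn ℂ φ W)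
    {Y v : E} {ζ : ℂ} (h : Y + ζ • v ∈ W) : AnalyticAt ℂ (fun ζ : ℂ => φ (Y + ζ • v)) ζ := by
  have hop : IsOpen ((fun ζ : ℂ => Y + ζ • v) ⁻¹' W) := hW.preimage (by fun_prop)
  have hd : DifferentiableOn ℂ (fun ζ : ℂ => φ (Y + ζ • v)) ((fun ζ : ℂ => Y + ζ • v) ⁻¹' W) :=
    fun ζ hζ =>
      (deriv_line (hφ.differentiableAt (hW.mem_nhds hζ))).differentiableAt.differentiableWithinAt
  exact hd.analyticAt (hop.mem_nhds h)

lemma eventually_forall_line {P : E → Prop} {K : Set ℂ} (hK : IsCompact K) {Y₀ v : E}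
    (h : ∀ ζ ∈ K, ∀ᶠ X in 𝓝 (Y₀ + ζ • v), P X) : ∀ᶠ Y in 𝓝 Y₀, ∀ ζ ∈ K, P (Y + ζ • v) := by
  refine hK.eventually_forall_of_forall_eventually fun ζ hζ => ?_
  have hc : ContinuousAt (fun p : E × ℂ => p.1 + p.2 • v) (Y₀, ζ) := by fun_prop
  exact hc.eventually (h ζ hζ)

lemma exists_circle_ne_zero {φ : E → ℂ} {W : Set E} (hW : IsOpen W)
    (hφ : DifferentiableOn ℂ φ W) {Z₀ v : E} (hZ₀ : Z₀ ∈ W)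
    (hv : ¬∀ᶠ ζ in 𝓝 (0 : ℂ), φ (Z₀ + ζ • v) = 0) :
    ∃ R > 0, ∃ B : Set E, IsOpen B ∧ Z₀ ∈ B ∧ ∀ Y ∈ B,
      (∀ ζ ∈ closedBall (0 : ℂ) R, Y + ζ • v ∈ W) ∧ ∀ ζ ∈ sphere (0 : ℂ) R, φ (Y + ζ • v) ≠ 0 := by
  have ha : AnalyticAt ℂ (fun ζ : ℂ => φ (Z₀ + ζ • v)) 0 :=
    analyticAt_line hW hφ (by simpa using hZ₀)
  have h1 := (ha.eventually_eq_zero_or_eventually_ne_zero).resolve_left hv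
  have h2 : ∀ᶠ ζ in 𝓝 (0 : ℂ), Z₀ + ζ • v ∈ W := by
    have hc : ContinuousAt (fun ζ : ℂ => Z₀ + ζ • v) 0 := by fun_prop
    exact hc.eventually (hW.mem_nhds (by simpa using hZ₀))
  obtain ⟨ε, hε, hball⟩ := Metric.eventually_nhds_iff_ball.mp
    ((eventually_nhdsWithin_iff.mp h1).and h2)
  have hsub : closedBall (0 : ℂ) (ε / 2) ⊆ ball 0 ε := closedBall_subset_ball (by linarith)
  have h3 := eventually_forall_line (P := fun X => X ∈ W) (isCompact_closedBall (0 : ℂ) (ε / 2))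
    (Y₀ := Z₀) (v := v) fun ζ hζ => hW.mem_nhds (hball ζ (hsub hζ)).2
  have h4 := eventually_forall_line (P := fun X => φ X ≠ 0) (isCompact_sphere (0 : ℂ) (ε / 2))
    (Y₀ := Z₀) (v := v) fun ζ hζ => by
      have hb := hball ζ (hsub (sphere_subset_closedBall hζ))
      refine (hφ.continuousOn.continuousAt (hW.mem_nhds hb.2)).eventually_ne (hb.1 ?_)
      rintro rfl
      simp at hζ
      linarith
  obtain ⟨B, hB, hBo, hZB⟩ := _root_.eventually_nhds_iff.mp (h3.and h4)
  exact ⟨ε / 2, half_pos hε, B, hBo, hZB, hB⟩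

lemma exists_circleIntegral_logDeriv_line {φ : E → ℂ} {W : Set E} (hW : IsOpen W)
    (hφ : DifferentiableOn ℂ φ W) {Y v : E} {c : ℂ} {R : ℝ} (hR : 0 < R)
    (hY : ∀ ζ ∈ closedBall c R, Y + ζ • v ∈ W) (hs : ∀ ζ ∈ sphere c R, φ (Y + ζ • v) ≠ 0) :
    ∃ (S : Finset ℂ) (m : ℂ → ℕ), (∀ z, z ∈ S ↔ z ∈ closedBall c R ∧ φ (Y + z • v) = 0) ∧
      (∀ z ∈ S, 1 ≤ m z) ∧ ∀ ψ : ℂ → ℂ, Differentiable ℂ ψ →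
        (∮ z in C(c, R), ψ z * (fderiv ℂ φ (Y + z • v) v / φ (Y + z • v))) =
          2 * Real.pi * I * ∑ z ∈ S, m z * ψ z := by
  obtain ⟨S, m, h1, h2, h3⟩ := exists_circleIntegral_logDeriv
    (p := fun ζ : ℂ => φ (Y + ζ • v)) hR (fun z hz => analyticAt_line hW hφ (hY z hz)) hs
  refine ⟨S, m, h1, h2, fun ψ hψ => ?_⟩
  rw [← h3 ψ hψ]
  refine circleIntegral.integral_congr hR.le fun z hz => ?_
  have := (deriv_line (hφ.differentiableAt
    (hW.mem_nhds (hY z (sphere_subset_closedBall hz))))).deriv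
  simp only [this]

lemma differentiableOn_logDeriv_dir [FiniteDimensional ℂ E] {φ : E → ℂ} {W : Set E}
    (hW : IsOpen W) (hφ : DifferentiableOn ℂ φ W) (v : E) :
    DifferentiableOn ℂ (fun Y => fderiv ℂ φ Y v / φ Y) (W ∩ {Y | φ Y ≠ 0}) := by
  simp only [div_eq_mul_inv]
  exact ((differentiableOn_fderiv_apply hW hφ v).mono inter_subset_left).mul
    ((hφ.mono inter_subset_left).inv fun Y hY => hY.2)

lemma isOpen_inter_ne_zero {φ : E → ℂ} {W : Set E} (hW : IsOpen W)
    (hφ : DifferentiableOn ℂ φ W) : IsOpen (W ∩ {Y | φ Y ≠ 0}) :=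
  hφ.continuousOn.isOpen_inter_preimage hW isOpen_ne

/-- If `h` vanishes on the zeros of `φ`, then `h ∂_v φ / φ` is holomorphic, for a direction `v` in
which `φ` does not vanish identically: along each line in the direction `v` the logarithmic
derivative has only simple poles. -/
lemma exists_differentiableOn_mul_logDeriv_dir [FiniteDimensional ℂ E] {φ h : E → ℂ} {W : Set E}
    (hW : IsOpen W) (hφ : DifferentiableOn ℂ φ W) (hh : DifferentiableOn ℂ h W)
    (hz : ∀ Y ∈ W, φ Y = 0 → h Y = 0) {Z₀ v : E} (hZ₀ : Z₀ ∈ W)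
    (hv : ¬∀ᶠ ζ in 𝓝 (0 : ℂ), φ (Z₀ + ζ • v) = 0) :
    ∃ (B : Set E) (κ : E → ℂ), IsOpen B ∧ Z₀ ∈ B ∧ B ⊆ W ∧ DifferentiableOn ℂ κ B ∧
      ∀ Y ∈ B, φ Y ≠ 0 → κ Y = h Y * (fderiv ℂ φ Y v / φ Y) := by
  obtain ⟨R, hR, B, hBo, hZB, hB⟩ := exists_circle_ne_zero hW hφ hZ₀ hv
  have hd := differentiableOn_logDeriv_dir hW hφ v
  have hd' : DifferentiableOn ℂ (fun Y => h Y * (fderiv ℂ φ Y v / φ Y)) (W ∩ {Y | φ Y ≠ 0}) :=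
    (hh.mono inter_subset_left).mul hd
  refine ⟨B, fun Y => ∮ ζ in C(0, R), (2 * Real.pi * I)⁻¹ * (ζ - 0)⁻¹ *
    (h (Y + ζ • v) * (fderiv ℂ φ (Y + ζ • v) v / φ (Y + ζ • v))), hBo, hZB, fun Y hY => by
      simpa using (hB Y hY).1 0 (mem_closedBall_self hR.le), ?_, ?_⟩
  · refine differentiableOn_circleIntegral (isOpen_inter_ne_zero hW hφ) hd' v hR.le ?_ ?_
    · refine ContinuousOn.mul continuousOn_const (ContinuousOn.inv₀ (by fun_prop) ?_)
      intro ζ hζ h0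
      have : ζ = 0 := by simpa using h0
      rw [this] at hζ
      simp at hζ
      linarith
    · exact fun Y hY ζ hζ => ⟨(hB Y hY).1 ζ (sphere_subset_closedBall hζ), (hB Y hY).2 ζ hζ⟩
  · intro Y hY hφY
    have hop : ∀ ζ : ℂ, Y + ζ • v ∈ W → φ (Y + ζ • v) ≠ 0 → ContinuousAt (fun ζ : ℂ =>
        h (Y + ζ • v) * (fderiv ℂ φ (Y + ζ • v) v / φ (Y + ζ • v))) ζ := fun ζ h1 h2 =>
      (analyticAt_line (isOpen_inter_ne_zero hW hφ) hd' (Y := Y) (v := v) (ζ := ζ)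
        ⟨h1, h2⟩).continuousAt
    have hYW : Y ∈ W := by simpa using (hB Y hY).1 0 (mem_closedBall_self hR.le)
    have key := circleIntegral_center_of_punctured (c := 0) (R := R)
      (q := fun ζ : ℂ => h (Y + ζ • v) * (fderiv ℂ φ (Y + ζ • v) v / φ (Y + ζ • v))) hR
      ?_ (fun ζ hζ => hop ζ ((hB Y hY).1 ζ (sphere_subset_closedBall hζ)) ((hB Y hY).2 ζ hζ))
      (hop 0 (by simpa using hYW) (by simpa using hφY))
    · simpa using key
    · intro b hb
      have hbW := (hB Y hY).1 b hb
      have hpa : ∀ z ∈ closedBall (0 : ℂ) R, AnalyticAt ℂ (fun ζ : ℂ => φ (Y + ζ • v)) z :=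
        fun z hz => analyticAt_line hW hφ ((hB Y hY).1 z hz)
      have hne := not_eventually_eq_zero_of_ne_zero hpa (mem_closedBall_self hR.le)
        (by simpa using hφY) hb
      obtain ⟨m, g, hg, hgb, hm, hlog⟩ := exists_logDeriv_eq (hpa b hb) hne
      have hha := analyticAt_line hW hh hbW
      have hds : AnalyticAt ℂ (dslope (fun ζ : ℂ => h (Y + ζ • v)) b) b := by
        obtain ⟨s, hs, hs'⟩ := hha.eventually_analyticAt.exists_mem
        have : DifferentiableOn ℂ (fun ζ : ℂ => h (Y + ζ • v)) s := fun z hz =>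
          (hs' z hz).differentiableAt.differentiableWithinAt
        exact ((differentiableOn_dslope hs).mpr this).analyticAt hs
      refine ⟨fun z => m * dslope (fun ζ : ℂ => h (Y + ζ • v)) b z +
        h (Y + z • v) * (deriv g z / g z),
        (analyticAt_const.mul hds).add (hha.mul (hg.deriv.div hg hgb)), ?_⟩
      have hWev : ∀ᶠ z in 𝓝[≠] b, Y + z • v ∈ W := by
        have hc : ContinuousAt (fun ζ : ℂ => Y + ζ • v) b := by fun_prop
        exact (hc.eventually (hW.mem_nhds hbW)).filter_mono nhdsWithin_le_nhds
      filter_upwards [hlog, self_mem_nhdsWithin, hWev] with z hz' hzb hzW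
      have hzb' : z - b ≠ 0 := sub_ne_zero.mpr hzb
      have hder := (deriv_line (hφ.differentiableAt (hW.mem_nhds hzW))).deriv
      rw [← hder, hz', dslope_of_ne _ hzb, slope_def_field]
      by_cases hmz : m = 0
      · simp [hmz]
      · have hb0 : h (Y + b • v) = 0 := hz _ hbW (by
          by_contra hcon
          exact hmz (hm.mpr hcon))
        rw [hb0]
        field_simp
        ring

lemma exists_dir_not_eventually_zero {φ : E → ℂ} {W : Set E} (hW : IsOpen W)
    (hφ : DifferentiableOn ℂ φ W) {Z₀ : E} (hZ₀ : Z₀ ∈ W) (hne : ¬∀ᶠ Y in 𝓝 Z₀, φ Y = 0) :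
    ∃ v₀ : E, ∀ v : E, ∃ t : ℂ, t ≠ 0 ∧
      (¬∀ᶠ ζ in 𝓝 (0 : ℂ), φ (Z₀ + ζ • v₀) = 0) ∧
      ¬∀ᶠ ζ in 𝓝 (0 : ℂ), φ (Z₀ + ζ • (v₀ + t • v)) = 0 := by
  obtain ⟨ε, hε, hball⟩ := Metric.isOpen_iff.mp hW Z₀ hZ₀
  have hex : ∃ Y ∈ ball Z₀ ε, φ Y ≠ 0 := by
    by_contra hcon
    push Not at hcon
    exact hne (Filter.mem_of_superset (ball_mem_nhds Z₀ hε) hcon)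
  obtain ⟨Y₁, hY₁, hφ₁⟩ := hex
  have hgood : ∀ w : E, Z₀ + w ∈ ball Z₀ ε → φ (Z₀ + w) ≠ 0 →
      ¬∀ᶠ ζ in 𝓝 (0 : ℂ), φ (Z₀ + ζ • w) = 0 := by
    intro w hw hφw h0
    have hw' : ‖w‖ < ε := by simpa using hw
    have hmem : ∀ ζ ∈ closedBall (0 : ℂ) 1, Z₀ + ζ • w ∈ W := fun ζ hζ => hball (by
      have h1 : ‖ζ‖ ≤ 1 := by simpa using hζ
      have h2 : ‖ζ‖ * ‖w‖ ≤ 1 * ‖w‖ := mul_le_mul_of_nonneg_right h1 (norm_nonneg _)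
      simp only [mem_ball, dist_self_add_left, norm_smul]
      linarith)
    refine not_eventually_eq_zero_of_ne_zero (p := fun ζ : ℂ => φ (Z₀ + ζ • w)) (c := 0) (R := 1)
      (fun z hz => analyticAt_line hW hφ (hmem z hz)) (w := 1) (by simp) (by simpa using hφw)
      (by simp) h0
  refine ⟨Y₁ - Z₀, fun v => ?_⟩
  have hc : ContinuousAt (fun t : ℂ => Y₁ + t • v) 0 := by fun_prop
  have hφc : ∀ᶠ Y in 𝓝 Y₁, φ Y ≠ 0 :=
    (hφ.continuousOn.continuousAt (hW.mem_nhds (hball hY₁))).eventually_ne hφ₁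
  have h1 : ∀ᶠ t in 𝓝 (0 : ℂ), Y₁ + t • v ∈ ball Z₀ ε ∧ φ (Y₁ + t • v) ≠ 0 := by
    have h2 : ∀ᶠ Y in 𝓝 (Y₁ + (0 : ℂ) • v), Y ∈ ball Z₀ ε ∧ φ Y ≠ 0 := by
      rw [zero_smul, add_zero]
      exact Filter.Eventually.and (isOpen_ball.mem_nhds hY₁) hφc
    exact hc.eventually h2
  obtain ⟨t, ht, ht0⟩ := ((h1.filter_mono nhdsWithin_le_nhds).and
    (self_mem_nhdsWithin : ∀ᶠ t in 𝓝[≠] (0 : ℂ), t ∈ ({0}ᶜ : Set ℂ))).exists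
  have e1 : Z₀ + (Y₁ - Z₀) = Y₁ := by abel
  have e2 : Z₀ + (Y₁ - Z₀ + t • v) = Y₁ + t • v := by abel
  exact ⟨t, ht0, hgood _ (by rwa [e1]) (by rwa [e1]), hgood _ (by rw [e2]; exact ht.1)
    (by rw [e2]; exact ht.2)⟩

/-- If `h` vanishes on the zeros of `φ`, then `h dφ / φ` is holomorphic. -/
lemma exists_differentiableOn_mul_logDeriv [FiniteDimensional ℂ E] {φ h : E → ℂ} {W : Set E}
    (hW : IsOpen W) (hφ : DifferentiableOn ℂ φ W) (hh : DifferentiableOn ℂ h W)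
    (hz : ∀ Y ∈ W, φ Y = 0 → h Y = 0) {Z₀ : E} (hZ₀ : Z₀ ∈ W)
    (hne : ¬∀ᶠ Y in 𝓝 Z₀, φ Y = 0) (v : E) :
    ∃ (B : Set E) (κ : E → ℂ), IsOpen B ∧ Z₀ ∈ B ∧ B ⊆ W ∧ DifferentiableOn ℂ κ B ∧
      ∀ Y ∈ B, φ Y ≠ 0 → κ Y = h Y * (fderiv ℂ φ Y v / φ Y) := by
  obtain ⟨v₀, hv₀⟩ := exists_dir_not_eventually_zero hW hφ hZ₀ hne
  obtain ⟨t, ht, h1, h2⟩ := hv₀ v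
  obtain ⟨B, κ, hB, hZB, hBW, hκ, he⟩ := exists_differentiableOn_mul_logDeriv_dir hW hφ hh hz hZ₀ h1
  obtain ⟨B', κ', hB', hZB', hBW', hκ', he'⟩ :=
    exists_differentiableOn_mul_logDeriv_dir hW hφ hh hz hZ₀ h2
  refine ⟨B ∩ B', fun Y => t⁻¹ * (κ' Y - κ Y), hB.inter hB', ⟨hZB, hZB'⟩,
    inter_subset_left.trans hBW,
    ((hκ'.mono inter_subset_right).sub (hκ.mono inter_subset_left)).const_mul _, ?_⟩
  intro Y hY hφY
  simp only [he Y hY.1 hφY, he' Y hY.2 hφY, map_add, map_smul, smul_eq_mul]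
  field_simp
  ring

/-- On a dense set of parallel lines, the zeros of `φ` stay apart from each other and do not
split under small translations of the line. -/
lemma exists_line_unique_zeros [FiniteDimensional ℂ E] {φ : E → ℂ} {W : Set E} (hW : IsOpen W)
    (hφ : DifferentiableOn ℂ φ W) {v : E} {R : ℝ} (hR : 0 < R) {B O : Set E}
    (hB : ∀ Y ∈ B, (∀ ζ ∈ closedBall (0 : ℂ) R, Y + ζ • v ∈ W) ∧
      ∀ ζ ∈ sphere (0 : ℂ) R, φ (Y + ζ • v) ≠ 0)
    (hO : IsOpen O) (hOB : O ⊆ B) (hne : O.Nonempty) :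
    ∃ Y₁ ∈ O, ∀ a ∈ closedBall (0 : ℂ) R, φ (Y₁ + a • v) = 0 → ∃ ε > 0,
      (∀ ζ ∈ closedBall a ε, Y₁ + ζ • v ∈ W) ∧ (∀ ζ ∈ sphere a ε, φ (Y₁ + ζ • v) ≠ 0) ∧
      ∀ᶠ Y in 𝓝 Y₁, ∃ z ∈ closedBall a ε, φ (Y + z • v) = 0 ∧
        ∀ z' ∈ closedBall a ε, φ (Y + z' • v) = 0 → z' = z := by
  have hcont : ∀ (c : ℂ) (r : ℝ), 0 ≤ r → ∀ Y ∈ O, (∀ ζ ∈ sphere c r, Y + ζ • v ∈ W) →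
      (∀ ζ ∈ sphere c r, φ (Y + ζ • v) ≠ 0) → ContinuousAt (fun Y => ∮ z in C(c, r),
        (1 : ℂ) * (fderiv ℂ φ (Y + z • v) v / φ (Y + z • v))) Y := by
    intro c r hr Y hY h1 h2
    have h3 := eventually_forall_line (P := fun X => X ∈ W ∩ {Y | φ Y ≠ 0})
      (isCompact_sphere c r) (Y₀ := Y) (v := v) fun ζ hζ =>
        (isOpen_inter_ne_zero hW hφ).mem_nhds ⟨h1 ζ hζ, h2 ζ hζ⟩
    obtain ⟨N, hN, hNo, hYN⟩ := _root_.eventually_nhds_iff.mp h3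
    exact ((differentiableOn_circleIntegral (isOpen_inter_ne_zero hW hφ)
      (differentiableOn_logDeriv_dir hW hφ v) v hr continuousOn_const hN).differentiableAt
        (hNo.mem_nhds hYN)).continuousAt
  choose! S m hS hm hint using fun Y (hY : Y ∈ O) => exists_circleIntegral_logDeriv_line hW hφ
    (Y := Y) (v := v) hR (hB Y (hOB hY)).1 (hB Y (hOB hY)).2
  obtain ⟨Y₀, hY₀⟩ := hne
  -- The number of zeros is bounded near `Y₀`, so that it attains a maximum.
  have hbd : ∃ N : ℕ, ∃ O' ⊆ O, IsOpen O' ∧ Y₀ ∈ O' ∧ ∀ Y ∈ O', (S Y).card ≤ N := by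
    have h1 := (hcont 0 R hR.le Y₀ hY₀
      (fun ζ hζ => (hB Y₀ (hOB hY₀)).1 ζ (sphere_subset_closedBall hζ)) (hB Y₀ (hOB hY₀)).2).norm
    set C := ‖∮ z in C(0, R), (1 : ℂ) * (fderiv ℂ φ (Y₀ + z • v) v / φ (Y₀ + z • v))‖ with hC
    have h2 := h1.eventually (gt_mem_nhds (show _ < C + 1 from lt_add_one C))
    obtain ⟨O', hO', hO'o, hYO'⟩ := _root_.eventually_nhds_iff.mp (h2.and (hO.mem_nhds hY₀))
    refine ⟨⌈(C + 1) / (2 * Real.pi)⌉₊, O', fun Y hY => (hO' Y hY).2, hO'o, hYO', fun Y hY => ?_⟩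
    have h3 := (hO' Y hY).1
    rw [hint Y (hO' Y hY).2 (fun _ => 1) (differentiable_const _)] at h3
    have h4 : ((S Y).card : ℝ) ≤ ∑ z ∈ S Y, (m Y z : ℝ) := by
      have : ∑ z ∈ S Y, (1 : ℝ) ≤ ∑ z ∈ S Y, (m Y z : ℝ) :=
        Finset.sum_le_sum fun z hz => by exact_mod_cast hm Y (hO' Y hY).2 z hz
      simpa using this
    have h5 : ‖2 * Real.pi * I * ∑ z ∈ S Y, (m Y z : ℂ) * 1‖ =
        2 * Real.pi * ∑ z ∈ S Y, (m Y z : ℝ) := by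
      have e : (∑ z ∈ S Y, (m Y z : ℂ) * 1) = ((∑ z ∈ S Y, m Y z : ℕ) : ℂ) := by
        push_cast; simp
      rw [e, norm_mul, norm_natCast]
      simp [abs_of_pos Real.pi_pos]
    rw [h5] at h3
    have h6 : ((S Y).card : ℝ) ≤ (C + 1) / (2 * Real.pi) := by
      rw [le_div_iff₀ (by positivity)]
      nlinarith [Real.pi_pos]
    exact_mod_cast h6.trans (Nat.le_ceil _)
  obtain ⟨N, O', hO'O, hO'o, hYO', hN⟩ := hbd
  have hmax : ∃ Y₁ ∈ O', ∀ Y ∈ O', (S Y).card ≤ (S Y₁).card := by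
    have hfin : ((fun Y => (S Y).card) '' O').Finite :=
      (finite_Iic N).subset (by rintro _ ⟨Y, hY, rfl⟩; exact hN Y hY)
    obtain ⟨_, ⟨Y₁, hY₁, rfl⟩, h⟩ := hfin.exists_maximal ⟨_, ⟨Y₀, hYO', rfl⟩⟩
    exact ⟨Y₁, hY₁, fun Y hY => not_lt.mp fun hlt =>
      absurd (h ⟨Y, hY, rfl⟩ hlt.le) (not_le.mpr hlt)⟩
  obtain ⟨Y₁, hY₁, hY₁max⟩ := hmax
  refine ⟨Y₁, hO'O hY₁, ?_⟩
  have hY₁O := hO'O hY₁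
  have hsep : ∃ ε > 0, ∀ a ∈ S Y₁, closedBall a ε ⊆ closedBall 0 R ∧
      ∀ b ∈ S Y₁, a ≠ b → 2 * ε < dist a b := by
    have h1 : ∀ᶠ ε in 𝓝[>] (0 : ℝ), ∀ a ∈ S Y₁, closedBall a ε ⊆ closedBall 0 R ∧
        ∀ b ∈ S Y₁, a ≠ b → 2 * ε < dist a b := by
      refine (Filter.eventually_all_finset (S Y₁)).mpr fun a ha => ?_
      have ha' := (hS Y₁ hY₁O a).mp ha
      have haR : dist a 0 < R := by
        rcases (mem_closedBall.mp ha'.1).lt_or_eq with h | h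
        · exact h
        · exact absurd ha'.2 ((hB Y₁ (hOB hY₁O)).2 a h)
      refine Filter.Eventually.and ?_ ((Filter.eventually_all_finset (S Y₁)).mpr fun b hb => ?_)
      · filter_upwards [(gt_mem_nhds (sub_pos.mpr haR)).filter_mono nhdsWithin_le_nhds]
          with ε hε x hx
        have := dist_triangle x a 0
        rw [mem_closedBall] at hx ⊢
        linarith
      · by_cases hab : a = b
        · exact Eventually.of_forall fun _ h => absurd hab h
        · filter_upwards [(gt_mem_nhds (half_pos (dist_pos.mpr hab))).filter_mono
            nhdsWithin_le_nhds] with ε hε _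
          linarith
    obtain ⟨ε, hε, hε0⟩ := (h1.and self_mem_nhdsWithin).exists
    exact ⟨ε, hε0, hε⟩
  obtain ⟨ε, hε, hεS⟩ := hsep
  have hsphere : ∀ a ∈ S Y₁, ∀ ζ ∈ sphere a ε, φ (Y₁ + ζ • v) ≠ 0 := by
    intro a ha ζ hζ h0
    have hζS : ζ ∈ S Y₁ := (hS Y₁ hY₁O ζ).mpr
      ⟨(hεS a ha).1 (sphere_subset_closedBall hζ), h0⟩
    have hne : a ≠ ζ := by
      rintro rfl
      simp at hζ
      linarith
    have := (hεS a ha).2 ζ hζS hne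
    rw [dist_comm, mem_sphere.mp hζ] at this
    linarith
  have hdisc : ∀ a ∈ S Y₁, ∀ ζ ∈ closedBall a ε, Y₁ + ζ • v ∈ W := fun a ha ζ hζ =>
    (hB Y₁ (hOB hY₁O)).1 ζ ((hεS a ha).1 hζ)
  -- Each zero persists under small translations.
  have hpersist : ∀ᶠ Y in 𝓝 Y₁, ∀ a ∈ S Y₁, ∃ z ∈ closedBall a ε, φ (Y + z • v) = 0 := by
    refine (Filter.eventually_all_finset (S Y₁)).mpr fun a ha => ?_
    obtain ⟨T, μ, hT, hμ, hTint⟩ := exists_circleIntegral_logDeriv_line hW hφ hε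
      (hdisc a ha) (hsphere a ha)
    have hint0 : (∮ z in C(a, ε), (1 : ℂ) * (fderiv ℂ φ (Y₁ + z • v) v / φ (Y₁ + z • v))) ≠ 0 := by
      rw [hTint (fun _ => 1) (differentiable_const _)]
      have haT : a ∈ T := (hT a).mpr ⟨mem_closedBall_self hε.le, ((hS Y₁ hY₁O a).mp ha).2⟩
      have hpos : 0 < ∑ z ∈ T, μ z := lt_of_lt_of_le (hμ a haT)
        (Finset.single_le_sum (f := μ) (fun _ _ => Nat.zero_le _) haT)
      have e : (∑ z ∈ T, (μ z : ℂ) * 1) = ((∑ z ∈ T, μ z : ℕ) : ℂ) := by push_cast; simp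
      rw [e]
      have : ((∑ z ∈ T, μ z : ℕ) : ℂ) ≠ 0 := by exact_mod_cast hpos.ne'
      simp [Real.pi_ne_zero, I_ne_zero]
      exact_mod_cast this
    have h1 := (hcont a ε hε.le Y₁ hY₁O
      (fun ζ hζ => hdisc a ha ζ (sphere_subset_closedBall hζ)) (hsphere a ha)).eventually_ne hint0
    have h2 := eventually_forall_line (P := fun X => X ∈ W) (isCompact_closedBall a ε)
      (Y₀ := Y₁) (v := v) fun ζ hζ => hW.mem_nhds (hdisc a ha ζ hζ)
    filter_upwards [h1, h2] with Y hY1 hY2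
    by_contra hcon
    push Not at hcon
    obtain ⟨T', μ', hT', hμ', hTint'⟩ := exists_circleIntegral_logDeriv_line hW hφ hε hY2
      fun ζ hζ => hcon ζ (sphere_subset_closedBall hζ)
    apply hY1
    rw [hTint' (fun _ => 1) (differentiable_const _)]
    have : T' = ∅ := Finset.eq_empty_of_forall_notMem fun z hz =>
      hcon z ((hT' z).mp hz).1 ((hT' z).mp hz).2
    simp [this]
  intro a ha hφa
  have haS : a ∈ S Y₁ := (hS Y₁ hY₁O a).mpr ⟨ha, hφa⟩
  refine ⟨ε, hε, hdisc a haS, hsphere a haS, ?_⟩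
  filter_upwards [hpersist, hO'o.mem_nhds hY₁] with Y hY hYO
  choose! z hz hφz using hY
  refine ⟨z a, hz a haS, hφz a haS, fun z' hz' hφz' => ?_⟩
  -- A second zero in the same disc would exceed the maximal number of zeros.
  by_contra hne
  have hsep' : ∀ b ∈ S Y₁, ∀ c ∈ S Y₁, b ≠ c → ∀ x ∈ closedBall b ε, ∀ y ∈ closedBall c ε,
      x ≠ y := by
    rintro b hb c hc hbc x hx y hy rfl
    have h1 := (hεS b hb).2 c hc hbc
    have h2 := dist_triangle_left b c x
    rw [mem_closedBall] at hx hy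
    linarith
  have hinj : Set.InjOn z (S Y₁) := fun b hb c hc hbc => by
    by_contra h
    exact hsep' b hb c hc h _ (hz b hb) _ (hz c hc) hbc
  have hnot : z' ∉ (S Y₁).image z := by
    intro h
    obtain ⟨b, hb, hbz⟩ := Finset.mem_image.mp h
    by_cases hab : b = a
    · exact hne (by rw [← hbz, hab])
    · exact hsep' b hb a haS hab _ (hz b hb) _ hz' hbz
  have hsub : insert z' ((S Y₁).image z) ⊆ S Y := by
    intro x hx
    rcases Finset.mem_insert.mp hx with rfl | hx
    · exact (hS Y (hO'O hYO) _).mpr ⟨(hεS a haS).1 hz', hφz'⟩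
    · obtain ⟨b, hb, rfl⟩ := Finset.mem_image.mp hx
      exact (hS Y (hO'O hYO) _).mpr ⟨(hεS b hb).1 (hz b hb), hφz b hb⟩
  have h1 := Finset.card_le_card hsub
  rw [Finset.card_insert_of_notMem hnot, Finset.card_image_of_injOn hinj] at h1
  have h2 := hY₁max Y hYO
  omega

/-- Near a zero of `φ` on a line along which it does not split, the zero set of `φ` has a reduced
equation: the displacement of the zero, weighted by its multiplicity. -/
lemma exists_reduced_equation [FiniteDimensional ℂ E] {φ : E → ℂ} {W : Set E} (hW : IsOpen W)
    (hφ : DifferentiableOn ℂ φ W) {v Y₁ : E} {a : ℂ} {ε : ℝ} (hε : 0 < ε)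
    (hdisc : ∀ ζ ∈ closedBall a ε, Y₁ + ζ • v ∈ W)
    (hsphere : ∀ ζ ∈ sphere a ε, φ (Y₁ + ζ • v) ≠ 0)
    (huniq : ∀ᶠ Y in 𝓝 Y₁, ∃ z ∈ closedBall a ε, φ (Y + z • v) = 0 ∧
        ∀ z' ∈ closedBall a ε, φ (Y + z' • v) = 0 → z' = z) :
    ∃ (U : Set E) (h : E → ℂ), IsOpen U ∧ Y₁ + a • v ∈ U ∧ U ⊆ W ∧ DifferentiableOn ℂ h U ∧
      (∀ X ∈ U, h X = 0 ↔ φ X = 0) ∧ ∀ X ∈ U, φ X = 0 → fderiv ℂ h X v ≠ 0 := by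
  have h1 := eventually_forall_line (P := fun X => X ∈ W) (isCompact_closedBall a ε)
      (Y₀ := Y₁) (v := v) fun ζ hζ => hW.mem_nhds (hdisc ζ hζ)
  have h2 := eventually_forall_line (P := fun X => X ∈ W ∩ {Y | φ Y ≠ 0}) (isCompact_sphere a ε)
    (Y₀ := Y₁) (v := v) fun ζ hζ => (isOpen_inter_ne_zero hW hφ).mem_nhds
      ⟨hdisc ζ (sphere_subset_closedBall hζ), hsphere ζ hζ⟩
  obtain ⟨N, hN, hNo, hYN⟩ := _root_.eventually_nhds_iff.mp ((huniq.and h1).and h2)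
  have hdiff : DifferentiableOn ℂ (fun Y => ∮ z in C(a, ε),
      (z - a) * (fderiv ℂ φ (Y + z • v) v / φ (Y + z • v))) N :=
    differentiableOn_circleIntegral (isOpen_inter_ne_zero hW hφ)
      (differentiableOn_logDeriv_dir hW hφ v) v hε.le (by fun_prop) fun Y hY => (hN Y hY).2
  have hval : ∀ Y ∈ N, ∀ z ∈ closedBall a ε, φ (Y + z • v) = 0 → ∃ m : ℕ, 1 ≤ m ∧
      (∮ z in C(a, ε), (z - a) * (fderiv ℂ φ (Y + z • v) v / φ (Y + z • v))) =
        2 * Real.pi * I * (m * (z - a)) := by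
    intro Y hY z hz hφz
    obtain ⟨S, m, hS, hm, hint⟩ := exists_circleIntegral_logDeriv_line hW hφ hε (hN Y hY).1.2
      fun ζ hζ => ((hN Y hY).2 ζ hζ).2
    obtain ⟨z₀, hz₀, hφz₀, hu⟩ := (hN Y hY).1.1
    have hzS : z ∈ S := (hS z).mpr ⟨hz, hφz⟩
    have hSz : S = {z} := by
      refine Finset.eq_singleton_iff_unique_mem.mpr ⟨hzS, fun x hx => ?_⟩
      rw [hu x ((hS x).mp hx).1 ((hS x).mp hx).2, hu z hz hφz]
    exact ⟨m z, hm z hzS, by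
      rw [hint (fun z => z - a) (differentiable_id.sub_const a), hSz, Finset.sum_singleton]⟩
  have hpre : Continuous fun X : E => X - a • v := by fun_prop
  have hUo : IsOpen ((fun X : E => X - a • v) ⁻¹' N) := hNo.preimage hpre
  have haε : a ∈ closedBall a ε := mem_closedBall_self hε.le
  have hh : DifferentiableOn ℂ (fun X => ∮ z in C(a, ε), (z - a) *
      (fderiv ℂ φ (X - a • v + z • v) v / φ (X - a • v + z • v)))
        ((fun X : E => X - a • v) ⁻¹' N) :=
    hdiff.comp (f := fun X : E => X - a • v) (by fun_prop) fun X hX => hX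
  refine ⟨(fun X : E => X - a • v) ⁻¹' N, _, hUo, ?_, ?_, hh, ?_, ?_⟩
  · simpa using hYN
  · intro X hX
    have := (hN _ hX).1.2 a haε
    simpa using this
  · intro X hX
    obtain ⟨z, hz, hφz, hu⟩ := (hN _ hX).1.1
    obtain ⟨m, hm, hi⟩ := hval _ hX z hz hφz
    have hm0 : (m : ℂ) ≠ 0 := by exact_mod_cast (Nat.one_le_iff_ne_zero.mp hm)
    simp only [hi, mul_eq_zero, I_ne_zero, hm0, OfNat.ofNat_ne_zero, ofReal_eq_zero,
      Real.pi_ne_zero, false_or, sub_eq_zero]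
    constructor
    · rintro rfl
      simpa using hφz
    · intro h0
      exact (hu a haε (by simpa using h0)).symm
  · intro X hX hφX h0
    have hline : HasDerivAt (fun t : ℂ => ∮ z in C(a, ε), (z - a) *
        (fderiv ℂ φ (X + t • v - a • v + z • v) v / φ (X + t • v - a • v + z • v))) 0 0 := by
      have := deriv_line (X := X) (v := v) (ζ := 0)
        (φ := fun X => ∮ z in C(a, ε), (z - a) *
          (fderiv ℂ φ (X - a • v + z • v) v / φ (X - a • v + z • v)))
        (by simpa using hh.differentiableAt (hUo.mem_nhds hX))
      simpa [h0] using this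
    have hsl := hline.tendsto_slope_zero.norm
    have hc : ContinuousAt (fun t : ℂ => X + t • v - a • v) 0 := by fun_prop
    have hmem : ∀ᶠ t in 𝓝 (0 : ℂ), X + t • v - a • v ∈ N :=
      hc.eventually (hNo.mem_nhds (by simpa using hX))
    have hX0 : (∮ z in C(a, ε), (z - a) *
        (fderiv ℂ φ (X - a • v + z • v) v / φ (X - a • v + z • v))) = 0 := by
      obtain ⟨m, hm, hi⟩ := hval _ hX a haε (by simpa using hφX)
      rw [hi]; simp
    refine absurd (ge_of_tendsto (b := 1) hsl ?_) (by simp)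
    have hsmall : ∀ᶠ t in 𝓝 (0 : ℂ), t ∈ closedBall (0 : ℂ) ε := closedBall_mem_nhds _ hε
    filter_upwards [hmem.filter_mono nhdsWithin_le_nhds, hsmall.filter_mono nhdsWithin_le_nhds,
      self_mem_nhdsWithin] with t ht1 ht2 ht0
    obtain ⟨m, hm, hi⟩ := hval _ ht1 (a - t) (by simpa using ht2) (by
      have : X + t • v - a • v + (a - t) • v = X := by rw [sub_smul]; abel
      rw [this, hφX])
    have ht0' : ‖t‖ ≠ 0 := norm_ne_zero_iff.mpr ht0
    have hm' : (1 : ℝ) ≤ m := by exact_mod_cast hm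
    simp only [zero_add, zero_smul, add_zero, hX0, sub_zero]
    rw [hi]
    simp only [smul_eq_mul, norm_mul, norm_inv, Complex.norm_ofNat, norm_real, norm_I, mul_one,
      norm_natCast, sub_sub_cancel_left, norm_neg, Real.norm_eq_abs, abs_of_pos Real.pi_pos]
    have : ‖t‖⁻¹ * (2 * Real.pi * (m * ‖t‖)) = 2 * Real.pi * m := by field_simp
    rw [this]
    nlinarith [Real.pi_gt_three]

/-- Extension across the zero set of `φ`: it suffices that `d` extends near those zeros where the
zero set of `φ` has a reduced equation with non-vanishing differential. -/
lemma exists_extension_of_reduced [FiniteDimensional ℂ E] {φ d : E → ℂ} {W : Set E} (hW : IsOpen W)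
    (hφ : DifferentiableOn ℂ φ W) (hd : DifferentiableOn ℂ d (W ∩ {Y | φ Y ≠ 0})) {Z₀ : E}
    (hZ₀ : Z₀ ∈ W) (hne : ¬∀ᶠ Y in 𝓝 Z₀, φ Y = 0)
    (hred : ∀ (v X : E) (U : Set E) (h : E → ℂ), IsOpen U → X ∈ U → U ⊆ W →
      DifferentiableOn ℂ h U → (∀ Y ∈ U, h Y = 0 ↔ φ Y = 0) →
      (∀ Y ∈ U, φ Y = 0 → fderiv ℂ h Y v ≠ 0) → φ X = 0 →
        ∃ (U' : Set E) (g : E → ℂ), IsOpen U' ∧ X ∈ U' ∧ DifferentiableOn ℂ g U' ∧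
          ∀ Y ∈ U' ∩ W, φ Y ≠ 0 → d Y = g Y) :
    ∃ (B : Set E) (κ : E → ℂ), IsOpen B ∧ Z₀ ∈ B ∧ B ⊆ W ∧ DifferentiableOn ℂ κ B ∧
      ∀ Y ∈ B, φ Y ≠ 0 → κ Y = d Y := by
  obtain ⟨v, hv⟩ := exists_dir_not_eventually_zero hW hφ hZ₀ hne
  obtain ⟨-, -, hv, -⟩ := hv 0
  obtain ⟨R, hR, B, hBo, hZB, hB⟩ := exists_circle_ne_zero hW hφ hZ₀ hv
  have hBW : B ⊆ W := fun Y hY => by simpa using (hB Y hY).1 0 (mem_closedBall_self hR.le)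
  have hκ : DifferentiableOn ℂ (fun Y => ∮ ζ in C(0, R), (2 * Real.pi * I)⁻¹ * (ζ - 0)⁻¹ *
      d (Y + ζ • v)) B := by
    refine differentiableOn_circleIntegral (isOpen_inter_ne_zero hW hφ) hd v hR.le ?_ ?_
    · refine ContinuousOn.mul continuousOn_const (ContinuousOn.inv₀ (by fun_prop) ?_)
      intro ζ hζ h0
      have : ζ = 0 := by simpa using h0
      rw [this] at hζ
      simp at hζ
      linarith
    · exact fun Y hY ζ hζ => ⟨(hB Y hY).1 ζ (sphere_subset_closedBall hζ), (hB Y hY).2 ζ hζ⟩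
  refine ⟨B, _, hBo, hZB, hBW, hκ, fun Y hY hφY => ?_⟩
  have hda : ∀ (Y : E) (ζ : ℂ), Y + ζ • v ∈ W → φ (Y + ζ • v) ≠ 0 →
      AnalyticAt ℂ (fun ζ : ℂ => d (Y + ζ • v)) ζ := fun Y ζ h1 h2 =>
    analyticAt_line (isOpen_inter_ne_zero hW hφ) hd ⟨h1, h2⟩
  by_contra hcon
  -- The set where the two functions differ is open, so it meets a line with stable zeros.
  have hBφ : IsOpen (B ∩ {Y | φ Y ≠ 0}) := isOpen_inter_ne_zero hBo (hφ.mono hBW)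
  have hO : IsOpen ((B ∩ {Y | φ Y ≠ 0}) ∩ {Y | (∮ ζ in C(0, R), (2 * Real.pi * I)⁻¹ *
      (ζ - 0)⁻¹ * d (Y + ζ • v)) - d Y ≠ 0}) := by
    refine ContinuousOn.isOpen_inter_preimage (t := {0}ᶜ) ?_ hBφ isOpen_compl_singleton
    exact (hκ.continuousOn.mono inter_subset_left).sub
      (hd.continuousOn.mono fun Y hY => ⟨hBW hY.1, hY.2⟩)
  obtain ⟨Y₁, hY₁, hzeros⟩ := exists_line_unique_zeros hW hφ hR hB hO
    (fun Y hY => hY.1.1) ⟨Y, ⟨hY, hφY⟩, sub_ne_zero.mpr hcon⟩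
  refine hY₁.2 (sub_eq_zero.mpr ?_)
  have h0 : Y₁ + (0 : ℂ) • v = Y₁ := by simp
  have key := circleIntegral_center_of_punctured (c := 0) (R := R)
      (q := fun ζ : ℂ => d (Y₁ + ζ • v)) hR ?_
      (fun ζ hζ => (hda Y₁ ζ ((hB Y₁ hY₁.1.1).1 ζ (sphere_subset_closedBall hζ))
        ((hB Y₁ hY₁.1.1).2 ζ hζ)).continuousAt)
      (hda Y₁ 0 (by rw [h0]; exact hBW hY₁.1.1) (by rw [h0]; exact hY₁.1.2)).continuousAt
  · simpa using key
  · intro a ha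
    have haW := (hB Y₁ hY₁.1.1).1 a ha
    by_cases hφa : φ (Y₁ + a • v) = 0
    · obtain ⟨ε, hε, h1, h2, h3⟩ := hzeros a ha hφa
      obtain ⟨U, h, hU, hXU, hUW, hh, hiff, hder⟩ := exists_reduced_equation hW hφ hε h1 h2 h3
      obtain ⟨U', g, hU', hXU', hg, hdg⟩ := hred v _ U h hU hXU hUW hh hiff hder hφa
      refine ⟨fun ζ => g (Y₁ + ζ • v), analyticAt_line hU' hg hXU', ?_⟩
      have hpa : ∀ z ∈ closedBall (0 : ℂ) R, AnalyticAt ℂ (fun ζ : ℂ => φ (Y₁ + ζ • v)) z :=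
        fun z hz => analyticAt_line hW hφ ((hB Y₁ hY₁.1.1).1 z hz)
      have hne' := not_eventually_eq_zero_of_ne_zero hpa (mem_closedBall_self hR.le)
        (by rw [h0]; exact hY₁.1.2) ha
      have h4 := ((hpa a ha).eventually_eq_zero_or_eventually_ne_zero).resolve_left hne'
      have hc : ContinuousAt (fun ζ : ℂ => Y₁ + ζ • v) a := by fun_prop
      have h5 := hc.eventually ((hU'.inter hW).mem_nhds ⟨hXU', haW⟩)
      filter_upwards [h4, h5.filter_mono nhdsWithin_le_nhds] with ζ hζ1 hζ2
      exact hdg _ hζ2 hζ1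
    · exact ⟨_, hda Y₁ a haW hφa, EventuallyEq.refl _ _⟩

end DivisorGeometry

namespace EvenLattice

open Filter

variable {n : ℕ} {M : EvenLattice n} {Ω : Set (V n)} {s : ℕ}

/-! ### Evaluation of sections on vectors of the ambient space -/

open Classical in
/-- The value of a section at `Y` on vectors of `Y^⊥`, with value `0` if `Y ∉ Ω` or if one of the
vectors is not orthogonal to `Y`. -/
noncomputable def ev (F : M.Sec Ω s) (Y : V n) (x : Fin s → V n) : ℂ :=
  if h : Y ∈ Ω ∧ ∀ r, M.pair Y (x r) = 0 then
    F ⟨Y, h.1⟩ (fun r => M.cls Y ⟨x r, h.2 r⟩) else 0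

lemma ev_of (F : M.Sec Ω s) {Y : V n} {x : Fin s → V n} (hY : Y ∈ Ω)
    (hx : ∀ r, M.pair Y (x r) = 0) :
    ev F Y x = F ⟨Y, hY⟩ (fun r => M.cls Y ⟨x r, hx r⟩) := dif_pos ⟨hY, hx⟩

lemma ev_coe (F : M.Sec Ω s) (Z : Ω) (w : Fin s → M.perp (Z : V n)) :
    ev F Z (fun r => (w r : V n)) = F Z (fun r => M.cls Z (w r)) := ev_of F Z.2 fun r => (w r).2

lemma represents_iff {F : M.Sec Ω s} {U : Set (V n)} {c : (Fin s → Fin (n + 2)) → V n → ℂ} :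
    Represents F U c ↔ ∀ Y ∈ Ω, Y ∈ U → ∀ x : Fin s → V n, (∀ r, M.pair Y (x r) = 0) →
      ev F Y x = form (fun I => c I Y) x := by
  constructor
  · intro h Y hY hYU x hx
    rw [ev_of F hY hx]
    exact h ⟨Y, hY⟩ hYU fun r => ⟨x r, hx r⟩
  · intro h Z hZ w
    rw [← ev_coe]
    exact h Z Z.2 hZ _ fun r => (w r).2

lemma Represents.ev_eq {F : M.Sec Ω s} {U : Set (V n)} {c : (Fin s → Fin (n + 2)) → V n → ℂ}
    (h : Represents F U c) {Y : V n} (hY : Y ∈ Ω) (hYU : Y ∈ U) {x : Fin s → V n}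
    (hx : ∀ r, M.pair Y (x r) = 0) : ev F Y x = form (fun I => c I Y) x :=
  represents_iff.mp h Y hY hYU x hx

lemma sec_ext_at {F G : M.Sec Ω s} (Z : Ω)
    (h : ∀ x : Fin s → V n, (∀ r, M.pair Z (x r) = 0) → ev F Z x = ev G Z x) : F Z = G Z := by
  refine MultilinearMap.ext fun x => ?_
  choose w hw using fun r => Submodule.mkQ_surjective _ (x r)
  have : x = fun r => M.cls Z (w r) := funext fun r => (hw r).symm
  rw [this, ← ev_coe, ← ev_coe]
  exact h _ fun r => (w r).2

lemma cls_eq_of_sub {Z : V n} {v w : M.perp Z} {t : ℂ} (h : (v : V n) = w + t • Z) :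
    M.cls Z v = M.cls Z w := by
  refine (Submodule.Quotient.eq _).mpr (Submodule.mem_span_singleton.mpr ⟨t, ?_⟩)
  simp [h]

lemma ev_add_smul (F : M.Sec Ω s) {Y : V n} (hYY : M.pair Y Y = 0) (x : Fin s → V n)
    (t : Fin s → ℂ) : ev F Y (fun r => x r + t r • Y) = ev F Y x := by
  by_cases h : Y ∈ Ω ∧ ∀ r, M.pair Y (x r) = 0
  · have h' : ∀ r, M.pair Y (x r + t r • Y) = 0 := fun r => by simp [h.2 r, hYY]
    rw [ev_of F h.1 h', ev_of F h.1 h.2]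
    congr 1
    funext r
    exact cls_eq_of_sub rfl
  · have h' : ¬(Y ∈ Ω ∧ ∀ r, M.pair Y (x r + t r • Y) = 0) := fun h' => h ⟨h'.1, fun r => by
      simpa [hYY] using h'.2 r⟩
    rw [ev, ev, dif_neg h, dif_neg h']

lemma multilinear_eq_form (μ : MultilinearMap ℂ (fun _ : Fin s => V n) ℂ) (w : Fin s → V n) :
    μ w = form (fun I => μ fun r => Pi.single (I r) 1) w := by
  have h : μ = form (fun I => μ fun r => Pi.single (I r) 1) := by
    refine Module.Basis.ext_multilinear (fun _ => Pi.basisFun ℂ (Fin (n + 2))) fun I => ?_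
    rw [form_apply, Fintype.sum_eq_single I]
    · simp
    · intro J hJ
      obtain ⟨r, hr⟩ := Function.ne_iff.mp hJ
      rw [Finset.prod_eq_zero (Finset.mem_univ r), mul_zero]
      simp [hr]
  exact congrArg (fun ν => ν w) h

/-! ### A holomorphic retraction onto the cone -/

variable (M) in
/-- The retraction of a neighbourhood of `Z₀` onto the quadric `Y · Y = 0`, along the lines in the
direction of `Z̄₀`. -/
noncomputable def retr (Z₀ Y : V n) : V n :=
  Y - (M.pair Y Y * (2 * M.pair Y (star Z₀))⁻¹) • star Z₀

variable (M) in
/-- The projection of `m` to `Y^⊥` along `Z̄₀`. -/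
noncomputable def projPerp (Z₀ Y m : V n) : V n :=
  m - (M.pair Y m * (M.pair Y (star Z₀))⁻¹) • star Z₀

lemma pair_star_self_ne_zero {Z : V n} (hZ : Z ∈ M.isotropicPositive) :
    M.pair Z (star Z) ≠ 0 := fun h => by
  have h2 := hZ.2
  rw [h] at h2
  simp at h2

lemma pair_star_star {Z : V n} (hZ : M.pair Z Z = 0) : M.pair (star Z) (star Z) = 0 := by
  rw [pair_star, hZ, star_zero]

lemma retr_of_isotropic {Z₀ Y : V n} (hY : M.pair Y Y = 0) : M.retr Z₀ Y = Y := by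
  simp [retr, hY]

lemma projPerp_of_perp {Z₀ Y m : V n} (hm : M.pair Y m = 0) : M.projPerp Z₀ Y m = m := by
  simp [projPerp, hm]

lemma pair_projPerp {Z₀ Y : V n} (hY : M.pair Y (star Z₀) ≠ 0) (m : V n) :
    M.pair Y (M.projPerp Z₀ Y m) = 0 := by
  simp only [projPerp, map_sub, map_smul, smul_eq_mul]
  field_simp
  ring

lemma pair_retr_star {Z₀ : V n} (hZ₀ : M.pair Z₀ Z₀ = 0) (Y : V n) :
    M.pair (M.retr Z₀ Y) (star Z₀) = M.pair Y (star Z₀) := by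
  simp [retr, pair_star_star hZ₀]

lemma pair_retr_retr {Z₀ Y : V n} (hZ₀ : M.pair Z₀ Z₀ = 0) (hY : M.pair Y (star Z₀) ≠ 0) :
    M.pair (M.retr Z₀ Y) (M.retr Z₀ Y) = 0 := by
  simp only [retr, map_sub, LinearMap.sub_apply, map_smul, LinearMap.smul_apply,
    pair_star_star hZ₀, smul_eq_mul, M.pair_comm (star Z₀) Y]
  field_simp
  ring

/-- The fibres of the retraction are the lines in the direction of `Z̄₀`. -/
lemma retr_add_smul {Z₀ Z : V n} (hZ₀ : M.pair Z₀ Z₀ = 0) (hZ : M.pair Z Z = 0)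
    (hZs : M.pair Z (star Z₀) ≠ 0) (t : ℂ) : M.retr Z₀ (Z + t • star Z₀) = Z := by
  have h1 : M.pair (Z + t • star Z₀) (Z + t • star Z₀) = 2 * t * M.pair Z (star Z₀) := by
    simp only [map_add, LinearMap.add_apply, map_smul, LinearMap.smul_apply, hZ,
      pair_star_star hZ₀, smul_eq_mul, M.pair_comm (star Z₀) Z]
    ring
  have h2 : M.pair (Z + t • star Z₀) (star Z₀) = M.pair Z (star Z₀) := by
    simp [pair_star_star hZ₀]
  have h3 : 2 * t * M.pair Z (star Z₀) * (2 * M.pair Z (star Z₀))⁻¹ = t := by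
    field_simp
  rw [retr, h1, h2, h3, add_sub_cancel_right]

lemma eq_retr_add_smul (Z₀ Y : V n) : ∃ t : ℂ, Y = M.retr Z₀ Y + t • star Z₀ :=
  ⟨M.pair Y Y * (2 * M.pair Y (star Z₀))⁻¹, by simp [retr]⟩

section Smoothness

variable {𝕜 : Type} [RCLike 𝕜] [NormedAlgebra 𝕜 ℂ]

lemma contDiffOn_pair {g h : V n → V n} {U : Set (V n)}
    (hg : ∀ k, ContDiffOn 𝕜 ∞ (fun Y => g Y k) U) (hh : ∀ k, ContDiffOn 𝕜 ∞ (fun Y => h Y k) U) :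
    ContDiffOn 𝕜 ∞ (fun Y => M.pair (g Y) (h Y)) U := by
  simp only [pair_apply]
  exact ContDiffOn.sum fun a _ => ContDiffOn.sum fun b _ =>
    ((hg a).mul contDiffOn_const).mul (hh b)

lemma contDiffOn_coord (U : Set (V n)) (k : Fin (n + 2)) :
    ContDiffOn 𝕜 ∞ (fun Y : V n => Y k) U := (contDiff_apply 𝕜 ℂ k).contDiffOn

lemma contDiffOn_retr {Z₀ : V n} {U : Set (V n)} (hU : ∀ Y ∈ U, M.pair Y (star Z₀) ≠ 0)
    (k : Fin (n + 2)) : ContDiffOn 𝕜 ∞ (fun Y => M.retr Z₀ Y k) U := by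
  simp only [retr, Pi.sub_apply, Pi.smul_apply, smul_eq_mul]
  refine (contDiffOn_coord U k).sub (ContDiffOn.mul (ContDiffOn.mul
    (contDiffOn_pair (contDiffOn_coord U) (contDiffOn_coord U)) (ContDiffOn.inv ?_ ?_))
      contDiffOn_const)
  · exact contDiffOn_const.mul (contDiffOn_pair (contDiffOn_coord U) fun _ => contDiffOn_const)
  · exact fun Y hY => mul_ne_zero two_ne_zero (hU Y hY)

lemma contDiffOn_projPerp {Z₀ m : V n} {U : Set (V n)} (hU : ∀ Y ∈ U, M.pair Y (star Z₀) ≠ 0)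
    (k : Fin (n + 2)) : ContDiffOn 𝕜 ∞ (fun Y => M.projPerp Z₀ Y m k) U := by
  simp only [projPerp, Pi.sub_apply, Pi.smul_apply, smul_eq_mul]
  refine contDiffOn_const.sub (ContDiffOn.mul (ContDiffOn.mul
    (contDiffOn_pair (contDiffOn_coord U) fun _ => contDiffOn_const) (ContDiffOn.inv ?_ ?_))
      contDiffOn_const)
  · exact contDiffOn_pair (contDiffOn_coord U) fun _ => contDiffOn_const
  · exact fun Y hY => hU Y hY

lemma contDiffOn_form {c : (Fin s → Fin (n + 2)) → V n → ℂ} {x : Fin s → V n → V n}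
    {U : Set (V n)} (hc : ∀ I, ContDiffOn 𝕜 ∞ (c I) U)
    (hx : ∀ r k, ContDiffOn 𝕜 ∞ (fun Y => x r Y k) U) :
    ContDiffOn 𝕜 ∞ (fun Y => form (fun I => c I Y) (fun r => x r Y)) U := by
  simp only [form_apply]
  exact ContDiffOn.sum fun I _ => (hc I).mul (contDiffOn_prod fun r _ => hx r (I r))

variable (M) in
/-- A section in the chart given by the retraction and the projections at `Z₀`. -/
noncomputable def chartFun (F : M.Sec Ω s) (Z₀ : V n) (x : Fin s → V n) (Y : V n) : ℂ :=
  ev F (M.retr Z₀ Y) fun r => M.projPerp Z₀ (M.retr Z₀ Y) (x r)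

/-- The values in the chart of the vectors of the standard basis are coefficients of the section. -/
lemma represents_chartFun (F : M.Sec Ω s) {Z₀ : V n} (hΩ : ∀ Z ∈ Ω, M.pair Z Z = 0) :
    Represents F {Y | M.pair Y (star Z₀) ≠ 0}
      (fun I => M.chartFun F Z₀ fun r => Pi.single (I r) 1) := by
  refine represents_iff.mpr fun Y hY hYU x hx => ?_
  have hlin : ∀ m, M.pair Y (M.projPerp Z₀ Y m) = 0 := pair_projPerp hYU
  let P : V n →ₗ[ℂ] M.perp Y := LinearMap.codRestrict (M.perp Y)
    (LinearMap.id - ((M.pair Y (star Z₀))⁻¹ • (M.pair Y)).smulRight (star Z₀)) (fun m => by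
      have := hlin m
      rw [mem_perp]
      convert this using 2
      simp [projPerp, mul_comm])
  have hP : ∀ m, ((P m : M.perp Y) : V n) = M.projPerp Z₀ Y m := fun m => by
    simp [P, projPerp, mul_comm]
  have hμ := multilinear_eq_form ((F ⟨Y, hY⟩).compLinearMap fun _ => (M.cls Y).comp P) x
  have h1 : ev F Y x = (F ⟨Y, hY⟩).compLinearMap (fun _ => (M.cls Y).comp P) x := by
    rw [ev_of F hY hx]
    simp only [MultilinearMap.compLinearMap_apply, LinearMap.comp_apply]
    congr 1
    funext r
    congr 1
    exact Subtype.ext (by rw [hP, projPerp_of_perp (hx r)])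
  rw [h1, hμ]
  congr 1
  congr 1
  funext I
  simp only [chartFun, retr_of_isotropic (hΩ Y hY)]
  rw [ev_of F hY fun r => hlin _]
  simp only [MultilinearMap.compLinearMap_apply, LinearMap.comp_apply]
  congr 1
  funext r
  congr 1
  exact Subtype.ext (hP _)

lemma chartFun_eq_form {F : M.Sec Ω s} {Z₀ : V n} (hZ₀ : M.pair Z₀ Z₀ = 0) {U : Set (V n)}
    {c : (Fin s → Fin (n + 2)) → V n → ℂ} (hr : Represents F U c) (x : Fin s → V n) {Y : V n}
    (hY : M.pair Y (star Z₀) ≠ 0) (hYU : M.retr Z₀ Y ∈ U) (hYΩ : M.retr Z₀ Y ∈ Ω) :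
    M.chartFun F Z₀ x Y =
      form (fun I => c I (M.retr Z₀ Y)) fun r => M.projPerp Z₀ (M.retr Z₀ Y) (x r) :=
  hr.ev_eq hYΩ hYU fun r => pair_projPerp (by rwa [pair_retr_star hZ₀]) _

lemma continuousAt_retr {Z₀ Y : V n} (hY : M.pair Y (star Z₀) ≠ 0) :
    ContinuousAt (M.retr Z₀) Y := by
  have hop : IsOpen {Y | M.pair Y (star Z₀) ≠ 0} :=
    isOpen_ne.preimage (f := fun Y => M.pair Y (star Z₀)) (M.pairL.flip (star Z₀)).continuous
  exact continuousAt_pi.mpr fun k => ((contDiffOn_retr (𝕜 := ℝ) (M := M) (Z₀ := Z₀)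
    (U := {Y | M.pair Y (star Z₀) ≠ 0}) (fun _ h => h) k).continuousOn).continuousAt
      (hop.mem_nhds hY)

lemma isOpen_pair_star_ne (Z₀ : V n) : IsOpen {Y | M.pair Y (star Z₀) ≠ 0} :=
  isOpen_ne.preimage (f := fun Y => M.pair Y (star Z₀)) (M.pairL.flip (star Z₀)).continuous

/-- Near a point `Z₀` of the cone, the retraction takes values in a given neighbourhood. -/
lemma exists_chart_nhds (hΩ : M.IsConeOpen Ω) {Z₀ : V n} (hZ₀ : Z₀ ∈ Ω) {U : Set (V n)}
    (hU : U ∈ 𝓝 Z₀) : ∃ W : Set (V n), IsOpen W ∧ Z₀ ∈ W ∧ ∀ Y ∈ W,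
      M.pair Y (star Z₀) ≠ 0 ∧ M.retr Z₀ Y ∈ U ∧ M.retr Z₀ Y ∈ Ω := by
  have hiso := hΩ.1 hZ₀
  have hs := pair_star_self_ne_zero hiso
  have hc := continuousAt_retr (M := M) hs
  have hfix := retr_of_isotropic (M := M) (Z₀ := Z₀) hiso.1
  have h1 : ∀ᶠ Y in 𝓝 Z₀, M.retr Z₀ Y ∈ U := hc.eventually (by rwa [hfix])
  have h2 : ∀ᶠ Y in 𝓝 Z₀, M.pair (M.retr Z₀ Y) (M.retr Z₀ Y) = 0 → M.retr Z₀ Y ∈ Ω :=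
    hc.eventually (p := fun Y => M.pair Y Y = 0 → Y ∈ Ω) (by rw [hfix]; exact hΩ.2 Z₀ hZ₀)
  have h3 : ∀ᶠ Y in 𝓝 Z₀, M.pair Y (star Z₀) ≠ 0 := (isOpen_pair_star_ne Z₀).mem_nhds hs
  obtain ⟨W, hW, hWo, hZW⟩ := _root_.eventually_nhds_iff.mp ((h1.and h2).and h3)
  exact ⟨W, hWo, hZW, fun Y hY => ⟨(hW Y hY).2, (hW Y hY).1.1,
    (hW Y hY).1.2 (pair_retr_retr hiso.1 (hW Y hY).2)⟩⟩

lemma contDiffOn_chartFun {F : M.Sec Ω s} {Z₀ : V n} (hZ₀ : M.pair Z₀ Z₀ = 0) {U : Set (V n)}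
    {c : (Fin s → Fin (n + 2)) → V n → ℂ} (hc : ∀ I, ContDiffOn 𝕜 ∞ (c I) U)
    (hr : Represents F U c) (x : Fin s → V n) {W : Set (V n)}
    (hW : ∀ Y ∈ W, M.pair Y (star Z₀) ≠ 0 ∧ M.retr Z₀ Y ∈ U ∧ M.retr Z₀ Y ∈ Ω) :
    ContDiffOn 𝕜 ∞ (M.chartFun F Z₀ x) W := by
  have hret : ContDiffOn 𝕜 ∞ (M.retr Z₀) W :=
    contDiffOn_pi.mpr fun k => contDiffOn_retr (fun Y hY => (hW Y hY).1) k
  have h1 : ContDiffOn 𝕜 ∞ (fun Y => form (fun I => c I (M.retr Z₀ Y))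
      fun r => M.projPerp Z₀ (M.retr Z₀ Y) (x r)) W := by
    refine contDiffOn_form (c := fun I Y => c I (M.retr Z₀ Y))
      (x := fun r Y => M.projPerp Z₀ (M.retr Z₀ Y) (x r))
      (fun I => (hc I).comp hret fun Y hY => (hW Y hY).2.1) fun r k => ?_
    exact (contDiffOn_projPerp (M := M) (Z₀ := Z₀) (m := x r)
      (U := {Y | M.pair Y (star Z₀) ≠ 0}) (fun _ h => h) k).comp hret fun Y hY => by
        rw [Set.mem_ofPred_eq, pair_retr_star hZ₀]; exact (hW Y hY).1
  exact h1.congr fun Y hY => chartFun_eq_form hZ₀ hr x (hW Y hY).1 (hW Y hY).2.1 (hW Y hY).2.2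

/-- Sections are regular if they are regular in the charts. -/
lemma isRegular_of_chartFun (hΩ : ∀ Z ∈ Ω, M.pair Z Z = 0) {F : M.Sec Ω s}
    (h : ∀ Z₀ ∈ Ω, ∃ W : Set (V n), IsOpen W ∧ Z₀ ∈ W ∧ (∀ Y ∈ W, M.pair Y (star Z₀) ≠ 0) ∧
      ∀ x : Fin s → V n, ContDiffOn 𝕜 ∞ (M.chartFun F Z₀ x) W) : IsRegular 𝕜 F := by
  intro Z
  obtain ⟨W, hW, hZW, hWd, hF⟩ := h Z Z.2
  exact ⟨W, hW, hZW, _, fun I => hF _, (represents_chartFun F hΩ).mono hWd⟩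

/-! ### Continuity and gluing -/

lemma continuousAt_form {c : (Fin s → Fin (n + 2)) → V n → ℂ} {x : Fin s → V n → V n} {Z : V n}
    {l : Filter (V n)} (hc : ∀ I, Tendsto (c I) l (𝓝 (c I Z)))
    (hx : ∀ r, Tendsto (x r) l (𝓝 (x r Z))) :
    Tendsto (fun Y => form (fun I => c I Y) (fun r => x r Y)) l
      (𝓝 (form (fun I => c I Z) (fun r => x r Z))) := by
  simp only [form_apply]
  exact tendsto_finsetSum _ fun I _ => (hc I).mul (tendsto_finsetProd _ fun r _ =>
    (tendsto_pi_nhds.mp (hx r)) (I r))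

lemma continuousAt_projPerp {Z₀ Y m : V n} (hY : M.pair Y (star Z₀) ≠ 0) :
    ContinuousAt (fun Y => M.projPerp Z₀ Y m) Y :=
  continuousAt_pi.mpr fun k => ((contDiffOn_projPerp (𝕜 := ℝ) (M := M) (Z₀ := Z₀) (m := m)
    (U := {Y | M.pair Y (star Z₀) ≠ 0}) (fun _ h => h) k).continuousOn).continuousAt
      ((isOpen_pair_star_ne Z₀).mem_nhds hY)

/-- Sections are continuous. -/
lemma IsRegular.tendsto_ev {F : M.Sec Ω s} (hF : IsRegular 𝕜 F) {Z : V n} (hZ : Z ∈ Ω)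
    {x : Fin s → V n → V n} {l : Filter (V n)} (hl : l ≤ 𝓝 Z) (hlΩ : ∀ᶠ Y in l, Y ∈ Ω)
    (hx : ∀ r, Tendsto (x r) l (𝓝 (x r Z)))
    (hxp : ∀ᶠ Y in l, ∀ r, M.pair Y (x r Y) = 0) (hxZ : ∀ r, M.pair Z (x r Z) = 0) :
    Tendsto (fun Y => ev F Y fun r => x r Y) l (𝓝 (ev F Z fun r => x r Z)) := by
  obtain ⟨U, hU, hZU, c, hc, hr⟩ := hF ⟨Z, hZ⟩
  rw [hr.ev_eq hZ hZU hxZ]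
  have h1 := continuousAt_form (c := c) (x := x) (Z := Z) (l := l)
    (fun I => (((hc I).continuousOn).continuousAt (hU.mem_nhds hZU)).tendsto.mono_left hl) hx
  refine h1.congr' ?_
  filter_upwards [hlΩ, hxp, hl (hU.mem_nhds hZU)] with Y h2 h3 h4
  rw [hr.ev_eq h2 h4 h3]

/-- Local coefficients over a dense subset define a section. -/
lemma exists_extension_of_local (hΩ : Ω ⊆ M.isotropicPositive) {Ω' : Set (V n)} (hsub : Ω' ⊆ Ω)
    (hdense : Ω ⊆ closure Ω') (F' : M.Sec Ω' s)
    (h : ∀ Z ∈ Ω, ∃ U : Set (V n), IsOpen U ∧ Z ∈ U ∧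
      ∃ c : (Fin s → Fin (n + 2)) → V n → ℂ, (∀ I, ContDiffOn 𝕜 ∞ (c I) U) ∧
        Represents F' U c) :
    ∃ F : M.Sec Ω s, IsRegular 𝕜 F ∧ ∀ Z : Ω', F ⟨Z, hsub Z.2⟩ = F' Z := by
  choose! U hU hZU c hc hr using h
  let F : M.Sec Ω s := fun Z =>
    (form (fun I => c Z I Z)).compLinearMap fun _ => M.orthRep (Z : V n)
  have hF : ∀ Z₀ ∈ Ω, Represents F (U Z₀) (c Z₀) := by
    intro Z₀ hZ₀ Y hYU w
    have hYs := pair_star_self_ne_zero (hΩ Y.2)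
    have hY0 := (hΩ Y.2).1
    have hns := normSq_ne_zero (hΩ Y.2)
    have : ∀ r, ∃ t : ℂ, M.orthRep (Y : V n) (M.cls Y (w r)) = w r + t • (Y : V n) := fun r =>
      ⟨-((M.normSq Y)⁻¹ * (1 / 2 * M.pair (star Y) (w r))), by
        simp only [orthRep, LinearMap.smul_apply, horiz_cls, neg_smul, ← sub_eq_add_neg]
        rw [smul_sub, smul_smul, smul_smul, inv_mul_cancel₀ hns, one_smul]⟩
    choose t ht using this
    change form (fun I => c Y I Y) (fun r => M.orthRep (Y : V n) (M.cls Y (w r))) = _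
    have hne : (𝓝[Ω'] (Y : V n)).NeBot := mem_closure_iff_nhdsWithin_neBot.mp (hdense Y.2)
    have hcont : ∀ r, Tendsto (fun Y' => M.projPerp Y Y' (w r)) (𝓝[Ω'] (Y : V n))
        (𝓝 (M.projPerp Y Y (w r))) := fun r =>
      (continuousAt_projPerp hYs).tendsto.mono_left nhdsWithin_le_nhds
    have hpw : ∀ r, M.projPerp Y Y (w r) = w r := fun r => projPerp_of_perp (w r).2
    have hcc : ∀ Z₁ ∈ Ω, (Y : V n) ∈ U Z₁ → ∀ I, Tendsto (c Z₁ I) (𝓝[Ω'] (Y : V n))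
        (𝓝 (c Z₁ I Y)) := fun Z₁ h1 h2 I =>
      (((hc Z₁ h1 I).continuousOn).continuousAt ((hU Z₁ h1).mem_nhds h2)).tendsto.mono_left
        nhdsWithin_le_nhds
    have l1 := continuousAt_form (c := c Y) (x := fun r Y' => M.projPerp Y Y' (w r) + t r • Y')
      (Z := Y) (l := 𝓝[Ω'] (Y : V n)) (hcc Y Y.2 (hZU Y Y.2)) fun r =>
        (hcont r).add ((continuous_const_smul (t r)).continuousAt.tendsto.mono_left
          nhdsWithin_le_nhds)
    have l2 := continuousAt_form (c := c Z₀) (x := fun r Y' => M.projPerp Y Y' (w r))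
      (Z := Y) (l := 𝓝[Ω'] (Y : V n)) (hcc Z₀ hZ₀ hYU) hcont
    simp only [hpw] at l1 l2
    simp only [ht]
    refine tendsto_nhds_unique l1 (l2.congr' ?_)
    filter_upwards [self_mem_nhdsWithin,
      nhdsWithin_le_nhds ((hU Y Y.2).mem_nhds (hZU Y Y.2)),
      nhdsWithin_le_nhds ((hU Z₀ hZ₀).mem_nhds hYU),
      nhdsWithin_le_nhds ((isOpen_pair_star_ne (M := M) (Y : V n)).mem_nhds hYs)]
      with Y' h1 h2 h3 h4
    have hp : ∀ r, M.pair Y' (M.projPerp Y Y' (w r)) = 0 := fun r => pair_projPerp h4 _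
    have hiso := (hΩ (hsub h1)).1
    rw [← (hr Z₀ hZ₀).ev_eq h1 h3 hp, ← (hr Y Y.2).ev_eq h1 h2 fun r => by
      rw [map_add, hp r, map_smul, hiso, smul_zero, add_zero],
      ev_add_smul F' hiso]
  refine ⟨F, fun Z => ⟨U Z, hU Z Z.2, hZU Z Z.2, c Z, hc Z Z.2, hF Z Z.2⟩, fun Z => ?_⟩
  have hZ := hsub Z.2
  refine MultilinearMap.ext fun x => ?_
  choose w hw using fun r => Submodule.mkQ_surjective _ (x r)
  have : x = fun r => M.cls Z (w r) := funext fun r => (hw r).symm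
  rw [this, hr Z hZ Z (hZU Z hZ) w]
  exact hF Z hZ ⟨Z, hZ⟩ (hZU Z hZ) w

end Smoothness

end EvenLattice

namespace EvenLattice

open Filter

variable {n : ℕ} {M : EvenLattice n} {Ω : Set (V n)} {s : ℕ}

/-! ### Antiholomorphic derivatives -/

lemma dbarDir_congr {g g' : V n → ℂ} {Z : V n} (h : g =ᶠ[𝓝 Z] g') (u : V n) :
    dbarDir g Z u = dbarDir g' Z u := by
  rw [dbarDir, dbarDir, h.fderiv_eq]

lemma dbarDir_of_holo {g : V n → ℂ} {Z : V n} (hg : DifferentiableAt ℂ g Z) (u : V n) :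
    dbarDir g Z u = 0 := by
  have h1 := (hg.hasFDerivAt.restrictScalars ℝ).fderiv
  rw [dbarDir, h1]
  simp only [ContinuousLinearMap.coe_restrictScalars', map_smul, smul_eq_mul]
  linear_combination (fderiv ℂ g Z u / 2) * Complex.I_sq

lemma dbarDir_add {g h : V n → ℂ} {Z : V n} (hg : DifferentiableAt ℝ g Z)
    (hh : DifferentiableAt ℝ h Z) (u : V n) :
    dbarDir (fun Y => g Y + h Y) Z u = dbarDir g Z u + dbarDir h Z u := by
  simp only [dbarDir, fderiv_fun_add hg hh, add_apply]
  ring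

lemma dbarDir_mul {g h : V n → ℂ} {Z : V n} (hg : DifferentiableAt ℝ g Z)
    (hh : DifferentiableAt ℝ h Z) (u : V n) :
    dbarDir (fun Y => g Y * h Y) Z u = dbarDir g Z u * h Z + g Z * dbarDir h Z u := by
  simp only [dbarDir, fderiv_fun_mul hg hh, add_apply, smul_apply, smul_eq_mul]
  ring

lemma dbarDir_const (a : ℂ) (Z u : V n) : dbarDir (fun _ => a) Z u = 0 :=
  dbarDir_of_holo (differentiableAt_const a) u

lemma dbarDir_sum {ι : Type*} {T : Finset ι} {g : ι → V n → ℂ} {Z : V n}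
    (hg : ∀ i ∈ T, DifferentiableAt ℝ (g i) Z) (u : V n) :
    dbarDir (fun Y => ∑ i ∈ T, g i Y) Z u = ∑ i ∈ T, dbarDir (g i) Z u := by
  simp only [dbarDir, fderiv_fun_sum hg, sum_apply]
  rw [Finset.mul_sum, ← Finset.sum_add_distrib, Finset.sum_div]

lemma dbarDir_prod {ι : Type*} [DecidableEq ι] {T : Finset ι} {g : ι → V n → ℂ} {Z : V n}
    (hg : ∀ i ∈ T, DifferentiableAt ℝ (g i) Z) (u : V n) :
    dbarDir (fun Y => ∏ i ∈ T, g i Y) Z u =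
      ∑ i ∈ T, dbarDir (g i) Z u * ∏ j ∈ T.erase i, g j Z := by
  induction T using Finset.induction_on with
  | empty => simp [dbarDir_const]
  | insert a T ha ih =>
    have hT : ∀ i ∈ T, DifferentiableAt ℝ (g i) Z := fun i hi => hg i (Finset.mem_insert_of_mem hi)
    have hda := hg a (Finset.mem_insert_self a T)
    have hprod : DifferentiableAt ℝ (fun Y => ∏ i ∈ T, g i Y) Z :=
      (HasFDerivAt.finsetProd fun r hr => (hT r hr).hasFDerivAt).differentiableAt
    simp only [Finset.prod_insert ha, Finset.sum_insert ha]
    rw [dbarDir_mul hda hprod, ih hT, Finset.erase_insert ha, Finset.mul_sum]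
    congr 1
    refine Finset.sum_congr rfl fun i hi => ?_
    have hia : a ≠ i := fun h => ha (h ▸ hi)
    rw [Finset.erase_insert_of_ne hia, Finset.prod_insert fun h => ha (Finset.mem_of_mem_erase h)]
    ring

lemma dbarDir_comp {g : V n → ℂ} {ρ : V n → V n} {Y : V n} (hg : DifferentiableAt ℝ g (ρ Y))
    (hρ : DifferentiableAt ℂ ρ Y) (u : V n) :
    dbarDir (fun Y => g (ρ Y)) Y u = dbarDir g (ρ Y) (fderiv ℂ ρ Y u) := by
  have h := (HasFDerivAt.comp Y hg.hasFDerivAt (hρ.hasFDerivAt.restrictScalars ℝ)).fderiv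
  have h' : fderiv ℝ (fun Y => g (ρ Y)) Y = _ := h
  simp only [dbarDir, h', ContinuousLinearMap.comp_apply,
    ContinuousLinearMap.coe_restrictScalars', map_smul]

lemma dbarDir_smul_right (g : V n → ℂ) (Z u : V n) (a : ℂ) :
    dbarDir g Z (a • u) = star a * dbarDir g Z u := by
  rw [dbarDir_eq, dbarDir_eq, Finset.mul_sum]
  refine Finset.sum_congr rfl fun k _ => ?_
  simp [mul_assoc]

lemma dbarDir_add_right (g : V n → ℂ) (Z u v : V n) :
    dbarDir g Z (u + v) = dbarDir g Z u + dbarDir g Z v := by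
  rw [dbarDir_eq, dbarDir_eq, dbarDir_eq, ← Finset.sum_add_distrib]
  refine Finset.sum_congr rfl fun k _ => ?_
  simp [add_mul]

/-- The Cauchy–Riemann equations. -/
lemma differentiableAt_complex_of_dbarDir {g : V n → ℂ} {Z : V n} (hg : DifferentiableAt ℝ g Z)
    (h : ∀ u, dbarDir g Z u = 0) : DifferentiableAt ℂ g Z := by
  have hI : ∀ u, fderiv ℝ g Z (Complex.I • u) = Complex.I * fderiv ℝ g Z u := fun u => by
    have h1 := h u
    rw [dbarDir] at h1
    linear_combination (-2 * Complex.I) * h1 + fderiv ℝ g Z (Complex.I • u) * Complex.I_sq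
  refine (differentiableAt_iff_restrictScalars ℝ hg).mpr
    ⟨⟨⟨⟨fderiv ℝ g Z, map_add _⟩, fun c x => ?_⟩, (fderiv ℝ g Z).continuous⟩, ?_⟩
  · have hc : c • x = c.re • x + c.im • (Complex.I • x) := by
      ext k
      simp only [Pi.smul_apply, Pi.add_apply, smul_eq_mul, Complex.real_smul]
      conv_lhs => rw [← Complex.re_add_im c]
      ring
    simp only [RingHom.id_apply, smul_eq_mul]
    rw [hc, map_add, map_smul, map_smul, hI, Complex.real_smul, Complex.real_smul]
    conv_rhs => rw [← Complex.re_add_im c]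
    ring
  · ext u
    rfl

lemma contDiffOn_dbarDir {g : V n → ℂ} {U : Set (V n)} (hU : IsOpen U) (hg : ContDiffOn ℝ ∞ g U)
    {u : V n → V n} (hu : ContDiffOn ℝ ∞ u U) : ContDiffOn ℝ ∞ (fun Z => dbarDir g Z (u Z)) U := by
  simp only [dbarDir_eq]
  exact ContDiffOn.sum fun k _ =>
    ((Complex.conjCLE.contDiff (n := ∞)).comp_contDiffOn (contDiffOn_pi.mp hu k)).mul
      (contDiffOn_dbar hU hg k)

/-! ### The lowering operator on holomorphic local frames -/

variable (M) in
/-- The horizontal part `|Z|² w - ½ (w · Z̄) Z` of a vector `w ∈ Z^⊥`. -/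
noncomputable def hvec (Z w : V n) : V n := M.normSq Z • w - (1 / 2 * M.pair (star Z) w) • Z

lemma pair_hvec {Z w : V n} (hZ : M.pair Z Z = 0) (hw : M.pair Z w = 0) :
    M.pair Z (M.hvec Z w) = 0 := by
  simp [hvec, hZ, hw]

lemma pair_star_hvec (Z w : V n) : M.pair (star Z) (M.hvec Z w) = 0 := by
  simp only [hvec, map_sub, map_smul, smul_eq_mul, normSq, M.pair_comm (star Z) Z]
  ring

lemma pair_hvec_star (Z w : V n) : M.pair Z (star (M.hvec Z w)) = 0 := by
  have h := pair_star (M := M) (star Z) (M.hvec Z w)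
  rwa [star_star, pair_star_hvec, star_zero] at h

lemma exists_coeff_dbar {F : M.Sec Ω s} (hΩ : M.IsConeOpen Ω) {Z : V n} (hZ : Z ∈ Ω)
    {U : Set (V n)} (hU : U ∈ 𝓝 Z) {c : (Fin s → Fin (n + 2)) → V n → ℂ}
    (hc : ∀ I, DifferentiableAt ℝ (c I) Z) (hr : Represents F U c)
    {x : Fin s → V n → V n} (hx : ∀ r, DifferentiableAt ℂ (x r) Z)
    (hxp : ∀ᶠ Y in 𝓝 Z, Y ∈ Ω → ∀ r, M.pair Y (x r Y) = 0)
    {g : V n → ℂ} (hg : DifferentiableAt ℝ g Z)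
    (hgF : ∀ᶠ Y in 𝓝 Z, Y ∈ Ω → g Y = ev F Y fun r => x r Y) {u : V n} (hu : M.pair Z u = 0) :
    ∑ I, dbarDir (c I) Z u * ∏ r, x r Z (I r) = dbarDir g Z u := by
  have hprod : ∀ I : Fin s → Fin (n + 2), DifferentiableAt ℂ (fun Y => ∏ r, x r Y (I r)) Z :=
    fun I => (HasFDerivAt.finsetProd fun r _ =>
      ((differentiableAt_pi.mp (hx r)) (I r)).hasFDerivAt).differentiableAt
  have key := sum_dbarDir_eq_zero (M := M) (ι := Option (Fin s → Fin (n + 2))) (hΩ.1 hZ)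
    (fun o => o.elim g c) (fun o => o.elim (fun _ => -1) fun I Y => ∏ r, x r Y (I r))
    (by rintro (_ | I); exacts [hg, hc I])
    (by rintro (_ | I); exacts [differentiableAt_const _, hprod I])
    (by
      filter_upwards [hΩ.2 Z hZ, hU, hxp, hgF] with Y h1 h2 h3 h4 h5
      have hY := h1 h5
      rw [Fintype.sum_option]
      simp only [Option.elim]
      rw [h4 hY, hr.ev_eq hY h2 (h3 hY), form_apply]
      ring) u hu
  rw [Fintype.sum_option] at key
  simp only [Option.elim] at key
  linear_combination key

/-- The lowering operator, evaluated on a holomorphic frame `x`: the antiholomorphic derivative of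
the function `F(x)` in the horizontal direction. -/
lemma ev_lowerFun {F : M.Sec Ω s} (hΩ : M.IsConeOpen Ω) (hF : IsRegular ℝ F) {Z : V n}
    (hZ : Z ∈ Ω) {x : Fin s → V n → V n} (hx : ∀ r, DifferentiableAt ℂ (x r) Z)
    (hxp : ∀ᶠ Y in 𝓝 Z, Y ∈ Ω → ∀ r, M.pair Y (x r Y) = 0)
    {g : V n → ℂ} (hg : DifferentiableAt ℝ g Z)
    (hgF : ∀ᶠ Y in 𝓝 Z, Y ∈ Ω → g Y = ev F Y fun r => x r Y) {w : Fin (s + 1) → V n}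
    (hw : M.pair Z (w (Fin.last s)) = 0) (hwx : ∀ r : Fin s, w r.castSucc = x r Z) :
    ev (lowerFun F hF) Z w = dbarDir g Z (star (M.hvec Z (w (Fin.last s)))) := by
  obtain ⟨U, hU, hZU, c, hc, hr⟩ := hF ⟨Z, hZ⟩
  have hwp : ∀ r, M.pair Z (w r) = 0 := fun r => by
    refine Fin.lastCases hw (fun r => ?_) r
    rw [hwx]; exact hxp.self_of_nhds hZ r
  rw [(lowerFun_represents hΩ hF hU hc hr).ev_eq hZ hZU hwp, form_lowerCoeff,
    ← exists_coeff_dbar hΩ hZ (hU.mem_nhds hZU)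
      (fun I => ((hc I).contDiffAt (hU.mem_nhds hZU)).differentiableAt (by simp)) hr hx hxp hg hgF
      (pair_hvec_star Z (w (Fin.last s)))]
  simp only [hwx]
  rfl

lemma differentiableAt_projPerp {Z₀ Y : V n} (hY : M.pair Y (star Z₀) ≠ 0) (m : V n) :
    DifferentiableAt ℂ (fun Y => M.projPerp Z₀ Y m) Y :=
  differentiableAt_pi.mpr fun k => ((contDiffOn_projPerp (𝕜 := ℂ) (M := M) (Z₀ := Z₀) (m := m)
    (U := {Y | M.pair Y (star Z₀) ≠ 0}) (fun _ h => h) k).contDiffAt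
      ((isOpen_pair_star_ne Z₀).mem_nhds hY)).differentiableAt (by simp)

lemma differentiableAt_retr {Z₀ Y : V n} (hY : M.pair Y (star Z₀) ≠ 0) :
    DifferentiableAt ℂ (M.retr Z₀) Y :=
  differentiableAt_pi.mpr fun k => ((contDiffOn_retr (𝕜 := ℂ) (M := M) (Z₀ := Z₀)
    (U := {Y | M.pair Y (star Z₀) ≠ 0}) (fun _ h => h) k).contDiffAt
      ((isOpen_pair_star_ne Z₀).mem_nhds hY)).differentiableAt (by simp)

/-- Every smooth section has a smooth value on a holomorphic frame through given vectors. -/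
lemma exists_frame (hΩ : M.IsConeOpen Ω) {𝕜 : Type} [RCLike 𝕜] [NormedAlgebra 𝕜 ℂ]
    {F : M.Sec Ω s} (hF : IsRegular 𝕜 F) {Z : V n} (hZ : Z ∈ Ω)
    {w : Fin s → V n} (hw : ∀ r, M.pair Z (w r) = 0) :
    ∃ (x : Fin s → V n → V n) (g : V n → ℂ), (∀ r, DifferentiableAt ℂ (x r) Z) ∧
      (∀ᶠ Y in 𝓝 Z, Y ∈ Ω → ∀ r, M.pair Y (x r Y) = 0) ∧ DifferentiableAt 𝕜 g Z ∧
      (∀ᶠ Y in 𝓝 Z, Y ∈ Ω → g Y = ev F Y fun r => x r Y) ∧ ∀ r, x r Z = w r := by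
  obtain ⟨U, hU, hZU, c, hc, hr⟩ := hF ⟨Z, hZ⟩
  obtain ⟨W, hW, hZW, hWU⟩ := exists_chart_nhds hΩ hZ (hU.mem_nhds hZU)
  have hiso := hΩ.1 hZ
  have hs := pair_star_self_ne_zero hiso
  refine ⟨fun r Y => M.projPerp Z Y (w r), M.chartFun F Z w, fun r =>
    differentiableAt_projPerp hs _, ?_, ?_, ?_, fun r => projPerp_of_perp (hw r)⟩
  · filter_upwards [(isOpen_pair_star_ne (M := M) Z).mem_nhds hs] with Y hY _ r
    exact pair_projPerp hY _
  · exact ((contDiffOn_chartFun hiso.1 hc hr w hWU).contDiffAt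
      (hW.mem_nhds hZW)).differentiableAt (by simp)
  · refine Eventually.of_forall fun Y hY => ?_
    simp only [chartFun, retr_of_isotropic (hΩ.1 hY).1]

/-! ### The kernel of the lowering operator -/

/-- The Cauchy–Riemann equations for a section, at the point `Z`. -/
def IsCR (F : M.Sec Ω s) (Z : V n) : Prop :=
  ∀ (U : Set (V n)) (c : (Fin s → Fin (n + 2)) → V n → ℂ), U ∈ 𝓝 Z →
    (∀ I, DifferentiableAt ℝ (c I) Z) → Represents F U c → ∀ u, M.pair Z u = 0 →
      ∀ x : Fin s → V n, (∀ r, M.pair Z (x r) = 0) →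
        ∑ I, dbarDir (c I) Z u * ∏ r, x r (I r) = 0

lemma IsRegular.isCR (hΩ : M.IsConeOpen Ω) {F : M.Sec Ω s} (hF : IsRegular ℂ F) {Z : V n}
    (hZ : Z ∈ Ω) : IsCR F Z := by
  intro U c hU hc hr u hu x hx
  obtain ⟨y, g, hy, hyp, hg, hgF, hyx⟩ := exists_frame hΩ hF hZ hx
  have := exists_coeff_dbar hΩ hZ hU hc hr hy hyp (hg.restrictScalars ℝ) hgF hu
  simp only [hyx] at this
  rw [this, dbarDir_of_holo hg]

lemma IsRegular.real {F : M.Sec Ω s} (hF : IsRegular ℂ F) : IsRegular ℝ F := by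
  intro Z
  obtain ⟨U, hU, hZU, c, hc, hr⟩ := hF Z
  exact ⟨U, hU, hZU, c, fun I => (hc I).restrict_scalars ℝ, hr⟩

lemma lowerFun_of_holomorphic (hΩ : M.IsConeOpen Ω) {F : M.Sec Ω s} (hF : IsRegular ℂ F)
    (hF' : IsRegular ℝ F) : lowerFun F hF' = 0 := by
  funext Z
  refine sec_ext_at Z fun w hw => ?_
  obtain ⟨y, g, hy, hyp, hg, hgF, hyx⟩ := exists_frame hΩ hF Z.2
    (w := fun r => w r.castSucc) fun r => hw _
  rw [ev_lowerFun hΩ hF' Z.2 hy hyp (hg.restrictScalars ℝ) hgF (hw _) fun r => (hyx r).symm,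
    dbarDir_of_holo hg, ev_of _ Z.2 hw]
  rfl

/-- A vector of `Z^⊥` is the sum of the conjugate of a horizontal vector and a multiple of `Z`. -/
lemma exists_star_hvec_add_smul {Z u : V n} (hZ : Z ∈ M.isotropicPositive)
    (hu : M.pair Z u = 0) : ∃ (w : V n) (t : ℂ), M.pair Z w = 0 ∧
      u = star (M.hvec Z w) + t • Z := by
  have hZZ := pair_star_self_ne_zero hZ
  have hns := normSq_ne_zero hZ
  set t := M.pair (star Z) u / M.pair Z (star Z) with ht
  have h1 : M.pair (star Z) (u - t • Z) = 0 := by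
    simp only [map_sub, map_smul, smul_eq_mul, M.pair_comm (star Z) Z, ht]
    field_simp
    ring
  have h2 : M.pair Z (u - t • Z) = 0 := by simp [hu, hZ.1]
  have h3 : M.pair Z (star (u - t • Z)) = 0 := by
    have := pair_star (M := M) (star Z) (u - t • Z)
    rwa [star_star, h1, star_zero] at this
  have h4 : M.pair (star Z) (star (u - t • Z)) = 0 := by
    rw [pair_star, h2, star_zero]
  refine ⟨(M.normSq Z)⁻¹ • star (u - t • Z), t, by rw [map_smul, h3, smul_zero], ?_⟩
  rw [hvec, map_smul, h4, smul_zero, mul_zero, zero_smul, sub_zero, smul_smul,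
    mul_inv_cancel₀ hns, one_smul, star_star, sub_add_cancel]

variable (M) in
/-- The retraction differentiates to tangent vectors of the cone. -/
lemma pair_fderiv_retr {Z₀ Y : V n} (hZ₀ : M.pair Z₀ Z₀ = 0) (hY : M.pair Y (star Z₀) ≠ 0)
    (u : V n) : M.pair (M.retr Z₀ Y) (fderiv ℂ (M.retr Z₀) Y u) = 0 := by
  have hd := (differentiableAt_retr (M := M) hY).hasFDerivAt
  have h1 := M.pairL.hasFDerivAt_of_bilinear hd hd
  have h2 : (fun Y => M.pairL (M.retr Z₀ Y) (M.retr Z₀ Y)) =ᶠ[𝓝 Y] fun _ => 0 := by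
    filter_upwards [(isOpen_pair_star_ne Z₀).mem_nhds hY] with Y' hY'
    exact pair_retr_retr hZ₀ hY'
  have h3 := congrArg (fun L => L u)
    (h1.unique ((hasFDerivAt_const (0 : ℂ) Y).congr_of_eventuallyEq h2))
  simp only [add_apply, ContinuousLinearMap.precompR_apply, ContinuousLinearMap.precompL_apply,
    zero_apply, pairL_apply] at h3
  rw [M.pair_comm (fderiv ℂ (M.retr Z₀) Y u)] at h3
  exact add_self_eq_zero.mp h3

/-- A smooth section which satisfies the Cauchy–Riemann equations on a dense set is holomorphic. -/
lemma isRegular_complex_of_isCR (hΩ : M.IsConeOpen Ω) {F : M.Sec Ω s} (hF : IsRegular ℝ F)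
    {S : Set (V n)} (hSΩ : S ⊆ Ω) (hS : Ω ⊆ closure S) (hCR : ∀ Z ∈ S, IsCR F Z) :
    IsRegular ℂ F := by
  refine isRegular_of_chartFun (fun Z hZ => (hΩ.1 hZ).1) fun Z₀ hZ₀ => ?_
  obtain ⟨U, hU, hZU, c, hc, hr⟩ := hF ⟨Z₀, hZ₀⟩
  obtain ⟨W, hW, hZW, hWU⟩ := exists_chart_nhds hΩ hZ₀ (hU.mem_nhds hZU)
  have hiso := (hΩ.1 hZ₀).1
  refine ⟨W, hW, hZW, fun Y hY => (hWU Y hY).1, fun x => ?_⟩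
  have hχ := contDiffOn_chartFun hiso hc hr x hWU
  refine contDiffOn_of_differentiableOn hW fun Y hY => DifferentiableAt.differentiableWithinAt ?_
  refine differentiableAt_complex_of_dbarDir
    ((hχ.contDiffAt (hW.mem_nhds hY)).differentiableAt (by simp)) fun u => ?_
  have hzero : ∀ Y ∈ W, M.retr Z₀ Y ∈ S → dbarDir (M.chartFun F Z₀ x) Y u = 0 := by
    intro Y hY hYS
    obtain ⟨h1, h2, h3⟩ := hWU Y hY
    have hρd := differentiableAt_retr (M := M) h1
    have h1' : M.pair (M.retr Z₀ Y) (star Z₀) ≠ 0 := by rwa [pair_retr_star hiso]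
    have hev : M.chartFun F Z₀ x =ᶠ[𝓝 Y] fun Y => form (fun I => c I (M.retr Z₀ Y))
        fun r => M.projPerp Z₀ (M.retr Z₀ Y) (x r) := by
      filter_upwards [hW.mem_nhds hY] with Y' hY'
      exact chartFun_eq_form hiso hr x (hWU Y' hY').1 (hWU Y' hY').2.1 (hWU Y' hY').2.2
    have hcd : ∀ I, DifferentiableAt ℝ (c I) (M.retr Z₀ Y) := fun I =>
      ((hc I).contDiffAt (hU.mem_nhds h2)).differentiableAt (by simp)
    have hpd : ∀ I : Fin s → Fin (n + 2), DifferentiableAt ℂ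
        (fun Z => ∏ r, M.projPerp Z₀ Z (x r) (I r)) (M.retr Z₀ Y) := fun I =>
      (HasFDerivAt.finsetProd fun r _ => ((differentiableAt_pi.mp
        (differentiableAt_projPerp h1' (x r))) (I r)).hasFDerivAt).differentiableAt
    have hprod : ∀ I, DifferentiableAt ℝ
        (fun Z => c I Z * ∏ r, M.projPerp Z₀ Z (x r) (I r)) (M.retr Z₀ Y) := fun I =>
      (hcd I).mul ((hpd I).restrictScalars ℝ)
    rw [dbarDir_congr hev]
    simp only [form_apply]
    rw [dbarDir_comp (g := fun Z => ∑ I, c I Z * ∏ r, M.projPerp Z₀ Z (x r) (I r))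
      (DifferentiableAt.fun_sum fun I _ => hprod I) hρd, dbarDir_sum fun I _ => hprod I]
    simp only [dbarDir_mul (hcd _) ((hpd _).restrictScalars ℝ), dbarDir_of_holo (hpd _),
      mul_zero, add_zero]
    exact hCR _ hYS U c (hU.mem_nhds h2) hcd hr _ (M.pair_fderiv_retr hiso h1 u) _
      fun r => pair_projPerp h1' _
  -- The preimage of `S` under the retraction is dense.
  have hdense : Y ∈ closure {Y' ∈ W | M.retr Z₀ Y' ∈ S} := by
    obtain ⟨h1, h2, h3⟩ := hWU Y hY
    obtain ⟨t, ht⟩ := eq_retr_add_smul (M := M) Z₀ Y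
    have hcont : Continuous fun Z : V n => Z + t • star Z₀ := by fun_prop
    have h4 : Y ∈ closure ((fun Z : V n => Z + t • star Z₀) ''
        (S ∩ {Z | M.pair Z (star Z₀) ≠ 0})) := by
      have h5 : M.retr Z₀ Y ∈ closure (S ∩ {Z | M.pair Z (star Z₀) ≠ 0}) := by
        rw [Set.inter_comm]
        exact (isOpen_pair_star_ne Z₀).inter_closure
          ⟨by rw [Set.mem_ofPred_eq, pair_retr_star hiso]; exact h1, hS h3⟩
      have := image_closure_subset_closure_image hcont ⟨_, h5, rfl⟩
      have ht' : (fun Z : V n => Z + t • star Z₀) (M.retr Z₀ Y) = Y := ht.symm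
      rwa [ht'] at this
    have h6 := hW.inter_closure ⟨hY, h4⟩
    refine closure_mono ?_ h6
    rintro _ ⟨hYW, Z, ⟨hZS, hZs⟩, rfl⟩
    refine ⟨hYW, ?_⟩
    rw [retr_add_smul hiso (hΩ.1 (hSΩ hZS)).1 hZs]
    exact hZS
  have hcont : ContinuousAt (fun Y => dbarDir (M.chartFun F Z₀ x) Y u) Y :=
    ((contDiffOn_dbarDir hW hχ (contDiffOn_const (c := u))).continuousOn).continuousAt
      (hW.mem_nhds hY)
  have hne := mem_closure_iff_nhdsWithin_neBot.mp hdense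
  refine tendsto_nhds_unique (l := 𝓝[{Y' ∈ W | M.retr Z₀ Y' ∈ S}] Y)
    (hcont.tendsto.mono_left nhdsWithin_le_nhds)
    ((tendsto_const_nhds (x := (0 : ℂ))).congr' ?_)
  filter_upwards [self_mem_nhdsWithin] with Y' hY'
  exact (hzero Y' hY'.1 hY'.2).symm

/-- In the radial direction the Cauchy–Riemann equations follow from homogeneity. -/
lemma isCR_of_lowerFun_eq_zero (hΩ : M.IsConeOpen Ω) {F : M.Sec Ω s} (hF : IsRegular ℝ F)
    (hL : lowerFun F hF = 0) {k : ℤ}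
    (hw : ∀ (a : ℂ) (Z : V n), a ≠ 0 → Z ∈ Ω → ∀ x : Fin s → V n, (∀ r, M.pair Z (x r) = 0) →
      ev F (a • Z) x = a ^ (-k) * ev F Z x) {Z : V n} (hZ : Z ∈ Ω) : IsCR F Z := by
  intro U c hU hc hr u hu x hx
  have hiso := hΩ.1 hZ
  obtain ⟨w, t, hwZ, rfl⟩ := exists_star_hvec_add_smul hiso hu
  simp only [dbarDir_add_right, dbarDir_smul_right, add_mul, Finset.sum_add_distrib]
  obtain ⟨y, g, hy, hyp, hg, hgF, hyx⟩ := exists_frame hΩ hF hZ hx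
  have e1 := exists_coeff_dbar hΩ hZ hU hc hr hy hyp hg hgF (pair_hvec_star Z w)
  have e2 := ev_lowerFun hΩ hF hZ hy hyp hg hgF (w := Fin.snoc x w) (by simpa using hwZ)
    fun r => by simp [hyx]
  have e3 : ev (0 : M.Sec Ω (s + 1)) Z (Fin.snoc x w) = 0 := by
    rw [ev]; split_ifs <;> simp
  rw [hL, e3] at e2
  simp only [hyx] at e1
  simp only [Fin.snoc_last] at e2
  rw [e1, ← e2, zero_add]
  -- The radial derivative is computed along `a ↦ a Z`.
  have hsmul : HasDerivAt (fun a : ℂ => a • Z) Z 1 := by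
    simpa using (hasDerivAt_id (1 : ℂ)).smul_const Z
  set A : (Fin s → Fin (n + 2)) → ℂ := fun I => ∏ r, x r (I r) with hA
  have hsum : HasFDerivAt (fun Y => ∑ I, c I Y * A I) (∑ I, A I • fderiv ℝ (c I) Z) Z :=
    HasFDerivAt.fun_sum fun I _ => by
      simpa using (hc I).hasFDerivAt.mul_const (A I)
  have h1 : HasFDerivAt (𝕜 := ℝ) (fun a : ℂ => ∑ I, c I (a • Z) * A I)
      ((∑ I, A I • fderiv ℝ (c I) Z).comp
        ((ContinuousLinearMap.toSpanSingleton ℂ Z).restrictScalars ℝ)) 1 := by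
    have hsum' : HasFDerivAt (fun Y => ∑ I, c I Y * A I) (∑ I, A I • fderiv ℝ (c I) Z)
        ((1 : ℂ) • Z) := by rwa [one_smul]
    exact hsum'.comp (1 : ℂ) (hsmul.hasFDerivAt.restrictScalars ℝ)
  have h2 : HasDerivAt (fun a : ℂ => a ^ (-k) * ev F Z x) (((-k : ℤ) : ℂ) * ev F Z x) 1 := by
    simpa using (hasDerivAt_zpow (-k) (1 : ℂ) (Or.inl one_ne_zero)).mul_const (ev F Z x)
  have hcts : ContinuousAt (fun a : ℂ => a • Z) 1 := hsmul.continuousAt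
  have h3 : (fun a : ℂ => ∑ I, c I (a • Z) * A I) =ᶠ[𝓝 1] fun a => a ^ (-k) * ev F Z x := by
    have h4 : ∀ᶠ a in 𝓝 (1 : ℂ), a • Z ∈ U := hcts.eventually (by simpa using hU)
    have h5 : ∀ᶠ a in 𝓝 (1 : ℂ), M.pair (a • Z) (a • Z) = 0 → a • Z ∈ Ω :=
      hcts.eventually (p := fun Y => M.pair Y Y = 0 → Y ∈ Ω) (by simpa using hΩ.2 Z hZ)
    filter_upwards [h4, h5, isOpen_ne.mem_nhds one_ne_zero] with a ha1 ha2 ha3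
    have hmem := ha2 (by simp [hiso.1])
    have hperp : ∀ r, M.pair (a • Z) (x r) = 0 := fun r => by simp [hx r]
    rw [← hw a Z ha3 hZ x hx, hr.ev_eq hmem ha1 hperp, form_apply]
  have h4 := h1.unique ((h2.hasFDerivAt.restrictScalars ℝ).congr_of_eventuallyEq h3)
  have e4 := congrArg (fun L => L (1 : ℂ)) h4
  have e5 := congrArg (fun L => L Complex.I) h4
  simp only [ContinuousLinearMap.comp_apply, ContinuousLinearMap.coe_restrictScalars',
    ContinuousLinearMap.toSpanSingleton_apply, one_smul, sum_apply,
    smul_apply, smul_eq_mul] at e4 e5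
  have e6 : ∑ I, dbarDir (c I) Z Z * A I = 0 := by
    have : ∑ I, dbarDir (c I) Z Z * A I = (∑ I, A I * fderiv ℝ (c I) Z Z +
        Complex.I * ∑ I, A I * fderiv ℝ (c I) Z (Complex.I • Z)) / 2 := by
      rw [Finset.mul_sum, ← Finset.sum_add_distrib, Finset.sum_div]
      refine Finset.sum_congr rfl fun I _ => ?_
      rw [dbarDir]
      ring
    rw [this, e4, e5]
    linear_combination (((-k : ℤ) : ℂ) * ev F Z x / 2) * Complex.I_sq
  calc ∑ I, star t * dbarDir (c I) Z Z * ∏ r, x r (I r)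
      = star t * ∑ I, dbarDir (c I) Z Z * A I := by
        rw [Finset.mul_sum]
        exact Finset.sum_congr rfl fun I _ => by rw [hA, mul_assoc]
    _ = 0 := by rw [e6, mul_zero]

end EvenLattice

namespace EvenLattice

open Filter

variable {n : ℕ} {M : EvenLattice n} {Ω : Set (V n)} {s : ℕ}

/-! ### Equivariance under similitudes -/

variable (M) in
/-- A linear automorphism of `M_ℂ` which is compatible with the pairing up to the factor `μ` and
with complex conjugation up to the factor `ν` of absolute value one.  The examples are the
homotheties, for which equivariance of a section is homogeneity, and the elements of `O⁺(M)`. -/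
structure Similitude where
  toEquiv : V n ≃L[ℂ] V n
  μ : ℂ
  ν : ℂ
  μ_ne : μ ≠ 0
  ν_unit : ν * star ν = 1
  pair_map : ∀ x y, M.pair (toEquiv x) (toEquiv y) = μ * M.pair x y
  star_map : ∀ x, star (toEquiv x) = ν • toEquiv (star x)

variable (M) in
/-- The homothety with factor `a`. -/
noncomputable def homothety (a : ℂ) (ha : a ≠ 0) : M.Similitude where
  toEquiv := ContinuousLinearEquiv.smulLeft (Units.mk0 a ha)
  μ := a ^ 2
  ν := star a / a
  μ_ne := pow_ne_zero 2 ha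
  ν_unit := by
    have : star a ≠ 0 := star_ne_zero.mpr ha
    rw [star_div₀, star_star]
    field_simp
  pair_map x y := by
    simp [ContinuousLinearEquiv.smulLeft_apply_apply, Units.smul_def]
    ring
  star_map x := by
    simp [ContinuousLinearEquiv.smulLeft_apply_apply, Units.smul_def, smul_smul, ha]

/-- `F(A Z)(t A x) = c F(Z)(x)`. -/
def Equivariant (A : M.Similitude) (t c : ℂ) (F : M.Sec Ω s) : Prop :=
  ∀ Z ∈ Ω, A.toEquiv Z ∈ Ω → ∀ x : Fin s → V n, (∀ r, M.pair Z (x r) = 0) →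
    ev F (A.toEquiv Z) (fun r => t • A.toEquiv (x r)) = c * ev F Z x

lemma Similitude.normSq_map (A : M.Similitude) (Z : V n) :
    M.normSq (A.toEquiv Z) = A.ν * A.μ * M.normSq Z := by
  rw [normSq, A.star_map, map_smul, A.pair_map, normSq, smul_eq_mul]
  ring

lemma Similitude.hvec_map (A : M.Similitude) (t : ℂ) (Z w : V n) :
    M.hvec (A.toEquiv Z) (t • A.toEquiv w) = (A.ν * A.μ * t) • A.toEquiv (M.hvec Z w) := by
  rw [hvec, hvec, A.normSq_map, A.star_map]
  simp only [map_smul, LinearMap.smul_apply, A.pair_map, map_sub, smul_eq_mul, smul_sub, smul_smul]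
  congr 1
  · congr 1; ring
  · congr 1; ring

lemma Equivariant.lowerFun (hΩ : M.IsConeOpen Ω) {F : M.Sec Ω s} (hF : IsRegular ℝ F)
    {A : M.Similitude} {t c : ℂ} (h : Equivariant A t c F) :
    Equivariant A t (c * (A.μ * t)) (lowerFun F hF) := by
  intro Z hZ hAZ w hw
  obtain ⟨y, g, hy, hyp, hg, hgF, hyx⟩ := exists_frame hΩ hF hZ
    (w := fun r => w r.castSucc) fun r => hw _
  have hinv : A.toEquiv.symm (A.toEquiv Z) = Z := A.toEquiv.symm_apply_apply Z
  have hc : ContinuousAt A.toEquiv.symm (A.toEquiv Z) := A.toEquiv.symm.continuous.continuousAt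
  have hpull : ∀ {p : V n → Prop}, (∀ᶠ Y in 𝓝 Z, p Y) →
      ∀ᶠ Y in 𝓝 (A.toEquiv Z), p (A.toEquiv.symm Y) := fun hp =>
    hc.eventually (by rwa [hinv])
  have hmem : ∀ᶠ Y in 𝓝 (A.toEquiv Z), Y ∈ Ω → A.toEquiv.symm Y ∈ Ω := by
    filter_upwards [hpull (hΩ.2 Z hZ)] with Y hY hYΩ
    refine hY ?_
    have h1 := (hΩ.1 hYΩ).1
    rw [← A.toEquiv.apply_symm_apply Y, A.pair_map] at h1
    exact (mul_eq_zero.mp h1).resolve_left A.μ_ne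
  have hdA : DifferentiableAt ℂ (A.toEquiv.symm : V n → V n) (A.toEquiv Z) :=
    A.toEquiv.symm.differentiableAt
  have hy' : ∀ r, DifferentiableAt ℂ (fun Y => t • A.toEquiv (y r (A.toEquiv.symm Y)))
      (A.toEquiv Z) := fun r =>
    (A.toEquiv.differentiableAt.comp _ (DifferentiableAt.comp (A.toEquiv Z)
      (by rw [hinv]; exact hy r) hdA)).const_smul t
  have hyp' : ∀ᶠ Y in 𝓝 (A.toEquiv Z), Y ∈ Ω → ∀ r,
      M.pair Y (t • A.toEquiv (y r (A.toEquiv.symm Y))) = 0 := by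
    filter_upwards [hpull hyp, hmem] with Y h1 h2 hY r
    have := A.pair_map (A.toEquiv.symm Y) (y r (A.toEquiv.symm Y))
    rw [A.toEquiv.apply_symm_apply] at this
    rw [map_smul, this, h1 (h2 hY) r, mul_zero, smul_zero]
  have hg1 : DifferentiableAt ℝ (fun Y => c * g Y) (A.toEquiv.symm (A.toEquiv Z)) := by
    rw [hinv]; exact hg.const_mul c
  have hg' : DifferentiableAt ℝ (fun Y => c * g (A.toEquiv.symm Y)) (A.toEquiv Z) :=
    DifferentiableAt.comp (g := fun Y => c * g Y) (A.toEquiv Z) hg1 (hdA.restrictScalars ℝ)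
  have hgF' : ∀ᶠ Y in 𝓝 (A.toEquiv Z), Y ∈ Ω → c * g (A.toEquiv.symm Y) =
      ev F Y fun r => t • A.toEquiv (y r (A.toEquiv.symm Y)) := by
    filter_upwards [hpull hyp, hpull hgF, hmem] with Y h1 h2 h3 hY
    have := h _ (h3 hY) (by rwa [A.toEquiv.apply_symm_apply]) _ (h1 (h3 hY))
    rw [A.toEquiv.apply_symm_apply] at this
    rw [this, h2 (h3 hY)]
  rw [ev_lowerFun hΩ hF hAZ hy' hyp' hg' hgF'
    (by rw [map_smul, A.pair_map, hw, mul_zero, smul_zero]) (fun r => by rw [hinv, hyx]),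
    ev_lowerFun hΩ hF hZ hy hyp hg hgF (hw _) (fun r => (hyx r).symm), A.hvec_map,
    dbarDir_comp (g := fun Y => c * g Y) hg1 hdA, hinv,
    dbarDir_mul (differentiableAt_const c) hg, dbarDir_const, zero_mul, zero_add, star_smul,
    A.star_map, ContinuousLinearEquiv.fderiv]
  simp only [map_smul, ContinuousLinearEquiv.coe_coe, ContinuousLinearEquiv.symm_apply_apply,
    dbarDir_smul_right, star_star]
  linear_combination (c * A.μ * t * dbarDir g Z (star (M.hvec Z (w (Fin.last s))))) * A.ν_unit

end EvenLattice

namespace PeriodDomain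

open EvenLattice Filter

variable {n : ℕ} {D : PeriodDomain n} {Ω : Set (V n)} {s : ℕ}

lemma hasWeight_iff {k : ℤ} {F : D.Sec Ω s} :
    HasWeight k F ↔ ∀ (a : ℂ) (ha : a ≠ 0),
      Equivariant (D.homothety a ha) a⁻¹ (a ^ (-k)) F := by
  have hap : ∀ (a : ℂ) (ha : a ≠ 0) (x : V n), (D.homothety a ha).toEquiv x = a • x :=
    fun a ha x => rfl
  constructor
  · intro h a ha Z hZ hZ' x hx
    have hx' : ∀ r, D.pair (a • Z) (x r) = 0 := fun r => by simp [hx r]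
    simp only [hap, inv_smul_smul₀ ha] at hZ' ⊢
    rw [ev_of F hZ' hx', ev_of F hZ hx]
    exact h a ⟨Z, hZ⟩ ⟨a • Z, hZ'⟩ ha rfl _ _ fun r => rfl
  · intro h a Z Z' ha hZZ w w' hww
    have h1 := h a ha Z Z.2 (by rw [hap, ← hZZ]; exact Z'.2) (fun r => w r) fun r => (w r).2
    simp only [hap, inv_smul_smul₀ ha, ← hZZ] at h1
    rw [← ev_coe, ← ev_coe, ← h1]
    simp only [hww]

/-- An element of `O⁺(M)` as a similitude. -/
noncomputable def isometry (γ : D.orthogonalGroup) : D.Similitude where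
  toEquiv := LinearEquiv.toContinuousLinearEquiv
    { toFun := act γ.1
      invFun := act γ.1⁻¹
      map_add' := fun x y => Matrix.mulVec_add _ x y
      map_smul' := fun c x => Matrix.mulVec_smul _ c x
      left_inv := fun x => by rw [← act_mul, inv_mul_cancel, act_one]
      right_inv := fun x => by rw [← act_mul, mul_inv_cancel, act_one] }
  μ := 1
  ν := 1
  μ_ne := one_ne_zero
  ν_unit := by simp
  pair_map x y := by
    have h := congrArg (fun A : Matrix (Fin (n + 2)) (Fin (n + 2)) ℤ =>
      A.map (Int.cast : ℤ → ℂ)) γ.2.1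
    simp only [Matrix.map_mul_intCast] at h
    change D.pair (act γ.1 x) (act γ.1 y) = 1 * D.pair x y
    rw [one_mul, pair, Matrix.toBilin'_apply', Matrix.toBilin'_apply']
    conv_rhs => rw [← h]
    rw [act, act, ← Matrix.mulVec_mulVec, ← Matrix.mulVec_mulVec, Matrix.dotProduct_mulVec x,
      ← Matrix.mulVec_transpose, ← Matrix.transpose_map, Matrix.transpose_transpose]
  star_map x := by
    change star (act γ.1 x) = (1 : ℂ) • act γ.1 (star x)
    rw [one_smul, act, act, Matrix.star_mulVec, ← Matrix.mulVec_transpose]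
    congr 1
    ext i j
    simp

lemma isometry_apply (γ : D.orthogonalGroup) (x : V n) : (isometry γ).toEquiv x = act γ.1 x := rfl

lemma isInvariant_iff {Γ : Subgroup D.orthogonalGroup} {F : D.Sec Ω s} :
    IsInvariant Γ F ↔ ∀ γ ∈ Γ, Equivariant (isometry γ) 1 1 F := by
  have hpair : ∀ (γ : D.orthogonalGroup) (Z x : V n),
      D.pair (act γ.1 Z) (act γ.1 x) = D.pair Z x := fun γ Z x => by
    have h := (isometry γ).pair_map Z x
    rw [show (isometry γ).μ = 1 from rfl, one_mul] at h
    exact h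
  constructor
  · intro h γ hγ Z hZ hZ' x hx
    simp only [isometry_apply, one_smul, one_mul] at hZ' ⊢
    have hx' : ∀ r, D.pair (act γ.1 Z) (act γ.1 (x r)) = 0 := fun r => by rw [hpair, hx r]
    rw [ev_of F hZ' hx', ev_of F hZ hx]
    exact h γ hγ ⟨Z, hZ⟩ ⟨_, hZ'⟩ rfl _ _ fun r => rfl
  · intro h γ hγ Z Z' hZZ w w' hww
    have h1 := h γ hγ Z Z.2 (by rw [isometry_apply, ← hZZ]; exact Z'.2) (fun r => w r)
      fun r => (w r).2
    simp only [isometry_apply, one_smul, one_mul, ← hZZ] at h1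
    rw [← ev_coe, ← ev_coe, ← h1]
    simp only [hww]

lemma HasWeight.lowerFun (hΩ : D.IsConeOpen Ω) {k : ℤ} {F : D.Sec Ω s} (hF : IsRegular ℝ F)
    (h : HasWeight k F) : HasWeight (k - 1) (lowerFun F hF) := by
  refine hasWeight_iff.mpr fun a ha => ?_
  have := (hasWeight_iff.mp h a ha).lowerFun hΩ hF
  convert this using 1
  change _ = a ^ (-k) * (a ^ 2 * a⁻¹)
  rw [show -(k - 1) = -k + 1 by ring, zpow_add₀ ha, zpow_one]
  field_simp

lemma IsInvariant.lowerFun (hΩ : D.IsConeOpen Ω) {Γ : Subgroup D.orthogonalGroup} {F : D.Sec Ω s}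
    (hF : IsRegular ℝ F) (h : IsInvariant Γ F) : IsInvariant Γ (lowerFun F hF) := by
  refine isInvariant_iff.mpr fun γ hγ => ?_
  have := (isInvariant_iff.mp h γ hγ).lowerFun hΩ hF
  convert this using 1
  change _ = (1 : ℂ) * (1 * 1)
  norm_num

/-! ### The cone and the complement of the divisor -/

lemma smul_mem_cone {a : ℂ} (ha : a ≠ 0) {Z : V n} (hZ : Z ∈ D.cone) : a • Z ∈ D.cone := by
  have hZi := isConeOpen_cone.1 hZ
  have hcon : IsPreconnected ((fun b : ℂ => b • Z) '' {0}ᶜ) := by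
    refine (isConnected_compl_singleton_of_one_lt_rank ?_ 0).isPreconnected.image _ (by fun_prop)
    rw [Complex.rank_real_complex]
    exact Cardinal.one_lt_two
  have hsub : (fun b : ℂ => b • Z) '' {0}ᶜ ⊆ D.isotropicPositive := by
    rintro _ ⟨b, hb, rfl⟩
    refine ⟨by simp [hZi.1], ?_⟩
    have h1 : D.pair (b • Z) (star (b • Z)) = (Complex.normSq b : ℂ) * D.pair Z (star Z) := by
      rw [star_smul]
      simp only [map_smul, LinearMap.smul_apply, smul_eq_mul, Complex.normSq_eq_conj_mul_self]
      rw [← mul_assoc]; rfl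
    change 0 < (D.pair (b • Z) (star (b • Z))).re
    rw [h1, Complex.re_ofReal_mul]
    exact mul_pos (Complex.normSq_pos.mpr hb) hZi.2
  have h2 := hcon.subset_connectedComponentIn ⟨1, one_ne_zero, one_smul ℂ Z⟩ hsub
  rw [cone, connectedComponentIn_eq hZ]
  exact h2 ⟨a, ha, rfl⟩

lemma act_mem_cone (γ : D.orthogonalGroup) {Z : V n} (hZ : Z ∈ D.cone) : act γ.1 Z ∈ D.cone := by
  rw [← γ.2.2]
  exact ⟨Z, hZ, rfl⟩

variable {Γ : Subgroup D.orthogonalGroup} {l : ℤ}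

/-- The value of `f` at a vector of `M_ℂ`, with value `0` off the cone. -/
noncomputable def totalValue (f : Mod Γ l 0) (Z : V n) : ℂ :=
  ev (f : D.Sec D.cone 0) Z fun r => r.elim0

lemma totalValue_of_mem (f : Mod Γ l 0) {Z : V n} (hZ : Z ∈ D.cone) :
    totalValue f Z = value f ⟨Z, hZ⟩ := by
  rw [totalValue, ev_of _ hZ fun r => r.elim0, value]
  congr 1
  funext r
  exact r.elim0

lemma mem_zeroLocus_iff {f : Mod Γ l 0} {Z : V n} :
    Z ∈ zeroLocus f ↔ Z ∈ D.cone ∧ totalValue f Z = 0 := by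
  constructor
  · rintro ⟨h, h0⟩
    exact ⟨h, by rw [totalValue_of_mem f h, h0]⟩
  · rintro ⟨h, h0⟩
    exact ⟨h, by rw [← totalValue_of_mem f h, h0]⟩

lemma mem_compl_iff {f : Mod Γ l 0} {Z : V n} :
    Z ∈ compl f ↔ Z ∈ D.cone ∧ totalValue f Z ≠ 0 := by
  rw [compl, Set.mem_sdiff, mem_zeroLocus_iff]
  tauto

lemma totalValue_smul (f : Mod Γ l 0) {a : ℂ} (ha : a ≠ 0) {Z : V n} (hZ : Z ∈ D.cone) :
    totalValue f (a • Z) = a ^ (-l) * totalValue f Z := by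
  have h := hasWeight_iff.mp f.2.2.1 a ha Z hZ (smul_mem_cone ha hZ) (fun r => r.elim0)
    fun r => r.elim0
  rw [totalValue, totalValue, ← h]
  congr 1
  funext r
  exact r.elim0

lemma totalValue_act (f : Mod Γ l 0) {γ : D.orthogonalGroup} (hγ : γ ∈ Γ) {Z : V n}
    (hZ : Z ∈ D.cone) : totalValue f (act γ.1 Z) = totalValue f Z := by
  have h := isInvariant_iff.mp f.2.2.2 γ hγ Z hZ (act_mem_cone γ hZ) (fun r => r.elim0)
    fun r => r.elim0
  rw [one_mul] at h
  rw [totalValue, totalValue, ← h]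
  congr 1
  funext r
  exact r.elim0

lemma smul_mem_compl {f : Mod Γ l 0} {a : ℂ} (ha : a ≠ 0) {Z : V n} (hZ : Z ∈ compl f) :
    a • Z ∈ compl f := by
  rw [mem_compl_iff] at hZ ⊢
  exact ⟨smul_mem_cone ha hZ.1, by
    rw [totalValue_smul f ha hZ.1]; exact mul_ne_zero (zpow_ne_zero _ ha) hZ.2⟩

lemma act_mem_compl {f : Mod Γ l 0} {γ : D.orthogonalGroup} (hγ : γ ∈ Γ) {Z : V n}
    (hZ : Z ∈ compl f) : act γ.1 Z ∈ compl f := by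
  rw [mem_compl_iff] at hZ ⊢
  exact ⟨act_mem_cone γ hZ.1, by rw [totalValue_act f hγ hZ.1]; exact hZ.2⟩

/-- The modular form `f` in the chart at a point of the cone. -/
lemma exists_chart_totalValue (f : Mod Γ l 0) {Z₀ : V n} (hZ₀ : Z₀ ∈ D.cone) {U : Set (V n)}
    (hU : U ∈ 𝓝 Z₀) : ∃ W : Set (V n), IsOpen W ∧ Z₀ ∈ W ∧
      (∀ Y ∈ W, D.pair Y (star Z₀) ≠ 0 ∧ D.retr Z₀ Y ∈ U ∧ D.retr Z₀ Y ∈ D.cone) ∧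
      DifferentiableOn ℂ (fun Y => totalValue f (D.retr Z₀ Y)) W := by
  obtain ⟨U', hU', hZU', c, hc, hr⟩ := f.2.1 ⟨Z₀, hZ₀⟩
  obtain ⟨W, hW, hZW, hWU⟩ := exists_chart_nhds isConeOpen_cone hZ₀
    (inter_mem hU (hU'.mem_nhds hZU'))
  have hiso := isConeOpen_cone.1 hZ₀
  have h1 := contDiffOn_chartFun hiso.1 hc hr (fun r => r.elim0) (W := W) fun Y hY =>
    ⟨(hWU Y hY).1, (hWU Y hY).2.1.2, (hWU Y hY).2.2⟩
  refine ⟨W, hW, hZW, fun Y hY => ⟨(hWU Y hY).1, (hWU Y hY).2.1.1, (hWU Y hY).2.2⟩,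
    (h1.differentiableOn (by simp)).congr fun Y hY => ?_⟩
  rw [totalValue, chartFun]
  congr 1
  funext r
  exact r.elim0

/-- A nonzero modular form does not vanish on an open subset of the cone. -/
lemma not_eventually_totalValue_eq_zero {f : Mod Γ l 0} (hf : f ≠ 0) {Z : V n} (hZ : Z ∈ D.cone) :
    ¬∀ᶠ Y in 𝓝 Z, Y ∈ D.cone → totalValue f Y = 0 := by
  intro hA
  have key : ∀ Z₀ ∈ D.cone, ∀ᶠ Z' in 𝓝[D.cone] Z₀,
      ((∀ᶠ Y in 𝓝 Z', Y ∈ D.cone → totalValue f Y = 0) →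
        ∀ᶠ Y in 𝓝 Z₀, Y ∈ D.cone → totalValue f Y = 0) := by
    intro Z₀ hZ₀
    obtain ⟨W, hW, hZW, hWU, hφ⟩ := exists_chart_totalValue f hZ₀ univ_mem
    obtain ⟨ε, hε, hball⟩ := Metric.isOpen_iff.mp hW Z₀ hZW
    filter_upwards [self_mem_nhdsWithin, nhdsWithin_le_nhds (Metric.ball_mem_nhds Z₀ hε)]
      with Z' hZ' hZ'b hv
    have hZ'i := (isConeOpen_cone.1 hZ').1
    have hv' : ∀ᶠ Y in 𝓝 Z', totalValue f (D.retr Z₀ Y) = 0 := by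
      have hc := continuousAt_retr (M := D.toEvenLattice) (hWU Z' (hball hZ'b)).1
      have h1 := hc.eventually (p := fun Y => Y ∈ D.cone → totalValue f Y = 0)
        (by rwa [retr_of_isotropic hZ'i])
      filter_upwards [h1, hW.mem_nhds (hball hZ'b)] with Y h2 h3
      exact h2 (hWU Y h3).2.2
    -- Propagation of the zero along the segments issuing from `Z'`.
    have hall : ∀ Y ∈ Metric.ball Z₀ ε, totalValue f (D.retr Z₀ Y) = 0 := by
      intro Y hY
      set P : Set ℂ := {τ | Z' + τ • (Y - Z') ∈ Metric.ball Z₀ ε} with hP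
      have hconv : Convex ℝ P := by
        intro τ hτ τ' hτ' a b ha hb hab
        have h1 := convex_ball Z₀ ε hτ hτ' ha hb hab
        have h2 : a • (Z' + τ • (Y - Z')) + b • (Z' + τ' • (Y - Z')) =
            Z' + (a • τ + b • τ') • (Y - Z') := by
          simp only [smul_add, add_smul, smul_assoc]
          rw [add_add_add_comm, ← add_smul, hab, one_smul]
        rwa [h2] at h1
      have han : AnalyticOnNhd ℂ (fun τ : ℂ => totalValue f (D.retr Z₀ (Z' + τ • (Y - Z')))) P :=
        fun τ hτ => analyticAt_line hW hφ (hball hτ)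
      have h0 : (0 : ℂ) ∈ P := by simpa [hP] using hZ'b
      have h1 : (1 : ℂ) ∈ P := by simpa [hP] using hY
      have hev : (fun τ : ℂ => totalValue f (D.retr Z₀ (Z' + τ • (Y - Z')))) =ᶠ[𝓝 0] 0 := by
        have hc : ContinuousAt (fun τ : ℂ => Z' + τ • (Y - Z')) 0 := by fun_prop
        exact hc.eventually (p := fun Y => totalValue f (D.retr Z₀ Y) = 0) (by simpa using hv')
      have := han.eqOn_zero_of_preconnected_of_eventuallyEq_zero hconv.isPreconnected h0 hev h1
      simpa using this
    filter_upwards [Metric.ball_mem_nhds Z₀ hε] with Y hY hYc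
    rw [← hall Y hY, retr_of_isotropic (isConeOpen_cone.1 hYc).1]
  have hcon : IsPreconnected D.cone := isPreconnected_connectedComponentIn
  have hall : ∀ Z' ∈ D.cone, totalValue f Z' = 0 := by
    intro Z' hZ'
    refine (hcon.induction₂' (fun x y => (∀ᶠ Y in 𝓝 x, Y ∈ D.cone → totalValue f Y = 0) →
      ∀ᶠ Y in 𝓝 y, Y ∈ D.cone → totalValue f Y = 0) (fun x hx => ?_)
        (fun x y z _ _ _ h1 h2 h => h2 (h1 h)) hZ hZ' hA).self_of_nhds hZ'
    have h1 : ∀ᶠ y in 𝓝 x, ((∀ᶠ Y in 𝓝 x, Y ∈ D.cone → totalValue f Y = 0) →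
        ∀ᶠ Y in 𝓝 y, Y ∈ D.cone → totalValue f Y = 0) := by
      by_cases hx' : ∀ᶠ Y in 𝓝 x, Y ∈ D.cone → totalValue f Y = 0
      · filter_upwards [eventually_eventually_nhds.mpr hx'] with y hy _
        exact hy
      · exact Eventually.of_forall fun y h => absurd h hx'
    exact (h1.filter_mono nhdsWithin_le_nhds).and (key x hx)
  refine hf (Subtype.ext (funext fun Z' => sec_ext_at Z' fun x hx => ?_))
  have h1 : x = fun r => r.elim0 := funext fun r => r.elim0
  rw [h1]
  refine (hall Z' Z'.2).trans ?_
  rw [ev_of _ Z'.2 fun r => r.elim0]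
  rfl

lemma cone_subset_closure_compl {f : Mod Γ l 0} (hf : f ≠ 0) : D.cone ⊆ closure (compl f) := by
  intro Z hZ
  by_contra h
  refine not_eventually_totalValue_eq_zero hf hZ ?_
  filter_upwards [isClosed_closure.isOpen_compl.mem_nhds h] with Y hY hYc
  by_contra h0
  exact hY (subset_closure (mem_compl_iff.mpr ⟨hYc, h0⟩))

/-- Density of the complement of the divisor in open subsets of the cone. -/
lemma cone_inter_subset_closure {f : Mod Γ l 0} (hf : f ≠ 0) {U : Set (V n)} (hU : IsOpen U) :
    D.cone ∩ U ⊆ closure (compl f ∩ U) := by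
  rw [Set.inter_comm D.cone, Set.inter_comm (compl f)]
  exact fun Z hZ => hU.inter_closure ⟨hZ.1, cone_subset_closure_compl hf hZ.2⟩

lemma isConeOpen_inter (hΩ : D.IsConeOpen Ω) {U : Set (V n)} (hU : IsOpen U) :
    D.IsConeOpen (Ω ∩ U) := by
  refine ⟨fun Z hZ => hΩ.1 hZ.1, fun Z hZ => ?_⟩
  filter_upwards [hΩ.2 Z hZ.1, hU.mem_nhds hZ.2] with Y h1 h2 h3
  exact ⟨h1 h3, h2⟩

/-- The chart function of `f` does not vanish identically. -/
lemma not_eventually_totalValue_retr {f : Mod Γ l 0} (hf : f ≠ 0) {Z : V n} (hZ : Z ∈ D.cone) :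
    ¬∀ᶠ Y in 𝓝 Z, totalValue f (D.retr Z Y) = 0 := fun h =>
  not_eventually_totalValue_eq_zero hf hZ (by
    filter_upwards [h] with Y hY hYc
    rwa [retr_of_isotropic (isConeOpen_cone.1 hYc).1] at hY)

end PeriodDomain

namespace EvenLattice

open Filter

variable {n : ℕ} {M : EvenLattice n} {Ω : Set (V n)} {s : ℕ}

/-! ### Symmetry of iterated lowering -/

lemma dbarDir_dbarDir_comm {g : V n → ℂ} {Z : V n} (hg : ContDiffAt ℝ ∞ g Z) (u v : V n) :
    dbarDir (fun Y => dbarDir g Y u) Z v = dbarDir (fun Y => dbarDir g Y v) Z u := by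
  have hd : DifferentiableAt ℝ (fderiv ℝ g) Z :=
    (hg.fderiv_right (m := 1) (by norm_cast)).differentiableAt (by simp)
  have hsymm : IsSymmSndFDerivAt ℝ g Z :=
    hg.isSymmSndFDerivAt (by
      rw [minSmoothness_of_isRCLikeNormedField]
      exact WithTop.coe_le_coe.mpr (le_top : (2 : ℕ∞) ≤ ⊤))
  have h1 : ∀ u : V n, HasFDerivAt (fun Y => fderiv ℝ g Y u)
      ((fderiv ℝ (fderiv ℝ g) Z).flip u) Z := fun u => by
    simpa using hd.hasFDerivAt.clm_apply (hasFDerivAt_const u Z)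
  have h2 : ∀ u v : V n, dbarDir (fun Y => dbarDir g Y u) Z v =
      (fderiv ℝ (fderiv ℝ g) Z v u + Complex.I * fderiv ℝ (fderiv ℝ g) Z v (Complex.I • u) +
        Complex.I * (fderiv ℝ (fderiv ℝ g) Z (Complex.I • v) u +
          Complex.I * fderiv ℝ (fderiv ℝ g) Z (Complex.I • v) (Complex.I • u))) / 4 := by
    intro u v
    have h3 : HasFDerivAt (fun Y => dbarDir g Y u) _ Z :=
      ((h1 u).add ((h1 (Complex.I • u)).const_mul Complex.I)).mul_const (2 : ℂ)⁻¹
    rw [dbarDir, h3.fderiv]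
    simp only [smul_apply, add_apply, ContinuousLinearMap.flip_apply, smul_eq_mul]
    ring
  rw [h2, h2, hsymm.eq v u, hsymm.eq v (Complex.I • u), hsymm.eq (Complex.I • v) u,
    hsymm.eq (Complex.I • v) (Complex.I • u)]
  ring

lemma differentiableAt_star_coord (Z : V n) (b : Fin (n + 2)) :
    DifferentiableAt ℝ (fun Y : V n => star (Y b)) Z :=
  (Complex.conjCLE.differentiable.comp (ContinuousLinearMap.proj (R := ℝ)
    (φ := fun _ : Fin (n + 2) => ℂ) b).differentiable).differentiableAt

lemma dbarDir_star_coord (Z u : V n) (b : Fin (n + 2)) :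
    dbarDir (fun Y => star (Y b)) Z u = star (u b) := by
  have h : HasFDerivAt (fun Y : V n => star (Y b)) (Complex.conjCLE.toContinuousLinearMap.comp
      (ContinuousLinearMap.proj (R := ℝ) (φ := fun _ : Fin (n + 2) => ℂ) b)) Z :=
    (Complex.conjCLE.toContinuousLinearMap.comp (ContinuousLinearMap.proj (R := ℝ)
      (φ := fun _ : Fin (n + 2) => ℂ) b)).hasFDerivAt
  rw [dbarDir, h.fderiv]
  simp
  linear_combination (-(starRingEnd ℂ (u b)) / 2) * Complex.I_sq

lemma differentiableAt_pair_star {w : V n → V n} {Z : V n} (hw : DifferentiableAt ℝ w Z) :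
    DifferentiableAt ℝ (fun Y => M.pair (star Y) (w Y)) Z := by
  simp only [pair_apply, Pi.star_apply]
  exact DifferentiableAt.fun_sum fun a _ => DifferentiableAt.fun_sum fun b _ =>
    ((differentiableAt_star_coord Z a).mul_const _).mul (differentiableAt_pi.mp hw b)

lemma dbarDir_pair_star {w : V n → V n} {Z : V n} (hw : DifferentiableAt ℂ w Z) (u : V n) :
    dbarDir (fun Y => M.pair (star Y) (w Y)) Z u = M.pair (star u) (w Z) := by
  have hwb : ∀ b, DifferentiableAt ℂ (fun Y => w Y b) Z := fun b => differentiableAt_pi.mp hw b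
  have hs : ∀ a b, DifferentiableAt ℝ (fun Y : V n => star (Y a) * (M.gram a b : ℂ)) Z :=
    fun a b => (differentiableAt_star_coord Z a).mul_const _
  have ht : ∀ a b, DifferentiableAt ℝ (fun Y : V n => star (Y a) * (M.gram a b : ℂ) * w Y b) Z :=
    fun a b => (hs a b).mul ((hwb b).restrictScalars ℝ)
  simp only [pair_apply, Pi.star_apply]
  rw [dbarDir_sum fun a _ => DifferentiableAt.fun_sum fun b _ => ht a b]
  refine Finset.sum_congr rfl fun a _ => ?_
  rw [dbarDir_sum fun b _ => ht a b]
  refine Finset.sum_congr rfl fun b _ => ?_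
  rw [dbarDir_mul (hs a b) ((hwb b).restrictScalars ℝ), dbarDir_of_holo (hwb b), mul_zero,
    add_zero, dbarDir_mul (differentiableAt_star_coord Z a) (differentiableAt_const _),
    dbarDir_const, mul_zero, add_zero, dbarDir_star_coord]

lemma normSq_eq (Z : V n) : M.normSq Z = M.pair (star Z) Z / 2 := by
  rw [normSq, M.pair_comm]

lemma differentiableAt_normSq (Z : V n) : DifferentiableAt ℝ M.normSq Z := by
  have : M.normSq = fun Y => M.pair (star Y) Y / 2 := funext normSq_eq
  rw [this]
  have h := differentiableAt_pair_star (M := M) (w := fun Y => Y) (Z := Z) differentiableAt_fun_id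
  simpa only [div_eq_mul_inv] using h.mul_const (2 : ℂ)⁻¹

lemma dbarDir_normSq (Z u : V n) : dbarDir M.normSq Z u = M.pair (star u) Z / 2 := by
  have : M.normSq = fun Y => (1 / 2 : ℂ) * M.pair (star Y) Y := funext fun Y => by
    rw [normSq_eq]; ring
  rw [this, dbarDir_mul (differentiableAt_const _)
      (differentiableAt_pair_star (w := fun Y => Y) differentiableAt_fun_id),
    dbarDir_const, dbarDir_pair_star (w := fun Y => Y) differentiableAt_fun_id]
  ring

lemma dbarDir_hvec {w : V n → V n} {Z : V n} (hw : DifferentiableAt ℂ w Z) {u : V n}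
    (hu : M.pair (star u) Z = 0) (k : Fin (n + 2)) :
    dbarDir (fun Y => M.hvec Y (w Y) k) Z u = -(1 / 2 * M.pair (star u) (w Z)) * Z k := by
  have hwk := differentiableAt_pi.mp hw k
  have hk : DifferentiableAt ℂ (fun Y : V n => Y k) Z :=
    differentiableAt_pi.mp differentiableAt_id k
  have hp := differentiableAt_pair_star (M := M) (hw.restrictScalars ℝ)
  have e : (fun Y => M.hvec Y (w Y) k) = fun Y => M.normSq Y * w Y k +
      (-(1 / 2) * M.pair (star Y) (w Y)) * Y k := funext fun Y => by
    simp [hvec]; ring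
  have h1 : DifferentiableAt ℝ (fun Y => M.normSq Y * w Y k) Z :=
    (differentiableAt_normSq Z).mul (hwk.restrictScalars ℝ)
  have h2 : DifferentiableAt ℝ (fun Y => -(1 / 2) * M.pair (star Y) (w Y) * Y k) Z :=
    (hp.const_mul _).mul (hk.restrictScalars ℝ)
  rw [e, dbarDir_add h1 h2,
    dbarDir_mul (differentiableAt_normSq Z) (hwk.restrictScalars ℝ), dbarDir_normSq, hu,
    dbarDir_of_holo hwk, dbarDir_mul (hp.const_mul _) (hk.restrictScalars ℝ), dbarDir_of_holo hk,
    dbarDir_mul (differentiableAt_const _) hp, dbarDir_const, dbarDir_pair_star hw]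
  ring

lemma differentiableAt_hvec {w : V n → V n} {Z : V n} (hw : DifferentiableAt ℂ w Z)
    (k : Fin (n + 2)) : DifferentiableAt ℝ (fun Y => M.hvec Y (w Y) k) Z := by
  have hwk := differentiableAt_pi.mp hw k
  have hk : DifferentiableAt ℂ (fun Y : V n => Y k) Z :=
    differentiableAt_pi.mp differentiableAt_id k
  simp only [hvec, Pi.sub_apply, Pi.smul_apply, smul_eq_mul]
  exact ((differentiableAt_normSq Z).mul (hwk.restrictScalars ℝ)).sub
    (((differentiableAt_pair_star (hw.restrictScalars ℝ)).const_mul _).mul (hk.restrictScalars ℝ))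

/-- An explicit expression for `𝖫² F`, which is symmetric in the last two arguments. -/
lemma exists_ev_lowerFun_lowerFun (hΩ : M.IsConeOpen Ω) {F : M.Sec Ω s} (hF : IsRegular ℝ F)
    {Z : V n} (hZ : Z ∈ Ω) (x : Fin s → V n) :
    ∃ g : V n → ℂ, ContDiffAt ℝ ∞ g Z ∧ ∀ y : Fin (s + 2) → V n, (∀ r, M.pair Z (y r) = 0) →
      (∀ r : Fin s, y r.castSucc.castSucc = x r) →
        ev (lowerFun (lowerFun F hF) (isRegular_lowerFun hΩ hF)) Z y =
          -(1 / 2 * (M.normSq Z * M.pair (y (Fin.last _)) (y (Fin.last s).castSucc))) *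
              dbarDir g Z (star Z) +
            dbarDir (fun Y => dbarDir g Y (star (M.hvec Z (y (Fin.last s).castSucc)))) Z
              (star (M.hvec Z (y (Fin.last _)))) := by
  obtain ⟨U, hU, hZU, c, hc, hr⟩ := hF ⟨Z, hZ⟩
  obtain ⟨W, hW, hZW, hWU⟩ := exists_chart_nhds hΩ hZ (hU.mem_nhds hZU)
  have hiso := hΩ.1 hZ
  have hZs := pair_star_self_ne_zero hiso
  have hret : M.retr Z Z = Z := retr_of_isotropic hiso.1
  have hχ := contDiffOn_chartFun hiso.1 hc hr x hWU
  refine ⟨M.chartFun F Z x, hχ.contDiffAt (hW.mem_nhds hZW), fun y hy hyx => ?_⟩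
  set g := M.chartFun F Z x with hg
  let X : Fin (s + 1) → V n → V n := fun r Y => M.projPerp Z (M.retr Z Y) (y r.castSucc)
  have hXd : ∀ r, ∀ Y ∈ W, DifferentiableAt ℂ (X r) Y := fun r Y hY =>
    DifferentiableAt.comp (g := fun Y' => M.projPerp Z Y' (y r.castSucc)) Y
      (differentiableAt_projPerp (by rw [pair_retr_star hiso.1]; exact (hWU Y hY).1) _)
      (differentiableAt_retr (hWU Y hY).1)
  have hXp : ∀ Y ∈ W, Y ∈ Ω → ∀ r, M.pair Y (X r Y) = 0 := by
    intro Y hY hYΩ r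
    have h1 : M.retr Z Y = Y := retr_of_isotropic (hΩ.1 hYΩ).1
    simp only [X, h1]
    exact pair_projPerp (hWU Y hY).1 _
  have hXZ : ∀ r, X r Z = y r.castSucc := fun r => by
    simp only [X, hret]
    exact projPerp_of_perp (hy _)
  have hgF : ∀ Y ∈ W, Y ∈ Ω → g Y = ev F Y fun r => X r.castSucc Y := by
    intro Y hY hYΩ
    have h1 : M.retr Z Y = Y := retr_of_isotropic (hΩ.1 hYΩ).1
    simp only [hg, chartFun, X, h1, hyx]
  have hgd : ∀ Y ∈ W, ContDiffAt ℝ ∞ g Y := fun Y hY => hχ.contDiffAt (hW.mem_nhds hY)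
  have hgd' : ∀ k, DifferentiableAt ℝ (fun Y => dbar g Y k) Z := fun k =>
    ((contDiffOn_dbar hW hχ k).contDiffAt (hW.mem_nhds hZW)).differentiableAt (by simp)
  have hform : ∀ Y, dbarDir g Y (star (M.hvec Y (X (Fin.last s) Y))) =
      ∑ k, M.hvec Y (X (Fin.last s) Y) k * dbar g Y k := fun Y => by
    rw [dbarDir_eq]
    simp
  have hXl := hXd (Fin.last s) Z hZW
  have hterm : ∀ k, DifferentiableAt ℝ (fun Y => M.hvec Y (X (Fin.last s) Y) k * dbar g Y k) Z :=
    fun k => (differentiableAt_hvec hXl k).mul (hgd' k)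
  have hG1 : DifferentiableAt ℝ
      (fun Y => ∑ k, M.hvec Y (X (Fin.last s) Y) k * dbar g Y k) Z :=
    DifferentiableAt.fun_sum fun k _ => hterm k
  have hGF : ∀ᶠ Y in 𝓝 Z, Y ∈ Ω → ∑ k, M.hvec Y (X (Fin.last s) Y) k * dbar g Y k =
      ev (lowerFun F hF) Y fun r => X r Y := by
    filter_upwards [hW.mem_nhds hZW] with Y hY hYΩ
    rw [← hform]
    refine (ev_lowerFun hΩ hF hYΩ (x := fun r => X r.castSucc) (g := g) (w := fun r => X r Y)
      (fun r => hXd _ Y hY)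
      ?_ ((hgd Y hY).differentiableAt (by simp)) ?_ (hXp Y hY hYΩ _) fun r => rfl).symm
    · filter_upwards [hW.mem_nhds hY] with Y' hY' h r using hXp Y' hY' h _
    · filter_upwards [hW.mem_nhds hY] with Y' hY' using hgF Y' hY'
  have hXpe : ∀ᶠ Y in 𝓝 Z, Y ∈ Ω → ∀ r, M.pair Y (X r Y) = 0 := by
    filter_upwards [hW.mem_nhds hZW] with Y hY using hXp Y hY
  have hmain := ev_lowerFun hΩ (isRegular_lowerFun hΩ hF) hZ (fun r => hXd r Z hZW) hXpe hG1 hGF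
    (w := y) (hy _) (fun r => (hXZ r).symm)
  have hu : M.pair (star (star (M.hvec Z (y (Fin.last _))))) Z = 0 := by
    rw [star_star, M.pair_comm, pair_hvec hiso.1 (hy _)]
  have hpair : M.pair (M.hvec Z (y (Fin.last _))) (y (Fin.last s).castSucc) =
      M.normSq Z * M.pair (y (Fin.last _)) (y (Fin.last s).castSucc) := by
    simp [hvec, hy]
  have hk : ∀ k, dbarDir (fun Y => M.hvec Y (X (Fin.last s) Y) k * dbar g Y k) Z
      (star (M.hvec Z (y (Fin.last _)))) =
        -(1 / 2 * (M.normSq Z * M.pair (y (Fin.last _)) (y (Fin.last s).castSucc))) *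
            (Z k * dbar g Z k) +
          M.hvec Z (y (Fin.last s).castSucc) k *
            dbarDir (fun Y => dbar g Y k) Z (star (M.hvec Z (y (Fin.last _)))) := by
    intro k
    rw [dbarDir_mul (differentiableAt_hvec hXl _) (hgd' _), dbarDir_hvec hXl hu, star_star, hXZ,
      hpair, mul_assoc]
  rw [hmain, dbarDir_sum fun k _ => hterm k, Finset.sum_congr rfl fun k _ => hk k,
    Finset.sum_add_distrib, ← Finset.mul_sum]
  congr 1
  · rw [dbarDir_eq]
    simp
  · have e : (fun Y => dbarDir g Y (star (M.hvec Z (y (Fin.last s).castSucc)))) =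
        fun Y => ∑ k, M.hvec Z (y (Fin.last s).castSucc) k * dbar g Y k := funext fun Y => by
      rw [dbarDir_eq]
      simp
    rw [e, dbarDir_sum fun k _ => (hgd' k).const_mul _]
    refine Finset.sum_congr rfl fun k _ => ?_
    rw [dbarDir_mul (differentiableAt_const _) (hgd' k), dbarDir_const, zero_mul, zero_add]

/-- `F` is symmetric in its arguments from the index `s₀` on. -/
def IsSymmFrom (s₀ : ℕ) (F : M.Sec Ω s) : Prop :=
  ∀ Z ∈ Ω, ∀ x : Fin s → V n, (∀ r, M.pair Z (x r) = 0) → ∀ i j : Fin s, s₀ ≤ i → s₀ ≤ j →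
    ev F Z (x ∘ Equiv.swap i j) = ev F Z x

lemma ev_lowerFun_swap (hΩ : M.IsConeOpen Ω) {F : M.Sec Ω s} (hF : IsRegular ℝ F) {i j : Fin s}
    (h : ∀ Z ∈ Ω, ∀ x : Fin s → V n, (∀ r, M.pair Z (x r) = 0) →
      ev F Z (x ∘ Equiv.swap i j) = ev F Z x) {Z : V n} (hZ : Z ∈ Ω) {x : Fin (s + 1) → V n}
    (hx : ∀ r, M.pair Z (x r) = 0) :
    ev (lowerFun F hF) Z (x ∘ Equiv.swap i.castSucc j.castSucc) = ev (lowerFun F hF) Z x := by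
  obtain ⟨y, g, hy, hyp, hg, hgF, hyx⟩ := exists_frame hΩ hF hZ
    (w := fun r => x r.castSucc) fun r => hx _
  have hcs : ∀ r : Fin s, Equiv.swap i.castSucc j.castSucc r.castSucc =
      (Equiv.swap i j r).castSucc := fun r =>
    ((Fin.castSucc_injective s).map_swap i j r).symm
  have hl : Equiv.swap i.castSucc j.castSucc (Fin.last s) = Fin.last s :=
    Equiv.swap_apply_of_ne_of_ne (Fin.castSucc_lt_last i).ne' (Fin.castSucc_lt_last j).ne'
  rw [ev_lowerFun hΩ hF hZ hy hyp hg hgF (w := x) (hx _) fun r => (hyx r).symm,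
    ev_lowerFun hΩ hF hZ (w := x ∘ Equiv.swap i.castSucc j.castSucc)
      (x := fun r => y (Equiv.swap i j r)) (fun r => hy _)
      (by filter_upwards [hyp] with Y h1 h2 r using h1 h2 _) hg
      (by
        filter_upwards [hyp, hgF] with Y h1 h2 hY
        rw [h2 hY]
        exact (h Y hY _ (h1 hY)).symm)
      (hx _) fun r => by rw [Function.comp_apply, hcs, hyx]]
  rw [Function.comp_apply, hl]

lemma ev_lowerFun_lowerFun_swap (hΩ : M.IsConeOpen Ω) {F : M.Sec Ω s} (hF : IsRegular ℝ F)
    {Z : V n} (hZ : Z ∈ Ω) {x : Fin (s + 2) → V n} (hx : ∀ r, M.pair Z (x r) = 0) :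
    ev (lowerFun (lowerFun F hF) (isRegular_lowerFun hΩ hF)) Z
        (x ∘ Equiv.swap (Fin.last s).castSucc (Fin.last (s + 1))) =
      ev (lowerFun (lowerFun F hF) (isRegular_lowerFun hΩ hF)) Z x := by
  obtain ⟨g, hg, h⟩ := exists_ev_lowerFun_lowerFun hΩ hF hZ
    fun r => x r.castSucc.castSucc
  rw [h x hx fun r => rfl, h (x ∘ _) (fun r => hx _) fun r => ?_]
  · simp only [Function.comp_apply, Equiv.swap_apply_left, Equiv.swap_apply_right]
    rw [dbarDir_dbarDir_comm hg, M.pair_comm]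
  · rw [Function.comp_apply, Equiv.swap_apply_of_ne_of_ne]
    · exact fun e => (Fin.castSucc_lt_last r).ne (Fin.castSucc_injective _ e)
    · exact (Fin.castSucc_lt_last _).ne

lemma IsSymmFrom.lowerFun_lowerFun (hΩ : M.IsConeOpen Ω) {F : M.Sec Ω s} (hF : IsRegular ℝ F)
    {s₀ : ℕ} (h : IsSymmFrom s₀ (lowerFun F hF)) :
    IsSymmFrom s₀ (lowerFun (lowerFun F hF) (isRegular_lowerFun hΩ hF)) := by
  have hF1 := isRegular_lowerFun hΩ hF
  have h1 : ∀ (Z : V n) (_ : Z ∈ Ω) (x : Fin (s + 2) → V n) (_ : ∀ r, M.pair Z (x r) = 0)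
      (i j : Fin (s + 1)), s₀ ≤ i → s₀ ≤ j →
      ev (lowerFun (lowerFun F hF) hF1) Z (x ∘ Equiv.swap i.castSucc j.castSucc) =
        ev (lowerFun (lowerFun F hF) hF1) Z x := fun Z hZ x hx i j hi hj =>
    ev_lowerFun_swap hΩ hF1 (fun Z hZ x hx => h Z hZ x hx i j hi hj) hZ hx
  have h2 : ∀ (Z : V n) (_ : Z ∈ Ω) (x : Fin (s + 2) → V n) (_ : ∀ r, M.pair Z (x r) = 0)
      (i : Fin (s + 1)), s₀ ≤ i →
      ev (lowerFun (lowerFun F hF) hF1) Z (x ∘ Equiv.swap i.castSucc (Fin.last _)) =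
        ev (lowerFun (lowerFun F hF) hF1) Z x := by
    intro Z hZ x hx i hi
    by_cases hil : i = Fin.last s
    · rw [hil]
      exact ev_lowerFun_lowerFun_swap hΩ hF hZ hx
    · -- Conjugation of the last adjacent transposition.
      have hne : i.castSucc ≠ (Fin.last s).castSucc := fun e => hil (Fin.castSucc_injective _ e)
      have hσ : Equiv.swap i.castSucc (Fin.last (s + 1)) =
          Equiv.swap i.castSucc (Fin.last s).castSucc *
            Equiv.swap (Fin.last s).castSucc (Fin.last (s + 1)) *
              Equiv.swap i.castSucc (Fin.last s).castSucc := by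
        have h3 := Equiv.swap_mul_swap_mul_swap (x := Fin.last (s + 1)) (y := (Fin.last s).castSucc)
          (z := i.castSucc) (Fin.castSucc_lt_last _).ne' (Fin.castSucc_lt_last _).ne'
        rw [Equiv.swap_comm _ i.castSucc, Equiv.swap_comm (Fin.last (s + 1))] at h3
        exact h3.symm
      have hl : s₀ ≤ ((Fin.last s : Fin (s + 1)) : ℕ) := by
        have := i.is_lt
        simp only [Fin.val_last]
        omega
      rw [hσ, Equiv.Perm.coe_mul, Equiv.Perm.coe_mul, ← Function.comp_assoc,
        ← Function.comp_assoc, h1 Z hZ ((x ∘ _) ∘ _) (fun r => hx _) _ _ hi hl,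
        ev_lowerFun_lowerFun_swap hΩ hF hZ (x := x ∘ _) fun r => hx _, h1 Z hZ _ hx _ _ hi hl]
  intro Z hZ x hx i j
  refine Fin.lastCases (fun hi => ?_) (fun i hi => ?_) i <;>
    refine Fin.lastCases (fun hj => ?_) (fun j hj => ?_) j
  · rw [Equiv.swap_self]; rfl
  · rw [Equiv.swap_comm]
    exact h2 Z hZ x hx j (by simpa using hj)
  · exact h2 Z hZ x hx i (by simpa using hi)
  · exact h1 Z hZ x hx i j (by simpa using hi) (by simpa using hj)

/-- `𝖫^d F` is symmetric in the arguments which correspond to the derivatives. -/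
lemma isSymmFrom_lowerIter (hΩ : M.IsConeOpen Ω) (F : M.smoothSec Ω s) (d : ℕ) :
    IsSymmFrom s (lowerIter hΩ s d F : M.Sec Ω (s + d)) := by
  induction d with
  | zero =>
    intro Z hZ x hx i j hi
    exact absurd i.is_lt (Nat.not_lt.mpr hi)
  | succ d ih =>
    cases d with
    | zero =>
      intro Z hZ x hx i j hi hj
      have h1 := i.is_lt
      have h2 := j.is_lt
      have : i = j := Fin.ext (by omega)
      rw [this, Equiv.swap_self]
      rfl
    | succ d => exact IsSymmFrom.lowerFun_lowerFun hΩ (lowerIter hΩ s d F).2 ih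

end EvenLattice

namespace EvenLattice

open Filter

variable {n : ℕ} {M : EvenLattice n} {Ω : Set (V n)} {s : ℕ}

/-! ### Holomorphic derivatives along the cone -/

lemma sum_dhol_mul (g : V n → ℂ) (Z u : V n) :
    ∑ k, dhol g Z k * u k = (fderiv ℝ g Z u - Complex.I * fderiv ℝ g Z (Complex.I • u)) / 2 := by
  have h1 : fderiv ℝ g Z u = ∑ k, ((u k).re * fderiv ℝ g Z (Pi.single k 1) +
      (u k).im * fderiv ℝ g Z (Pi.single k Complex.I)) := by
    conv_lhs => rw [eq_sum_real u]
    simp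
  have h2 : fderiv ℝ g Z (Complex.I • u) = ∑ k, (-(u k).im * fderiv ℝ g Z (Pi.single k 1) +
      (u k).re * fderiv ℝ g Z (Pi.single k Complex.I)) := by
    conv_lhs => rw [eq_sum_real (Complex.I • u)]
    simp
  rw [h1, h2, Finset.mul_sum, ← Finset.sum_sub_distrib, Finset.sum_div]
  refine Finset.sum_congr rfl fun k _ => ?_
  rw [dhol]
  linear_combination ((fderiv ℝ g Z (Pi.single k 1) - Complex.I *
    fderiv ℝ g Z (Pi.single k Complex.I)) / 2) * (-(Complex.re_add_im (u k))) -
      ((u k).im * fderiv ℝ g Z (Pi.single k Complex.I)) / 2 * Complex.I_sq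

/-- A holomorphic function which vanishes on the cone has zero derivative along the cone. -/
lemma fderiv_eq_zero_of_vanish {Z : V n} (hZ : Z ∈ M.isotropicPositive) {h : V n → ℂ}
    (hd : DifferentiableAt ℂ h Z) (h0 : ∀ᶠ Y in 𝓝 Z, M.pair Y Y = 0 → h Y = 0) {u : V n}
    (hu : M.pair Z u = 0) : fderiv ℂ h Z u = 0 := by
  have h1 : HasFDerivAt (fun Y => star (h Y)) (Complex.conjCLE.toContinuousLinearMap.comp
      ((fderiv ℂ h Z).restrictScalars ℝ)) Z :=
    Complex.conjCLE.toContinuousLinearMap.hasFDerivAt.comp Z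
      (hd.hasFDerivAt.restrictScalars ℝ)
  have h2 := sum_dbarDir_eq_zero (ι := Fin 1) hZ (fun _ Y => star (h Y)) (fun _ _ => 1)
    (fun _ => h1.differentiableAt) (fun _ => differentiableAt_const _) (by
      filter_upwards [h0] with Y hY hYY
      simp [hY hYY]) u hu
  simp only [Finset.univ_unique, Finset.sum_singleton, mul_one, dbarDir, h1.fderiv] at h2
  simp at h2
  have h3 : star (fderiv ℂ h Z u) = 0 := by
    change (starRingEnd ℂ) (fderiv ℂ h Z u) = 0
    linear_combination h2 / 2 + ((starRingEnd ℂ) (fderiv ℂ h Z u) / 2) * Complex.I_sq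
  simpa using h3

lemma fderiv_normSq_eq_zero {Z u : V n} (h1 : M.pair Z (star u) = 0)
    (h2 : M.pair (star Z) u = 0) : fderiv ℝ M.normSq Z u = 0 := by
  have hl : HasDerivAt (fun t : ℝ => Z + t • u) u 0 := by
    simpa using ((hasDerivAt_id (0 : ℝ)).smul_const u).const_add Z
  have hN := (differentiableAt_normSq (M := M) Z).hasFDerivAt
  have h3 : HasDerivAt (fun t : ℝ => M.normSq (Z + t • u)) (fderiv ℝ M.normSq Z u) 0 := by
    have hN' : HasFDerivAt M.normSq (fderiv ℝ M.normSq Z) (Z + (0 : ℝ) • u) := by simpa using hN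
    exact hN'.comp_hasDerivAt (0 : ℝ) hl
  have h4 : (fun t : ℝ => M.normSq (Z + t • u)) =
      fun t : ℝ => M.normSq Z + ((t : ℂ) ^ 2) * M.normSq u := by
    funext t
    have e : t • u = (t : ℂ) • u := (Complex.coe_smul t u).symm
    have e' : star ((t : ℂ) • u) = (t : ℂ) • star u := by
      rw [star_smul]; simp
    rw [M.pair_comm] at h2
    simp only [normSq, e, star_add, e', map_add, LinearMap.add_apply, map_smul,
      LinearMap.smul_apply, h1, h2, smul_eq_mul]
    ring
  rw [h4] at h3
  have h5 : HasDerivAt (fun t : ℝ => M.normSq Z + ((t : ℂ) ^ 2) * M.normSq u) 0 0 := by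
    have h6 : HasDerivAt (fun t : ℝ => (t : ℂ)) 1 0 := Complex.ofRealCLM.hasDerivAt
    simpa using ((h6.pow 2).mul_const (M.normSq u)).const_add (M.normSq Z)
  exact h3.unique h5

/-- Differentiation of the values of a holomorphic multi-differential on smooth vector fields. -/
lemma dbarDir_form {m : ℕ} {c : (Fin m → Fin (n + 2)) → V n → ℂ} {X : Fin m → V n → V n} {Z : V n}
    (hc : ∀ I, DifferentiableAt ℂ (c I) Z)
    (hX : ∀ i k, DifferentiableAt ℝ (fun Y => X i Y k) Z) (u : V n) :
    dbarDir (fun Y => form (fun I => c I Y) fun i => X i Y) Z u =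
      ∑ i, form (fun I => c I Z) (Function.update (fun i => X i Z) i
        fun k => dbarDir (fun Y => X i Y k) Z u) := by
  classical
  have hp : ∀ I : Fin m → Fin (n + 2), DifferentiableAt ℝ (fun Y => ∏ i, X i Y (I i)) Z := fun I =>
    (HasFDerivAt.finsetProd fun i _ => (hX i (I i)).hasFDerivAt).differentiableAt
  have ht : ∀ I : Fin m → Fin (n + 2),
      DifferentiableAt ℝ (fun Y => c I Y * ∏ i, X i Y (I i)) Z := fun I =>
    ((hc I).restrictScalars ℝ).mul (hp I)
  simp only [form_apply]
  rw [dbarDir_sum fun I _ => ht I, Finset.sum_comm]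
  refine Finset.sum_congr rfl fun I _ => ?_
  rw [dbarDir_mul ((hc I).restrictScalars ℝ) (hp I), dbarDir_of_holo (hc I), zero_mul, zero_add,
    dbarDir_prod fun i _ => hX i (I i), Finset.mul_sum]
  refine Finset.sum_congr rfl fun i _ => ?_
  rw [← Finset.mul_prod_erase _ _ (Finset.mem_univ i), Function.update_self]
  congr 2
  refine Finset.prod_congr rfl fun j hj => ?_
  rw [Function.update_of_ne (Finset.ne_of_mem_erase hj)]

/-- Insertion of a vector field in the last arguments of a multi-differential. -/
lemma exists_form_insert {𝕜 : Type} [RCLike 𝕜] [NormedAlgebra 𝕜 ℂ] {m s t : ℕ} (h : m = s + t)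
    {c : (Fin m → Fin (n + 2)) → V n → ℂ} {X : V n → V n} {U : Set (V n)}
    (hc : ∀ I, ContDiffOn 𝕜 ∞ (c I) U) (hX : ∀ k, ContDiffOn 𝕜 ∞ (fun Y => X Y k) U) :
    ∃ c' : (Fin s → Fin (n + 2)) → V n → ℂ, (∀ J, ContDiffOn 𝕜 ∞ (c' J) U) ∧
      ∀ (Y : V n) (x : Fin s → V n), form (fun J => c' J Y) x =
        form (fun I => c I Y) fun i => Fin.append x (fun _ => X Y) (Fin.cast h i) := by
  refine ⟨fun J Y => form (fun I => c I Y) fun i =>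
    Fin.append (fun r => (Pi.single (J r) 1 : V n)) (fun _ => X Y) (Fin.cast h i),
    fun J => ?_, fun Y x => ?_⟩
  · refine contDiffOn_form (x := fun i Y => Fin.append (fun r => (Pi.single (J r) 1 : V n))
      (fun _ => X Y) (Fin.cast h i)) hc fun i k => ?_
    generalize Fin.cast h i = j
    refine Fin.addCases (fun j => ?_) (fun j => ?_) j
    · simp only [Fin.append_left]
      exact contDiffOn_const
    · simp only [Fin.append_right]
      exact hX k
  · exact (multilinear_eq_form (PeriodDomain.insertLast
      ((form fun I => c I Y).domDomCongr (finCongr h)) fun _ => X Y) x).symm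

end EvenLattice

namespace PeriodDomain

open EvenLattice Filter

variable {n : ℕ} {D : PeriodDomain n} {Γ : Subgroup D.orthogonalGroup} {l : ℤ}

/-! ### The gradient field of a modular form -/

lemma append_update_right {E : Type*} {s t : ℕ} [DecidableEq (Fin t)] (w : Fin s → E)
    (v : Fin t → E) (i : Fin t) (z : E) : Fin.append w (Function.update v i z) =
      Function.update (Fin.append w v) (Fin.natAdd s i) z := by
  funext j
  refine Fin.addCases (fun j => ?_) (fun j => ?_) j
  · have h' : Fin.castAdd t j ≠ Fin.natAdd s i := by
      intro e
      have := congrArg Fin.val e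
      simp at this
      omega
    simp [Function.update_of_ne, h']
  · by_cases h : j = i
    · subst h; simp
    · have h' : Fin.natAdd s j ≠ Fin.natAdd s i := fun e => h (Fin.natAdd_injective _ s e)
      simp [Function.update_of_ne, h, h']

lemma pairing_tensorPow {E : Type*} [AddCommGroup E] [Module ℂ E] [FiniteDimensional ℂ E]
    (B : LinearMap.BilinForm ℂ E) (hB : B.Nondegenerate) (hs : B.IsSymm) {s t : ℕ}
    (F : MultilinearMap ℂ (fun _ : Fin (s + t) => E) ℂ) (G : Module.Dual ℂ E) :
    pairing B hB F (tensorPow G t) = insertLast F fun _ => (B.toDual hB).symm G := by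
  set b := Module.finBasis ℂ E
  have h1 : (B.toDual hB).symm G = ∑ i, G (B.dualBasis hB b i) • b i := by
    refine (B.toDual hB).injective (LinearMap.ext fun x => ?_)
    rw [LinearEquiv.apply_symm_apply, LinearMap.BilinForm.toDual_def]
    have hx := (B.dualBasis hB b).sum_repr x
    conv_lhs => rw [← hx]
    simp only [map_sum, map_smul, LinearMap.sum_apply, LinearMap.smul_apply,
      LinearMap.BilinForm.dualBasis_repr_apply, smul_eq_mul]
    exact Finset.sum_congr rfl fun i _ => by rw [hs.eq, mul_comm]
  refine MultilinearMap.ext fun w => ?_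
  change _ = F (Fin.append w fun _ => (B.toDual hB).symm G)
  let μ : MultilinearMap ℂ (fun _ : Fin t => E) ℂ :=
    { toFun := fun v => F (Fin.append w v)
      map_update_add' := by
        intro _ v i x y
        simp only [append_update_right, F.map_update_add]
      map_update_smul' := by
        intro _ v i c x
        simp only [append_update_right, F.map_update_smul] }
  change _ = μ fun _ => (B.toDual hB).symm G
  rw [h1, μ.map_sum]
  simp only [pairing, sum_apply, smul_apply, smul_eq_mul, tensorPow,
    MultilinearMap.compLinearMap_apply, MultilinearMap.mkPiAlgebra_apply]
  refine Finset.sum_congr rfl fun I _ => ?_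
  rw [μ.map_smul_univ (fun i => G (B.dualBasis hB b (I i))) fun i => b (I i)]
  rfl

/-- The element of `Z^⊥ / ℂ Z` which corresponds to `G` under the trace pairing. -/
noncomputable def gradVec (f : Mod Γ l 0) (Z : compl f) : D.E (Z : V n) :=
  ((D.tr (Z : V n)).toDual (D.tr_nondegenerate Z)).symm (logDeriv f Z)

/-- An explicit form of the logarithmic derivative. -/
lemma logDeriv_cls (hl : l ≠ 0) (f : Mod Γ l 0) (Z : compl f) {g : V n → ℂ}
    (hg : DifferentiableAt ℂ g Z)
    (hgf : ∀ᶠ Y in 𝓝 (Z : V n), Y ∈ D.cone → g Y = totalValue f Y) (w : D.perp (Z : V n)) :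
    logDeriv f Z (D.cls Z w) = fderiv ℂ g Z w / (l * totalValue f Z) +
      D.pair (star (Z : V n)) w / (2 * D.normSq (Z : V n)) := by
  have hZc : (Z : V n) ∈ D.cone := Z.2.1
  have hiso := isConeOpen_cone.1 hZc
  have hN := normSq_ne_zero hiso
  have hv : totalValue f Z ≠ 0 := (mem_compl_iff.mp Z.2).2
  have hZZ : D.pair (Z : V n) (Z : V n) = 0 := hiso.1
  obtain ⟨U, hU, hZU, hc, hr⟩ := f.2.1.coeff_spec ⟨Z, hZc⟩
  set c : V n → ℂ := f.2.1.coeff ⟨Z, hZc⟩ (fun r => r.elim0) with hcdef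
  have hcf : ∀ Y ∈ U, Y ∈ D.cone → c Y = totalValue f Y := by
    intro Y hY hYc
    have h0 : ∀ I : Fin 0 → Fin (n + 2), I = fun r => r.elim0 := fun I => funext fun r => r.elim0
    rw [totalValue, hr.ev_eq hYc hY fun r => r.elim0, form_apply,
      Fintype.sum_eq_single (fun r => r.elim0) fun I hI => absurd (h0 I) hI]
    simp [hcdef]
  have hcd : DifferentiableAt ℂ c Z :=
    ((hc _).contDiffAt (hU.mem_nhds hZU)).differentiableAt (by simp)
  have hcone : ∀ᶠ Y in 𝓝 (Z : V n), D.pair Y Y = 0 → Y ∈ D.cone :=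
    (isConeOpen_cone (D := D)).2 Z hZc
  have hcg : ∀ u, D.pair (Z : V n) u = 0 → fderiv ℂ c Z u = fderiv ℂ g Z u := by
    intro u hu
    have h1 := fderiv_eq_zero_of_vanish hiso (hcd.sub hg) (by
      filter_upwards [hcone, hgf, hU.mem_nhds hZU] with Y h1 h2 h3 h4
      rw [Pi.sub_apply, hcf Y h3 (h1 h4), h2 (h1 h4), sub_self]) hu
    rw [fderiv_sub hcd hg] at h1
    exact sub_eq_zero.mp h1
  -- Euler's relation.
  have hrad : fderiv ℂ c Z Z = -l * totalValue f Z := by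
    have hsm : HasDerivAt (fun a : ℂ => a • (Z : V n)) (Z : V n) 1 := by
      simpa using (hasDerivAt_id (1 : ℂ)).smul_const (Z : V n)
    have hc1 : HasFDerivAt c (fderiv ℂ c Z) ((1 : ℂ) • (Z : V n)) := by
      rw [one_smul]; exact hcd.hasFDerivAt
    have h1 : HasDerivAt (fun a : ℂ => c (a • (Z : V n))) (fderiv ℂ c Z Z) 1 :=
      hc1.comp_hasDerivAt (1 : ℂ) hsm
    have h2 : HasDerivAt (fun a : ℂ => a ^ (-l) * totalValue f Z)
        (((-l : ℤ) : ℂ) * totalValue f Z) 1 := by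
      simpa using (hasDerivAt_zpow (-l) (1 : ℂ) (Or.inl one_ne_zero)).mul_const (totalValue f Z)
    have h3 : (fun a : ℂ => c (a • (Z : V n))) =ᶠ[𝓝 1] fun a => a ^ (-l) * totalValue f Z := by
      have h4 : ∀ᶠ a in 𝓝 (1 : ℂ), a • (Z : V n) ∈ U :=
        hsm.continuousAt.eventually (by simpa using hU.mem_nhds hZU)
      filter_upwards [h4, isOpen_ne.mem_nhds one_ne_zero] with a h5 h6
      rw [hcf _ h5 (smul_mem_cone h6 hZc), totalValue_smul f h6 hZc]
    have := h1.unique (h2.congr_of_eventuallyEq h3)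
    rw [this]
    push_cast
    ring
  set o : V n := D.orthRep Z (D.cls Z w) with ho
  have hoe : o = (w : V n) -
      (D.pair (star (Z : V n)) w / (2 * D.normSq (Z : V n))) • (Z : V n) := by
    rw [ho, orthRep, LinearMap.smul_apply, horiz_cls, smul_sub, smul_smul, smul_smul,
      inv_mul_cancel₀ hN, one_smul]
    congr 2
    field_simp
  have ho1 : D.pair (star (Z : V n)) o = 0 := by
    have h1 : o = (D.normSq (Z : V n))⁻¹ • D.hvec Z w := by
      rw [ho, orthRep, LinearMap.smul_apply, horiz_cls, hvec]
    rw [h1, map_smul, pair_star_hvec, smul_zero]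
  have ho2 : D.pair (Z : V n) (star o) = 0 := by
    have := pair_star (M := D.toEvenLattice) (star (Z : V n)) o
    rwa [star_star, ho1, star_zero] at this
  -- The power of `|Z|²` does not contribute in the directions orthogonal to `Z̄`.
  have hprod : ∀ u, D.pair (star (Z : V n)) u = 0 → D.pair (Z : V n) (star u) = 0 →
      fderiv ℝ (fun Y => D.normSq Y ^ l * c Y) Z u = D.normSq (Z : V n) ^ l * fderiv ℂ c Z u := by
    intro u hu1 hu2
    have h1 : HasFDerivAt (fun Y => D.normSq Y ^ l) _ (Z : V n) :=
      HasFDerivAt.comp (Z : V n) ((hasDerivAt_zpow l (D.normSq (Z : V n))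
        (Or.inl hN)).hasFDerivAt.restrictScalars ℝ)
          (differentiableAt_normSq (M := D.toEvenLattice) (Z : V n)).hasFDerivAt
    have h2 := h1.fun_mul (hcd.hasFDerivAt.restrictScalars ℝ)
    rw [h2.fderiv]
    simp [fderiv_normSq_eq_zero hu2 hu1]
  have hI : D.pair (Z : V n) (star (Complex.I • o)) = 0 := by
    rw [star_smul, map_smul, ho2, smul_zero]
  have hpo : D.pair (Z : V n) o = 0 := by
    rw [hoe, map_sub, map_smul, hZZ, show D.pair (Z : V n) w = 0 from w.2, smul_zero, sub_zero]
  have hraise : raise f ⟨Z, hZc⟩ (D.cls Z w) = fderiv ℂ c Z o := by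
    have h1 : raise f ⟨Z, hZc⟩ (D.cls Z w) = (D.normSq (Z : V n)) ^ (-l) *
        ∑ k, dhol (fun Y => D.normSq Y ^ l * c Y) Z k * o k := by
      simp only [raise, LinearMap.comp_apply, LinearMap.sum_apply, LinearMap.smul_apply,
        LinearMap.proj_apply, smul_eq_mul, Finset.mul_sum, mul_assoc]
      rfl
    have hNl : D.normSq (Z : V n) ^ (-l) * D.normSq (Z : V n) ^ l = 1 := by
      rw [← zpow_add₀ hN, neg_add_cancel, zpow_zero]
    rw [h1, sum_dhol_mul, hprod o ho1 ho2, hprod (Complex.I • o)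
      (by rw [map_smul, ho1, smul_zero]) hI, map_smul, smul_eq_mul]
    linear_combination (fderiv ℂ c Z o) * hNl - (D.normSq (Z : V n) ^ (-l) *
      D.normSq (Z : V n) ^ l * fderiv ℂ c Z o / 2) * Complex.I_sq
  have hl' : (l : ℂ) ≠ 0 := by exact_mod_cast hl
  rw [logDeriv, LinearMap.smul_apply, hraise, ← totalValue_of_mem, hoe, map_sub, map_smul, hrad,
    hcg w w.2, smul_eq_mul, smul_eq_mul]
  field_simp
  ring

variable (D) in
/-- The vector `q(Y) + Ȳ / (2 |Y|²)` with `q(Y)` dual to `dφ / (l φ)`.  If `φ` is a local extension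
of `f` off the cone, it represents `gradVec f`. -/
noncomputable def gradField (l : ℤ) (φ : V n → ℂ) (Y : V n) : V n :=
  ((D.gram.map (Int.cast : ℤ → ℂ))⁻¹).mulVec
    (fun k => (l : ℂ)⁻¹ * (fderiv ℂ φ Y (Pi.single k 1) / φ Y)) +
      (2 * D.normSq Y)⁻¹ • star Y

lemma pair_gradField (l : ℤ) (φ : V n → ℂ) (Y w : V n) :
    D.pair (gradField D l φ Y) w = fderiv ℂ φ Y w / (l * φ Y) +
      D.pair (star Y) w / (2 * D.normSq Y) := by
  have hu : IsUnit (D.gram.map (Int.cast : ℤ → ℂ)).det := isUnit_iff_ne_zero.mpr D.gram_det_ne_zero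
  have hw : fderiv ℂ φ Y w = ∑ k, w k * fderiv ℂ φ Y (Pi.single k 1) := by
    conv_lhs => rw [← Finset.univ_sum_single w]
    rw [map_sum]
    refine Finset.sum_congr rfl fun k _ => ?_
    rw [show (Pi.single k (w k) : V n) = w k • Pi.single k 1 by
      rw [← Pi.single_smul, smul_eq_mul, mul_one], map_smul, smul_eq_mul]
  rw [gradField, map_add, LinearMap.add_apply, map_smul, LinearMap.smul_apply, smul_eq_mul]
  congr 1
  · rw [D.pair_comm, pair, Matrix.toBilin'_apply', Matrix.mulVec_mulVec,
      Matrix.mul_nonsing_inv _ hu,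
      Matrix.one_mulVec, dotProduct, hw, Finset.sum_div]
    refine Finset.sum_congr rfl fun k _ => ?_
    rw [div_eq_mul_inv, div_eq_mul_inv, mul_inv]
    ring
  · rw [div_eq_mul_inv, mul_comm]

lemma gradField_spec (hl : l ≠ 0) (f : Mod Γ l 0) (Z : compl f) {g : V n → ℂ}
    (hg : DifferentiableAt ℂ g Z)
    (hgf : ∀ᶠ Y in 𝓝 (Z : V n), Y ∈ D.cone → g Y = totalValue f Y) :
    ∃ h : gradField D l g Z ∈ D.perp (Z : V n), D.cls Z ⟨gradField D l g Z, h⟩ = gradVec f Z := by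
  have hZc : (Z : V n) ∈ D.cone := Z.2.1
  have hiso := isConeOpen_cone.1 hZc
  have hN := normSq_ne_zero hiso
  have hv : totalValue f Z ≠ 0 := (mem_compl_iff.mp Z.2).2
  have hl' : (l : ℂ) ≠ 0 := by exact_mod_cast hl
  have hgZ : g Z = totalValue f Z := hgf.self_of_nhds hZc
  have hrad : fderiv ℂ g Z Z = -l * totalValue f Z := by
    have h1 := logDeriv_cls hl f Z hg hgf ⟨Z, hiso.1⟩
    have h2 : D.cls (Z : V n) ⟨Z, hiso.1⟩ = 0 :=
      (Submodule.Quotient.mk_eq_zero _).mpr (Submodule.mem_span_singleton_self (Z : V n))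
    have h3 : D.pair (star (Z : V n)) Z = 2 * D.normSq (Z : V n) := by rw [normSq_eq]; ring
    rw [h2, map_zero] at h1
    simp only [h3] at h1
    rw [div_self (mul_ne_zero two_ne_zero hN)] at h1
    field_simp at h1
    linear_combination -h1
  have h : gradField D l g Z ∈ D.perp (Z : V n) := by
    rw [mem_perp, D.pair_comm, pair_gradField, hrad, hgZ,
      show D.pair (star (Z : V n)) Z = 2 * D.normSq (Z : V n) by rw [normSq_eq]; ring]
    field_simp
    ring
  refine ⟨h, ?_⟩
  rw [gradVec, LinearEquiv.eq_symm_apply]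
  refine LinearMap.ext fun x => ?_
  obtain ⟨w, rfl⟩ := Submodule.mkQ_surjective _ x
  rw [LinearMap.BilinForm.toDual_def, tr_cls, pair_gradField, hgZ]
  exact (logDeriv_cls hl f Z hg hgf w).symm

end PeriodDomain

namespace EvenLattice

open Filter

variable {n : ℕ} {M : EvenLattice n} {Ω : Set (V n)} {s : ℕ}

lemma ev_smul (F : M.Sec Ω s) {Y : V n} (hY : Y ∈ Ω) {x : Fin s → V n}
    (hx : ∀ r, M.pair Y (x r) = 0) (b : Fin s → ℂ) :
    ev F Y (fun r => b r • x r) = (∏ r, b r) * ev F Y x := by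
  rw [ev_of F hY hx, ev_of F hY fun r => by rw [map_smul, hx r, smul_zero]]
  exact (F ⟨Y, hY⟩).map_smul_univ b fun r => M.cls Y ⟨x r, hx r⟩

lemma prod_append_cast {m s t : ℕ} (h : m = s + t) (a : ℂ) :
    ∏ i : Fin m, Fin.append (fun _ : Fin s => (1 : ℂ)) (fun _ : Fin t => a) (Fin.cast h i) =
      a ^ t := by
  subst h
  simp [Fin.prod_univ_add]

/-- Rescaling of the last `t` arguments. -/
lemma ev_append_smul {m t : ℕ} (F : M.Sec Ω m) (h : m = s + t) {Y : V n} (hY : Y ∈ Ω)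
    {x : Fin s → V n} (hx : ∀ r, M.pair Y (x r) = 0) {v : V n} (hv : M.pair Y v = 0) (a : ℂ) :
    ev F Y (fun i => Fin.append x (fun _ : Fin t => a • v) (Fin.cast h i)) =
      a ^ t * ev F Y (fun i => Fin.append x (fun _ : Fin t => v) (Fin.cast h i)) := by
  rw [← prod_append_cast h a, ← ev_smul F hY]
  · congr 1
    funext i
    generalize Fin.cast h i = j
    refine Fin.addCases (fun j => ?_) (fun j => ?_) j <;> simp
  · intro i
    generalize Fin.cast h i = j
    refine Fin.addCases (fun j => ?_) (fun j => ?_) j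
    · simpa using hx j
    · simpa using hv

end EvenLattice

namespace PeriodDomain

open EvenLattice Filter

variable {n : ℕ} {D : PeriodDomain n} {Γ : Subgroup D.orthogonalGroup} {l : ℤ}

/-! ### Contraction with the gradient field -/

lemma perp_append {m s t : ℕ} (h : m = s + t) {Y v : V n} {x : Fin s → V n}
    (hx : ∀ r, D.pair Y (x r) = 0) (hv : D.pair Y v = 0) (i : Fin m) :
    D.pair Y (Fin.append x (fun _ : Fin t => v) (Fin.cast h i)) = 0 := by
  generalize Fin.cast h i = j
  refine Fin.addCases (fun j => ?_) (fun j => ?_) j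
  · simpa using hx j
  · simpa using hv

/-- The section `⟨F, G^{⊗ t}⟩` of rank `s`, for `F` of rank `m = s + t`. -/
noncomputable def contr {f : Mod Γ l 0} {m s t : ℕ} (F : D.Sec (compl f) m) (h : m = s + t) :
    D.Sec (compl f) s :=
  fun Z => insertLast ((F Z).domDomCongr (finCongr h)) fun _ => gradVec f Z

lemma pairLogDeriv_eq_contr (f : Mod Γ l 0) {s d : ℕ} (F : D.Sec (compl f) (s + d)) :
    pairLogDeriv f F = contr F rfl := by
  funext Z
  have hs : (D.tr (Z : V n)).IsSymm := ⟨fun x y => by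
    obtain ⟨v, rfl⟩ := Submodule.mkQ_surjective _ x
    obtain ⟨w, rfl⟩ := Submodule.mkQ_surjective _ y
    exact D.pair_comm _ _⟩
  rw [pairLogDeriv, pairing_tensorPow _ _ hs]
  rfl

lemma ev_contr {f : Mod Γ l 0} {m s t : ℕ} (F : D.Sec (compl f) m) (h : m = s + t) {Y : V n}
    (hY : Y ∈ compl f) {v : V n} (hv : ∃ h : v ∈ D.perp Y, D.cls Y ⟨v, h⟩ = gradVec f ⟨Y, hY⟩)
    {x : Fin s → V n} (hx : ∀ r, D.pair Y (x r) = 0) :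
    ev (contr F h) Y x = ev F Y fun i => Fin.append x (fun _ : Fin t => v) (Fin.cast h i) := by
  obtain ⟨hv, hvc⟩ := hv
  rw [ev_of _ hY hx, ev_of _ hY (perp_append h hx hv)]
  change F ⟨Y, hY⟩ (fun i => Fin.append _ _ (Fin.cast h i)) = _
  congr 1
  funext i
  rw [← hvc]
  have key : ∀ (j : Fin (s + t)) (hj : D.pair Y (Fin.append x (fun _ => v) j) = 0),
      Fin.append (fun r => D.cls Y ⟨x r, hx r⟩) (fun _ => D.cls Y ⟨v, hv⟩) j =
        D.cls Y ⟨Fin.append x (fun _ => v) j, hj⟩ := by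
    intro j
    refine Fin.addCases (fun j => ?_) (fun j => ?_) j <;> intro hj <;> simp
  exact key _ _

/-- After multiplication with a local equation, the gradient field extends over the divisor. -/
lemma exists_smooth_mul_gradField {φ h : V n → ℂ} {W : Set (V n)} (hW : IsOpen W)
    (hφ : DifferentiableOn ℂ φ W) (hh : DifferentiableOn ℂ h W)
    (hz : ∀ Y ∈ W, φ Y = 0 → h Y = 0) {Z₀ : V n} (hZ₀ : Z₀ ∈ W)
    (hne : ¬∀ᶠ Y in 𝓝 Z₀, φ Y = 0) (hN : ∀ Y ∈ W, D.normSq Y ≠ 0) (l : ℤ) :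
    ∃ (B : Set (V n)) (κ : V n → V n), IsOpen B ∧ Z₀ ∈ B ∧ B ⊆ W ∧
      (∀ k, ContDiffOn ℝ ∞ (fun Y => κ Y k) B) ∧
        ∀ Y ∈ B, φ Y ≠ 0 → κ Y = h Y • gradField D l φ Y := by
  choose B κ hB hZB hBW hκ he using fun k : Fin (n + 2) =>
    exists_differentiableOn_mul_logDeriv hW hφ hh hz hZ₀ hne (Pi.single k 1 : V n)
  have hBo : IsOpen (⋂ k, B k) := isOpen_iInter_of_finite hB
  have hsub : ∀ k, (⋂ k, B k) ⊆ B k := fun k => Set.iInter_subset _ k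
  have hsW : (⋂ k, B k) ⊆ W := (hsub 0).trans (hBW 0)
  have hsm : ∀ {g : V n → ℂ}, DifferentiableOn ℂ g (⋂ k, B k) →
      ContDiffOn ℝ ∞ g (⋂ k, B k) := fun hg =>
    (contDiffOn_of_differentiableOn hBo hg).restrict_scalars ℝ
  refine ⟨⋂ k, B k, fun Y => ((D.gram.map (Int.cast : ℤ → ℂ))⁻¹).mulVec
      (fun k => (l : ℂ)⁻¹ * κ k Y) + (h Y * (2 * D.normSq Y)⁻¹) • star Y, hBo,
    Set.mem_iInter.mpr hZB, hsW, fun k => ?_, fun Y hY hφY => ?_⟩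
  · have hcoord : ∀ k, ContDiff ℝ ∞ (fun Y : V n => star Y k) := fun k =>
      Complex.conjCLE.contDiff.comp (contDiff_apply ℝ ℂ k)
    have hNs : ContDiffOn ℝ ∞ (fun Y => D.normSq Y) (⋂ k, B k) := by
      simp only [normSq]
      exact (contDiffOn_pair (contDiffOn_coord _) fun k => (hcoord k).contDiffOn).div_const 2
    simp only [Pi.add_apply, Pi.smul_apply, smul_eq_mul, Matrix.mulVec, dotProduct]
    have h1 : ∀ j, ContDiffOn ℝ ∞ (fun Y => ((D.gram.map (Int.cast : ℤ → ℂ))⁻¹) k j *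
        ((l : ℂ)⁻¹ * κ j Y)) (⋂ k, B k) := fun j =>
      contDiffOn_const.mul (contDiffOn_const.mul (hsm ((hκ j).mono (hsub j))))
    have h2 : ContDiffOn ℝ ∞ (fun Y => (2 * D.normSq Y)⁻¹) (⋂ k, B k) :=
      (contDiffOn_const.mul hNs).inv fun Y hY => mul_ne_zero two_ne_zero (hN Y (hsW hY))
    have h3 : ContDiffOn ℝ ∞ (fun Y => h Y * (2 * D.normSq Y)⁻¹ * star Y k) (⋂ k, B k) :=
      ((hsm (hh.mono hsW)).mul h2).mul (hcoord k).contDiffOn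
    exact (ContDiffOn.sum fun j _ => h1 j).add h3
  · rw [gradField, smul_add, smul_smul, ← Matrix.mulVec_smul]
    refine congrArg (fun u : V n => u + _) (congrArg _ (funext fun k => ?_))
    rw [he k Y (hsub k hY) hφY, Pi.smul_apply, smul_eq_mul]
    ring

/-- A chart at a point of the cone in which the gradient field is defined. -/
lemma exists_chart_gradField (hl : l ≠ 0) (f : Mod Γ l 0) {Z₀ : V n} (hZ₀ : Z₀ ∈ D.cone)
    {U : Set (V n)} (hU : U ∈ 𝓝 Z₀) : ∃ W : Set (V n), IsOpen W ∧ Z₀ ∈ W ∧ W ⊆ U ∧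
      (∀ Y ∈ W, D.pair Y (star Z₀) ≠ 0 ∧ D.retr Z₀ Y ∈ U ∧ D.retr Z₀ Y ∈ D.cone) ∧
      (∀ Y ∈ W, D.normSq Y ≠ 0) ∧
      DifferentiableOn ℂ (fun Y => totalValue f (D.retr Z₀ Y)) W ∧
      ∀ Y ∈ W, ∀ hY : Y ∈ compl f, ∃ h : gradField D l (fun Y => totalValue f (D.retr Z₀ Y)) Y ∈
        D.perp Y, D.cls Y ⟨_, h⟩ = gradVec f ⟨Y, hY⟩ := by
  obtain ⟨W, hW, hZW, hWU, hφ⟩ := exists_chart_totalValue f hZ₀ hU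
  have hN : ∀ᶠ Y in 𝓝 Z₀, D.normSq Y ≠ 0 :=
    (differentiableAt_normSq (M := D.toEvenLattice) Z₀).continuousAt.eventually_ne
      (normSq_ne_zero (isConeOpen_cone.1 hZ₀))
  obtain ⟨W', hW', hWo', hZW'⟩ := _root_.eventually_nhds_iff.mp (hN.and hU)
  refine ⟨W ∩ W', hW.inter hWo', ⟨hZW, hZW'⟩, fun Y hY => (hW' Y hY.2).2, fun Y hY => hWU Y hY.1,
    fun Y hY => (hW' Y hY.2).1, hφ.mono Set.inter_subset_left, fun Y hY hYc => ?_⟩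
  refine gradField_spec hl f ⟨Y, hYc⟩ (hφ.differentiableAt (hW.mem_nhds hY.1)) ?_
  exact Eventually.of_forall fun Y' hY' => by rw [retr_of_isotropic (isConeOpen_cone.1 hY').1]

lemma isRegular_contr (hl : l ≠ 0) {f : Mod Γ l 0} (hf : f ≠ 0) {m s t : ℕ}
    {F : D.Sec (compl f) m} (hF : IsRegular ℝ F) (h : m = s + t) : IsRegular ℝ (contr F h) := by
  intro Z
  obtain ⟨U, hU, hZU, c, hc, hr⟩ := hF Z
  obtain ⟨W, hW, hZW, hWU, -, hN, hφ, hgrad⟩ :=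
    exists_chart_gradField hl f Z.2.1 (hU.mem_nhds hZU)
  set φ : V n → ℂ := fun Y => totalValue f (D.retr Z Y) with hφdef
  have hφZ : φ Z ≠ 0 := by
    simp only [hφdef, retr_of_isotropic (isConeOpen_cone.1 Z.2.1).1]
    exact (mem_compl_iff.mp Z.2).2
  have hWo : IsOpen (W ∩ {Y | φ Y ≠ 0}) := hφ.continuousOn.isOpen_inter_preimage hW isOpen_ne
  obtain ⟨B, κ, hB, hZB, hBW, hκ, he⟩ := exists_smooth_mul_gradField (D := D) (h := fun _ => 1) hWo
    (hφ.mono Set.inter_subset_left) (differentiableOn_const _) (fun Y hY h0 => absurd h0 hY.2)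
    ⟨hZW, hφZ⟩ (not_eventually_totalValue_retr hf Z.2.1) (fun Y hY => hN Y hY.1) l
  have hBU : B ⊆ U := fun Y hY => hWU (hBW hY).1
  obtain ⟨c', hc', hr'⟩ := exists_form_insert h (fun I => (hc I).mono hBU) hκ
  refine ⟨B, hB, hZB, c', hc', represents_iff.mpr fun Y hY hYB x hx => ?_⟩
  obtain ⟨hp, hcls⟩ := hgrad Y (hBW hYB).1 hY
  rw [ev_contr F h hY ⟨hp, hcls⟩ hx, hr', hr.ev_eq hY (hBU hYB) (perp_append h hx hp),
    he Y hYB (hBW hYB).2, one_smul]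

/-- Each contraction with the gradient field increases the pole order by at most one. -/
lemma hasPoleOrderLE_contr (hl : l ≠ 0) {f : Mod Γ l 0} (hf : f ≠ 0) {m s t : ℕ}
    {F : D.Sec (compl f) m} {e : ℤ} (hF : HasPoleOrderLE ℝ f e F) (h : m = s + t) :
    HasPoleOrderLE ℝ f (e + t) (contr F h) := by
  intro U h₀ hU hh₀
  obtain ⟨F', hF', hFF⟩ := hF U h₀ hU hh₀
  obtain ⟨hhol, hzero, -⟩ := id hh₀
  let G' : D.Sec (compl f ∩ U) s := fun Z => (h₀ Z) ^ (e + t) • contr F h ⟨Z, Z.2.1⟩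
  have hsub : compl f ∩ U ⊆ D.cone ∩ U := fun Z hZ => ⟨hZ.1.1, hZ.2⟩
  suffices hloc : ∀ Z₀ ∈ D.cone ∩ U, ∃ U' : Set (V n), IsOpen U' ∧ Z₀ ∈ U' ∧
      ∃ c : (Fin s → Fin (n + 2)) → V n → ℂ, (∀ I, ContDiffOn ℝ ∞ (c I) U') ∧
        Represents G' U' c by
    obtain ⟨G, hG, hGG⟩ := exists_extension_of_local (M := D.toEvenLattice) (𝕜 := ℝ)
      (fun Z hZ => isConeOpen_cone.1 hZ.1) hsub (cone_inter_subset_closure hf hU) G' hloc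
    exact ⟨G, hG, fun Z h1 h2 => hGG ⟨Z, h2, h1.2⟩⟩
  intro Z₀ hZ₀
  obtain ⟨U₁, hU₁, hZU₁, c, hc, hr⟩ := hF' ⟨Z₀, hZ₀⟩
  obtain ⟨W, hW, hZW, hWU, hWr, hN, hφ, hgrad⟩ :=
    exists_chart_gradField hl f hZ₀.1 (inter_mem (hU.mem_nhds hZ₀.2) (hU₁.mem_nhds hZU₁))
  have hh : DifferentiableOn ℂ (fun Y => h₀ (D.retr Z₀ Y)) W := fun Y hY =>
    (DifferentiableAt.comp Y (hhol.differentiableAt (hU.mem_nhds (hWr Y hY).2.1.1))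
      (differentiableAt_retr (hWr Y hY).1)).differentiableWithinAt
  obtain ⟨B, κ, hB, hZB, hBW, hκ, he⟩ := exists_smooth_mul_gradField (D := D) hW hφ hh
    (fun Y hY h0 => (hzero _ ⟨(hWr Y hY).2.2, (hWr Y hY).2.1.1⟩).mpr
      (mem_zeroLocus_iff.mpr ⟨(hWr Y hY).2.2, h0⟩))
    hZW (not_eventually_totalValue_retr hf hZ₀.1) hN l
  obtain ⟨c', hc', hr'⟩ := exists_form_insert h (fun I => (hc I).mono fun Y hY =>
    (hWU (hBW hY)).2) hκ
  refine ⟨B, hB, hZB, c', hc', represents_iff.mpr fun Y hY hYB x hx => ?_⟩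
  obtain ⟨hp, hcls⟩ := hgrad Y (hBW hYB) hY.1
  have hret : D.retr Z₀ Y = Y := retr_of_isotropic (isConeOpen_cone.1 hY.1.1).1
  have hne : totalValue f (D.retr Z₀ Y) ≠ 0 := by
    rw [hret]; exact (mem_compl_iff.mp hY.1).2
  have hh0 : h₀ Y ≠ 0 := fun h0 => hY.1.2 ((hzero Y ⟨hY.1.1, hY.2⟩).mp h0)
  have hκp : D.pair Y (h₀ Y • gradField D l (fun Y => totalValue f (D.retr Z₀ Y)) Y) = 0 := by
    rw [map_smul, show D.pair Y _ = 0 from hp, smul_zero]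
  rw [hr', he Y hYB hne, hret, ← hr.ev_eq (hsub hY) (hWU (hBW hYB)).2 (perp_append h hx hκp),
    ev_append_smul F' h (hsub hY) hx hp]
  have e1 : ev G' Y x = h₀ Y ^ (e + t) * ev (contr F h) Y x := by
    rw [ev_of G' hY hx, ev_of _ hY.1 hx]
    rfl
  have e2 : ∀ y : Fin m → V n, (∀ r, D.pair Y (y r) = 0) → ev F' Y y = h₀ Y ^ e * ev F Y y := by
    intro y hy
    rw [ev_of F' (hsub hY) hy, ev_of F hY.1 hy, hFF Y (hsub hY) hY.1]
    rfl
  rw [e1, e2 _ (perp_append h hx hp), ev_contr F h hY.1 ⟨hp, hcls⟩ hx, zpow_add₀ hh0, zpow_natCast]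
  ring

lemma exists_gradVec_rep (f : Mod Γ l 0) {Z : V n} (hZ : Z ∈ compl f) :
    ∃ (v : V n) (h : v ∈ D.perp Z), D.cls Z ⟨v, h⟩ = gradVec f ⟨Z, hZ⟩ := by
  obtain ⟨v, hv⟩ := Submodule.mkQ_surjective _ (gradVec f ⟨Z, hZ⟩)
  exact ⟨v, v.2, hv⟩

/-- Equivariance of the gradient field. -/
lemma gradVec_map (hl : l ≠ 0) {f : Mod Γ l 0} {A : D.Similitude} {c : ℂ} (hc : c ≠ 0)
    (hA : ∀ Y ∈ D.cone, A.toEquiv Y ∈ D.cone → totalValue f (A.toEquiv Y) = c * totalValue f Y)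
    {Z : V n} (hZ : Z ∈ compl f) (hAZ : A.toEquiv Z ∈ compl f) {v : V n}
    (hv : ∃ h : v ∈ D.perp Z, D.cls Z ⟨v, h⟩ = gradVec f ⟨Z, hZ⟩) :
    ∃ h : A.μ⁻¹ • A.toEquiv v ∈ D.perp (A.toEquiv Z),
      D.cls (A.toEquiv Z) ⟨_, h⟩ = gradVec f ⟨A.toEquiv Z, hAZ⟩ := by
  obtain ⟨hvp, hvc⟩ := hv
  have hperp : ∀ {x : V n}, D.pair Z x = 0 → D.pair (A.toEquiv Z) (A.toEquiv x) = 0 := fun hx => by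
    rw [A.pair_map, hx, mul_zero]
  have h : A.μ⁻¹ • A.toEquiv v ∈ D.perp (A.toEquiv Z) := by
    rw [mem_perp, map_smul, hperp hvp, smul_zero]
  refine ⟨h, ?_⟩
  rw [gradVec, LinearEquiv.eq_symm_apply]
  rw [gradVec, LinearEquiv.eq_symm_apply] at hvc
  refine LinearMap.ext fun x => ?_
  obtain ⟨w', rfl⟩ := Submodule.mkQ_surjective _ x
  set w : V n := A.toEquiv.symm w' with hw
  have hw' : A.toEquiv w = w' := A.toEquiv.apply_symm_apply _
  have hwp : D.pair Z w = 0 := by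
    have h1 : D.pair (A.toEquiv Z) w' = 0 := w'.2
    rw [← hw', A.pair_map] at h1
    exact (mul_eq_zero.mp h1).resolve_left A.μ_ne
  have h1 := congrArg (fun L => L (D.cls Z ⟨w, hwp⟩)) hvc
  simp only [LinearMap.BilinForm.toDual_def] at h1 ⊢
  rw [tr_cls] at h1 ⊢
  change D.pair (A.μ⁻¹ • A.toEquiv v) w' = _
  rw [← hw', map_smul, LinearMap.smul_apply, A.pair_map, smul_eq_mul, inv_mul_cancel_left₀ A.μ_ne]
  obtain ⟨W, hW, hZW, -, hφ⟩ := exists_chart_totalValue f hZ.1 univ_mem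
  set φ : V n → ℂ := fun Y => totalValue f (D.retr Z Y) with hφdef
  have hφd : DifferentiableAt ℂ φ Z := hφ.differentiableAt (hW.mem_nhds hZW)
  have hφf : ∀ Y ∈ D.cone, φ Y = totalValue f Y := fun Y hY => by
    simp only [hφdef, retr_of_isotropic (isConeOpen_cone.1 hY).1]
  have hinv : A.toEquiv.symm (A.toEquiv Z) = Z := A.toEquiv.symm_apply_apply Z
  have hg : HasFDerivAt (fun Y => c * φ (A.toEquiv.symm Y))
      (c • (fderiv ℂ φ Z).comp (A.toEquiv.symm : V n →L[ℂ] V n)) (A.toEquiv Z) := by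
    have h2 : HasFDerivAt φ (fderiv ℂ φ Z) (A.toEquiv.symm (A.toEquiv Z)) := by
      rw [hinv]; exact hφd.hasFDerivAt
    exact (h2.comp (A.toEquiv Z) A.toEquiv.symm.hasFDerivAt).const_mul c
  have hgf : ∀ᶠ Y in 𝓝 (A.toEquiv Z), Y ∈ D.cone →
      c * φ (A.toEquiv.symm Y) = totalValue f Y := by
    have h2 : ∀ᶠ Y in 𝓝 (A.toEquiv Z), D.pair (A.toEquiv.symm Y) (A.toEquiv.symm Y) = 0 →
        A.toEquiv.symm Y ∈ D.cone :=
      A.toEquiv.symm.continuous.continuousAt.eventually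
        (p := fun Y => D.pair Y Y = 0 → Y ∈ D.cone)
        (by rw [hinv]; exact (isConeOpen_cone (D := D)).2 Z hZ.1)
    filter_upwards [h2] with Y h3 hY
    have h4 : A.toEquiv.symm Y ∈ D.cone := h3 (by
      have h5 := (isConeOpen_cone.1 hY).1
      rw [← A.toEquiv.apply_symm_apply Y, A.pair_map] at h5
      exact (mul_eq_zero.mp h5).resolve_left A.μ_ne)
    rw [hφf _ h4, ← hA _ h4 (by rwa [A.toEquiv.apply_symm_apply]), A.toEquiv.apply_symm_apply]
  have e1 := logDeriv_cls hl f ⟨A.toEquiv Z, hAZ⟩ hg.differentiableAt hgf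
    ⟨A.toEquiv w, hperp hwp⟩
  have e2 := logDeriv_cls hl f ⟨Z, hZ⟩ hφd (Eventually.of_forall hφf) ⟨w, hwp⟩
  have e3 : D.cls (A.toEquiv Z) w' = D.cls (A.toEquiv Z) ⟨A.toEquiv w, hperp hwp⟩ := by
    congr 1
    exact Subtype.ext hw'.symm
  refine h1.trans ((e2.trans ?_).trans ((congrArg _ e3).trans e1).symm)
  have hν : A.ν ≠ 0 := fun h0 => by
    have := A.ν_unit
    rw [h0, zero_mul] at this
    exact zero_ne_one this
  rw [hg.fderiv, hA Z hZ.1 hAZ.1, A.normSq_map, A.star_map]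
  simp only [smul_apply, ContinuousLinearMap.comp_apply, ContinuousLinearEquiv.coe_coe,
    A.toEquiv.symm_apply_apply, map_smul, LinearMap.smul_apply, A.pair_map, smul_eq_mul]
  congr 1
  · rw [mul_left_comm (l : ℂ), mul_div_mul_left _ _ hc]
  · rw [show A.ν * (A.μ * D.pair (star Z) w) = (A.ν * A.μ) * D.pair (star Z) w by ring,
      show 2 * (A.ν * A.μ * D.normSq Z) = (A.ν * A.μ) * (2 * D.normSq Z) by ring,
      mul_div_mul_left _ _ (mul_ne_zero hν A.μ_ne)]

lemma equivariant_contr (hl : l ≠ 0) {f : Mod Γ l 0} {A : D.Similitude} {c c₀ t₀ : ℂ} (hc : c₀ ≠ 0)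
    (ht : t₀ ≠ 0)
    (hA : ∀ Y ∈ D.cone, A.toEquiv Y ∈ D.cone → totalValue f (A.toEquiv Y) = c₀ * totalValue f Y)
    {m s t : ℕ} {F : D.Sec (compl f) m} (hF : Equivariant A t₀ c F) (h : m = s + t) :
    Equivariant A t₀ ((A.μ * t₀)⁻¹ ^ t * c) (contr F h) := by
  intro Z hZ hAZ x hx
  obtain ⟨v, hv, hvc⟩ := exists_gradVec_rep f hZ
  have hv' := gradVec_map hl hc hA hZ hAZ ⟨hv, hvc⟩
  have hperp : ∀ {x : V n}, D.pair Z x = 0 →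
      D.pair (A.toEquiv Z) (t₀ • A.toEquiv x) = 0 := fun hx => by
    rw [map_smul, A.pair_map, hx, mul_zero, smul_zero]
  rw [ev_contr F h hAZ hv' fun r => hperp (hx r), ev_contr F h hZ ⟨hv, hvc⟩ hx]
  have e : A.μ⁻¹ • A.toEquiv v = (A.μ * t₀)⁻¹ • t₀ • A.toEquiv v := by
    rw [smul_smul]
    congr 1
    field_simp
  rw [e, ev_append_smul F h hAZ (fun r => hperp (hx r)) (hperp hv), mul_assoc]
  congr 1
  rw [← hF Z hZ hAZ _ (perp_append h hx hv)]
  congr 1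
  funext i
  generalize Fin.cast h i = j
  refine Fin.addCases (fun j => ?_) (fun j => ?_) j <;> simp

lemma hasWeight_contr (hl : l ≠ 0) {f : Mod Γ l 0} {m s t : ℕ} {F : D.Sec (compl f) m} {k : ℤ}
    (hF : HasWeight k F) (h : m = s + t) : HasWeight (k + t) (contr F h) := by
  refine hasWeight_iff.mpr fun a ha => ?_
  have h1 := equivariant_contr hl (A := D.homothety a ha) (zpow_ne_zero (-l) ha) (inv_ne_zero ha)
    (fun Y hY _ => totalValue_smul f ha hY) (hasWeight_iff.mp hF a ha) h
  convert h1 using 1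
  change _ = (a ^ 2 * a⁻¹)⁻¹ ^ t * _
  rw [show a ^ 2 * a⁻¹ = a by field_simp, neg_add, zpow_add₀ ha, zpow_neg, zpow_neg, zpow_natCast,
    inv_pow]
  ring

lemma isInvariant_contr (hl : l ≠ 0) {f : Mod Γ l 0} {m s t : ℕ} {F : D.Sec (compl f) m}
    (hF : IsInvariant Γ F) (h : m = s + t) : IsInvariant Γ (contr F h) := by
  refine isInvariant_iff.mpr fun γ hγ => ?_
  have h1 := equivariant_contr hl (A := isometry γ) one_ne_zero one_ne_zero
    (fun Y hY _ => by rw [one_mul]; exact totalValue_act f hγ hY) (isInvariant_iff.mp hF γ hγ) h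
  convert h1 using 1
  change _ = ((1 : ℂ) * 1)⁻¹ ^ t * 1
  simp

/-- The antiholomorphic derivative of the gradient field. -/
lemma dbarDir_gradField {φ : V n → ℂ} {Z w : V n} (hφ : ∀ᶠ Y in 𝓝 Z, DifferentiableAt ℂ φ Y)
    (h0 : φ Z ≠ 0) (hZ : Z ∈ D.isotropicPositive) (hw : D.pair Z w = 0) (l : ℤ)
    (k : Fin (n + 2)) :
    DifferentiableAt ℝ (fun Y => gradField D l φ Y k) Z ∧
      dbarDir (fun Y => gradField D l φ Y k) Z (star (D.hvec Z w)) =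
        D.hvec Z w k / (2 * D.normSq Z) := by
  have hN := normSq_ne_zero hZ
  obtain ⟨W, hW, hWo, hZW⟩ := _root_.eventually_nhds_iff.mp hφ
  have hd : DifferentiableOn ℂ φ W := fun Y hY => (hW Y hY).differentiableWithinAt
  have hq : DifferentiableAt ℂ (fun Y => ((D.gram.map (Int.cast : ℤ → ℂ))⁻¹).mulVec
      (fun k => (l : ℂ)⁻¹ * (fderiv ℂ φ Y (Pi.single k 1) / φ Y)) k) Z := by
    simp only [Matrix.mulVec, dotProduct]
    have h1 : ∀ j : Fin (n + 2),
        DifferentiableAt ℂ (fun Y => fderiv ℂ φ Y (Pi.single j 1) / φ Y) Z :=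
      fun j => by
        simp only [div_eq_mul_inv]
        exact ((differentiableOn_fderiv_apply hWo hd _).differentiableAt (hWo.mem_nhds hZW)).mul
          ((hW Z hZW).inv h0)
    exact DifferentiableAt.fun_sum fun j _ => ((h1 j).const_mul _).const_mul _
  have hNd := differentiableAt_normSq (M := D.toEvenLattice) Z
  have hNi : DifferentiableAt ℝ (fun Y => (2 * D.normSq Y)⁻¹) Z :=
    (hNd.const_mul 2).inv (mul_ne_zero two_ne_zero hN)
  have hβ : DifferentiableAt ℝ (fun Y : V n => (2 * D.normSq Y)⁻¹ * star (Y k)) Z :=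
    hNi.mul (differentiableAt_star_coord Z k)
  have e : (fun Y => gradField D l φ Y k) = fun Y => ((D.gram.map (Int.cast : ℤ → ℂ))⁻¹).mulVec
      (fun k => (l : ℂ)⁻¹ * (fderiv ℂ φ Y (Pi.single k 1) / φ Y)) k +
        (2 * D.normSq Y)⁻¹ * star (Y k) := rfl
  rw [e]
  refine ⟨(hq.restrictScalars ℝ).add hβ, ?_⟩
  rw [dbarDir_add (hq.restrictScalars ℝ) hβ, dbarDir_of_holo hq, zero_add]
  have hNu : dbarDir D.normSq Z (star (D.hvec Z w)) = 0 := by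
    rw [dbarDir_normSq, star_star, D.pair_comm, pair_hvec hZ.1 hw, zero_div]
  have h1 := dbarDir_mul (hNd.const_mul 2) hβ (star (D.hvec Z w))
  have h2 : (fun Y : V n => 2 * D.normSq Y * ((2 * D.normSq Y)⁻¹ * star (Y k))) =ᶠ[𝓝 Z]
      fun Y => star (Y k) := by
    filter_upwards [hNd.continuousAt.eventually_ne hN] with Y hY
    rw [mul_inv_cancel_left₀ (mul_ne_zero two_ne_zero hY)]
  rw [dbarDir_congr h2, dbarDir_star_coord, dbarDir_mul (differentiableAt_const _) hNd,
    dbarDir_const, hNu, Pi.star_apply, star_star] at h1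
  rw [h1]
  field_simp
  ring

/-- Lowering a contraction of a holomorphic symmetric form removes one of the factors `G`. -/
lemma lowerFun_contr (hl : l ≠ 0) {f : Mod Γ l 0} {m s t : ℕ} {F : D.Sec (compl f) m}
    (hF : IsRegular ℂ F) (hsym : IsSymmFrom s F) (h : m = s + (t + 1)) (h' : m = s + 1 + t)
    (hreg : IsRegular ℝ (contr F h)) :
    lowerFun (contr F h) hreg = (((t + 1 : ℕ) : ℂ) / 2) • contr F h' := by
  classical
  funext Z
  refine sec_ext_at Z fun w hw => ?_
  have hiso := isConeOpen_cone.1 Z.2.1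
  have hZs := pair_star_self_ne_zero hiso
  have hN := normSq_ne_zero hiso
  obtain ⟨U, hU, hZU, c, hc, hr⟩ := hF Z
  obtain ⟨W, hW, hZW, hWU, hWr, -, hφ, hgrad⟩ :=
    exists_chart_gradField hl f Z.2.1 (hU.mem_nhds hZU)
  set φ : V n → ℂ := fun Y => totalValue f (D.retr Z Y) with hφdef
  set γ : V n → V n := gradField D l φ with hγ
  have hφZ : φ Z ≠ 0 := by
    simp only [hφdef, retr_of_isotropic hiso.1]
    exact (mem_compl_iff.mp Z.2).2
  obtain ⟨hγp, hγc⟩ := hgrad Z hZW Z.2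
  have hγd := fun k => dbarDir_gradField (D := D) (φ := φ) (Z := Z) (w := w (Fin.last s))
    (by filter_upwards [hW.mem_nhds hZW] with Y hY using hφ.differentiableAt (hW.mem_nhds hY))
    hφZ hiso (hw _) l k
  set y : Fin s → V n → V n := fun r Y => D.projPerp Z Y (w r.castSucc) with hy
  set X : Fin m → V n → V n := fun i Y =>
    Fin.append (fun r => y r Y) (fun _ : Fin (t + 1) => γ Y) (Fin.cast h i) with hX
  have hyd : ∀ r, DifferentiableAt ℂ (y r) Z := fun r => differentiableAt_projPerp hZs _
  have hyZ : ∀ r, y r Z = w r.castSucc := fun r => projPerp_of_perp (hw _)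
  have hyp : ∀ᶠ Y in 𝓝 (Z : V n), Y ∈ compl f → ∀ r, D.pair Y (y r Y) = 0 := by
    filter_upwards [hW.mem_nhds hZW] with Y hY _ r
    exact pair_projPerp (hWr Y hY).1 _
  have hcd : ∀ I, DifferentiableAt ℂ (c I) Z := fun I =>
    ((hc I).contDiffAt (hU.mem_nhds hZU)).differentiableAt (by simp)
  have hXd : ∀ i k, DifferentiableAt ℝ (fun Y => X i Y k) Z := by
    intro i k
    simp only [hX]
    generalize Fin.cast h i = j
    refine Fin.addCases (fun j => ?_) (fun j => ?_) j
    · simp only [Fin.append_left]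
      exact (differentiableAt_pi.mp (hyd j) k).restrictScalars ℝ
    · simp only [Fin.append_right]
      exact (hγd k).1
  have hg : DifferentiableAt ℝ (fun Y => form (fun I => c I Y) fun i => X i Y) Z := by
    simp only [form_apply]
    exact DifferentiableAt.fun_sum fun I _ => ((hcd I).restrictScalars ℝ).mul
      (HasFDerivAt.finsetProd fun i _ => (hXd i (I i)).hasFDerivAt).differentiableAt
  have hgF : ∀ᶠ Y in 𝓝 (Z : V n), Y ∈ compl f →
      form (fun I => c I Y) (fun i => X i Y) = ev (contr F h) Y fun r => y r Y := by
    filter_upwards [hyp, hW.mem_nhds hZW] with Y h1 h2 hY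
    obtain ⟨hp, hcl⟩ := hgrad Y h2 hY
    rw [ev_contr F h hY ⟨hp, hcl⟩ (h1 hY), hr.ev_eq hY (hWU h2) (perp_append h (h1 hY) hp)]
  rw [ev_lowerFun (isConeOpen_compl f) hreg Z.2 hyd hyp hg hgF (hw _) fun r => (hyZ r).symm,
    dbarDir_form hcd hXd]
  -- The vector field differentiates to half of the new argument, up to a multiple of `Z`.
  set w₁ := w (Fin.last s) with hw₁
  have hXZ : (fun i => X i Z) = fun i => Fin.append (fun r : Fin s => w r.castSucc)
      (fun _ : Fin (t + 1) => γ Z) (Fin.cast h i) := by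
    simp only [hX, hyZ]
  have hXp : ∀ i, D.pair Z (X i Z) = 0 := fun i => by
    have := perp_append (D := D) (Y := Z) (v := γ Z) h (x := fun r : Fin s => w r.castSucc)
      (fun r => hw _) hγp i
    rwa [← congrFun hXZ i] at this
  set i₀ : Fin m := Fin.cast h.symm (Fin.natAdd s 0) with hi₀
  have hupd : ∀ i : Fin m, s ≤ i → X i Z = γ Z := by
    intro i hi
    have h1 : Fin.cast h i = Fin.natAdd s ⟨i - s, by omega⟩ := Fin.ext (by simp; omega)
    simp only [hX, h1, Fin.append_right]
  have hE : ∀ i : Fin m, s ≤ i →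
      form (fun I => c I Z) (Function.update (fun i => X i Z) i
        fun k => dbarDir (fun Y => X i Y k) Z (star (D.hvec Z w₁))) =
      1 / 2 * ev F Z (Function.update (fun i => X i Z) i₀ w₁) := by
    intro i hi
    have h1 : Fin.cast h i = Fin.natAdd s ⟨i - s, by omega⟩ := Fin.ext (by simp; omega)
    have h2 : (fun k => dbarDir (fun Y => X i Y k) Z (star (D.hvec Z w₁))) =
        (1 / 2 : ℂ) • w₁ + (-(1 / 2 * D.pair (star (Z : V n)) w₁) / (2 * D.normSq (Z : V n))) •
          (Z : V n) := by
      funext k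
      have h3 : (fun Y => X i Y k) = fun Y => gradField D l φ Y k := by
        simp only [hX, h1, Fin.append_right, hγ]
      rw [h3, (hγd k).2]
      simp only [hvec, Pi.add_apply, Pi.sub_apply, Pi.smul_apply, smul_eq_mul]
      field_simp
      ring
    have hperp : ∀ (j : Fin m) {u : V n}, D.pair Z u = 0 → ∀ r,
        D.pair Z (Function.update (fun i => X i Z) j u r) = 0 := by
      intro j u hu r
      by_cases hrj : r = j
      · subst hrj; simpa using hu
      · simpa [Function.update_of_ne hrj] using hXp r
    have hup : D.pair (Z : V n) ((1 / 2 : ℂ) • w₁) = 0 := by rw [map_smul, hw, smul_zero]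
    rw [h2, ← hr.ev_eq Z.2 hZU (hperp i (by rw [map_add, hup, map_smul, hiso.1, smul_zero,
      add_zero]))]
    have h4 : Function.update (fun i => X i (Z : V n)) i ((1 / 2 : ℂ) • w₁ +
        (-(1 / 2 * D.pair (star (Z : V n)) w₁) / (2 * D.normSq (Z : V n))) • (Z : V n)) =
        fun r => Function.update (fun i => X i (Z : V n)) i ((1 / 2 : ℂ) • w₁) r +
          (Pi.single i (-(1 / 2 * D.pair (star (Z : V n)) w₁) / (2 * D.normSq (Z : V n))) :
            Fin m → ℂ) r • (Z : V n) := by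
      funext r
      by_cases hri : r = i
      · subst hri; simp
      · simp [hri]
    rw [h4, ev_add_smul F hiso.1]
    have h5 : Function.update (fun i => X i (Z : V n)) i ((1 / 2 : ℂ) • w₁) =
        fun r => (Function.update (fun _ => (1 : ℂ)) i (1 / 2) r) •
          Function.update (fun i => X i (Z : V n)) i w₁ r := by
      funext r
      by_cases hri : r = i
      · subst hri; simp
      · simp [Function.update_of_ne hri]
    rw [h5, ev_smul F Z.2 (hperp i (hw _)), Finset.prod_update_of_mem (Finset.mem_univ i)]
    simp only [Finset.prod_const_one, mul_one]
    congr 1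
    rw [← hsym Z Z.2 _ (hperp i (hw _)) i i₀ hi (by simp [hi₀])]
    congr 1
    funext r
    simp only [Function.comp_apply]
    by_cases h6 : r = i₀
    · subst h6
      rw [Equiv.swap_apply_right, Function.update_self, Function.update_self]
    · by_cases h7 : r = i
      · subst h7
        rw [Equiv.swap_apply_left, Function.update_of_ne h6]
        by_cases h8 : i₀ = r
        · exact absurd h8.symm h6
        · rw [Function.update_of_ne h8, hupd r hi, hupd i₀ (by simp [hi₀])]
      · rw [Equiv.swap_apply_of_ne_of_ne h7 h6, Function.update_of_ne h7, Function.update_of_ne h6]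
  have hE0 : ∀ i : Fin m, ¬s ≤ i →
      form (fun I => c I Z) (Function.update (fun i => X i Z) i
        fun k => dbarDir (fun Y => X i Y k) Z (star (D.hvec Z w₁))) = 0 := by
    intro i hi
    have h1 : Fin.cast h i = Fin.castAdd (t + 1) ⟨i, by omega⟩ := Fin.ext (by simp)
    have h2 : (fun k => dbarDir (fun Y => X i Y k) Z (star (D.hvec Z w₁))) = 0 := by
      funext k
      have h3 : (fun Y => X i Y k) = fun Y => y ⟨i, by omega⟩ Y k := by
        simp only [hX, h1, Fin.append_left]
      rw [h3, dbarDir_of_holo (differentiableAt_pi.mp (hyd _) k)]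
      rfl
    rw [h2, (form fun I => c I (Z : V n)).map_coord_zero i (by simp)]
  have hsum : ∀ i : Fin m, form (fun I => c I Z) (Function.update (fun i => X i Z) i
      fun k => dbarDir (fun Y => X i Y k) Z (star (D.hvec Z w₁))) =
      if s ≤ (i : ℕ) then 1 / 2 * ev F Z (Function.update (fun i => X i Z) i₀ w₁) else 0 := by
    intro i
    split_ifs with hi
    · exact hE i hi
    · exact hE0 i hi
  have hcard : (Finset.univ.filter fun i : Fin m => s ≤ (i : ℕ)).card = t + 1 := by
    subst h
    rw [Finset.card_filter, Fin.sum_univ_add]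
    simp
  have hfin : ev (contr F h') Z w = ev F Z (Function.update (fun i => X i Z) i₀ w₁) := by
    rw [ev_contr F h' Z.2 ⟨hγp, hγc⟩ hw]
    congr 1
    funext i
    by_cases hi : i = i₀
    · subst hi
      have h1 : Fin.cast h' i₀ = Fin.castAdd t (Fin.last s) := Fin.ext (by simp [hi₀])
      rw [h1, Fin.append_left, Function.update_self, hw₁]
    · rw [Function.update_of_ne hi]
      by_cases hs : s ≤ (i : ℕ)
      · have hne : (i : ℕ) ≠ s := fun e => hi (Fin.ext (by simp [hi₀, e]))
        have h1 : Fin.cast h' i = Fin.natAdd (s + 1) ⟨i - (s + 1), by omega⟩ :=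
          Fin.ext (by simp; omega)
        rw [h1, Fin.append_right, hupd i hs]
      · have h1 : Fin.cast h' i = Fin.castAdd t (Fin.castSucc ⟨i, by omega⟩) := Fin.ext (by simp)
        have h2 : Fin.cast h i = Fin.castAdd (t + 1) ⟨i, by omega⟩ := Fin.ext (by simp)
        rw [h1, Fin.append_left, congrFun hXZ i, h2, Fin.append_left]
  rw [Finset.sum_congr rfl fun i _ => hsum i, ← Finset.sum_filter, Finset.sum_const, hcard, ← hfin,
    nsmul_eq_mul]
  rw [ev_of _ Z.2 hw, ev_of _ Z.2 hw]
  change _ = ((t + 1 : ℕ) : ℂ) / 2 * _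
  ring

end PeriodDomain

/-- A triangularity criterion: maps `φ_d : M_d → A` for `d < N` assemble to an isomorphism
`⨁ M_d ≅ A` as soon as there are maps `L_d` on `A` such that `L_d ∘ φ_e` vanishes for `e < d`, is
injective for `e = d`, and has image `L_d (ker L_{d+1})`. -/
lemma bijective_toModule_of_triangular {N : ℕ} {M : Fin N → Type*} [∀ d, AddCommMonoid (M d)]
    [∀ d, Module ℂ (M d)] {Y : Type*} [AddCommGroup Y] [Module ℂ Y] {A : Submodule ℂ Y}
    {B : ℕ → Type*}
    [∀ d, AddCommGroup (B d)] [∀ d, Module ℂ (B d)] (φ : ∀ d, M d →ₗ[ℂ] A)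
    (L : ∀ d, A →ₗ[ℂ] B d) (hlt : ∀ (d : ℕ) (e : Fin N) (x : M e), (e : ℕ) < d → L d (φ e x) = 0)
    (hinj : ∀ (d : Fin N) (x y : M d), L d (φ d x) = L d (φ d y) → x = y)
    (hsurj : ∀ (d : Fin N) (a : A), L (d + 1) a = 0 → ∃ x, L d (φ d x) = L d a)
    (hge : ∀ (d : ℕ) (a : A), N ≤ d → L (d + 1) a = 0 → L d a = 0)
    (h0 : ∀ a, L 0 a = 0 → a = 0) (hex : ∀ a, ∃ d, L d a = 0) :
    Function.Bijective (DirectSum.toModule ℂ (Fin N) A φ) := by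
  classical
  have hlof : ∀ d x, DirectSum.toModule ℂ (Fin N) A φ (DirectSum.lof ℂ (Fin N) M d x) = φ d x :=
    fun d x => DirectSum.toModule_lof ℂ d x
  have hsum : ∀ x : ⨁ d, M d, DirectSum.toModule ℂ (Fin N) A φ x = ∑ d, φ d (x d) := by
    intro x
    conv_lhs => rw [← DirectSum.sum_univ_of x]
    rw [map_sum]
    exact Finset.sum_congr rfl fun d _ => hlof d (x d)
  refine ⟨?_, ?_⟩
  · intro x y hxy
    by_contra hne
    have hex : (Finset.univ.filter fun d => x d ≠ y d).Nonempty := by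
      by_contra hempty
      rw [Finset.not_nonempty_iff_eq_empty, Finset.filter_eq_empty_iff] at hempty
      refine hne (DFinsupp.ext fun d => ?_)
      have := hempty (Finset.mem_univ d)
      push Not at this
      exact this
    -- The highest difference, of degree `d`, is detected by `L d`.
    set d := (Finset.univ.filter fun d => x d ≠ y d).max' hex with hd
    have hdmem := (Finset.mem_filter.mp ((Finset.univ.filter fun d => x d ≠ y d).max'_mem hex)).2
    refine hdmem (hinj d (x d) (y d) ?_)
    have h1 : L d (∑ e, φ e (x e)) - L d (∑ e, φ e (y e)) = 0 := by
      rw [← hsum, ← hsum, hxy, sub_self]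
    rw [map_sum, map_sum, ← Finset.sum_sub_distrib, Finset.sum_eq_single d] at h1
    · exact sub_eq_zero.mp h1
    · intro e _ he
      rcases lt_or_gt_of_ne he with hlt' | hgt
      · rw [hlt d e (x e) hlt', hlt d e (y e) hlt', sub_zero]
      · have h3 : x e = y e := by
          by_contra h4
          exact absurd ((Finset.univ.filter fun d => x d ≠ y d).le_max' e
            (Finset.mem_filter.mpr ⟨Finset.mem_univ e, h4⟩)) (not_le.mpr hgt)
        rw [h3, sub_self]
    · exact fun h => absurd (Finset.mem_univ d) h
  · have key : ∀ (d : ℕ) (a : A), L d a = 0 →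
        a ∈ LinearMap.range (DirectSum.toModule ℂ (Fin N) A φ) := by
      intro d
      induction d with
      | zero =>
        intro a ha
        rw [h0 a ha]
        exact zero_mem _
      | succ d ih =>
        intro a ha
        by_cases hd : d < N
        · obtain ⟨x, hx⟩ := hsurj ⟨d, hd⟩ a ha
          have h2 := ih (a - φ ⟨d, hd⟩ x) (by rw [map_sub, sub_eq_zero]; exact hx.symm)
          have := add_mem h2 (⟨_, hlof ⟨d, hd⟩ x⟩ :
            φ ⟨d, hd⟩ x ∈ LinearMap.range (DirectSum.toModule ℂ (Fin N) A φ))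
          rwa [sub_add_cancel] at this
        · exact ih a (hge d a (not_lt.mp hd) ha)
    intro a
    obtain ⟨d, hd⟩ := hex a
    exact key d a hd

namespace PeriodDomain

open EvenLattice Filter

variable {n : ℕ} {D : PeriodDomain n} {Γ : Subgroup D.orthogonalGroup} {l : ℤ}

/-! ### The contractions as almost-holomorphic forms -/

section Contraction

variable {f : Mod Γ l 0} {m s t : ℕ}

lemma contr_zero_right (F : D.Sec (compl f) m) (h : m = m + 0) : contr F h = F := by
  funext Z
  refine MultilinearMap.ext fun w => ?_
  change F Z (fun i => Fin.append w (fun _ => gradVec f Z) (Fin.cast h i)) = F Z w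
  congr 1
  funext i
  exact Fin.append_left w (fun _ : Fin 0 => gradVec f Z) i

lemma IsSymmFrom_mono {Ω : Set (V n)} {F : D.Sec Ω m} {s₁ s₂ : ℕ} (h : IsSymmFrom s₁ F)
    (h12 : s₁ ≤ s₂) : IsSymmFrom s₂ F := fun Z hZ x hx i j hi hj =>
  h Z hZ x hx i j (h12.trans hi) (h12.trans hj)

lemma isSymmFrom_iff {Ω : Set (V n)} {d : ℕ} {F : D.Sec Ω (s + d)} :
    IsSymmFrom s F ↔ ∀ (Z : Ω) (w : Fin s → D.E (Z : V n)) (v : Fin d → D.E (Z : V n))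
      (σ : Equiv.Perm (Fin d)), F Z (Fin.append w (v ∘ σ)) = F Z (Fin.append w v) := by
  have hswap : ∀ {X : Type} (w : Fin s → X) (v : Fin d → X) (i j : Fin d),
      Fin.append w (v ∘ Equiv.swap i j) =
        Fin.append w v ∘ Equiv.swap (Fin.natAdd s i) (Fin.natAdd s j) := by
    intro X w v i j
    funext r
    refine Fin.addCases (fun r => ?_) (fun r => ?_) r
    · have h1 : ∀ i : Fin d, Fin.castAdd d r ≠ Fin.natAdd s i := fun i e => by
        have := congrArg Fin.val e
        simp at this
        omega
      simp [Equiv.swap_apply_of_ne_of_ne (h1 i) (h1 j)]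
    · have h1 := (Fin.natAdd_injective d s).map_swap i j r
      simp [← h1]
  constructor
  · intro h Z w v σ
    induction σ using Equiv.Perm.swap_induction_on' with
    | one => rfl
    | mul_swap τ i j hij ih =>
      rw [← ih, Equiv.Perm.coe_mul, ← Function.comp_assoc, hswap]
      choose x hx using fun r => Submodule.mkQ_surjective _ (Fin.append w (v ∘ τ) r)
      have hx' : Fin.append w (v ∘ τ) = fun r => D.cls Z (x r) := funext fun r => (hx r).symm
      have h1 := h Z Z.2 (fun r => x r) (fun r => (x r).2) (Fin.natAdd s i) (Fin.natAdd s j)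
        (by simp) (by simp)
      rw [ev_of (x := fun r => ((x r : D.perp (Z : V n)) : V n)) _ Z.2 fun r => (x r).2,
        ev_of (x := (fun r => ((x r : D.perp (Z : V n)) : V n)) ∘
          Equiv.swap (Fin.natAdd s i) (Fin.natAdd s j)) _ Z.2 fun r => (x _).2] at h1
      rw [hx']
      exact h1
  · intro h Z hZ x hx i j hi hj
    rw [ev_of F hZ hx, ev_of (x := x ∘ Equiv.swap i j) F hZ fun r => hx _]
    obtain ⟨i, rfl⟩ : ∃ i' : Fin d, i = Fin.natAdd s i' :=
      ⟨⟨i - s, by omega⟩, Fin.ext (by simp; omega)⟩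
    obtain ⟨j, rfl⟩ : ∃ j' : Fin d, j = Fin.natAdd s j' :=
      ⟨⟨j - s, by omega⟩, Fin.ext (by simp; omega)⟩
    have h1 := h ⟨Z, hZ⟩ (fun r => D.cls Z ⟨x (Fin.castAdd d r), hx _⟩)
      (fun r => D.cls Z ⟨x (Fin.natAdd s r), hx _⟩) (Equiv.swap i j)
    rw [hswap] at h1
    have h2 : Fin.append (fun r => D.cls Z ⟨x (Fin.castAdd d r), hx _⟩)
        (fun r => D.cls Z ⟨x (Fin.natAdd s r), hx _⟩) = fun r => D.cls Z ⟨x r, hx r⟩ :=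
      Fin.append_castAdd_natAdd (f := fun r => D.cls Z ⟨x r, hx r⟩)
    rw [h2] at h1
    exact h1

lemma lowerIter_succ {Ω : Set (V n)} (hΩ : D.IsConeOpen Ω) (F : D.smoothSec Ω s) (d : ℕ) :
    lowerIter hΩ s (d + 1) F = lower hΩ (s + d) (lowerIter hΩ s d F) := rfl

lemma lowerIter_eq_zero_of_le {Ω : Set (V n)} (hΩ : D.IsConeOpen Ω) {F : D.smoothSec Ω s}
    {a b : ℕ} (hab : a ≤ b) (h : lowerIter hΩ s a F = 0) : lowerIter hΩ s b F = 0 := by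
  induction b, hab using Nat.le_induction with
  | base => exact h
  | succ b _ ih => rw [lowerIter_succ, ih, map_zero]

/-- `𝖫^j ⟨F, G^{⊗ d}⟩` is a nonzero multiple of `⟨F, G^{⊗ (d - j)}⟩`. -/
lemma exists_lowerIter_contr (hl : l ≠ 0) (f : Mod Γ l 0) (s d j t : ℕ) (h : s + d = s + j + t) :
    ∃ c : ℂ, c ≠ 0 ∧ ∀ (F : D.Sec (compl f) (s + d)), IsRegular ℂ F → IsSymmFrom s F →
      ∀ hreg : IsRegular ℝ (contr F (rfl : s + d = s + d)),
        (lowerIter (isConeOpen_compl f) s j ⟨contr F rfl, hreg⟩ : D.Sec (compl f) (s + j)) =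
          c • contr F h := by
  induction j generalizing t with
  | zero =>
    obtain rfl : d = t := by omega
    exact ⟨1, one_ne_zero, fun F _ _ _ => by rw [one_smul]; rfl⟩
  | succ j ih =>
    have h0 : s + d = s + j + (t + 1) := by omega
    obtain ⟨c, hc, hcF⟩ := ih (t + 1) h0
    refine ⟨c * (((t + 1 : ℕ) : ℂ) / 2), mul_ne_zero hc (div_ne_zero
    (Nat.cast_ne_zero.mpr (Nat.succ_ne_zero t)) two_ne_zero),
      fun F hF hsym hreg => ?_⟩
    have h1 := hcF F hF hsym hreg
    have hreg' : IsRegular ℝ (contr F h0) := by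
      have h2 := (lowerIter (isConeOpen_compl f) s j ⟨contr F rfl, hreg⟩).2
      have h3 : contr F h0 = c⁻¹ • (lowerIter (isConeOpen_compl f) s j
          ⟨contr F rfl, hreg⟩ : D.Sec (compl f) (s + j)) := by
        rw [h1, smul_smul, inv_mul_cancel₀ hc, one_smul]
      rw [h3]
      exact IsRegular.smul _ h2
    have h2 : lowerIter (isConeOpen_compl f) s j ⟨contr F rfl, hreg⟩ =
        c • (⟨contr F h0, hreg'⟩ : D.smoothSec (compl f) (s + j)) := Subtype.ext h1
    rw [lowerIter_succ, h2, map_smul]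
    change c • lowerFun (contr F h0) hreg' = _
    rw [lowerFun_contr hl hF (IsSymmFrom_mono hsym (Nat.le_add_right s j)) h0 h, smul_smul]

lemma lowerIter_contr_eq_zero (hl : l ≠ 0) {f : Mod Γ l 0} {s d j : ℕ} (hj : d < j)
    {F : D.Sec (compl f) (s + d)} (hF : IsRegular ℂ F) (hsym : IsSymmFrom s F)
    (hreg : IsRegular ℝ (contr F (rfl : s + d = s + d))) :
    lowerIter (isConeOpen_compl f) s j ⟨contr F rfl, hreg⟩ = 0 := by
  refine lowerIter_eq_zero_of_le _ hj ?_
  obtain ⟨c, -, h⟩ := exists_lowerIter_contr hl f s d d 0 rfl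
  have h1 : lowerIter (isConeOpen_compl f) s d ⟨contr F rfl, hreg⟩ =
      c • (⟨F, hF.real⟩ : D.smoothSec (compl f) (s + d)) := by
    refine Subtype.ext ((h F hF hsym hreg).trans ?_)
    rw [contr_zero_right]
    rfl
  rw [lowerIter_succ, h1, map_smul]
  refine smul_eq_zero_of_right _ (Subtype.ext ?_)
  exact lowerFun_of_holomorphic (isConeOpen_compl f) hF _

lemma HasPoleOrderLE.real {s : ℕ} {e : ℤ} {F : D.Sec (compl f) s}
    (h : HasPoleOrderLE ℂ f e F) : HasPoleOrderLE ℝ f e F := fun U h₀ hU hh => by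
  obtain ⟨F', h1, h2⟩ := h U h₀ hU hh
  exact ⟨F', IsRegular.real h1, h2⟩

/-- The map `F ↦ ⟨F, G^{⊗ d}⟩`. -/
noncomputable def contrMap (hl : l ≠ 0) {f : Mod Γ l 0} (hf : f ≠ 0) (k : ℤ) (s d : ℕ) :
    LogModSym f (k - d) s d →ₗ[ℂ] LogAHMod f k s where
  toFun F := ⟨⟨contr F.1 rfl, isRegular_contr hl hf (IsRegular.real F.2.1.1) rfl⟩, by
    obtain ⟨⟨h1, h2, h3, h4⟩, h5⟩ := F.2
    have hsym := isSymmFrom_iff.mpr h5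
    refine ⟨⟨d + 1, lowerIter_contr_eq_zero hl (Nat.lt_succ_self d) h1 hsym _⟩, ?_,
      isInvariant_contr hl h3 rfl, fun j => ?_⟩
    · have := hasWeight_contr hl h2 (rfl : s + d = s + d)
      rwa [sub_add_cancel] at this
    · rcases le_or_gt j d with hj | hj
      · obtain ⟨c, -, h⟩ := exists_lowerIter_contr hl f s d j (d - j) (by omega)
        rw [h F.1 h1 hsym]
        refine HasPoleOrderLE.smul c ?_
        have := hasPoleOrderLE_contr hl hf (HasPoleOrderLE.real h4)
          (show s + d = s + j + (d - j) by omega)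
        convert this using 1
        push_cast [hj]
        ring
      · rw [lowerIter_contr_eq_zero hl hj h1 hsym]
        exact HasPoleOrderLE.zero⟩
  map_add' F F' := rfl
  map_smul' a F := rfl

lemma contrMap_coe (hl : l ≠ 0) {f : Mod Γ l 0} (hf : f ≠ 0) (k : ℤ) (s d : ℕ)
    (F : LogModSym f (k - d) s d) :
    ((contrMap hl hf k s d F).1 : D.Sec (compl f) s) = contr F.1 rfl := rfl

end Contraction

/-! ### The leading term of an almost-holomorphic form -/

section LeadingTerm

variable {f : Mod Γ l 0} {s : ℕ}

lemma isCR_of_restrict {Ω Ω' : Set (V n)} (hsub : Ω' ⊆ Ω) (hΩ' : D.IsConeOpen Ω')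
    {F : D.Sec Ω s} {G : D.Sec Ω' s} (hFG : ∀ Z : Ω', F ⟨Z, hsub Z.2⟩ = G Z) (hG : IsRegular ℂ G)
    {Z : V n} (hZ : Z ∈ Ω') : IsCR F Z := by
  intro U c hU hc hr
  refine IsRegular.isCR hΩ' hG hZ U c hU hc fun Y hY w => ?_
  rw [← hFG Y]
  exact hr ⟨Y, hsub Y.2⟩ hY w

/-- For holomorphic sections, the smooth and the holomorphic notions of pole order agree. -/
lemma HasPoleOrderLE.complex (hf : f ≠ 0) {e : ℤ} {F : D.Sec (compl f) s} (hF : IsRegular ℂ F)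
    (h : HasPoleOrderLE ℝ f e F) : HasPoleOrderLE ℂ f e F := by
  intro U h₀ hU hh
  obtain ⟨F', h1, h2⟩ := h U h₀ hU hh
  refine ⟨F', ?_, h2⟩
  have hsub : compl f ∩ U ⊆ D.cone ∩ U := fun Z hZ => ⟨hZ.1.1, hZ.2⟩
  have hΩ' := isConeOpen_inter (isConeOpen_compl f) hU
  refine isRegular_complex_of_isCR (isConeOpen_inter isConeOpen_cone hU) h1 hsub
    (cone_inter_subset_closure hf hU) fun Z hZ =>
      isCR_of_restrict hsub hΩ' (G := fun Z => h₀ Z ^ e • F ⟨Z, Z.2.1⟩)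
        (fun Z => h2 Z (hsub Z.2) Z.2.1) ?_ hZ
  intro Z
  obtain ⟨U₁, hU₁, hZU₁, c, hc, hr⟩ := hF ⟨Z, Z.2.1⟩
  have hne : h₀ Z ≠ 0 := fun h0 => Z.2.1.2 ((hh.2.1 Z (hsub Z.2)).mp h0)
  have hWo : IsOpen (U ∩ {Y | h₀ Y ≠ 0}) :=
    hh.1.continuousOn.isOpen_inter_preimage hU isOpen_ne
  have hz : DifferentiableOn ℂ (fun Y => h₀ Y ^ e) (U₁ ∩ (U ∩ {Y | h₀ Y ≠ 0})) := fun Y hY =>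
    (DifferentiableAt.comp Y (differentiableAt_zpow.mpr (Or.inl hY.2.2))
      (hh.1.differentiableAt (hU.mem_nhds hY.2.1))).differentiableWithinAt
  refine ⟨U₁ ∩ (U ∩ {Y | h₀ Y ≠ 0}), hU₁.inter hWo, ⟨hZU₁, Z.2.2, hne⟩,
    fun I Y => h₀ Y ^ e * c I Y, fun I => (contDiffOn_of_differentiableOn (hU₁.inter hWo) hz).mul
      ((hc I).mono Set.inter_subset_left), fun Y hY w => ?_⟩
  have h3 := hr ⟨Y, Y.2.1⟩ hY.1 w
  rw [smul_apply, h3]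
  simp only [form_apply, smul_eq_mul, Finset.mul_sum, mul_assoc]

lemma hasWeight_lowerIter {Ω : Set (V n)} (hΩ : D.IsConeOpen Ω) {k : ℤ} {F : D.smoothSec Ω s}
    (h : HasWeight k F.1) (d : ℕ) : HasWeight (k - d) (lowerIter hΩ s d F).1 := by
  induction d with
  | zero =>
    have e : k - ((0 : ℕ) : ℤ) = k := by simp
    rw [e]
    exact h
  | succ d ih =>
    have := HasWeight.lowerFun hΩ (lowerIter hΩ s d F).2 ih
    have e : k - ((d + 1 : ℕ) : ℤ) = k - d - 1 := by push_cast; ring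
    rw [e]
    exact this

lemma isInvariant_lowerIter {Ω : Set (V n)} (hΩ : D.IsConeOpen Ω) {F : D.smoothSec Ω s}
    (h : IsInvariant Γ F.1) (d : ℕ) : IsInvariant Γ (lowerIter hΩ s d F).1 := by
  induction d with
  | zero => exact h
  | succ d ih => exact IsInvariant.lowerFun hΩ (lowerIter hΩ s d F).2 ih

/-- If `𝖫^{d+1} F = 0`, then `𝖫^d F` is a logarithmic modular form: it is holomorphic as a
homogeneous section in the kernel of `𝖫`, and symmetric as an iterated derivative. -/
lemma lowerIter_mem_logModSym (hf : f ≠ 0) {k : ℤ} (F : LogAHMod f k s) {d : ℕ}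
    (h : lowerIter (isConeOpen_compl f) s (d + 1) F.1 = 0) :
    (lowerIter (isConeOpen_compl f) s d F.1).1 ∈ LogModSym f (k - d) s d := by
  obtain ⟨-, h1, h2, h3⟩ := F.2
  have hw := hasWeight_lowerIter (isConeOpen_compl f) h1 d
  have hw' : ∀ (a : ℂ) (Z : V n), a ≠ 0 → Z ∈ compl f → ∀ x : Fin (s + d) → V n,
      (∀ r, D.pair Z (x r) = 0) →
        ev (lowerIter (isConeOpen_compl f) s d F.1).1 (a • Z) x =
          a ^ (-(k - d)) * ev (lowerIter (isConeOpen_compl f) s d F.1).1 Z x := by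
    intro a Z ha hZ x hx
    have := hasWeight_iff.mp hw a ha Z hZ (smul_mem_compl ha hZ) x hx
    simpa [homothety, ContinuousLinearEquiv.smulLeft_apply_apply, Units.smul_def,
      inv_smul_smul₀ ha] using this
  have hL : lowerFun (lowerIter (isConeOpen_compl f) s d F.1).1
      (lowerIter (isConeOpen_compl f) s d F.1).2 = 0 := congrArg Subtype.val h
  have hreg : IsRegular ℂ (lowerIter (isConeOpen_compl f) s d F.1).1 :=
    isRegular_complex_of_isCR (isConeOpen_compl f) (lowerIter (isConeOpen_compl f) s d F.1).2
      subset_rfl subset_closure fun Z hZ =>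
        isCR_of_lowerFun_eq_zero (isConeOpen_compl f) _ hL hw' hZ
  exact ⟨⟨hreg, hw, isInvariant_lowerIter _ h2 d, HasPoleOrderLE.complex hf hreg (h3 d)⟩,
    isSymmFrom_iff.mp (isSymmFrom_lowerIter _ F.1 d)⟩

end LeadingTerm

/-! ### The structure theorem, given the vanishing in negative weight -/

section Structure

variable {f : Mod Γ l 0} {s : ℕ}

lemma exists_lowerIter_contrMap (hl : l ≠ 0) (hf : f ≠ 0) (k : ℤ) (s d : ℕ) :
    ∃ c : ℂ, c ≠ 0 ∧ ∀ F : LogModSym f (k - d) s d,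
      (lowerIter (isConeOpen_compl f) s d (contrMap hl hf k s d F).1).1 = c • F.1 := by
  obtain ⟨c, hc, h⟩ := exists_lowerIter_contr hl f s d d 0 rfl
  refine ⟨c, hc, fun F => ?_⟩
  have := h F.1 F.2.1.1 (isSymmFrom_iff.mpr F.2.2) (contrMap hl hf k s d F).1.2
  rw [contr_zero_right] at this
  exact this

lemma bijective_toModule_contrMap (hl : l ≠ 0) (hf : f ≠ 0) (k : ℤ) (s : ℕ)
    (hvan : ∀ (j : ℤ) (m : ℕ), j < 0 → ∀ F ∈ LogMod f j m, F = 0) :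
    Function.Bijective (DirectSum.toModule ℂ (Fin (k + 1).toNat) (LogAHMod f k s)
      fun d : Fin (k + 1).toNat => contrMap hl hf k s d) := by
  let L : ∀ d : ℕ, LogAHMod f k s →ₗ[ℂ] D.smoothSec (compl f) (s + d) := fun d =>
    (lowerIter (isConeOpen_compl f) s d).comp (LogAHMod f k s).subtype
  have hL : ∀ (d : ℕ) (a : LogAHMod f k s),
      L d a = lowerIter (isConeOpen_compl f) s d a.1 := fun _ _ => rfl
  have hlt : ∀ (d : ℕ) (e : Fin (k + 1).toNat) (x : LogModSym f (k - (e : ℕ)) s e),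
      (e : ℕ) < d → L d (contrMap hl hf k s e x) = 0 := fun d e x hed =>
    lowerIter_contr_eq_zero hl hed x.2.1.1 (isSymmFrom_iff.mpr x.2.2) _
  have hinj : ∀ (d : Fin (k + 1).toNat) (x y : LogModSym f (k - (d : ℕ)) s d),
      L d (contrMap hl hf k s d x) = L d (contrMap hl hf k s d y) → x = y := by
    intro d x y hxy
    obtain ⟨c, hc, hcF⟩ := exists_lowerIter_contrMap (f := f) hl hf k s (d : ℕ)
    have h6 : c • x.1 = c • y.1 :=
      ((hcF x).symm.trans (congrArg Subtype.val hxy)).trans (hcF y)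
    exact Subtype.ext (smul_right_injective _ hc h6)
  have hsurj : ∀ (d : Fin (k + 1).toNat) (a : LogAHMod f k s), L (d + 1) a = 0 →
      ∃ x : LogModSym f (k - (d : ℕ)) s d, L d (contrMap hl hf k s d x) = L d a := by
    intro d a ha
    have hH := lowerIter_mem_logModSym hf a ha
    obtain ⟨c, hc, hcF⟩ := exists_lowerIter_contrMap (f := f) hl hf k s (d : ℕ)
    refine ⟨c⁻¹ • ⟨_, hH⟩, Subtype.ext ((hcF _).trans ?_)⟩
    exact smul_inv_smul₀ hc _
  have hge : ∀ (d : ℕ) (a : LogAHMod f k s), (k + 1).toNat ≤ d → L (d + 1) a = 0 → L d a = 0 :=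
    fun d a hd ha => Subtype.ext
      (hvan (k - d) (s + d) (by omega) _ (lowerIter_mem_logModSym hf a ha).1)
  exact bijective_toModule_of_triangular (N := (k + 1).toNat)
    (M := fun d : Fin (k + 1).toNat => LogModSym f (k - (d : ℕ)) s d) (A := LogAHMod f k s)
    (B := fun d => D.smoothSec (compl f) (s + d))
    (fun d : Fin (k + 1).toNat => contrMap hl hf k s d) L hlt hinj hsurj hge
    (fun a ha => Subtype.ext ha) fun a => a.2.1

end Structure

end PeriodDomain

/-! ### Extension across `𝓗` -/

namespace EvenLattice

open Filter

variable {n : ℕ} {M : EvenLattice n} {s : ℕ}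

lemma ev_restrict {Ω Ω' : Set (V n)} (hsub : Ω' ⊆ Ω) {F : M.Sec Ω' s} {F' : M.Sec Ω s}
    (h : ∀ Z : Ω', F' ⟨Z, hsub Z.2⟩ = F Z) {Y : V n} (hY : Y ∈ Ω') {x : Fin s → V n}
    (hx : ∀ r, M.pair Y (x r) = 0) : ev F' Y x = ev F Y x := by
  rw [ev_of F hY hx, ev_of F' (hsub hY) hx, ← h ⟨Y, hY⟩]

/-- Equivariance extends from a dense subset, by continuity. -/
lemma Equivariant.of_dense {𝕜 : Type} [RCLike 𝕜] [NormedAlgebra 𝕜 ℂ] {Ω Ω' : Set (V n)}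
    (hΩ : Ω ⊆ M.isotropicPositive) (hsub : Ω' ⊆ Ω) (hdense : Ω ⊆ closure Ω') {F : M.Sec Ω' s}
    {F' : M.Sec Ω s} (hF' : IsRegular 𝕜 F') (hFF : ∀ Z : Ω', F' ⟨Z, hsub Z.2⟩ = F Z)
    {A : M.Similitude} {t c : ℂ} (hA : ∀ Y ∈ Ω', A.toEquiv Y ∈ Ω') (h : Equivariant A t c F) :
    Equivariant A t c F' := by
  intro Z hZ hAZ x hx
  have hZZ := pair_star_self_ne_zero (hΩ hZ)
  have hne : (𝓝[Ω'] Z).NeBot := mem_closure_iff_nhdsWithin_neBot.mp (hdense hZ)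
  have hle : 𝓝[Ω'] Z ≤ 𝓝 Z := nhdsWithin_le_nhds
  have hmem : ∀ᶠ Y in 𝓝[Ω'] Z, Y ∈ Ω' := self_mem_nhdsWithin
  have hpne : ∀ᶠ Y in 𝓝[Ω'] Z, M.pair Y (star Z) ≠ 0 :=
    hle ((isOpen_pair_star_ne Z).mem_nhds hZZ)
  have hfix : ∀ r, M.projPerp Z Z (x r) = x r := fun r => projPerp_of_perp (hx r)
  have hsymm : ∀ Y, A.toEquiv.symm (A.toEquiv Y) = Y := A.toEquiv.symm_apply_apply
  have hpt : ∀ r, Tendsto (fun Y => M.projPerp Z Y (x r)) (𝓝[Ω'] Z) (𝓝 (M.projPerp Z Z (x r))) :=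
    fun r => (continuousAt_projPerp hZZ).tendsto.mono_left hle
  have h1 := hF'.tendsto_ev hZ (x := fun r Y => M.projPerp Z Y (x r)) hle
    (hmem.mono fun Y hY => hsub hY) hpt
    (hpne.mono fun Y hY r => pair_projPerp hY _) fun r => pair_projPerp hZZ _
  have hmap : map A.toEquiv (𝓝[Ω'] Z) ≤ 𝓝 (A.toEquiv Z) :=
    A.toEquiv.continuous.continuousAt.tendsto.mono_left hle
  have h2 := hF'.tendsto_ev hAZ
    (x := fun r Y => t • A.toEquiv (M.projPerp Z (A.toEquiv.symm Y) (x r))) hmap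
    (eventually_map.mpr (hmem.mono fun Y hY => hsub (hA Y hY)))
    (fun r => by
      rw [tendsto_map'_iff]
      simp only [Function.comp_def, hsymm]
      exact ((A.toEquiv.continuous.tendsto _).comp (hpt r)).const_smul t)
    (eventually_map.mpr (hpne.mono fun Y hY r => by
      rw [hsymm, map_smul, A.pair_map, pair_projPerp hY, mul_zero, smul_zero]))
    fun r => by rw [hsymm, map_smul, A.pair_map, pair_projPerp hZZ, mul_zero, smul_zero]
  rw [tendsto_map'_iff] at h2
  simp only [Function.comp_def, hsymm, hfix] at h1 h2
  refine tendsto_nhds_unique h2 ((h1.const_mul c).congr' ?_)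
  filter_upwards [hmem, hpne] with Y hY hp
  have hp' : ∀ r, M.pair Y (M.projPerp Z Y (x r)) = 0 := fun r => pair_projPerp hp _
  rw [ev_restrict hsub hFF (x := fun r => M.projPerp Z Y (x r)) hY hp',
    ← h Y hY (hA Y hY) _ hp', ev_restrict hsub hFF (hA Y hY) fun r => by
      rw [map_smul, A.pair_map, hp', mul_zero, smul_zero]]

end EvenLattice

namespace PeriodDomain

open EvenLattice Filter

variable {n : ℕ} {D : PeriodDomain n} {Γ : Subgroup D.orthogonalGroup} {l : ℤ} {f : Mod Γ l 0}
  {s : ℕ}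

/-- A function `h` on an open subset of `M_ℂ` with the same zeros as the chart function of `f`
restricts, on a translate of the cone, to a reduced equation of `𝓗`, if its derivative in some
direction has no zero on its zero locus: the chart function is constant along the lines in
direction `Z̄₀`, so that this direction may be taken tangent to the cone. -/
lemma isLocalEquation_translate {Z₀ : V n} (hZ₀ : Z₀ ∈ D.cone) {U : Set (V n)} (hU : IsOpen U)
    {h : V n → ℂ} (hh : DifferentiableOn ℂ h U) {v : V n}
    (hzero : ∀ Y ∈ U, h Y = 0 ↔ totalValue f (D.retr Z₀ Y) = 0)
    (hd : ∀ Y ∈ U, h Y = 0 → fderiv ℂ h Y v ≠ 0) (t : ℂ) :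
    IsLocalEquation f ({Z | Z + t • star Z₀ ∈ U} ∩ {Z | D.pair Z (star Z₀) ≠ 0})
      fun Z => h (Z + t • star Z₀) := by
  have hZ₀' := (isConeOpen_cone.1 hZ₀).1
  have hz : ∀ Z ∈ D.cone, Z + t • star Z₀ ∈ U → D.pair Z (star Z₀) ≠ 0 →
      (h (Z + t • star Z₀) = 0 ↔ Z ∈ zeroLocus f) := fun Z hZ hZU hp => by
    rw [hzero _ hZU, retr_add_smul hZ₀' (isConeOpen_cone.1 hZ).1 hp, mem_zeroLocus_iff,
      and_iff_right hZ]
  refine ⟨fun Z hZ => ?_, fun Z hZ => hz Z hZ.1 hZ.2.1 hZ.2.2, fun Z hZ => subset_closure ⟨hZ, ?_⟩⟩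
  · have h1 := hh.differentiableAt (hU.mem_nhds hZ.1)
    exact (DifferentiableAt.comp Z (f := fun Z => Z + t • star Z₀) h1
      (differentiableAt_id.add_const _)).differentiableWithinAt
  obtain ⟨hZz, hZU, hp⟩ := hZ
  have hZc : Z ∈ D.cone := (mem_zeroLocus_iff.mp hZz).1
  have hZi := isConeOpen_cone.1 hZc
  have h0 : h (Z + t • star Z₀) = 0 := (hz Z hZc hZU hp).mpr hZz
  have hdiff := hh.differentiableAt (hU.mem_nhds hZU)
  have hstar : fderiv ℂ h (Z + t • star Z₀) (star Z₀) = 0 := by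
    have hline : HasDerivAt (fun τ : ℂ => Z + τ • star Z₀) (star Z₀) t := by
      have h3 := ((hasDerivAt_id t).smul_const (star Z₀)).const_add Z
      rwa [one_smul] at h3
    have h1 : HasDerivAt (fun τ : ℂ => h (Z + τ • star Z₀))
        (fderiv ℂ h (Z + t • star Z₀) (star Z₀)) t :=
      hdiff.hasFDerivAt.comp_hasDerivAt t hline
    have h2 : (fun τ : ℂ => h (Z + τ • star Z₀)) =ᶠ[𝓝 t] fun _ => 0 := by
      filter_upwards [hline.continuousAt.eventually (hU.mem_nhds hZU)] with τ hτ
      rw [hzero _ hτ, retr_add_smul hZ₀' hZi.1 hp]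
      exact (mem_zeroLocus_iff.mp hZz).2
    exact h1.unique ((hasDerivAt_const t (0 : ℂ)).congr_of_eventuallyEq h2)
  refine ⟨D.projPerp Z₀ Z v, pair_projPerp hp v, ?_⟩
  rw [fderiv_comp_add_right, projPerp, map_sub, map_smul, hstar, smul_zero, sub_zero]
  exact hd _ hZU h0

/-- Meromorphic sections with poles of non-positive order extend holomorphically across `𝓗`. -/
lemma exists_extension_of_poleOrder (hf : f ≠ 0) {k : ℤ} (hk : k ≤ 0) {F : D.Sec (compl f) s}
    (hF : IsRegular ℂ F) (hpole : HasPoleOrderLE ℂ f k F) :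
    ∃ F' : D.Sec D.cone s, IsRegular ℂ F' ∧ ∀ Z : compl f, F' ⟨Z, Z.2.1⟩ = F Z := by
  have hsub : compl f ⊆ D.cone := fun Z hZ => hZ.1
  refine exists_extension_of_local (M := D.toEvenLattice) (𝕜 := ℂ) isConeOpen_cone.1 hsub
    (cone_subset_closure_compl hf) F fun Z₀ hZ₀ => ?_
  have hZ₀' := (isConeOpen_cone.1 hZ₀).1
  obtain ⟨W, hW, hZW, hWr, hφ⟩ := exists_chart_totalValue f hZ₀ univ_mem
  set φ : V n → ℂ := fun Y => totalValue f (D.retr Z₀ Y) with hφdef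
  have hcompl : ∀ Y ∈ W, φ Y ≠ 0 → D.retr Z₀ Y ∈ compl f := fun Y hY h =>
    mem_compl_iff.mpr ⟨(hWr Y hY).2.2, h⟩
  have hchart : ∀ x : Fin s → V n,
      DifferentiableOn ℂ (D.chartFun F Z₀ x) (W ∩ {Y | φ Y ≠ 0}) := by
    intro x Y hY
    have hYc := hcompl Y hY.1 hY.2
    obtain ⟨U, hU, hYU, c, hc, hr⟩ := hF ⟨_, hYc⟩
    have hev : ∀ᶠ Y' in 𝓝 Y, D.retr Z₀ Y' ∈ U ∧ (Y' ∈ W ∩ {Y | φ Y ≠ 0}) :=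
      ((continuousAt_retr (hWr Y hY.1).1).eventually (hU.mem_nhds hYU)).and
        ((hφ.continuousOn.isOpen_inter_preimage hW isOpen_ne).mem_nhds hY)
    obtain ⟨W', hW', hWo', hYW'⟩ := _root_.eventually_nhds_iff.mp hev
    have := contDiffOn_chartFun hZ₀' hc hr x (W := W') fun Y' hY' =>
      ⟨(hWr Y' (hW' Y' hY').2.1).1, (hW' Y' hY').1, hcompl Y' (hW' Y' hY').2.1 (hW' Y' hY').2.2⟩
    exact ((this.differentiableOn (by simp)).differentiableAt
      (hWo'.mem_nhds hYW')).differentiableWithinAt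
  have hred : ∀ x : Fin s → V n, ∃ B κ, IsOpen B ∧ Z₀ ∈ B ∧ B ⊆ W ∧ DifferentiableOn ℂ κ B ∧
      ∀ Y ∈ B, φ Y ≠ 0 → κ Y = D.chartFun F Z₀ x Y := by
    intro x
    refine exists_extension_of_reduced hW hφ (hchart x) hZW (not_eventually_totalValue_retr hf hZ₀)
      fun v X U h hU hXU hUW hh hzero hd hX => ?_
    obtain ⟨t, ht⟩ := eq_retr_add_smul (M := D.toEvenLattice) Z₀ X
    set Z₁ := D.retr Z₀ X with hZ₁
    have hXW := hWr X (hUW hXU)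
    set U₁ : Set (V n) := {Z | Z + t • star Z₀ ∈ U} ∩ {Z | D.pair Z (star Z₀) ≠ 0} with hU₁
    have hU₁o : IsOpen U₁ := (hU.preimage (continuous_id.add continuous_const)).inter
      (isOpen_pair_star_ne Z₀)
    have heq : IsLocalEquation f U₁ fun Z => h (Z + t • star Z₀) :=
      isLocalEquation_translate hZ₀ hU hh hzero (fun Y hY h0 => hd Y hY ((hzero Y hY).mp h0)) t
    obtain ⟨F₁, hF₁, hFF⟩ := hpole U₁ _ hU₁o heq
    have hZ₁U : Z₁ ∈ D.cone ∩ U₁ := ⟨hXW.2.2, by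
      change Z₁ + t • star Z₀ ∈ U
      rw [← ht]; exact hXU, by
      change D.pair Z₁ (star Z₀) ≠ 0
      rw [hZ₁, pair_retr_star hZ₀']; exact hXW.1⟩
    obtain ⟨U₂, hU₂, hZU₂, c, hc, hr⟩ := hF₁ ⟨Z₁, hZ₁U⟩
    have hev : ∀ᶠ Y in 𝓝 X, D.retr Z₀ Y ∈ U₂ ∩ U₁ ∧ Y ∈ W :=
      ((continuousAt_retr hXW.1).eventually ((hU₂.inter hU₁o).mem_nhds ⟨hZU₂, hZ₁U.2⟩)).and
        (hW.mem_nhds (hUW hXU))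
    obtain ⟨U', hU', hUo', hXU'⟩ := _root_.eventually_nhds_iff.mp hev
    obtain ⟨m, hm⟩ := Int.eq_ofNat_of_zero_le (neg_nonneg.mpr hk)
    refine ⟨U', fun Y => h (D.retr Z₀ Y + t • star Z₀) ^ m * D.chartFun F₁ Z₀ x Y, hUo', hXU',
      ?_, fun Y hY hφY => ?_⟩
    · have h1 := (contDiffOn_chartFun hZ₀' hc hr x (W := U') fun Y hY =>
        ⟨(hWr Y (hU' Y hY).2).1, (hU' Y hY).1.1, (hWr Y (hU' Y hY).2).2.2,
          (hU' Y hY).1.2⟩).differentiableOn (by simp)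
      have h2 : DifferentiableOn ℂ (fun Y => h (D.retr Z₀ Y + t • star Z₀)) U' := fun Y hY =>
        (DifferentiableAt.comp Y (f := D.retr Z₀)
          (heq.1.differentiableAt (hU₁o.mem_nhds (hU' Y hY).1.2))
          (differentiableAt_retr (hWr Y (hU' Y hY).2).1)).differentiableWithinAt
      exact (h2.pow m).mul h1
    · have hYc := hcompl Y hY.2 hφY
      have hY1 := (hU' Y hY.1).1.2
      have hp : ∀ r, D.pair (D.retr Z₀ Y) (D.projPerp Z₀ (D.retr Z₀ Y) (x r)) = 0 := fun r =>
        pair_projPerp hY1.2 _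
      have hne : h (D.retr Z₀ Y + t • star Z₀) ≠ 0 := fun h0 =>
        hYc.2 ((heq.2.1 _ ⟨hYc.1, hY1⟩).mp h0)
      simp only [chartFun]
      rw [ev_of (x := fun r => D.projPerp Z₀ (D.retr Z₀ Y) (x r)) F hYc hp,
        ev_of (x := fun r => D.projPerp Z₀ (D.retr Z₀ Y) (x r)) F₁ ⟨hYc.1, hY1⟩ hp,
        hFF _ ⟨hYc.1, hY1⟩ hYc, smul_apply, smul_eq_mul, ← mul_assoc, ← zpow_natCast,
        ← zpow_add₀ hne]
      have : (m : ℤ) + k = 0 := by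
        change -k = (m : ℤ) at hm
        omega
      rw [this, zpow_zero, one_mul]
  choose B κ hB hZB hBW hκ he using hred
  refine ⟨⋂ I : Fin s → Fin (n + 2), B fun r => Pi.single (I r) 1,
    isOpen_iInter_of_finite fun I => hB _, Set.mem_iInter.mpr fun I => hZB _,
    fun I => κ fun r => Pi.single (I r) 1, fun I => ?_, represents_iff.mpr fun Y hY hYB x hx => ?_⟩
  · exact contDiffOn_of_differentiableOn (isOpen_iInter_of_finite fun I => hB _)
      ((hκ _).mono (Set.iInter_subset _ I))
  · have hB' : ∀ I : Fin s → Fin (n + 2), Y ∈ B fun r => Pi.single (I r) 1 := Set.mem_iInter.mp hYB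
    by_cases hs : Nonempty (Fin s → Fin (n + 2))
    · obtain ⟨I₀⟩ := hs
      have hYW := hBW _ (hB' I₀)
      have hφY : φ Y ≠ 0 := by
        simp only [hφdef, retr_of_isotropic (isConeOpen_cone.1 hY.1).1]
        exact (mem_compl_iff.mp hY).2
      rw [(represents_chartFun F (fun Z hZ => (isConeOpen_cone.1 (hsub hZ)).1)).ev_eq hY
        (hWr Y hYW).1 hx]
      congr 2
      funext I
      exact (he _ Y (hB' I) hφY).symm
    · exact absurd ⟨fun _ => 0⟩ hs

/-- Logarithmic forms of non-positive weight are holomorphic modular forms. -/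
lemma exists_mod_of_logMod (hf : f ≠ 0) {k : ℤ} (hk : k ≤ 0) {F : D.Sec (compl f) s}
    (hF : F ∈ LogMod f k s) : ∃ F' ∈ Mod Γ k s, ∀ Z : compl f, F' ⟨Z, Z.2.1⟩ = F Z := by
  obtain ⟨hreg, hw, hinv, hpole⟩ := hF
  obtain ⟨F', hF', hFF⟩ := exists_extension_of_poleOrder hf hk hreg hpole
  have hsub : compl f ⊆ D.cone := fun Z hZ => hZ.1
  refine ⟨F', ⟨hF', hasWeight_iff.mpr fun a ha => ?_, isInvariant_iff.mpr fun γ hγ => ?_⟩, hFF⟩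
  · exact Equivariant.of_dense isConeOpen_cone.1 hsub (cone_subset_closure_compl hf) hF' hFF
      (fun Y hY => smul_mem_compl ha hY) (hasWeight_iff.mp hw a ha)
  · exact Equivariant.of_dense isConeOpen_cone.1 hsub (cone_subset_closure_compl hf) hF' hFF
      (fun Y hY => act_mem_compl hγ hY) (isInvariant_iff.mp hinv γ hγ)

end PeriodDomain

/-! ### Anisotropic ternary sublattices -/

/-- A ternary form which modulo `p` is an anisotropic binary form, and whose third diagonal
coefficient is exactly divisible by `p`, is anisotropic over `ℤ`: infinite descent. -/
lemma eq_zero_of_ternary {p : ℕ} (hp : p.Prime) {a₀₀ a₀₁ a₁₁ a₀₂ a₁₂ a₂₂ : ℤ}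
    (h : ∀ a b : ℤ, (p : ℤ) ∣ a₀₀ * a ^ 2 + 2 * a₀₁ * a * b + a₁₁ * b ^ 2 →
      (p : ℤ) ∣ a ∧ (p : ℤ) ∣ b)
    (h₀ : (p : ℤ) ∣ a₀₂) (h₁ : (p : ℤ) ∣ a₁₂) (h₂ : (p : ℤ) ∣ a₂₂) (h₃ : ¬(p : ℤ) ^ 2 ∣ a₂₂)
    {a b c : ℤ} (habc : a₀₀ * a ^ 2 + 2 * a₀₁ * a * b + a₁₁ * b ^ 2 +
      2 * c * (a₀₂ * a + a₁₂ * b) + a₂₂ * c ^ 2 = 0) : a = 0 ∧ b = 0 ∧ c = 0 := by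
  have hpz : Prime (p : ℤ) := Nat.prime_iff_prime_int.mp hp
  have key : ∀ (N : ℕ) (a b c : ℤ), a₀₀ * a ^ 2 + 2 * a₀₁ * a * b + a₁₁ * b ^ 2 +
      2 * c * (a₀₂ * a + a₁₂ * b) + a₂₂ * c ^ 2 = 0 →
      (p : ℤ) ^ N ∣ a ∧ (p : ℤ) ^ N ∣ b ∧ (p : ℤ) ^ N ∣ c := by
    intro N
    induction N with
    | zero => intro a b c _; simp
    | succ N ih =>
      intro a b c habc
      obtain ⟨e₀, he₀⟩ := h₀
      obtain ⟨e₁, he₁⟩ := h₁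
      obtain ⟨e₂, he₂⟩ := h₂
      obtain ⟨⟨a', rfl⟩, ⟨b', rfl⟩⟩ := h a b ⟨-(2 * c * (e₀ * a + e₁ * b) + e₂ * c ^ 2), by
        rw [he₀, he₁, he₂] at habc; linear_combination habc⟩
      have hp0 : (p : ℤ) ≠ 0 := hpz.ne_zero
      have hc : (p : ℤ) ∣ e₂ * c ^ 2 := by
        refine ⟨-(a₀₀ * a' ^ 2 + 2 * a₀₁ * a' * b' + a₁₁ * b' ^ 2 +
          2 * c * (e₀ * a' + e₁ * b')), ?_⟩
        apply mul_left_cancel₀ hp0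
        rw [he₀, he₁, he₂] at habc
        linear_combination habc
      have he : ¬(p : ℤ) ∣ e₂ := fun ⟨e, he⟩ => h₃ ⟨e, by rw [he₂, he]; ring⟩
      obtain ⟨c', rfl⟩ := hpz.dvd_of_dvd_pow ((hpz.dvd_or_dvd hc).resolve_left he)
      have h' : a₀₀ * a' ^ 2 + 2 * a₀₁ * a' * b' + a₁₁ * b' ^ 2 +
          2 * c' * (a₀₂ * a' + a₁₂ * b') + a₂₂ * c' ^ 2 = 0 := by
        apply mul_left_cancel₀ (pow_ne_zero 2 hp0)
        linear_combination habc
      obtain ⟨ha, hb, hc⟩ := ih a' b' c' h'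
      simp only [pow_succ']
      exact ⟨mul_dvd_mul_left _ ha, mul_dvd_mul_left _ hb, mul_dvd_mul_left _ hc⟩
  have hzero : ∀ z : ℤ, (∀ N : ℕ, (p : ℤ) ^ N ∣ z) → z = 0 := fun z hz => by
    refine Int.eq_zero_of_dvd_of_natAbs_lt_natAbs (hz z.natAbs) ?_
    rw [Int.natAbs_pow, Int.natAbs_natCast]
    exact Nat.lt_pow_self hp.one_lt
  exact ⟨hzero a fun N => (key N a b c habc).1, hzero b fun N => (key N a b c habc).2.1,
    hzero c fun N => (key N a b c habc).2.2⟩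

/-- Binary diagonal forms over finite fields are universal. -/
lemma exists_mul_sq_add_mul_sq {K : Type*} [Field K] [Fintype K] (hK : Fintype.card K % 2 = 1)
    {a b : K} (ha : a ≠ 0) (hb : b ≠ 0) (c : K) : ∃ x y : K, a * x ^ 2 + b * y ^ 2 = c := by
  open Polynomial in
  obtain ⟨x, y, h⟩ := FiniteField.exists_root_sum_quadratic (f := C a * X ^ 2 + C 0 * X + C (-c))
    (g := C b * X ^ 2 + C 0 * X + C 0) (degree_quadratic ha) (degree_quadratic hb) hK
  refine ⟨x, y, ?_⟩
  simp at h
  linear_combination h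

/-- In a regular quadratic space of dimension at least five over a finite field, there are an
anisotropic plane and an isotropic vector orthogonal to it. -/
lemma exists_plane_and_isotropic {K W : Type*} [Field K] [Fintype K] [AddCommGroup W] [Module K W]
    [FiniteDimensional K W] (hK : Fintype.card K % 2 = 1) (h2 : (2 : K) ≠ 0)
    (B : LinearMap.BilinForm K W) (hB : LinearMap.IsSymm B) (hnd : B.Nondegenerate)
    (hdim : 5 ≤ Module.finrank K W) :
    ∃ x y t : W, (∀ a b : K, B x x * a ^ 2 + 2 * B x y * a * b + B y y * b ^ 2 = 0 →
      a = 0 ∧ b = 0) ∧ B x t = 0 ∧ B y t = 0 ∧ B t t = 0 ∧ t ≠ 0 := by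
  have : Invertible (2 : K) := invertibleOfNonzero h2
  obtain ⟨v, hv⟩ := LinearMap.BilinForm.exists_orthogonal_basis hB
  have hself : ∀ i, B (v i) (v i) ≠ 0 :=
    fun i => hv.not_isOrtho_basis_self_of_separatingLeft hnd.1 i
  let e : Fin 5 → W := fun i => v (Fin.castLE hdim i)
  have he : ∀ i, B (e i) (e i) ≠ 0 := fun i => hself _
  have ho : ∀ i j, i ≠ j → B (e i) (e j) = 0 := fun i j hij =>
    hv fun h => hij (Fin.castLE_injective hdim h)
  obtain ⟨ν, hν⟩ : ∃ ν : K, ¬IsSquare ν := FiniteField.exists_nonsquare (by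
    intro h; rw [ringChar.eq_iff] at h
    exact h2 (by have := CharP.cast_eq_zero K 2; exact_mod_cast this))
  have hν0 : ν ≠ 0 := fun h => hν (h ▸ ⟨0, by simp⟩)
  obtain ⟨α, β, hαβ⟩ := exists_mul_sq_add_mul_sq hK (he 1) (he 2) (-(B (e 0) (e 0) * ν))
  obtain ⟨γ, δ, hγδ⟩ := exists_mul_sq_add_mul_sq hK (he 3) (he 4)
    (B (e 1) (e 1) * B (e 2) (e 2) * (B (e 0) (e 0) * ν))
  have h01 := ho 0 1 (by decide)
  have h02 := ho 0 2 (by decide)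
  have h03 := ho 0 3 (by decide)
  have h04 := ho 0 4 (by decide)
  have h12 := ho 1 2 (by decide)
  have h13 := ho 1 3 (by decide)
  have h14 := ho 1 4 (by decide)
  have h21 := ho 2 1 (by decide)
  have h23 := ho 2 3 (by decide)
  have h24 := ho 2 4 (by decide)
  have h31 := ho 3 1 (by decide)
  have h32 := ho 3 2 (by decide)
  have h34 := ho 3 4 (by decide)
  have h41 := ho 4 1 (by decide)
  have h42 := ho 4 2 (by decide)
  have h43 := ho 4 3 (by decide)
  have hyy : B (α • e 1 + β • e 2) (α • e 1 + β • e 2) = -(B (e 0) (e 0) * ν) := by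
    simp only [map_add, map_smul, LinearMap.add_apply, LinearMap.smul_apply, smul_eq_mul, h12, h21]
    linear_combination hαβ
  refine ⟨e 0, α • e 1 + β • e 2,
    (B (e 2) (e 2) * β) • e 1 - (B (e 1) (e 1) * α) • e 2 + γ • e 3 + δ • e 4, ?_, ?_, ?_, ?_, ?_⟩
  · intro a b hab
    rw [hyy] at hab
    have hxy : B (e 0) (α • e 1 + β • e 2) = 0 := by simp [h01, h02]
    rw [hxy] at hab
    have h3 : a ^ 2 = ν * b ^ 2 := mul_left_cancel₀ (he 0) (by linear_combination hab)
    have hb : b = 0 := by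
      by_contra hb
      refine hν ⟨a / b, ?_⟩
      field_simp
      linear_combination -h3
    rw [hb] at h3
    exact ⟨by simpa using h3, hb⟩
  · simp [h01, h02, h03, h04]
  · simp only [map_add, map_sub, map_smul, LinearMap.add_apply, LinearMap.smul_apply, smul_eq_mul,
      h12, h21, h13, h14, h23, h24]
    ring
  · simp only [map_add, map_sub, map_smul, LinearMap.add_apply, LinearMap.sub_apply,
      LinearMap.smul_apply, smul_eq_mul, h12, h21, h13, h14, h23, h24, h31, h32, h34, h41, h42, h43]
    linear_combination hγδ + B (e 1) (e 1) * B (e 2) (e 2) * hαβ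
  · intro h0
    have h1 := congrArg (fun w => B (e 1) w) h0
    have h5 := congrArg (fun w => B (e 2) w) h0
    simp only [map_add, map_sub, map_smul, map_zero, smul_eq_mul, h12, h13, h14] at h1
    simp only [map_add, map_sub, map_smul, map_zero, smul_eq_mul, h21, h23, h24] at h5
    have hβ : β = 0 := by
      have : B (e 1) (e 1) * (B (e 2) (e 2) * β) = 0 := by linear_combination h1
      simpa [he 1, he 2] using this
    have hα : α = 0 := by
      have : B (e 2) (e 2) * (B (e 1) (e 1) * α) = 0 := by linear_combination -h5
      simpa [he 1, he 2] using this
    rw [hα, hβ] at hαβ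
    have : B (e 0) (e 0) * ν = 0 := by linear_combination hαβ
    exact (mul_ne_zero (he 0) hν0) this

namespace EvenLattice

variable {n : ℕ} (M : EvenLattice n)

/-- There are a positive integer `m` and an integral `(n+2) × 3` matrix `P₀` such that the
quadratic form of `M` is anisotropic on the span of the columns of each `P` congruent to `P₀`
modulo `m`. -/
lemma exists_anisotropic_residue (hn : 3 ≤ n) : ∃ (m : ℕ) (P₀ : Matrix (Fin (n + 2)) (Fin 3) ℤ),
    0 < m ∧ ∀ P : Matrix (Fin (n + 2)) (Fin 3) ℤ, (∀ i j, (m : ℤ) ∣ P i j - P₀ i j) →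
      ∀ c : Fin 3 → ℤ, c ⬝ᵥ (P.transpose * M.gram * P).mulVec c = 0 → c = 0 := by
  obtain ⟨p, hpN, hp⟩ := Nat.exists_infinite_primes (M.gram.det.natAbs + 3)
  have hpf : Fact p.Prime := ⟨hp⟩
  have hdet0 : M.gram.det ≠ 0 := fun h => M.gram_det_ne_zero (by
    have h1 : ((M.gram.det : ℤ) : ℂ) = (M.gram.map (Int.cast : ℤ → ℂ)).det := Int.cast_det M.gram
    rw [← h1, h, Int.cast_zero])
  have hdetp : (M.gram.map (Int.cast : ℤ → ZMod p)).det ≠ 0 := by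
    have h1 : ((M.gram.det : ℤ) : ZMod p) = (M.gram.map (Int.cast : ℤ → ZMod p)).det :=
      Int.cast_det M.gram
    rw [← h1, Ne, ZMod.intCast_zmod_eq_zero_iff_dvd]
    intro h
    exact hdet0 (Int.eq_zero_of_dvd_of_natAbs_lt_natAbs h (by rw [Int.natAbs_natCast]; omega))
  set B : LinearMap.BilinForm (ZMod p) (Fin (n + 2) → ZMod p) :=
    Matrix.toBilin' (M.gram.map (Int.cast : ℤ → ZMod p)) with hB
  have hBa : ∀ x y, B x y = x ⬝ᵥ (M.gram.map (Int.cast : ℤ → ZMod p)).mulVec y := fun x y =>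
    Matrix.toBilin'_apply' _ x y
  have hBs : ∀ x y, B x y = B y x := by
    intro x y
    have h : (M.gram.map (Int.cast : ℤ → ZMod p)).IsSymm := M.symm.map _
    rw [hBa, hBa, Matrix.dotProduct_mulVec, ← Matrix.mulVec_transpose, h.eq, dotProduct_comm]
  have hcard : Fintype.card (ZMod p) % 2 = 1 := by
    rw [ZMod.card]
    exact hp.eq_two_or_odd.resolve_left (by omega)
  have h2 : (2 : ZMod p) ≠ 0 := by
    intro h
    have h' : ((2 : ℕ) : ZMod p) = 0 := by exact_mod_cast h
    rw [ZMod.natCast_eq_zero_iff] at h'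
    have := Nat.le_of_dvd two_pos h'
    omega
  obtain ⟨x, y, t, hxy, hxt, hyt, htt, ht⟩ := exists_plane_and_isotropic hcard h2 B ⟨hBs⟩
    (LinearMap.BilinForm.nondegenerate_toBilin'_iff_det_ne_zero.mpr hdetp)
    (by simp only [Module.finrank_fin_fun]; omega)
  -- Lift to integral vectors; `q v w` is the integral pairing.
  have hlift : ∀ x : Fin (n + 2) → ZMod p, ∃ x' : Fin (n + 2) → ℤ, ∀ i, (x' i : ZMod p) = x i :=
    fun x => ⟨fun i => (ZMod.intCast_surjective (x i)).choose,
      fun i => (ZMod.intCast_surjective (x i)).choose_spec⟩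
  set q : LinearMap.BilinForm ℤ (Fin (n + 2) → ℤ) := Matrix.toBilin' M.gram with hq
  have hqa : ∀ v w, q v w = ∑ i, ∑ j, v i * M.gram i j * w j := fun v w =>
    Matrix.toBilin'_apply _ v w
  have hqs : ∀ v w, q v w = q w v := by
    intro v w
    simp only [hq, Matrix.toBilin'_apply']
    rw [Matrix.dotProduct_mulVec, ← Matrix.mulVec_transpose, M.symm.eq, dotProduct_comm]
  have hcast : ∀ v w : Fin (n + 2) → ℤ, ((q v w : ℤ) : ZMod p) =
      B (fun i => (v i : ZMod p)) fun i => (w i : ZMod p) := by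
    intro v w
    rw [hqa, hB, Matrix.toBilin'_apply]
    push_cast
    rfl
  have hdvd : ∀ z : ℤ, (p : ℤ) ∣ z ↔ (z : ZMod p) = 0 := fun z =>
    (ZMod.intCast_zmod_eq_zero_iff_dvd z p).symm
  obtain ⟨x', hx'⟩ := hlift x
  obtain ⟨y', hy'⟩ := hlift y
  obtain ⟨t', ht'⟩ := hlift t
  obtain ⟨w', hw'⟩ : ∃ w' : Fin (n + 2) → ℤ, ¬(p : ℤ) ∣ q t' w' := by
    by_contra hcon
    push Not at hcon
    refine ht
      ((LinearMap.BilinForm.nondegenerate_toBilin'_iff_det_ne_zero.mpr hdetp).1 t fun w => ?_)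
    obtain ⟨w', hw'⟩ := hlift w
    have h1 := (hdvd _).mp (hcon w')
    rw [hcast] at h1
    simpa only [ht', hw'] using h1
  have hp2 : ¬(p : ℤ) ∣ 2 := by
    rw [hdvd]; exact_mod_cast h2
  have hpz : Prime (p : ℤ) := Nat.prime_iff_prime_int.mp hp
  -- Changing `t` modulo `p` makes its norm exactly divisible by `p`.
  obtain ⟨t'', ht'', htt''⟩ : ∃ t'' : Fin (n + 2) → ℤ, (∀ i, (t'' i : ZMod p) = t i) ∧
      ¬(p : ℤ) ^ 2 ∣ q t'' t'' := by
    by_cases hcase : (p : ℤ) ^ 2 ∣ q t' t'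
    · refine ⟨t' + (p : ℤ) • w', fun i => by simp [ht'], fun h => ?_⟩
      have h1 : q (t' + (p : ℤ) • w') (t' + (p : ℤ) • w') =
          q t' t' + (p : ℤ) * (2 * q t' w') + (p : ℤ) ^ 2 * q w' w' := by
        simp only [map_add, map_smul, LinearMap.add_apply, LinearMap.smul_apply, smul_eq_mul,
          hqs w' t']
        ring
      have h3 : (p : ℤ) ^ 2 ∣ (p : ℤ) * (2 * q t' w') := by
        have h4 : (p : ℤ) * (2 * q t' w') = q (t' + (p : ℤ) • w') (t' + (p : ℤ) • w') - q t' t' -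
            (p : ℤ) ^ 2 * q w' w' := by rw [h1]; ring
        rw [h4]
        exact dvd_sub (dvd_sub h hcase) (dvd_mul_right _ _)
      rw [pow_two] at h3
      exact (hpz.dvd_or_dvd ((mul_dvd_mul_iff_left hpz.ne_zero).mp h3)).elim hp2 hw'
    · exact ⟨t', ht', hcase⟩
  refine ⟨p ^ 2, fun i => ![x' i, y' i, t'' i], pow_pos hp.pos 2, fun P hP c hc => ?_⟩
  have hcol : ∀ (j : Fin 3) (v : Fin (n + 2) → ℤ),
      (∀ i, (![x' i, y' i, t'' i] : Fin 3 → ℤ) j = v i) →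
      ∃ r : Fin (n + 2) → ℤ, (fun i => P i j) = v + ((p : ℤ) ^ 2) • r := by
    intro j v hv
    choose r hr using fun i => hP i j
    refine ⟨r, funext fun i => ?_⟩
    have : P i j - (![x' i, y' i, t'' i] : Fin 3 → ℤ) j = _ := hr i
    rw [hv i] at this
    push_cast at this
    simp only [Pi.add_apply, Pi.smul_apply, smul_eq_mul]
    linarith
  obtain ⟨r₀, hr₀⟩ := hcol 0 x' fun i => rfl
  obtain ⟨r₁, hr₁⟩ := hcol 1 y' fun i => rfl
  obtain ⟨r₂, hr₂⟩ := hcol 2 t'' fun i => rfl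
  have hmod : ∀ (j : Fin 3) (v r : Fin (n + 2) → ℤ) (w : Fin (n + 2) → ZMod p),
      (fun i => P i j) = v + ((p : ℤ) ^ 2) • r → (∀ i, (v i : ZMod p) = w i) →
      (fun i => ((P i j : ℤ) : ZMod p)) = w := by
    intro j v r w h hv
    funext i
    have := congrFun h i
    simp only [Pi.add_apply, Pi.smul_apply, smul_eq_mul] at this
    rw [this]
    simp [hv]
  have hm0 := hmod 0 x' r₀ x hr₀ hx'
  have hm1 := hmod 1 y' r₁ y hr₁ hy'
  have hm2 := hmod 2 t'' r₂ t hr₂ ht''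
  have hsum : c ⬝ᵥ (P.transpose * M.gram * P).mulVec c =
      q (∑ j, c j • fun i => P i j) (∑ j, c j • fun i => P i j) := by
    have h1 : (∑ j, c j • fun i => P i j) = P.mulVec c := by
      funext i
      simp [Matrix.mulVec, dotProduct, mul_comm]
    rw [h1, hq, Matrix.toBilin'_apply', ← Matrix.mulVec_mulVec, ← Matrix.mulVec_mulVec,
      Matrix.dotProduct_mulVec, Matrix.vecMul_transpose]
  rw [hsum] at hc
  simp only [Fin.sum_univ_three, map_add, map_smul, LinearMap.add_apply, LinearMap.smul_apply,
    smul_eq_mul] at hc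
  have hres := eq_zero_of_ternary hp (a₀₀ := q (fun i => P i 0) fun i => P i 0)
    (a₀₁ := q (fun i => P i 0) fun i => P i 1) (a₁₁ := q (fun i => P i 1) fun i => P i 1)
    (a₀₂ := q (fun i => P i 0) fun i => P i 2) (a₁₂ := q (fun i => P i 1) fun i => P i 2)
    (a₂₂ := q (fun i => P i 2) fun i => P i 2) (a := c 0) (b := c 1) (c := c 2) ?_ ?_ ?_ ?_ ?_ ?_
  · funext j
    fin_cases j
    exacts [hres.1, hres.2.1, hres.2.2]
  · intro a b hab
    rw [hdvd] at hab
    push_cast at hab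
    rw [hcast, hcast, hcast, hm0, hm1] at hab
    have := hxy a b hab
    rwa [hdvd, hdvd]
  · rw [hdvd, hcast, hm0, hm2, hxt]
  · rw [hdvd, hcast, hm1, hm2, hyt]
  · rw [hdvd, hcast, hm2, htt]
  · rw [hr₂]
    intro h
    refine htt'' ?_
    have h1 : q t'' t'' = q (t'' + ((p : ℤ) ^ 2) • r₂) (t'' + ((p : ℤ) ^ 2) • r₂) -
        (p : ℤ) ^ 2 * (2 * q t'' r₂ + (p : ℤ) ^ 2 * q r₂ r₂) := by
      simp only [map_add, map_smul, LinearMap.add_apply, LinearMap.smul_apply, smul_eq_mul,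
        hqs r₂ t'']
      ring
    rw [h1]
    exact dvd_sub h (dvd_mul_right _ _)
  · rw [hqs (fun i => P i 1) fun i => P i 0, hqs (fun i => P i 2) fun i => P i 0,
      hqs (fun i => P i 2) fun i => P i 1] at hc
    linear_combination hc

end EvenLattice

open MeasureTheory in
/-- Minkowski's theorem for thin boxes: if `T ℤ³` has no nonzero vector of length less than `1`,
then it contains three independent vectors whose size is bounded in terms of the covolume. -/
lemma exists_bounded_integral_matrix (T : Matrix (Fin 3) (Fin 3) ℝ) {R : ℝ} (hdet : T.det ≠ 0)
    (hR : 9 * |T.det| < R) (hR1 : 1 ≤ R)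
    (hT : ∀ c : Fin 3 → ℤ, c ≠ 0 → 1 ≤ ∑ i, (T.mulVec fun j => (c j : ℝ)) i ^ 2) :
    ∃ b : Matrix (Fin 3) (Fin 3) ℤ, b.det ≠ 0 ∧
      ∀ i j, |(T * b.map (Int.cast : ℤ → ℝ)) i j| ≤ R := by
  -- A lattice vector in the box of half-sides `R` in the direction `k` and `1/3` in the others.
  have hbox : ∀ k : Fin 3, ∃ c : Fin 3 → ℤ, c ≠ 0 ∧ ∀ i,
      |(T.mulVec fun j => (c j : ℝ)) i| ≤ if i = k then R else 1 / 3 := by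
    intro k
    set ρ : Fin 3 → ℝ := fun i => if i = k then R else 1 / 3 with hρ
    have hρ0 : ∀ i, 0 ≤ ρ i := fun i => by
      simp only [hρ]; split_ifs <;> linarith
    set Q : Set (Fin 3 → ℝ) := Set.pi Set.univ fun i => Set.Icc (-ρ i) (ρ i) with hQ
    set L := Matrix.toLin' T with hL
    have hLdet : LinearMap.det L ≠ 0 := by rwa [hL, LinearMap.det_toLin']
    have hvol : volume Q = ENNReal.ofReal (8 * R / 9) := by
      rw [hQ, volume_pi, Measure.pi_pi]
      simp only [Real.volume_Icc]
      rw [← ENNReal.ofReal_prod_of_nonneg fun i _ => by linarith [hρ0 i]]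
      congr 1
      fin_cases k <;> simp [Fin.prod_univ_three, hρ] <;> ring
    have hfund := ZSpan.isAddFundamentalDomain' (Pi.basisFun ℝ (Fin 3)) volume
    have hF : volume (ZSpan.fundamentalDomain (Pi.basisFun ℝ (Fin 3))) = 1 := by
      rw [ZSpan.fundamentalDomain_pi_basisFun, volume_pi, Measure.pi_pi]
      simp
    have : Countable (Submodule.span ℤ (Set.range (Pi.basisFun ℝ (Fin 3)))).toAddSubgroup :=
      inferInstanceAs (Countable (Submodule.span ℤ (Set.range (Pi.basisFun ℝ (Fin 3)))))
    obtain ⟨x, hx0, hx⟩ := exists_ne_zero_mem_lattice_of_measure_mul_two_pow_lt_measure hfund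
      (s := L ⁻¹' Q) (fun x hx => by
        simp only [Set.mem_preimage, hQ, Set.mem_univ_pi, Set.mem_Icc, map_neg, Pi.neg_apply]
          at hx ⊢
        exact fun i => ⟨by linarith [(hx i).2], by linarith [(hx i).1]⟩)
      ((convex_pi fun i _ => convex_Icc _ _).linear_preimage L) (by
        rw [hF, one_mul, Measure.addHaar_preimage_linearMap volume hLdet, hvol,
          ← ENNReal.ofReal_mul (abs_nonneg _), hL, LinearMap.det_toLin', abs_inv,
          Module.finrank_fin_fun]
        have h8 : (2 : ENNReal) ^ 3 = ENNReal.ofReal 8 := by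
          rw [show (8 : ℝ) = 2 ^ 3 by norm_num, ENNReal.ofReal_pow (by norm_num)]
          simp
        rw [h8]
        refine (ENNReal.ofReal_lt_ofReal_iff_of_nonneg (by norm_num)).mpr ?_
        have hpos := abs_pos.mpr hdet
        rw [inv_mul_eq_div, lt_div_iff₀ hpos]
        linarith)
    obtain ⟨c, hc⟩ := (Submodule.mem_span_range_iff_exists_fun ℤ).mp
      (show (x : Fin 3 → ℝ) ∈ Submodule.span ℤ (Set.range (Pi.basisFun ℝ (Fin 3))) from x.2)
    have hxc : (x : Fin 3 → ℝ) = fun j => (c j : ℝ) := by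
      rw [← hc]
      funext j
      simp [Finset.sum_apply, Pi.single_apply]
    refine ⟨c, fun h0 => hx0 (Subtype.ext ?_), fun i => ?_⟩
    · rw [hxc, h0]
      funext j
      simp
    · rw [← hxc]
      exact abs_le.mpr (hx i trivial)
  choose c hc0 hc using hbox
  refine ⟨Matrix.of fun i k => c k i, ?_, fun i k => ?_⟩
  · have hent : ∀ i k, (T * (Matrix.of fun i k => c k i).map (Int.cast : ℤ → ℝ)) i k =
        (T.mulVec fun j => (c k j : ℝ)) i := fun i k => rfl
    have h1 : (T * (Matrix.of fun i k => c k i).map (Int.cast : ℤ → ℝ)).det ≠ 0 := by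
      refine det_ne_zero_of_sum_col_lt_diag fun k => ?_
      simp only [hent, Real.norm_eq_abs]
      have h2 := hT (c k) (hc0 k)
      have hk := fun i => hc k i
      have hsmall : ∀ i, i ≠ k → |(T.mulVec fun j => (c k j : ℝ)) i| ≤ 1 / 3 := fun i hi => by
        have := hk i; rwa [if_neg hi] at this
      have hsq : ∀ i, i ≠ k → (T.mulVec fun j => (c k j : ℝ)) i ^ 2 ≤ 1 / 9 := fun i hi => by
        rw [← sq_abs]
        nlinarith [hsmall i hi, abs_nonneg ((T.mulVec fun j => (c k j : ℝ)) i)]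
      rw [← Finset.add_sum_erase _ _ (Finset.mem_univ k)] at h2
      have hcard : (Finset.univ.erase k : Finset (Fin 3)).card = 2 := by
        rw [Finset.card_erase_of_mem (Finset.mem_univ k)]; rfl
      have h3 : ∑ i ∈ Finset.univ.erase k, (T.mulVec fun j => (c k j : ℝ)) i ^ 2 ≤ 2 * (1 / 9) := by
        have := Finset.sum_le_card_nsmul (Finset.univ.erase k) _ _
          fun i hi => hsq i (Finset.ne_of_mem_erase hi)
        simpa [hcard] using this
      have h4 : ∑ i ∈ Finset.univ.erase k, |(T.mulVec fun j => (c k j : ℝ)) i| ≤ 2 * (1 / 3) := by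
        have := Finset.sum_le_card_nsmul (Finset.univ.erase k) _ _
          fun i hi => hsmall i (Finset.ne_of_mem_erase hi)
        simpa [hcard] using this
      refine lt_of_le_of_lt h4 ?_
      by_contra hcon
      push Not at hcon
      rw [← sq_abs] at h2
      nlinarith [abs_nonneg ((T.mulVec fun j => (c k j : ℝ)) k)]
    intro h0
    refine h1 ?_
    rw [Matrix.det_mul, ← Int.cast_det, h0, Int.cast_zero, mul_zero]
  · change |(T.mulVec fun j => (c k j : ℝ)) i| ≤ R
    refine (hc k i).trans ?_
    split_ifs <;> linarith

/-- The standard form of signature `(2,1)`. -/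
def lorentz : Matrix (Fin 3) (Fin 3) ℝ := Matrix.diagonal ![1, 1, -1]

lemma det_lorentz : lorentz.det = -1 := by
  rw [lorentz, Matrix.det_diagonal, Fin.prod_univ_three]
  simp

lemma dotProduct_lorentz (x : Fin 3 → ℝ) : x ⬝ᵥ lorentz.mulVec x = x 0 ^ 2 + x 1 ^ 2 - x 2 ^ 2 := by
  simp only [lorentz, Matrix.mulVec_diagonal, dotProduct, Fin.sum_univ_three]
  simp
  ring

/-- Reduction theory of anisotropic ternary forms: each orthonormal frame `S` of the form `A` is
at bounded distance from a rational frame. -/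
lemma exists_bounded_inv_mul {A : Matrix (Fin 3) (Fin 3) ℤ}
    (hA : ∀ c : Fin 3 → ℤ, c ⬝ᵥ A.mulVec c = 0 → c = 0) : ∃ R : ℝ,
      ∀ S : Matrix (Fin 3) (Fin 3) ℝ, S.transpose * A.map (Int.cast : ℤ → ℝ) * S = lorentz →
        ∃ b : Matrix (Fin 3) (Fin 3) ℤ, b.det ≠ 0 ∧
          ∀ i j, |(S⁻¹ * b.map (Int.cast : ℤ → ℝ)) i j| ≤ R := by
  set Ar := A.map (Int.cast : ℤ → ℝ) with hAr
  refine ⟨9 * (1 + |Ar.det|) + 1, fun S hS => ?_⟩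
  have hdet : S.det * Ar.det * S.det = -1 := by
    rw [← det_lorentz, ← hS, Matrix.det_mul, Matrix.det_mul, Matrix.det_transpose]
  have hS0 : S.det ≠ 0 := fun h => by rw [h] at hdet; norm_num at hdet
  have hu : IsUnit S.det := isUnit_iff_ne_zero.mpr hS0
  have hT : S⁻¹.transpose * lorentz * S⁻¹ = Ar := by
    have h1 : S⁻¹.transpose * S.transpose = 1 := by
      rw [← Matrix.transpose_mul, Matrix.mul_nonsing_inv _ hu, Matrix.transpose_one]
    calc S⁻¹.transpose * lorentz * S⁻¹ = (S⁻¹.transpose * S.transpose) * Ar * (S * S⁻¹) := by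
          rw [← hS]; simp only [Matrix.mul_assoc]
      _ = Ar := by rw [h1, Matrix.mul_nonsing_inv _ hu, Matrix.one_mul, Matrix.mul_one]
  have hdetT : S⁻¹.det ^ 2 = |Ar.det| := by
    have h1 : S⁻¹.det * -1 * S⁻¹.det = Ar.det := by
      rw [← hT, Matrix.det_mul, Matrix.det_mul, Matrix.det_transpose, det_lorentz]
    rw [← h1, show S⁻¹.det * -1 * S⁻¹.det = -(S⁻¹.det ^ 2) by ring, abs_neg,
      abs_of_nonneg (sq_nonneg _)]
  refine exists_bounded_integral_matrix S⁻¹ ?_ ?_ ?_ fun c hc => ?_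
  · rw [Matrix.det_nonsing_inv, Ring.inverse_eq_inv']
    exact inv_ne_zero hS0
  · have h2 : |S⁻¹.det| ≤ 1 + |Ar.det| := by
      rw [← hdetT]
      nlinarith [sq_abs S⁻¹.det, sq_nonneg (|S⁻¹.det| - 1), abs_nonneg S⁻¹.det]
    linarith
  · linarith [abs_nonneg Ar.det]
  · set x := S⁻¹.mulVec fun j => (c j : ℝ) with hx
    have h1 : x ⬝ᵥ lorentz.mulVec x = ((c ⬝ᵥ A.mulVec c : ℤ) : ℝ) := by
      have h2 : x ⬝ᵥ lorentz.mulVec x = (fun j => (c j : ℝ)) ⬝ᵥ Ar.mulVec fun j => (c j : ℝ) := by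
        rw [← hT, ← Matrix.mulVec_mulVec, ← Matrix.mulVec_mulVec, Matrix.dotProduct_mulVec _ _
          (lorentz.mulVec _), Matrix.vecMul_transpose]
      rw [h2]
      simp [dotProduct, Matrix.mulVec, hAr]
    have h2 : (1 : ℝ) ≤ |x ⬝ᵥ lorentz.mulVec x| := by
      rw [h1, ← Int.cast_abs]
      exact_mod_cast Int.one_le_abs fun h => hc (hA c h)
    rw [dotProduct_lorentz] at h2
    rw [Fin.sum_univ_three]
    refine h2.trans (abs_le.mpr ⟨?_, ?_⟩) <;> nlinarith [sq_nonneg (x 0), sq_nonneg (x 1),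
      sq_nonneg (x 2)]

lemma exists_eventually_eq_of_finite {α : Type*} [Finite α] (U : Ultrafilter ℕ) (g : ℕ → α) :
    ∃ a, ∀ᶠ j in (U : Filter ℕ), g j = a := by
  by_contra hcon
  push Not at hcon
  obtain ⟨j, hj⟩ := (Filter.eventually_all.mpr hcon).exists
  exact hj (g j) rfl

namespace EvenLattice

variable {n : ℕ} (M : EvenLattice n)

/-- The vector of the span of the columns of `P` with the complex coordinates `c` in the real
frame `S`. -/
def frameVec (P : Matrix (Fin (n + 2)) (Fin 3) ℤ) (S : Matrix (Fin 3) (Fin 3) ℝ) (c : Fin 3 → ℂ) :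
    V n :=
  (P.map (Int.cast : ℤ → ℂ)).mulVec ((S.map Complex.ofReal).mulVec c)

/-- `S` is an orthonormal frame, of signature `(2,1)`, of the span of the columns of `P`. -/
def IsFrame (P : Matrix (Fin (n + 2)) (Fin 3) ℤ) (S : Matrix (Fin 3) (Fin 3) ℝ) : Prop :=
  S.transpose * (P.transpose * M.gram * P).map (Int.cast : ℤ → ℝ) * S = lorentz

variable {M} {P : Matrix (Fin (n + 2)) (Fin 3) ℤ} {S : Matrix (Fin 3) (Fin 3) ℝ}

lemma continuous_frameVec (P : Matrix (Fin (n + 2)) (Fin 3) ℤ) (c : Fin 3 → ℂ) :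
    Continuous fun S => frameVec P S c := by
  unfold frameVec
  fun_prop

lemma star_frameVec (c : Fin 3 → ℂ) : star (frameVec P S c) = frameVec P S (star c) := by
  funext i
  simp only [frameVec, Matrix.mulVec, dotProduct, Pi.star_apply, star_sum, star_mul',
    Matrix.map_apply]
  simp

lemma pair_eq_dotProduct (x y : V n) :
    M.pair x y = x ⬝ᵥ (M.gram.map (Int.cast : ℤ → ℂ)).mulVec y := by
  rw [pair, Matrix.toBilin'_apply']

lemma pair_frameVec (hS : M.IsFrame P S) (c d : Fin 3 → ℂ) :
    M.pair (frameVec P S c) (frameVec P S d) = c 0 * d 0 + c 1 * d 1 - c 2 * d 2 := by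
  have h1 : (S.map Complex.ofReal).transpose * ((P.map (Int.cast : ℤ → ℂ)).transpose *
      M.gram.map (Int.cast : ℤ → ℂ) * P.map (Int.cast : ℤ → ℂ)) * S.map Complex.ofReal =
        lorentz.map Complex.ofReal := by
    rw [← hS]
    ext i j
    simp [Matrix.mul_apply]
  have h2 : M.pair (frameVec P S c) (frameVec P S d) =
      c ⬝ᵥ (lorentz.map Complex.ofReal).mulVec d := by
    rw [← h1, pair_eq_dotProduct, frameVec, frameVec]
    simp only [← Matrix.mulVec_mulVec]
    rw [Matrix.dotProduct_mulVec c, Matrix.vecMul_transpose,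
      Matrix.dotProduct_mulVec _ (P.map (Int.cast : ℤ → ℂ)).transpose, Matrix.vecMul_transpose]
  rw [h2]
  simp [lorentz, Matrix.mulVec, dotProduct, Fin.sum_univ_three, Matrix.diagonal_apply]
  ring

lemma frameVec_mem_isotropicPositive (hS : M.IsFrame P S) :
    frameVec P S ![1, Complex.I, 0] ∈ M.isotropicPositive := by
  refine ⟨?_, ?_⟩
  · rw [pair_frameVec hS]
    simp
  · rw [star_frameVec, pair_frameVec hS]
    simp

/-- Two rational frames of the span of the columns of `P` with equal Gram matrices, which are
congruent to a sufficiently high modulus, are related by an integral isometry which fixes the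
orthogonal complement. -/
lemma exists_isometry_of_congruent {b b₀ : Matrix (Fin 3) (Fin 3) ℤ}
    (hdet : ((P.transpose * M.gram * P) * b₀).det ≠ 0)
    (hgram : b.transpose * (P.transpose * M.gram * P) * b =
      b₀.transpose * (P.transpose * M.gram * P) * b₀)
    (hmod : ∀ i j, ((P.transpose * M.gram * P) * b₀).det ∣ b i j - b₀ i j) :
    ∃ γ : GL (Fin (n + 2)) ℤ, (γ : Matrix (Fin (n + 2)) (Fin (n + 2)) ℤ).transpose * M.gram * γ =
      M.gram ∧ (γ : Matrix (Fin (n + 2)) (Fin (n + 2)) ℤ) * (P * b₀) = P * b ∧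
      ∀ q : V n, (∀ c, M.pair ((P.map (Int.cast : ℤ → ℂ)).mulVec c) q = 0) →
        PeriodDomain.act γ q = q := by
  set A := P.transpose * M.gram * P with hA
  choose X hX using hmod
  have hbX : b - b₀ = (A * b₀).det • Matrix.of X := by
    ext i j
    simp [hX i j]
  have hAt : A.transpose = A := by
    rw [hA, Matrix.transpose_mul, Matrix.transpose_mul, Matrix.transpose_transpose, M.symm.eq,
      Matrix.mul_assoc]
  set Y := Matrix.of X * (A * b₀).adjugate with hY
  have hYb : Y * (A * b₀) = b - b₀ := by
    rw [hY, Matrix.mul_assoc, Matrix.adjugate_mul, hbX, Matrix.mul_smul, Matrix.mul_one]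
  have hE : Y.transpose + Y + Y.transpose * A * Y = 0 := by
    set E := Y.transpose + Y + Y.transpose * A * Y with hEdef
    have h1 : (A * b₀).transpose * E * (A * b₀) = 0 := by
      have h2 : (A * b₀).transpose * Y.transpose = b.transpose - b₀.transpose := by
        rw [← Matrix.transpose_mul, hYb, Matrix.transpose_sub]
      have h3 : (A * b₀).transpose = b₀.transpose * A := by rw [Matrix.transpose_mul, hAt]
      calc (A * b₀).transpose * E * (A * b₀) = ((A * b₀).transpose * Y.transpose) * (A * b₀) +
            (A * b₀).transpose * (Y * (A * b₀)) +
            ((A * b₀).transpose * Y.transpose) * A * (Y * (A * b₀)) := by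
            rw [hEdef]
            simp only [Matrix.mul_add, Matrix.add_mul, Matrix.mul_assoc]
        _ = b.transpose * A * b - b₀.transpose * A * b₀ := by
            rw [h2, hYb, h3]
            simp only [Matrix.mul_sub, Matrix.sub_mul, Matrix.mul_assoc]
            abel
        _ = 0 := by rw [hgram, sub_self]
    have h4 : (A * b₀).transpose.adjugate * ((A * b₀).transpose * E * (A * b₀)) *
        (A * b₀).adjugate = ((A * b₀).det * (A * b₀).det) • E := by
      calc _ = ((A * b₀).transpose.adjugate * (A * b₀).transpose) * E *
            ((A * b₀) * (A * b₀).adjugate) := by simp only [Matrix.mul_assoc]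
        _ = _ := by
            rw [Matrix.adjugate_mul, Matrix.mul_adjugate, Matrix.det_transpose, Matrix.smul_mul,
              Matrix.one_mul, Matrix.mul_smul, Matrix.mul_one, smul_smul]
    rw [h1, Matrix.mul_zero, Matrix.zero_mul] at h4
    exact (smul_eq_zero.mp h4.symm).resolve_left (mul_ne_zero hdet hdet)
  set γ₀ : Matrix (Fin (n + 2)) (Fin (n + 2)) ℤ := 1 + P * Y * P.transpose * M.gram with hγ₀
  have hiso : γ₀.transpose * M.gram * γ₀ = M.gram := by
    have h1 : γ₀.transpose = 1 + M.gram * P * Y.transpose * P.transpose := by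
      rw [hγ₀, Matrix.transpose_add, Matrix.transpose_one]
      simp only [Matrix.transpose_mul, Matrix.transpose_transpose, M.symm.eq, Matrix.mul_assoc]
    calc γ₀.transpose * M.gram * γ₀ = M.gram + M.gram * P *
          (Y.transpose + Y + Y.transpose * A * Y) * (P.transpose * M.gram) := by
          rw [h1, hγ₀, hA]
          simp only [Matrix.mul_add, Matrix.add_mul, Matrix.mul_one, Matrix.one_mul,
            Matrix.mul_assoc]
          abel
      _ = M.gram := by rw [hE, Matrix.mul_zero, Matrix.zero_mul, add_zero]
  have hunit : IsUnit γ₀.det := by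
    have hG : M.gram.det ≠ 0 := fun h => M.gram_det_ne_zero (by
      have h1 : ((M.gram.det : ℤ) : ℂ) = (M.gram.map (Int.cast : ℤ → ℂ)).det := Int.cast_det M.gram
      rw [← h1, h, Int.cast_zero])
    have h1 := congrArg Matrix.det hiso
    rw [Matrix.det_mul, Matrix.det_mul, Matrix.det_transpose] at h1
    exact IsUnit.of_mul_eq_one γ₀.det (mul_left_cancel₀ hG (by linear_combination h1))
  refine ⟨Matrix.GeneralLinearGroup.mk'' γ₀ hunit, hiso, ?_, fun q hq => ?_⟩
  · change γ₀ * (P * b₀) = P * b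
    have : γ₀ * (P * b₀) = P * (b₀ + Y * (A * b₀)) := by
      rw [hγ₀, hA]
      simp only [Matrix.mul_add, Matrix.add_mul, Matrix.one_mul, Matrix.mul_assoc]
    rw [this, hYb, add_sub_cancel]
  · change (γ₀.map (Int.cast : ℤ → ℂ)).mulVec q = q
    have h1 : γ₀.map (Int.cast : ℤ → ℂ) = 1 + P.map (Int.cast : ℤ → ℂ) * Y.map (Int.cast : ℤ → ℂ) *
        ((P.map (Int.cast : ℤ → ℂ)).transpose * M.gram.map (Int.cast : ℤ → ℂ)) := by
      ext i j
      simp [hγ₀, Matrix.mul_apply, Matrix.one_apply, Matrix.mul_assoc]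
    have h2 : ((P.map (Int.cast : ℤ → ℂ)).transpose * M.gram.map (Int.cast : ℤ → ℂ)).mulVec q =
        0 := by
      funext j
      have h3 := hq (Pi.single j 1)
      rw [pair_eq_dotProduct, ← Matrix.vecMul_transpose, ← Matrix.dotProduct_mulVec,
        single_one_dotProduct, Matrix.mulVec_mulVec] at h3
      exact h3
    rw [h1, Matrix.add_mulVec, Matrix.one_mulVec, ← Matrix.mulVec_mulVec, h2, Matrix.mulVec_zero,
      add_zero]

end EvenLattice

/-! ### Compactness of the quotient of the frames -/

namespace PeriodDomain

open EvenLattice Filter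

variable {n : ℕ} {D : PeriodDomain n}

section Components

variable {γ : GL (Fin (n + 2)) ℤ}

lemma pair_act_of_isometry (hγ : (γ : Matrix (Fin (n + 2)) (Fin (n + 2)) ℤ).transpose * D.gram * γ =
    D.gram) (x y : V n) : D.pair (act γ x) (act γ y) = D.pair x y := by
  have h : ((γ : Matrix (Fin (n + 2)) (Fin (n + 2)) ℤ).map (Int.cast : ℤ → ℂ)).transpose *
      D.gram.map (Int.cast : ℤ → ℂ) * (γ : Matrix (Fin (n + 2)) (Fin (n + 2)) ℤ).map
        (Int.cast : ℤ → ℂ) = D.gram.map (Int.cast : ℤ → ℂ) := by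
    conv_rhs => rw [← hγ]
    ext i j
    simp [Matrix.mul_apply]
  have h2 : x ⬝ᵥ (D.gram.map (Int.cast : ℤ → ℂ)).mulVec y = x ⬝ᵥ
      (((γ : Matrix (Fin (n + 2)) (Fin (n + 2)) ℤ).map (Int.cast : ℤ → ℂ)).transpose *
        D.gram.map (Int.cast : ℤ → ℂ) * (γ : Matrix (Fin (n + 2)) (Fin (n + 2)) ℤ).map
          (Int.cast : ℤ → ℂ)).mulVec y := by rw [h]
  rw [pair_eq_dotProduct, pair_eq_dotProduct, act, act, h2, ← Matrix.mulVec_mulVec,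
    ← Matrix.mulVec_mulVec, Matrix.dotProduct_mulVec x, Matrix.vecMul_transpose]

lemma star_act (γ : GL (Fin (n + 2)) ℤ) (x : V n) : star (act γ x) = act γ (star x) := by
  funext i
  simp [act, Matrix.mulVec, dotProduct, star_sum]

lemma act_inv_act (γ : GL (Fin (n + 2)) ℤ) (x : V n) : act γ⁻¹ (act γ x) = x := by
  rw [← act_mul, inv_mul_cancel, act_one]

lemma act_act_inv (γ : GL (Fin (n + 2)) ℤ) (x : V n) : act γ (act γ⁻¹ x) = x := by
  rw [← act_mul, mul_inv_cancel, act_one]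

lemma continuous_act (γ : GL (Fin (n + 2)) ℤ) : Continuous (act γ : V n → V n) := by
  unfold act
  fun_prop

/-- An integral isometry which maps a point to the cone maps its whole component to the cone. -/
lemma act_mem_cone_of_mem_component
    (hγ : (γ : Matrix (Fin (n + 2)) (Fin (n + 2)) ℤ).transpose * D.gram * γ = D.gram) {z z' : V n}
    (hz : z ∈ D.isotropicPositive) (hz' : z' ∈ connectedComponentIn D.isotropicPositive z)
    (h : act γ z ∈ D.cone) : act γ z' ∈ D.cone := by
  have hsub : act γ '' connectedComponentIn D.isotropicPositive z ⊆ D.isotropicPositive := by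
    rintro _ ⟨y, hy, rfl⟩
    have hyQ := connectedComponentIn_subset _ _ hy
    refine ⟨?_, ?_⟩
    · rw [pair_act_of_isometry hγ]; exact hyQ.1
    · rw [star_act, pair_act_of_isometry hγ]; exact hyQ.2
  have h1 := (isPreconnected_connectedComponentIn.image _
    (continuous_act γ).continuousOn).subset_connectedComponentIn
      (Set.mem_image_of_mem _ (mem_connectedComponentIn hz)) hsub
  have h2 : D.cone = connectedComponentIn D.isotropicPositive (act γ z) := connectedComponentIn_eq h
  rw [h2]
  exact h1 (Set.mem_image_of_mem _ hz')

lemma mem_orthogonalGroup_of_act_mem_cone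
    (hγ : (γ : Matrix (Fin (n + 2)) (Fin (n + 2)) ℤ).transpose * D.gram * γ = D.gram) {z : V n}
    (hz : z ∈ D.cone) (h : act γ z ∈ D.cone) : γ ∈ D.orthogonalGroup := by
  have hγ' : ((γ⁻¹ : GL (Fin (n + 2)) ℤ) : Matrix (Fin (n + 2)) (Fin (n + 2)) ℤ).transpose *
      D.gram * ((γ⁻¹ : GL (Fin (n + 2)) ℤ) : Matrix (Fin (n + 2)) (Fin (n + 2)) ℤ) = D.gram := by
    have h1 : (γ : Matrix (Fin (n + 2)) (Fin (n + 2)) ℤ) * (γ⁻¹ : GL (Fin (n + 2)) ℤ) = 1 := by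
      rw [← Units.val_mul, mul_inv_cancel, Units.val_one]
    have h2 : ((γ⁻¹ : GL (Fin (n + 2)) ℤ) : Matrix (Fin (n + 2)) (Fin (n + 2)) ℤ).transpose *
        (γ : Matrix (Fin (n + 2)) (Fin (n + 2)) ℤ).transpose = 1 := by
      rw [← Matrix.transpose_mul, h1, Matrix.transpose_one]
    conv_lhs => rw [← hγ]
    calc _ = (((γ⁻¹ : GL (Fin (n + 2)) ℤ) : Matrix (Fin (n + 2)) (Fin (n + 2)) ℤ).transpose *
        (γ : Matrix (Fin (n + 2)) (Fin (n + 2)) ℤ).transpose) * D.gram *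
          ((γ : Matrix (Fin (n + 2)) (Fin (n + 2)) ℤ) * (γ⁻¹ : GL (Fin (n + 2)) ℤ)) := by
          simp only [Matrix.mul_assoc]
      _ = D.gram := by rw [h1, h2, Matrix.one_mul, Matrix.mul_one]
  have hcomp : ∀ {z : V n}, z ∈ D.cone → D.cone = connectedComponentIn D.isotropicPositive z :=
    fun hz => connectedComponentIn_eq hz
  refine ⟨hγ, Set.Subset.antisymm ?_ fun y hy => ⟨act γ⁻¹ y, ?_, act_act_inv γ y⟩⟩
  · rintro _ ⟨y, hy, rfl⟩
    exact act_mem_cone_of_mem_component hγ (isConeOpen_cone.1 hz) (hcomp hz ▸ hy) h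
  · refine act_mem_cone_of_mem_component hγ' (isConeOpen_cone.1 h) (hcomp h ▸ hy) ?_
    rw [act_inv_act]
    exact hz

end Components

section Maximum

variable (D) in
/-- The frames of the span of the columns of `P` which define points of the cone. -/
def frames (P : Matrix (Fin (n + 2)) (Fin 3) ℤ) : Set (Matrix (Fin 3) (Fin 3) ℝ) :=
  {S | D.IsFrame P S ∧ frameVec P S ![1, Complex.I, 0] ∈ D.cone}

variable {Γ : Subgroup D.orthogonalGroup} {P : Matrix (Fin (n + 2)) (Fin 3) ℤ}

/-- If the span of the columns of `P` is anisotropic, then the isometries in `Γ` which preserve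
this span and fix its orthogonal complement act cocompactly on the frames; hence invariant
continuous functions attain their maximum. -/
lemma exists_isMaxOn_frames (hΓ : Γ.FiniteIndex)
    (hP : ∀ c : Fin 3 → ℤ, c ⬝ᵥ (P.transpose * D.gram * P).mulVec c = 0 → c = 0)
    {ψ : Matrix (Fin 3) (Fin 3) ℝ → ℝ} (hψ : ContinuousOn ψ (D.frames P))
    (hinv : ∀ γ ∈ Γ, ∀ S ∈ D.frames P, ∀ S' ∈ D.frames P,
      (∀ c, act γ.1 (frameVec P S c) = frameVec P S' c) →
      (∀ q : V n, (∀ c, D.pair ((P.map (Int.cast : ℤ → ℂ)).mulVec c) q = 0) → act γ.1 q = q) →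
        ψ S = ψ S')
    (hne : (D.frames P).Nonempty) : ∃ S₀ ∈ D.frames P, ∀ S ∈ D.frames P, ψ S ≤ ψ S₀ := by
  -- A maximizing sequence `S j`, with rational frames `b j` at bounded distance.
  obtain ⟨u, -, hu, hus⟩ := exists_seq_tendsto_sSup
    (S := (fun S => ((ψ S : ℝ) : EReal)) '' D.frames P) (hne.image _) (OrderTop.bddAbove _)
  choose S hS hSu using hus
  obtain ⟨R, hR⟩ := exists_bounded_inv_mul hP
  choose b hb0 hbR using fun j => hR (S j) (hS j).1
  set A := P.transpose * D.gram * P with hA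
  let U : Ultrafilter ℕ := hyperfilter ℕ
  let B : ℕ → Matrix (Fin 3) (Fin 3) ℝ := fun j => (S j)⁻¹ * (b j).map (Int.cast : ℤ → ℝ)
  obtain ⟨B₀, hB₀⟩ : ∃ B₀, Tendsto B U (𝓝 B₀) := by
    have hcpt : IsCompact (Set.pi Set.univ fun _ : Fin 3 => Set.pi Set.univ fun _ : Fin 3 =>
        Set.Icc (-R) R) := isCompact_univ_pi fun _ => isCompact_univ_pi fun _ => isCompact_Icc
    obtain ⟨B₀, -, h⟩ := hcpt.ultrafilter_le_nhds (U.map B) (by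
      refine le_principal_iff.mpr (Filter.mem_map.mpr (Filter.univ_mem' fun j => ?_))
      exact fun i _ k _ => abs_le.mp (hbR j i k))
    exact ⟨B₀, h⟩
  have hSdet : ∀ j, IsUnit (S j).det := fun j => by
    have h := congrArg Matrix.det (hS j).1
    rw [Matrix.det_mul, det_lorentz] at h
    exact isUnit_iff_ne_zero.mpr fun h0 => by rw [h0, mul_zero] at h; norm_num at h
  have hSB : ∀ j, S j * B j = (b j).map (Int.cast : ℤ → ℝ) := fun j => by
    change S j * ((S j)⁻¹ * _) = _
    rw [← Matrix.mul_assoc, Matrix.mul_nonsing_inv _ (hSdet j), Matrix.one_mul]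
  let N : ℕ → Matrix (Fin 3) (Fin 3) ℤ := fun j => (b j).transpose * A * b j
  have hNB : ∀ j, (B j).transpose * lorentz * B j = (N j).map (Int.cast : ℤ → ℝ) := fun j => by
    have h1 : (N j).map (Int.cast : ℤ → ℝ) = ((b j).map (Int.cast : ℤ → ℝ)).transpose *
        A.map (Int.cast : ℤ → ℝ) * (b j).map (Int.cast : ℤ → ℝ) := by
      ext i k
      simp [N, Matrix.mul_apply]
    have h2 : (S j).transpose * A.map (Int.cast : ℤ → ℝ) * S j = lorentz := (hS j).1
    rw [h1, ← hSB j, Matrix.transpose_mul (S j) (B j), ← h2]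
    simp only [Matrix.mul_assoc]
  have hAdet : A.det ≠ 0 := by
    intro h0
    have h := congrArg Matrix.det (hS 0).1
    rw [Matrix.det_mul, Matrix.det_mul, det_lorentz] at h
    have h1 : ((P.transpose * D.gram * P).map (Int.cast : ℤ → ℝ)).det = 0 := by
      rw [← Int.cast_det]
      exact_mod_cast h0
    rw [h1, mul_zero, zero_mul] at h
    norm_num at h
  have hNdet : ∀ j, (N j).det ≠ 0 := fun j => by
    simp only [N, Matrix.det_mul, Matrix.det_transpose]
    exact mul_ne_zero (mul_ne_zero (hb0 j) hAdet) (hb0 j)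
  -- The Gram matrices are eventually constant.
  have hNlim : Tendsto (fun j => (N j).map (Int.cast : ℤ → ℝ)) U
      (𝓝 (B₀.transpose * lorentz * B₀)) := by
    have hcont : Continuous fun B : Matrix (Fin 3) (Fin 3) ℝ => B.transpose * lorentz * B := by
      fun_prop
    simp only [← hNB]
    exact (hcont.tendsto B₀).comp hB₀
  obtain ⟨N₀, hN₀⟩ : ∃ N₀, ∀ᶠ j in (U : Filter ℕ), N j = N₀ := by
    have h1 : ∀ᶠ j in (U : Filter ℕ), ∀ i k,
        |((N j i k : ℤ) : ℝ) - (B₀.transpose * lorentz * B₀) i k| < 1 / 2 := by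
      refine eventually_all.mpr fun i => eventually_all.mpr fun k => ?_
      have h2 : Tendsto (fun j => ((N j i k : ℤ) : ℝ)) U
          (𝓝 ((B₀.transpose * lorentz * B₀) i k)) :=
        (((continuous_apply k).comp (continuous_apply i)).tendsto _).comp hNlim
      exact (Metric.tendsto_nhds.mp h2) (1 / 2) (by norm_num)
    obtain ⟨j₀, hj₀⟩ := h1.exists
    refine ⟨N j₀, h1.mono fun j hj => ?_⟩
    ext i k
    have h2 : |((N j i k - N j₀ i k : ℤ) : ℝ)| < 1 := by
      have h3 := abs_lt.mp (hj i k)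
      have h4 := abs_lt.mp (hj₀ i k)
      push_cast
      exact abs_lt.mpr ⟨by linarith, by linarith⟩
    have h3 : |N j i k - N j₀ i k| < 1 := by exact_mod_cast h2
    exact sub_eq_zero.mp (Int.abs_lt_one_iff.mp h3)
  have hN₀det : N₀.det ≠ 0 := by
    obtain ⟨j, hj⟩ := hN₀.exists
    exact hj ▸ hNdet j
  have hNeZero : NeZero N₀.det.natAbs := ⟨Int.natAbs_ne_zero.mpr hN₀det⟩
  obtain ⟨r, hr⟩ := exists_eventually_eq_of_finite U
    fun j => (b j).map (Int.cast : ℤ → ZMod N₀.det.natAbs)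
  obtain ⟨j₀, hNj₀, hrj₀⟩ := (hN₀.and hr).exists
  have hiso : ∀ j, N j = N₀ ∧ (b j).map (Int.cast : ℤ → ZMod N₀.det.natAbs) = r →
      ∃ γ : GL (Fin (n + 2)) ℤ, (γ : Matrix (Fin (n + 2)) (Fin (n + 2)) ℤ).transpose * D.gram * γ =
        D.gram ∧ (γ : Matrix (Fin (n + 2)) (Fin (n + 2)) ℤ) * (P * b j₀) = P * b j ∧
        ∀ q : V n, (∀ c, D.pair ((P.map (Int.cast : ℤ → ℂ)).mulVec c) q = 0) → act γ q = q := by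
    rintro j ⟨hj1, hj2⟩
    refine exists_isometry_of_congruent (M := D.toEvenLattice) (b := b j) (b₀ := b j₀) ?_ ?_
      fun i k => ?_
    · rw [Matrix.det_mul]
      exact mul_ne_zero hAdet (hb0 j₀)
    · exact hj1.trans hNj₀.symm
    · have h1 : (N₀.det.natAbs : ℤ) ∣ b j i k - b j₀ i k := by
        rw [← ZMod.intCast_zmod_eq_zero_iff_dvd]
        have h2 := congrFun (congrFun (hj2.trans hrj₀.symm) i) k
        simp only [Matrix.map_apply] at h2
        push_cast
        rw [h2, sub_self]
      refine (Dvd.dvd.trans ?_ (Int.natAbs_dvd.mp h1))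
      refine ⟨(b j₀).det, ?_⟩
      rw [← hNj₀]
      simp only [N, Matrix.det_mul, Matrix.det_transpose]
      ring
  choose! g hgiso hgb hgq using hiso
  -- The frame at distance `B` from the rational frame `b i`.
  let Nr : Matrix (Fin 3) (Fin 3) ℝ := N₀.map (Int.cast : ℤ → ℝ)
  have hNr : IsUnit Nr.det := by
    have : Nr.det = ((N₀.det : ℤ) : ℝ) := (Int.cast_det N₀).symm
    rw [this]
    exact isUnit_iff_ne_zero.mpr (Int.cast_ne_zero.mpr hN₀det)
  let W : ℕ → Matrix (Fin 3) (Fin 3) ℝ → Matrix (Fin 3) (Fin 3) ℝ := fun i B =>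
    (b i).map (Int.cast : ℤ → ℝ) * (Nr⁻¹ * B.transpose * lorentz)
  have hWcont : ∀ i, Continuous (W i) := fun i => by
    simp only [W]
    fun_prop
  have hleft : ∀ C : Matrix (Fin 3) (Fin 3) ℝ, C.transpose * lorentz * C = Nr →
      (Nr⁻¹ * C.transpose * lorentz) * C = 1 := fun C hC => by
    rw [Matrix.mul_assoc, Matrix.mul_assoc, ← Matrix.mul_assoc C.transpose, hC,
      Matrix.nonsing_inv_mul _ hNr]
  have hWframe : ∀ i, N i = N₀ → ∀ C : Matrix (Fin 3) (Fin 3) ℝ,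
      C.transpose * lorentz * C = Nr → D.IsFrame P (W i C) := by
    intro i hi C hC
    set C' := Nr⁻¹ * C.transpose * lorentz with hC'
    have h1 : C' * C = 1 := hleft C hC
    have h2 : C * C' = 1 := mul_eq_one_comm.mp h1
    have h3 : Nr = ((b i).map (Int.cast : ℤ → ℝ)).transpose * A.map (Int.cast : ℤ → ℝ) *
        (b i).map (Int.cast : ℤ → ℝ) := by
      ext k m
      simp [Nr, ← hi, N, Matrix.mul_apply]
    have h4 : C'.transpose * C.transpose = 1 := by
      rw [← Matrix.transpose_mul, h2, Matrix.transpose_one]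
    change ((b i).map (Int.cast : ℤ → ℝ) * C').transpose * A.map (Int.cast : ℤ → ℝ) *
      ((b i).map (Int.cast : ℤ → ℝ) * C') = lorentz
    calc _ = C'.transpose * (((b i).map (Int.cast : ℤ → ℝ)).transpose *
          A.map (Int.cast : ℤ → ℝ) * (b i).map (Int.cast : ℤ → ℝ)) * C' := by
          rw [Matrix.transpose_mul]
          simp only [Matrix.mul_assoc]
      _ = (C'.transpose * C.transpose) * lorentz * (C * C') := by
          rw [← h3, ← hC]
          simp only [Matrix.mul_assoc]
      _ = lorentz := by rw [h4, h2, Matrix.one_mul, Matrix.mul_one]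
  have hWS : ∀ j, N j = N₀ → W j (B j) = S j := by
    intro j hj
    have h1 := hleft (B j) (by rw [hNB j, hj])
    have h2 : B j * (Nr⁻¹ * (B j).transpose * lorentz) = 1 := mul_eq_one_comm.mp h1
    change (b j).map (Int.cast : ℤ → ℝ) * (Nr⁻¹ * (B j).transpose * lorentz) = S j
    rw [← hSB j, Matrix.mul_assoc, h2, Matrix.mul_one]
  have hact : ∀ j, N j = N₀ ∧ (b j).map (Int.cast : ℤ → ZMod N₀.det.natAbs) = r →
      ∀ C c, act (g j) (frameVec P (W j₀ C) c) = frameVec P (W j C) c := by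
    intro j hj C c
    have h1 : ∀ i, frameVec P (W i C) c = ((P * b i).map (Int.cast : ℤ → ℂ)).mulVec
        (((Nr⁻¹ * C.transpose * lorentz).map Complex.ofReal).mulVec c) := by
      intro i
      have h2 : (W i C).map Complex.ofReal = (b i).map (Int.cast : ℤ → ℂ) *
          (Nr⁻¹ * C.transpose * lorentz).map Complex.ofReal := by
        ext k m
        simp only [W]
        rw [Matrix.map_apply, Matrix.mul_apply, Matrix.mul_apply]
        simp
      have h3 : (P * b i).map (Int.cast : ℤ → ℂ) =
          P.map (Int.cast : ℤ → ℂ) * (b i).map (Int.cast : ℤ → ℂ) :=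
        Matrix.map_mul (f := Int.castRingHom ℂ)
      rw [frameVec, h2, h3, ← Matrix.mulVec_mulVec, ← Matrix.mulVec_mulVec]
    have h4 : ((g j : Matrix (Fin (n + 2)) (Fin (n + 2)) ℤ) * (P * b j₀)).map (Int.cast : ℤ → ℂ) =
        (g j : Matrix (Fin (n + 2)) (Fin (n + 2)) ℤ).map (Int.cast : ℤ → ℂ) *
          (P * b j₀).map (Int.cast : ℤ → ℂ) := Matrix.map_mul (f := Int.castRingHom ℂ)
    rw [h1, h1, act, Matrix.mulVec_mulVec, ← h4, hgb j hj]
  -- The limit of the translated points.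
  have hB₀N : B₀.transpose * lorentz * B₀ = Nr :=
    tendsto_nhds_unique hNlim (tendsto_const_nhds.congr' (hN₀.mono fun j hj => by
      change Nr = (N j).map _
      rw [hj]))
  set e : Fin 3 → ℂ := ![1, Complex.I, 0] with he
  set Z₀ := frameVec P (W j₀ B₀) e with hZ₀
  have hZ₀Q : Z₀ ∈ D.isotropicPositive :=
    frameVec_mem_isotropicPositive (hWframe j₀ hNj₀ B₀ hB₀N)
  have hlim : Tendsto (fun j => frameVec P (W j₀ (B j)) e) U (𝓝 Z₀) :=
    (((continuous_frameVec P e).comp (hWcont j₀)).tendsto B₀).comp hB₀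
  obtain ⟨T, hT, hZT, hTQ, hev⟩ := exists_preconnected_nhds hZ₀Q
  have hJ₁ : ∀ᶠ j in (U : Filter ℕ), (N j = N₀ ∧
      (b j).map (Int.cast : ℤ → ZMod N₀.det.natAbs) = r) ∧
      frameVec P (W j₀ (B j)) e ∈ connectedComponentIn D.isotropicPositive Z₀ := by
    filter_upwards [hN₀, hr, hlim.eventually hev] with j h1 h2 h3
    refine ⟨⟨h1, h2⟩, hT.subset_connectedComponentIn hZT hTQ (h3 ?_)⟩
    exact (frameVec_mem_isotropicPositive (hWframe j₀ hNj₀ (B j) (by rw [hNB j, h1]))).1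
  have hcone : ∀ j, (N j = N₀ ∧ (b j).map (Int.cast : ℤ → ZMod N₀.det.natAbs) = r) ∧
      frameVec P (W j₀ (B j)) e ∈ connectedComponentIn D.isotropicPositive Z₀ →
      act (g j) Z₀ ∈ D.cone := by
    rintro j ⟨hj, hjc⟩
    refine act_mem_cone_of_mem_component (hgiso j hj) (connectedComponentIn_subset _ _ hjc) ?_
      (?_ : act (g j) (frameVec P (W j₀ (B j)) e) ∈ D.cone)
    · rw [← connectedComponentIn_eq hjc]
      exact mem_connectedComponentIn hZ₀Q
    · rw [hact j hj, hWS j hj.1]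
      exact (hS j).2
  obtain ⟨j₁, hj₁⟩ := hJ₁.exists
  have hmul : ∀ {γ δ : GL (Fin (n + 2)) ℤ},
      (γ : Matrix (Fin (n + 2)) (Fin (n + 2)) ℤ).transpose * D.gram * γ = D.gram →
      (δ : Matrix (Fin (n + 2)) (Fin (n + 2)) ℤ).transpose * D.gram * δ = D.gram →
      ((γ * δ⁻¹ : GL (Fin (n + 2)) ℤ) : Matrix (Fin (n + 2)) (Fin (n + 2)) ℤ).transpose *
        D.gram * ((γ * δ⁻¹ : GL (Fin (n + 2)) ℤ) : Matrix (Fin (n + 2)) (Fin (n + 2)) ℤ) =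
          D.gram := by
    intro γ δ hγ hδ
    have h1 : (δ : Matrix (Fin (n + 2)) (Fin (n + 2)) ℤ) * (δ⁻¹ : GL (Fin (n + 2)) ℤ) = 1 := by
      rw [← Units.val_mul, mul_inv_cancel, Units.val_one]
    have h2 : ((δ⁻¹ : GL (Fin (n + 2)) ℤ) : Matrix (Fin (n + 2)) (Fin (n + 2)) ℤ).transpose *
        (δ : Matrix (Fin (n + 2)) (Fin (n + 2)) ℤ).transpose = 1 := by
      rw [← Matrix.transpose_mul, h1, Matrix.transpose_one]
    rw [Units.val_mul, Matrix.transpose_mul]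
    calc _ = ((δ⁻¹ : GL (Fin (n + 2)) ℤ) : Matrix (Fin (n + 2)) (Fin (n + 2)) ℤ).transpose *
          ((γ : Matrix (Fin (n + 2)) (Fin (n + 2)) ℤ).transpose * D.gram * γ) *
            ((δ⁻¹ : GL (Fin (n + 2)) ℤ) : Matrix (Fin (n + 2)) (Fin (n + 2)) ℤ) := by
          simp only [Matrix.mul_assoc]
      _ = (((δ⁻¹ : GL (Fin (n + 2)) ℤ) : Matrix (Fin (n + 2)) (Fin (n + 2)) ℤ).transpose *
          (δ : Matrix (Fin (n + 2)) (Fin (n + 2)) ℤ).transpose) * D.gram *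
            ((δ : Matrix (Fin (n + 2)) (Fin (n + 2)) ℤ) * (δ⁻¹ : GL (Fin (n + 2)) ℤ)) := by
          rw [hγ]
          conv_lhs => rw [← hδ]
          simp only [Matrix.mul_assoc]
      _ = D.gram := by rw [h1, h2, Matrix.one_mul, Matrix.mul_one]
  have hO : ∀ j, (N j = N₀ ∧ (b j).map (Int.cast : ℤ → ZMod N₀.det.natAbs) = r) ∧
      frameVec P (W j₀ (B j)) e ∈ connectedComponentIn D.isotropicPositive Z₀ →
      ∃ h : D.orthogonalGroup, (h : GL (Fin (n + 2)) ℤ) = g j * (g j₁)⁻¹ := by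
    intro j hj
    refine ⟨⟨_, mem_orthogonalGroup_of_act_mem_cone (hmul (hgiso j hj.1) (hgiso j₁ hj₁.1))
      (hcone j₁ hj₁) ?_⟩, rfl⟩
    rw [act_mul, act_inv_act]
    exact hcone j hj
  choose! h hh using hO
  -- The cosets are eventually constant.
  have : Finite (D.orthogonalGroup ⧸ Γ) := Subgroup.finite_quotient_of_finiteIndex
  obtain ⟨a, ha⟩ := exists_eventually_eq_of_finite U
    fun j => (((h j)⁻¹ : D.orthogonalGroup) : D.orthogonalGroup ⧸ Γ)
  obtain ⟨j₂, hj₂, hj₂a⟩ := (hJ₁.and ha).exists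
  have hmem : ∀ᶠ j in (U : Filter ℕ), W j₂ (B j) ∈ D.frames P ∧ ψ (W j₂ (B j)) = ψ (S j) := by
    filter_upwards [hJ₁, ha] with j hj hja
    have hδΓ : h j * (h j₂)⁻¹ ∈ Γ := by
      have h1 := QuotientGroup.eq.mp (hja.trans hj₂a.symm)
      rwa [inv_inv] at h1
    have hδ : ((h j * (h j₂)⁻¹ : D.orthogonalGroup) : GL (Fin (n + 2)) ℤ) = g j * (g j₂)⁻¹ := by
      rw [Subgroup.coe_mul, Subgroup.coe_inv, hh j hj, hh j₂ hj₂]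
      group
    have hfr : W j₂ (B j) ∈ D.frames P := by
      refine ⟨hWframe j₂ hj₂.1.1 (B j) (by rw [hNB j, hj.1.1]), ?_⟩
      rw [← he, ← hact j₂ hj₂.1]
      exact act_mem_cone_of_mem_component (hgiso j₂ hj₂.1) hZ₀Q hj.2 (hcone j₂ hj₂)
    refine ⟨hfr, hinv _ hδΓ _ hfr _ (hS j) (fun c => ?_) fun q hq => ?_⟩
    · rw [hδ, act_mul, ← hact j₂ hj₂.1, act_inv_act, hact j hj.1, hWS j hj.1.1]
    · rw [hδ, act_mul]
      have h1 : act (g j₂)⁻¹ q = q := by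
        conv_lhs => rw [← hgq j₂ hj₂.1 q hq]
        exact act_inv_act _ _
      rw [h1, hgq j hj.1 q hq]
  have hfr₀ : W j₂ B₀ ∈ D.frames P := by
    refine ⟨hWframe j₂ hj₂.1.1 B₀ hB₀N, ?_⟩
    rw [← he, ← hact j₂ hj₂.1]
    exact hcone j₂ hj₂
  have hlimψ : Tendsto (fun j => ψ (S j)) U (𝓝 (ψ (W j₂ B₀))) := by
    have h1 : Tendsto (fun j => W j₂ (B j)) U (𝓝[D.frames P] (W j₂ B₀)) :=
      tendsto_nhdsWithin_iff.mpr ⟨((hWcont j₂).tendsto B₀).comp hB₀, hmem.mono fun j hj => hj.1⟩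
    exact (((hψ _ hfr₀).tendsto.comp h1)).congr' (hmem.mono fun j hj => hj.2)
  refine ⟨W j₂ B₀, hfr₀, fun S' hS' => ?_⟩
  have hsup : ((ψ (W j₂ B₀) : ℝ) : EReal) =
      sSup ((fun S => ((ψ S : ℝ) : EReal)) '' D.frames P) := by
    refine tendsto_nhds_unique ((continuous_coe_real_ereal.tendsto _).comp hlimψ)
      ((hu.mono_left Nat.hyperfilter_le_atTop).congr fun j => (hSu j).symm)
  rw [← EReal.coe_le_coe_iff, hsup]
  exact le_sSup (Set.mem_image_of_mem _ hS')

end Maximum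

end PeriodDomain

/-! ### The maximum principle on rational discs -/

namespace EvenLattice

open Filter

variable {n : ℕ} {M : EvenLattice n} {P : Matrix (Fin (n + 2)) (Fin 3) ℤ}
  {S : Matrix (Fin 3) (Fin 3) ℝ}

lemma frameVec_add (c d : Fin 3 → ℂ) : frameVec P S (c + d) = frameVec P S c + frameVec P S d := by
  simp only [frameVec, Matrix.mulVec_add]

lemma frameVec_smul (a : ℂ) (c : Fin 3 → ℂ) : frameVec P S (a • c) = a • frameVec P S c := by
  simp only [frameVec, Matrix.mulVec_smul]

lemma frameVec_mul (H : Matrix (Fin 3) (Fin 3) ℝ) (c : Fin 3 → ℂ) :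
    frameVec P (S * H) c = frameVec P S ((H.map Complex.ofReal).mulVec c) := by
  have h : (S * H).map Complex.ofReal = S.map Complex.ofReal * H.map Complex.ofReal :=
    Matrix.map_mul (f := Complex.ofRealHom)
  rw [frameVec, h, ← Matrix.mulVec_mulVec, frameVec]

lemma pair_frameVec_eq_zero {q : V n}
    (hq : ∀ c, M.pair ((P.map (Int.cast : ℤ → ℂ)).mulVec c) q = 0) (c : Fin 3 → ℂ) :
    M.pair (frameVec P S c) q = 0 := hq _

/-- The tangent space of the cone at a point of a frame splits into the radial direction, the third
vector of the frame, and the orthogonal complement of its span. -/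
lemma exists_decomposition (hS : M.IsFrame P S) {w : V n}
    (hw : M.pair (frameVec P S ![1, Complex.I, 0]) w = 0) : ∃ (α β : ℂ) (q : V n),
      (∀ c, M.pair ((P.map (Int.cast : ℤ → ℂ)).mulVec c) q = 0) ∧
        w = (β • frameVec P S ![0, 0, 1] + q) + α • frameVec P S ![1, Complex.I, 0] := by
  have hlin : ∀ c : Fin 3 → ℂ, frameVec P S c = c 0 • frameVec P S ![1, 0, 0] +
      c 1 • frameVec P S ![0, 1, 0] + c 2 • frameVec P S ![0, 0, 1] := by
    intro c
    rw [← frameVec_smul, ← frameVec_smul, ← frameVec_smul, ← frameVec_add, ← frameVec_add]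
    congr 1
    funext i
    fin_cases i <;> simp
  set ε₀ := M.pair (frameVec P S ![1, 0, 0]) w with hε₀
  set ε₁ := M.pair (frameVec P S ![0, 1, 0]) w with hε₁
  set ε₂ := M.pair (frameVec P S ![0, 0, 1]) w with hε₂
  have hwε : ∀ c, M.pair (frameVec P S c) w = c 0 * ε₀ + c 1 * ε₁ + c 2 * ε₂ := by
    intro c
    rw [hlin c]
    simp only [map_add, map_smul, LinearMap.add_apply, LinearMap.smul_apply, smul_eq_mul]
    rfl
  have h1 : ε₀ + Complex.I * ε₁ = 0 := by
    rw [hwε] at hw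
    simpa using hw
  have h2 : ε₁ = Complex.I * ε₀ := by
    linear_combination (-Complex.I) * h1 + ε₁ * Complex.I_sq
  refine ⟨ε₀, -ε₂, w - ε₀ • frameVec P S ![1, 0, 0] - ε₁ • frameVec P S ![0, 1, 0] +
    ε₂ • frameVec P S ![0, 0, 1], fun c => ?_, ?_⟩
  · have hdet : IsUnit S.det := by
      have h := congrArg Matrix.det hS
      rw [Matrix.det_mul, det_lorentz] at h
      exact isUnit_iff_ne_zero.mpr fun h0 => by rw [h0, mul_zero] at h; norm_num at h
    have hc : (P.map (Int.cast : ℤ → ℂ)).mulVec c =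
        frameVec P S ((S⁻¹.map Complex.ofReal).mulVec c) := by
      rw [← frameVec_mul, Matrix.mul_nonsing_inv _ hdet, frameVec]
      congr 1
      have : (1 : Matrix (Fin 3) (Fin 3) ℝ).map Complex.ofReal = 1 :=
        Matrix.map_one _ Complex.ofReal_zero Complex.ofReal_one
      rw [this, Matrix.one_mulVec]
    rw [hc]
    simp only [map_add, map_sub, map_smul, smul_eq_mul, hwε, pair_frameVec hS]
    simp
    ring
  · rw [hlin ![1, Complex.I, 0], h2]
    simp only [Matrix.cons_val_zero, Matrix.cons_val_one, Matrix.cons_val, smul_add, smul_smul,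
      zero_smul, smul_zero, mul_one, neg_smul]
    rw [mul_comm ε₀ Complex.I]
    abel

lemma IsRegular.exists_ev_eq_form {𝕜 : Type} [RCLike 𝕜] [NormedAlgebra 𝕜 ℂ] {Ω : Set (V n)} {s : ℕ}
    {F : M.Sec Ω s} (hF : IsRegular 𝕜 F) {Z : V n} (hZ : Z ∈ Ω) :
    ∃ c : (Fin s → Fin (n + 2)) → V n → ℂ, (∀ I, ContDiffAt 𝕜 ∞ (c I) Z) ∧
      ∀ᶠ Y in 𝓝 Z, Y ∈ Ω → ∀ x : Fin s → V n, (∀ r, M.pair Y (x r) = 0) →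
        ev F Y x = form (fun I => c I Y) x := by
  obtain ⟨U, hU, hZU, c, hc, hr⟩ := hF ⟨Z, hZ⟩
  refine ⟨c, fun I => (hc I).contDiffAt (hU.mem_nhds hZU), ?_⟩
  filter_upwards [hU.mem_nhds hZU] with Y hYU hY x hx
  exact hr.ev_eq hY hYU hx

/-- The isometry of the form of signature `(2,1)` which moves the base point `t = 0` of the disc
(parametrized by `discVec`) to `t = a + i b`. -/
noncomputable def boost (a b : ℝ) : Matrix (Fin 3) (Fin 3) ℝ :=
  (1 - a ^ 2 - b ^ 2)⁻¹ • !![1 + a ^ 2 - b ^ 2, 2 * a * b, 2 * a;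
    2 * a * b, 1 - a ^ 2 + b ^ 2, 2 * b; 2 * a, 2 * b, 1 + a ^ 2 + b ^ 2]

lemma isFrame_mul_boost (hS : M.IsFrame P S) {a b : ℝ} (hab : 1 - a ^ 2 - b ^ 2 ≠ 0) :
    M.IsFrame P (S * boost a b) := by
  have hJ : (boost a b).transpose * lorentz * boost a b = lorentz := by
    ext i j
    fin_cases i <;> fin_cases j <;>
      simp [boost, lorentz, Matrix.mul_apply, Fin.sum_univ_three, Matrix.diagonal_apply] <;>
      field_simp <;> ring
  unfold IsFrame at hS ⊢
  rw [Matrix.transpose_mul, ← hJ]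
  conv_rhs => rw [← hS]
  simp only [Matrix.mul_assoc]

/-- A parametrization by `|t| < 1` of a disc of isotropic lines for the form `x₀² + x₁² - x₂²`; the
value at `t = 0` is the vector `(1, i, 0)`, which defines the point of a frame. -/
noncomputable def discVec (t : ℂ) : Fin 3 → ℂ :=
  ![1, Complex.I, 0] + t • ![0, 0, 2] + t ^ 2 • ![1, -Complex.I, 0]

/-- Half the derivative of `discVec`. -/
noncomputable def discTangent (t : ℂ) : Fin 3 → ℂ := ![0, 0, 1] + t • ![1, -Complex.I, 0]

lemma boost_mulVec_base (t : ℂ) : ((boost t.re t.im).map Complex.ofReal).mulVec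
    ![1, Complex.I, 0] = (((1 - t.re ^ 2 - t.im ^ 2)⁻¹ : ℝ) : ℂ) • discVec t := by
  funext i
  obtain ⟨a, b⟩ := t
  fin_cases i <;>
    simp [boost, discVec, Matrix.mulVec, dotProduct, Fin.sum_univ_three,
      Complex.mk_eq_add_mul_I] <;>
    ring_nf <;> simp [Complex.I_sq] <;> ring

lemma boost_mulVec_last (t : ℂ) (ht : 1 - t.re ^ 2 - t.im ^ 2 ≠ 0) :
    ((boost t.re t.im).map Complex.ofReal).mulVec ![0, 0, 1] = discTangent t +
      (star t * (((1 - t.re ^ 2 - t.im ^ 2)⁻¹ : ℝ) : ℂ)) • discVec t := by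
  obtain ⟨a, b⟩ := t
  simp only at ht
  have ht' : (1 - (a : ℂ) ^ 2 - (b : ℂ) ^ 2) ≠ 0 := by exact_mod_cast ht
  have hs : star (Complex.mk a b) = (a : ℂ) - b * Complex.I := by
    apply Complex.ext <;> simp
  have hI : Complex.I ^ 3 = -Complex.I := by rw [pow_succ, Complex.I_sq]; ring
  have hI4 : Complex.I ^ 4 = 1 := Complex.I_pow_four
  rw [hs]
  funext i
  fin_cases i <;>
    simp [boost, discVec, discTangent, Matrix.mulVec, dotProduct, Fin.sum_univ_three,
      Complex.mk_eq_add_mul_I] <;>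
    field_simp <;> ring_nf <;> simp [Complex.I_sq, hI, hI4] <;> ring

lemma pair_discVec (hS : M.IsFrame P S) (t : ℂ) :
    M.pair (frameVec P S (discVec t)) (frameVec P S (discVec t)) = 0 := by
  rw [pair_frameVec hS]
  simp [discVec]
  linear_combination (1 - t ^ 2) ^ 2 * Complex.I_sq

lemma pair_discVec_star (hS : M.IsFrame P S) (t : ℂ) :
    M.pair (frameVec P S (discVec t)) (star (frameVec P S (discVec t))) =
      ((2 * (1 - t.re ^ 2 - t.im ^ 2) ^ 2 : ℝ) : ℂ) := by
  rw [star_frameVec, pair_frameVec hS]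
  obtain ⟨a, b⟩ := t
  simp only [discVec, Pi.star_apply, Pi.add_apply, Pi.smul_apply, smul_eq_mul]
  apply Complex.ext <;> simp [pow_two] <;> ring

lemma pair_discVec_discTangent (hS : M.IsFrame P S) (t : ℂ) :
    M.pair (frameVec P S (discVec t)) (frameVec P S (discTangent t)) = 0 := by
  rw [pair_frameVec hS]
  simp [discVec, discTangent]
  linear_combination (-t * (1 - t ^ 2)) * Complex.I_sq

end EvenLattice

namespace PeriodDomain

open EvenLattice Filter

variable {n : ℕ} {D : PeriodDomain n} {Γ : Subgroup D.orthogonalGroup} {s : ℕ} {k : ℤ}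
  {P : Matrix (Fin (n + 2)) (Fin 3) ℤ}

lemma HasWeight.ev_smul {Ω : Set (V n)} {F : D.Sec Ω s} (hF : HasWeight k F) {a : ℂ} (ha : a ≠ 0)
    {Z : V n} (hZ : Z ∈ Ω) (haZ : a • Z ∈ Ω) {x : Fin s → V n} (hx : ∀ r, D.pair Z (x r) = 0) :
    ev F (a • Z) x = a ^ (-k) * ev F Z x := by
  have := hasWeight_iff.mp hF a ha Z hZ haZ x hx
  simpa [homothety, ContinuousLinearEquiv.smulLeft_apply_apply, Units.smul_def,
    inv_smul_smul₀ ha] using this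

lemma discVec_mem_cone {S : Matrix (Fin 3) (Fin 3) ℝ} (hS : S ∈ D.frames P) {t : ℂ}
    (ht : t ∈ Metric.ball (0 : ℂ) 1) : frameVec P S (discVec t) ∈ D.cone := by
  have hcont : Continuous fun t => frameVec P S (discVec t) := by
    simp only [discVec, frameVec_add, frameVec_smul]
    fun_prop
  have hsub : (fun t => frameVec P S (discVec t)) '' Metric.ball 0 1 ⊆ D.isotropicPositive := by
    rintro _ ⟨t, ht, rfl⟩
    refine ⟨pair_discVec hS.1 t, ?_⟩
    rw [pair_discVec_star hS.1, Complex.ofReal_re]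
    have h1 : ‖t‖ < 1 := mem_ball_zero_iff.mp ht
    have h2 : ‖t‖ ^ 2 = t.re ^ 2 + t.im ^ 2 := by
      rw [← Complex.normSq_eq_norm_sq, Complex.normSq_apply]; ring
    have h3 : 0 < 1 - t.re ^ 2 - t.im ^ 2 := by nlinarith [norm_nonneg t]
    positivity
  have h0 : frameVec P S (discVec 0) ∈ D.cone := by
    have : discVec 0 = ![1, Complex.I, 0] := by simp [discVec]
    rw [this]
    exact hS.2
  have h1 := ((convex_ball (0 : ℂ) 1).isPreconnected.image _
    hcont.continuousOn).subset_connectedComponentIn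
      (Set.mem_image_of_mem _ (Metric.mem_ball_self one_pos)) hsub
  have h2 : D.cone = connectedComponentIn D.isotropicPositive (frameVec P S (discVec 0)) :=
    connectedComponentIn_eq h0
  rw [h2]
  exact h1 (Set.mem_image_of_mem _ ht)

/-- The restriction of a section to a disc in the span of the columns of `P`, evaluated on
vectors whose components in this span are tangent to the disc. -/
noncomputable def discFun (F : D.Sec D.cone s) (P : Matrix (Fin (n + 2)) (Fin 3) ℤ)
    (S : Matrix (Fin 3) (Fin 3) ℝ) (β : Fin s → ℂ) (q : Fin s → V n) (t : ℂ) : ℂ :=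
  ev F (frameVec P S (discVec t)) fun r => β r • frameVec P S (discTangent t) + q r

/-- The component of a section in the normalized frame `S`. -/
noncomputable def frameFun (F : D.Sec D.cone s) (P : Matrix (Fin (n + 2)) (Fin 3) ℤ)
    (β : Fin s → ℂ) (q : Fin s → V n) (S : Matrix (Fin 3) (Fin 3) ℝ) : ℂ :=
  ev F (frameVec P S ![1, Complex.I, 0]) fun r => β r • frameVec P S ![0, 0, 1] + q r

variable {F : D.Sec D.cone s} {β : Fin s → ℂ} {q : Fin s → V n}
  {S : Matrix (Fin 3) (Fin 3) ℝ}

lemma perp_discTangent (hS : D.IsFrame P S)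
    (hq : ∀ r c, D.pair ((P.map (Int.cast : ℤ → ℂ)).mulVec c) (q r) = 0) (t : ℂ) (r : Fin s) :
    D.pair (frameVec P S (discVec t)) (β r • frameVec P S (discTangent t) + q r) = 0 := by
  rw [map_add, map_smul, pair_discVec_discTangent hS, smul_zero, pair_frameVec_eq_zero (hq r),
    add_zero]

lemma perp_frame (hS : D.IsFrame P S)
    (hq : ∀ r c, D.pair ((P.map (Int.cast : ℤ → ℂ)).mulVec c) (q r) = 0) (r : Fin s) :
    D.pair (frameVec P S ![1, Complex.I, 0]) (β r • frameVec P S ![0, 0, 1] + q r) = 0 := by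
  rw [map_add, map_smul, pair_frameVec hS, pair_frameVec_eq_zero (hq r)]
  simp

lemma discFun_zero : discFun F P S β q 0 = frameFun F P β q S := by
  have h1 : discVec 0 = ![1, Complex.I, 0] := by simp [discVec]
  have h2 : discTangent 0 = ![0, 0, 1] := by simp [discTangent]
  rw [discFun, frameFun, h1, h2]

lemma differentiableOn_discFun (hF : IsRegular ℂ F) (hS : S ∈ D.frames P)
    (hq : ∀ r c, D.pair ((P.map (Int.cast : ℤ → ℂ)).mulVec c) (q r) = 0) :
    DifferentiableOn ℂ (discFun F P S β q) (Metric.ball 0 1) := by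
  intro t ht
  obtain ⟨c, hc, hev⟩ := hF.exists_ev_eq_form (discVec_mem_cone hS ht)
  have hd : Differentiable ℂ fun t => frameVec P S (discVec t) := by
    simp only [discVec, frameVec_add, frameVec_smul]
    fun_prop
  have hd' : ∀ r i, DifferentiableAt ℂ
      (fun t => (β r • frameVec P S (discTangent t) + q r) i) t := by
    intro r i
    simp only [discTangent, frameVec_add, frameVec_smul, Pi.add_apply, Pi.smul_apply, smul_eq_mul]
    fun_prop
  have h1 : DifferentiableAt ℂ (fun t => form (fun I => c I (frameVec P S (discVec t)))
      fun r => β r • frameVec P S (discTangent t) + q r) t := by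
    simp only [form_apply]
    refine DifferentiableAt.fun_sum fun I _ => ?_
    refine DifferentiableAt.mul (DifferentiableAt.comp t (g := c I)
      ((hc I).differentiableAt (by simp)) (hd t)) ?_
    exact DifferentiableAt.fun_finsetProd fun r _ => hd' r (I r)
  refine (h1.congr_of_eventuallyEq ?_).differentiableWithinAt
  filter_upwards [hd.continuous.continuousAt.eventually hev, Metric.isOpen_ball.mem_nhds ht]
    with t' h2 h3
  exact h2 (discVec_mem_cone hS h3) _ fun r => perp_discTangent hS.1 hq t' r

lemma continuousOn_frameFun (hF : IsRegular ℂ F)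
    (hq : ∀ r c, D.pair ((P.map (Int.cast : ℤ → ℂ)).mulVec c) (q r) = 0) :
    ContinuousOn (frameFun F P β q) (D.frames P) := by
  intro S hS
  obtain ⟨c, hc, hev⟩ := hF.exists_ev_eq_form hS.2
  have hd := continuous_frameVec P ![1, Complex.I, 0]
  have h1 : ContinuousAt (fun S => form (fun I => c I (frameVec P S ![1, Complex.I, 0]))
      fun r => β r • frameVec P S ![0, 0, 1] + q r) S := by
    simp only [form_apply]
    refine tendsto_finsetSum _ fun I _ => ?_
    refine Tendsto.mul ((hc I).continuousAt.comp (f := fun S => frameVec P S ![1, Complex.I, 0])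
      hd.continuousAt) ?_
    refine tendsto_finsetProd _ fun r _ => ?_
    have h2 : Continuous fun S => (β r • frameVec P S ![0, 0, 1] + q r) (I r) :=
      (continuous_apply (I r)).comp
        (((continuous_frameVec P ![0, 0, 1]).const_smul (β r)).add continuous_const)
    exact h2.tendsto S
  refine h1.continuousWithinAt.congr_of_eventuallyEq ?_
    (hev.self_of_nhds hS.2 _ fun r => perp_frame hS.1 hq r)
  filter_upwards [mem_nhdsWithin_of_mem_nhds (hd.continuousAt.eventually hev),
    self_mem_nhdsWithin] with S' h2 h3
  exact h2 h3.2 _ fun r => perp_frame h3.1 hq r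

lemma mul_boost_mem_frames (hS : S ∈ D.frames P) {t : ℂ} (ht : t ∈ Metric.ball (0 : ℂ) 1) :
    0 < 1 - t.re ^ 2 - t.im ^ 2 ∧ S * boost t.re t.im ∈ D.frames P := by
  have h1 : ‖t‖ < 1 := mem_ball_zero_iff.mp ht
  have h2 : ‖t‖ ^ 2 = t.re ^ 2 + t.im ^ 2 := by
    rw [← Complex.normSq_eq_norm_sq, Complex.normSq_apply]; ring
  have h3 : 0 < 1 - t.re ^ 2 - t.im ^ 2 := by nlinarith [norm_nonneg t]
  refine ⟨h3, isFrame_mul_boost hS.1 h3.ne', ?_⟩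
  rw [frameVec_mul, boost_mulVec_base, frameVec_smul]
  exact smul_mem_cone (Complex.ofReal_ne_zero.mpr (inv_ne_zero h3.ne')) (discVec_mem_cone hS ht)

lemma frameFun_mul_boost (hw : HasWeight k F) (hS : S ∈ D.frames P)
    (hq : ∀ r c, D.pair ((P.map (Int.cast : ℤ → ℂ)).mulVec c) (q r) = 0) {t : ℂ}
    (ht : t ∈ Metric.ball (0 : ℂ) 1) : frameFun F P β q (S * boost t.re t.im) =
      ((1 - t.re ^ 2 - t.im ^ 2 : ℝ) : ℂ) ^ k * discFun F P S β q t := by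
  obtain ⟨h3, -⟩ := mul_boost_mem_frames hS ht
  have hρ : (((1 - t.re ^ 2 - t.im ^ 2)⁻¹ : ℝ) : ℂ) ≠ 0 :=
    Complex.ofReal_ne_zero.mpr (inv_ne_zero h3.ne')
  have hZ := discVec_mem_cone hS ht
  have hx := fun r => perp_discTangent (β := β) hS.1 hq t r
  have hiso := pair_discVec hS.1 t
  rw [frameFun, frameVec_mul, boost_mulVec_base, frameVec_smul, frameVec_mul,
    boost_mulVec_last t h3.ne', frameVec_add, frameVec_smul]
  have hx' : (fun r => β r • (frameVec P S (discTangent t) +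
      (star t * (((1 - t.re ^ 2 - t.im ^ 2)⁻¹ : ℝ) : ℂ)) • frameVec P S (discVec t)) + q r) =
      fun r => (β r • frameVec P S (discTangent t) + q r) +
        (β r * (star t * (((1 - t.re ^ 2 - t.im ^ 2)⁻¹ : ℝ) : ℂ))) •
          frameVec P S (discVec t) := by
    funext r
    rw [smul_add, smul_smul]
    abel
  rw [hx', hw.ev_smul hρ hZ (smul_mem_cone hρ hZ) fun r => by
      rw [map_add, hx r, map_smul, hiso, smul_zero, add_zero],
    ev_add_smul F hiso (fun r => β r • frameVec P S (discTangent t) + q r), discFun]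
  congr 1
  push_cast
  rw [inv_zpow', neg_neg]

/-- In negative weight, the components of a section cannot have a non-zero maximum, by the maximum
principle on the disc through a maximal point. -/
lemma frameFun_eq_zero_of_isMax (hk : k < 0) (hF : IsRegular ℂ F) (hw : HasWeight k F)
    (hq : ∀ r c, D.pair ((P.map (Int.cast : ℤ → ℂ)).mulVec c) (q r) = 0) (hS : S ∈ D.frames P)
    (hmax : ∀ S' ∈ D.frames P, ‖frameFun F P β q S'‖ ≤ ‖frameFun F P β q S‖) :
    frameFun F P β q S = 0 := by
  set C := ‖frameFun F P β q S‖ with hC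
  obtain ⟨m, hm⟩ : ∃ m : ℕ, k = -((m + 1 : ℕ) : ℤ) := ⟨(-k - 1).toNat, by omega⟩
  have hball : Metric.closedBall (0 : ℂ) (1 / 2) ⊆ Metric.ball 0 1 :=
    Metric.closedBall_subset_ball (by norm_num)
  have hbound : ∀ t ∈ frontier (Metric.ball (0 : ℂ) (1 / 2)),
      ‖discFun F P S β q t‖ ≤ (3 / 4) ^ (m + 1) * C := by
    intro t ht
    rw [frontier_ball _ (by norm_num), mem_sphere_zero_iff_norm] at ht
    have htb : t ∈ Metric.ball (0 : ℂ) 1 := by rw [mem_ball_zero_iff, ht]; norm_num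
    have h2 : ‖t‖ ^ 2 = t.re ^ 2 + t.im ^ 2 := by
      rw [← Complex.normSq_eq_norm_sq, Complex.normSq_apply]; ring
    have h3 : (1 - t.re ^ 2 - t.im ^ 2 : ℝ) = 3 / 4 := by
      rw [ht] at h2; linarith
    have h4 := hmax _ (mul_boost_mem_frames hS htb).2
    rw [frameFun_mul_boost hw hS hq htb, h3, norm_mul, norm_zpow, Complex.norm_real, hm, zpow_neg,
      zpow_natCast, Real.norm_of_nonneg (by norm_num : (0 : ℝ) ≤ 3 / 4),
      inv_mul_le_iff₀ (by positivity)] at h4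
    exact h4
  have hd : DiffContOnCl ℂ (discFun F P S β q) (Metric.ball 0 (1 / 2)) := by
    refine ((differentiableOn_discFun hF hS hq).mono ?_).diffContOnCl
    rw [closure_ball _ (by norm_num)]
    exact hball
  have h0 := Complex.norm_le_of_forall_mem_frontier_norm_le Metric.isBounded_ball hd hbound
    (subset_closure (Metric.mem_ball_self (by norm_num : (0 : ℝ) < 1 / 2)))
  rw [discFun_zero, ← hC] at h0
  have h1 : ((3 : ℝ) / 4) ^ (m + 1) < 1 := pow_lt_one₀ (by norm_num) (by norm_num) (by omega)
  have h2 : C = 0 := by nlinarith [norm_nonneg (frameFun F P β q S)]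
  exact norm_eq_zero.mp h2

/-- Modular forms of negative weight vanish at the points of anisotropic ternary sublattices. -/
lemma ev_frame_eq_zero (hΓ : Γ.FiniteIndex) (hk : k < 0) (hF : F ∈ Mod Γ k s)
    (hP : ∀ c : Fin 3 → ℤ, c ⬝ᵥ (P.transpose * D.gram * P).mulVec c = 0 → c = 0)
    (hS : S ∈ D.frames P) {x : Fin s → V n}
    (hx : ∀ r, D.pair (frameVec P S ![1, Complex.I, 0]) (x r) = 0) :
    ev F (frameVec P S ![1, Complex.I, 0]) x = 0 := by
  obtain ⟨hreg, hw, hinv⟩ := hF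
  choose α β q hq hxe using fun r => exists_decomposition hS.1 (hx r)
  have hiso := (isConeOpen_cone.1 hS.2).1
  have h1 : ev F (frameVec P S ![1, Complex.I, 0]) x = frameFun F P β q S := by
    have : x = fun r => (β r • frameVec P S ![0, 0, 1] + q r) +
        α r • frameVec P S ![1, Complex.I, 0] := funext hxe
    rw [this, ev_add_smul F hiso (fun r => β r • frameVec P S ![0, 0, 1] + q r), frameFun]
  obtain ⟨S₀, hS₀, hmax⟩ := exists_isMaxOn_frames (ψ := fun S => ‖frameFun F P β q S‖) hΓ hP
    (continuousOn_frameFun hreg hq).norm (by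
      intro γ hγ S hS S' hS' hact hfix
      have h2 := isInvariant_iff.mp hinv γ hγ _ hS.2 (by
        rw [isometry_apply, hact]; exact hS'.2)
        (fun r => β r • frameVec P S ![0, 0, 1] + q r) fun r => perp_frame hS.1 hq r
      rw [one_mul] at h2
      simp only [one_smul, map_add, map_smul, isometry_apply, hact] at h2
      have h3 : ∀ r, act γ.1 (q r) = q r := fun r => hfix (q r) (hq r)
      simp only [h3] at h2
      change ‖frameFun F P β q S‖ = ‖frameFun F P β q S'‖
      rw [frameFun, frameFun, h2]) ⟨S, hS⟩
  have h4 := frameFun_eq_zero_of_isMax hk hreg hw hq hS₀ hmax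
  have h5 := hmax S hS
  simp only [h4, norm_zero] at h5
  rw [h1]
  exact norm_le_zero_iff.mp h5

end PeriodDomain

/-! ### Density of the points on rational anisotropic discs -/

/-- Gram–Schmidt orthonormalization for a ternary form of signature `(2,1)`; only the first two
vectors of the frame are made explicit. -/
lemma exists_orthonormalization {A : Matrix (Fin 3) (Fin 3) ℝ} (hA : A.IsSymm) (h0 : 0 < A 0 0)
    (h1 : 0 < A 1 1 - A 0 1 / A 0 0 * A 0 1)
    (h2 : A 2 2 - A 0 2 / A 0 0 * A 0 2 - (A 1 2 - A 0 1 / A 0 0 * A 0 2) /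
      (A 1 1 - A 0 1 / A 0 0 * A 0 1) * (A 1 2 - A 0 1 / A 0 0 * A 0 2) < 0) :
    ∃ L : Matrix (Fin 3) (Fin 3) ℝ, L.transpose * A * L = lorentz ∧
      (∀ j, L j 0 = ![(√(A 0 0))⁻¹, 0, 0] j) ∧
      ∀ j, L j 1 = ![-(A 0 1 / A 0 0) * (√(A 1 1 - A 0 1 / A 0 0 * A 0 1))⁻¹,
        (√(A 1 1 - A 0 1 / A 0 0 * A 0 1))⁻¹, 0] j := by
  have e10 : A 1 0 = A 0 1 := hA.apply 0 1
  have e20 : A 2 0 = A 0 2 := hA.apply 0 2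
  have e21 : A 2 1 = A 1 2 := hA.apply 1 2
  set a := A 0 0 with ha
  set u := A 0 1 / a with hu
  set a' := A 1 1 - u * A 0 1 with ha'
  set v := A 0 2 / a with hv
  set c := A 1 2 - u * A 0 2 with hc
  set w := c / a' with hw
  set d := A 2 2 - v * A 0 2 - w * c with hd
  have f01 : A 0 1 = u * a := by rw [hu]; field_simp
  have f02 : A 0 2 = v * a := by rw [hv]; field_simp
  have f12 : A 1 2 = w * a' + u * (v * a) := by
    rw [← f02, hw, div_mul_cancel₀ _ h1.ne', hc]; ring
  have f11 : A 1 1 = a' + u * (u * a) := by rw [← f01, ha']; ring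
  have fc : c = w * a' := by rw [hw, div_mul_cancel₀ _ h1.ne']
  have f22 : A 2 2 = d + v * (v * a) + w * (w * a') := by rw [hd, ← f02, ← fc]; ring
  clear_value a u a' v c w d
  have s0 : (√a)⁻¹ * (√a)⁻¹ * a = 1 := by
    rw [← mul_inv, Real.mul_self_sqrt h0.le, inv_mul_cancel₀ h0.ne']
  have s1 : (√a')⁻¹ * (√a')⁻¹ * a' = 1 := by
    rw [← mul_inv, Real.mul_self_sqrt h1.le, inv_mul_cancel₀ h1.ne']
  have s2 : (√(-d))⁻¹ * (√(-d))⁻¹ * d = -1 := by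
    rw [← mul_inv, Real.mul_self_sqrt (by linarith), inv_neg, neg_mul, inv_mul_cancel₀ h2.ne]
  generalize (√a)⁻¹ = p at *
  generalize (√a')⁻¹ = q at *
  generalize (√(-d))⁻¹ = r at *
  refine ⟨!![p, -u * q, (w * u - v) * r; 0, q, -w * r; 0, 0, r], ?_, fun j => ?_, fun j => ?_⟩
  · ext i j
    fin_cases i <;> fin_cases j <;>
      simp [Matrix.mul_apply, Fin.sum_univ_three, lorentz, e10, e20, e21, ← ha, f01, f02, f11, f12,
        f22]
    · linear_combination s0
    · ring
    · ring
    · left; ring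
    · linear_combination s1
    · ring
    · left; ring
    · ring
    · linear_combination s2
  · fin_cases j <;> rfl
  · fin_cases j <;> rfl

namespace EvenLattice

open Filter

variable {n : ℕ} {M : EvenLattice n}

/-- Since `n > 2`, the orthogonal complement of a positive definite plane contains a negative
vector. -/
lemma exists_negative_orthogonal (hn : 3 ≤ n) (x y : Fin (n + 2) → ℝ) :
    ∃ t : Fin (n + 2) → ℝ, x ⬝ᵥ (M.gram.map (Int.cast : ℤ → ℝ)).mulVec t = 0 ∧
      y ⬝ᵥ (M.gram.map (Int.cast : ℤ → ℝ)).mulVec t = 0 ∧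
      t ⬝ᵥ (M.gram.map (Int.cast : ℤ → ℝ)).mulVec t < 0 := by
  set G := M.gram.map (Int.cast : ℤ → ℝ) with hG
  obtain ⟨W, hW, hneg⟩ :=
    exists_finrank_eq_sigNeg_and_negDef G.toQuadraticForm'
  rw [M.sig_neg] at hW
  let φ : W →ₗ[ℝ] (Fin 2 → ℝ) :=
    (LinearMap.pi ![dotProductBilin ℝ ℝ x, dotProductBilin ℝ ℝ y]).comp
      ((Matrix.mulVecLin G).comp W.subtype)
  have hφ : LinearMap.ker φ ≠ ⊥ := LinearMap.ker_ne_bot_of_finrank_lt (by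
    rw [hW, Module.finrank_fin_fun]; omega)
  obtain ⟨t, ht, ht0⟩ := (Submodule.ne_bot_iff _).mp hφ
  have ht' : φ t = 0 := ht
  refine ⟨t, congrFun ht' 0, congrFun ht' 1, ?_⟩
  have h1 := hneg t ht0
  have h2 : ((-G.toQuadraticForm').restrict W) t = -((t : Fin (n + 2) → ℝ) ⬝ᵥ G.mulVec t) := by
    simp [Matrix.toQuadraticForm', Matrix.toLinearMap₂'_apply', QuadraticMap.restrict]
  rw [h2] at h1
  linarith

/-- An isotropic positive vector is a limit of multiples of the vectors attached to orthonormal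
frames of rational spaces, whose integral bases lie in a given residue class: round large
multiples of a real basis of a space of signature `(2,1)` which contains the vector, and
orthonormalize. -/
lemma exists_frameVec_approx (hn : 3 ≤ n) {Z : V n} (hZ : Z ∈ M.isotropicPositive) {m : ℕ}
    (hm : 0 < m) (P₀ : Matrix (Fin (n + 2)) (Fin 3) ℤ) {U : Set (V n)} (hU : U ∈ 𝓝 Z) :
    ∃ (P : Matrix (Fin (n + 2)) (Fin 3) ℤ) (S : Matrix (Fin 3) (Fin 3) ℝ) (a : ℂ),
      (∀ i j, (m : ℤ) ∣ P i j - P₀ i j) ∧ M.IsFrame P S ∧ a ≠ 0 ∧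
        a • frameVec P S ![1, Complex.I, 0] ∈ U := by
  set G := M.gram.map (Int.cast : ℤ → ℝ) with hG
  have hGs : G.IsSymm := M.symm.map _
  set X : Fin (n + 2) → ℝ := fun i => (Z i).re with hX
  set Y : Fin (n + 2) → ℝ := fun i => (Z i).im with hY
  obtain ⟨T, hXT, hYT, hTT⟩ := M.exists_negative_orthogonal hn X Y
  have hpair : ∀ x y : Fin (n + 2) → ℝ, x ⬝ᵥ G.mulVec y = ∑ i, ∑ j, x i * M.gram i j * y j :=
    fun x y => by
      simp only [dotProduct, Matrix.mulVec, hG, Matrix.map_apply, Finset.mul_sum, mul_assoc]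
  have hcomm : ∀ x y : Fin (n + 2) → ℝ, x ⬝ᵥ G.mulVec y = y ⬝ᵥ G.mulVec x := fun x y => by
    rw [Matrix.dotProduct_mulVec, ← Matrix.mulVec_transpose, hGs.eq, dotProduct_comm]
  have hre : X ⬝ᵥ G.mulVec X - Y ⬝ᵥ G.mulVec Y = 0 := by
    have h := congrArg Complex.re hZ.1
    rw [pair_apply] at h
    simpa [hpair, hX, hY, Finset.sum_sub_distrib] using h
  have him : X ⬝ᵥ G.mulVec Y + Y ⬝ᵥ G.mulVec X = 0 := by
    have h := congrArg Complex.im hZ.1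
    rw [pair_apply] at h
    simpa [hpair, hX, hY, Finset.sum_add_distrib] using h
  have hpos : 0 < X ⬝ᵥ G.mulVec X + Y ⬝ᵥ G.mulVec Y := by
    have h := hZ.2
    rw [pair_apply] at h
    simpa [hpair, hX, hY, Finset.sum_add_distrib] using h
  have hXY : X ⬝ᵥ G.mulVec Y = 0 := by linarith [hcomm X Y]
  set ρ := X ⬝ᵥ G.mulVec X with hρ
  have hYY : Y ⬝ᵥ G.mulVec Y = ρ := by linarith
  have hρ0 : 0 < ρ := by linarith
  set B : Matrix (Fin (n + 2)) (Fin 3) ℝ := Matrix.of fun i => ![X i, Y i, T i] with hB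
  -- Integral matrices in the residue class of `P₀`, with `P N / N → B`.
  set P : ℕ → Matrix (Fin (n + 2)) (Fin 3) ℤ := fun N =>
    Matrix.of fun i j => P₀ i j + m * ⌊N * B i j / m⌋ with hPdef
  set Q : ℕ → Matrix (Fin (n + 2)) (Fin 3) ℝ := fun N =>
    (N : ℝ)⁻¹ • (P N).map (Int.cast : ℤ → ℝ) with hQdef
  have hm' : (0 : ℝ) < m := by exact_mod_cast hm
  have hQlim : Tendsto Q atTop (𝓝 B) := by
    refine tendsto_pi_nhds.mpr fun i => tendsto_pi_nhds.mpr fun j => ?_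
    rw [tendsto_iff_norm_sub_tendsto_zero]
    refine squeeze_zero' (g := fun N : ℕ => (|(P₀ i j : ℝ)| + m) * (N : ℝ)⁻¹)
      (Eventually.of_forall fun _ => norm_nonneg _) ?_ ?_
    · filter_upwards [eventually_gt_atTop 0] with N hN
      have hN' : (0 : ℝ) < N := by exact_mod_cast hN
      have h1 := Int.floor_le ((N : ℝ) * B i j / m)
      have h2 := Int.lt_floor_add_one ((N : ℝ) * B i j / m)
      rw [le_div_iff₀ hm'] at h1
      rw [div_lt_iff₀ hm'] at h2
      have e : Q N i j - B i j =
          (P₀ i j + m * (⌊(N : ℝ) * B i j / m⌋ : ℝ) - N * B i j) * (N : ℝ)⁻¹ := by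
        simp only [hQdef, hPdef, Matrix.smul_apply, Matrix.map_apply, Matrix.of_apply, smul_eq_mul]
        push_cast
        field_simp
      rw [e, norm_mul, norm_inv, Real.norm_natCast]
      refine mul_le_mul_of_nonneg_right ?_ (by positivity)
      rw [Real.norm_eq_abs, add_sub_assoc]
      refine (abs_add_le _ _).trans (add_le_add le_rfl ?_)
      rw [abs_le]
      constructor <;> nlinarith
    · simpa using tendsto_inv_atTop_nhds_zero_nat.const_mul (|(P₀ i j : ℝ)| + m)
  set A : ℕ → Matrix (Fin 3) (Fin 3) ℝ := fun N => (Q N).transpose * G * Q N with hAdef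
  have hAlim : Tendsto A atTop (𝓝 (B.transpose * G * B)) := by
    have hc : Continuous fun Q : Matrix (Fin (n + 2)) (Fin 3) ℝ => Q.transpose * G * Q := by
      fun_prop
    exact (hc.tendsto B).comp hQlim
  have hent : ∀ i j, (B.transpose * G * B) i j = (fun r => B r i) ⬝ᵥ G.mulVec (fun r => B r j) :=
    fun i j => by
      rw [Matrix.mul_assoc, Matrix.mul_apply']
      rfl
  have hlim : ∀ i j, Tendsto (fun N => A N i j) atTop
      (𝓝 ((fun r => B r i) ⬝ᵥ G.mulVec (fun r => B r j))) := fun i j => by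
    rw [← hent]
    exact tendsto_pi_nhds.mp (tendsto_pi_nhds.mp hAlim i) j
  have l00 : Tendsto (fun N => A N 0 0) atTop (𝓝 ρ) := hlim 0 0
  have l01 : Tendsto (fun N => A N 0 1) atTop (𝓝 0) := hXY ▸ hlim 0 1
  have l02 : Tendsto (fun N => A N 0 2) atTop (𝓝 0) := hXT ▸ hlim 0 2
  have l11 : Tendsto (fun N => A N 1 1) atTop (𝓝 ρ) := hYY ▸ hlim 1 1
  have l12 : Tendsto (fun N => A N 1 2) atTop (𝓝 0) := hYT ▸ hlim 1 2
  have l22 : Tendsto (fun N => A N 2 2) atTop (𝓝 (T ⬝ᵥ G.mulVec T)) := hlim 2 2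
  have lu : Tendsto (fun N => A N 0 1 / A N 0 0) atTop (𝓝 0) :=
    zero_div ρ ▸ l01.div l00 hρ0.ne'
  have la' : Tendsto (fun N => A N 1 1 - A N 0 1 / A N 0 0 * A N 0 1) atTop (𝓝 ρ) := by
    simpa using l11.sub (lu.mul l01)
  have lc : Tendsto (fun N => A N 1 2 - A N 0 1 / A N 0 0 * A N 0 2) atTop (𝓝 0) := by
    simpa using l12.sub (lu.mul l02)
  have ld : Tendsto (fun N => A N 2 2 - A N 0 2 / A N 0 0 * A N 0 2 -
      (A N 1 2 - A N 0 1 / A N 0 0 * A N 0 2) / (A N 1 1 - A N 0 1 / A N 0 0 * A N 0 1) *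
        (A N 1 2 - A N 0 1 / A N 0 0 * A N 0 2)) atTop (𝓝 (T ⬝ᵥ G.mulVec T)) := by
    simpa using (l22.sub ((l02.div l00 hρ0.ne').mul l02)).sub ((lc.div la' hρ0.ne').mul lc)
  set p : ℕ → ℝ := fun N => (√(A N 0 0))⁻¹ with hp
  set q : ℕ → ℝ := fun N => (√(A N 1 1 - A N 0 1 / A N 0 0 * A N 0 1))⁻¹ with hq
  have hs0 : √ρ ≠ 0 := (Real.sqrt_pos.mpr hρ0).ne'
  have lp : Tendsto p atTop (𝓝 (√ρ)⁻¹) :=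
    ((Real.continuous_sqrt.tendsto ρ).comp l00).inv₀ hs0
  have lq : Tendsto q atTop (𝓝 (√ρ)⁻¹) :=
    ((Real.continuous_sqrt.tendsto ρ).comp la').inv₀ hs0
  have lQ : ∀ i j, Tendsto (fun N => Q N i j) atTop (𝓝 (B i j)) := fun i j =>
    tendsto_pi_nhds.mp (tendsto_pi_nhds.mp hQlim i) j
  -- The vectors attached to the frames obtained by orthonormalization.
  set w : ℕ → V n := fun N i => ((Q N i 0 * p N : ℝ) : ℂ) +
    ((Q N i 0 * (-(A N 0 1 / A N 0 0) * q N) + Q N i 1 * q N : ℝ) : ℂ) * Complex.I with hw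
  have hwlim : Tendsto (fun N => ((√ρ : ℝ) : ℂ) • w N) atTop (𝓝 Z) := by
    refine tendsto_pi_nhds.mpr fun i => ?_
    have h1 := (lQ i 0).mul lp
    have h2 := ((lQ i 0).mul (lu.neg.mul lq)).add ((lQ i 1).mul lq)
    have h3 := (((Complex.continuous_ofReal.tendsto _).comp h1).add
      (((Complex.continuous_ofReal.tendsto _).comp h2).mul_const Complex.I)).const_mul
        ((√ρ : ℝ) : ℂ)
    have hlimit : ((√ρ : ℝ) : ℂ) * (((B i 0 * (√ρ)⁻¹ : ℝ) : ℂ) +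
        ((B i 0 * (-0 * (√ρ)⁻¹) + B i 1 * (√ρ)⁻¹ : ℝ) : ℂ) * Complex.I) = Z i := by
      have hs0' : ((√ρ : ℝ) : ℂ) ≠ 0 := Complex.ofReal_ne_zero.mpr hs0
      have e0 : B i 0 = (Z i).re := rfl
      have e1 : B i 1 = (Z i).im := rfl
      rw [e0, e1]
      push_cast
      conv_rhs => rw [← Complex.re_add_im (Z i)]
      field_simp
      ring
    rw [hlimit] at h3
    exact h3
  obtain ⟨N, hN, h0, h1, h2, hNU⟩ := ((eventually_gt_atTop 0).and
    ((l00.eventually_const_lt hρ0).and ((la'.eventually_const_lt hρ0).and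
      ((ld.eventually_lt_const hTT).and (hwlim.eventually hU))))).exists
  have hN' : (N : ℝ) ≠ 0 := by exact_mod_cast hN.ne'
  have hAs : (A N).IsSymm := by
    rw [Matrix.IsSymm, hAdef]
    simp only [Matrix.transpose_mul, Matrix.transpose_transpose, hGs.eq, Matrix.mul_assoc]
  obtain ⟨L, hL, hL0, hL1⟩ := exists_orthonormalization hAs h0 h1 h2
  refine ⟨P N, (N : ℝ)⁻¹ • L, ((√ρ : ℝ) : ℂ), fun i j => ?_, ?_,
    Complex.ofReal_ne_zero.mpr hs0, ?_⟩
  · simp [hPdef]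
  · have h3 : ((P N).transpose * M.gram * P N).map (Int.cast : ℤ → ℝ) =
        ((P N).map (Int.cast : ℤ → ℝ)).transpose * G * (P N).map (Int.cast : ℤ → ℝ) := by
      ext i j
      simp [Matrix.mul_apply, hG]
    rw [IsFrame, h3, ← hL]
    simp only [hAdef, hQdef, Matrix.transpose_smul, Matrix.smul_mul, Matrix.mul_smul,
      Matrix.mul_assoc]
  · have hwe : frameVec (P N) ((N : ℝ)⁻¹ • L) ![1, Complex.I, 0] = w N := ?_
    · rw [hwe]
      exact hNU
    funext i
    simp only [frameVec, Matrix.mulVec, dotProduct, Fin.sum_univ_three, Matrix.map_apply,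
      Matrix.smul_apply, hL0, hL1, hw, hp, hq, hQdef, smul_eq_mul]
    simp
    ring

end EvenLattice

namespace PeriodDomain

open EvenLattice Filter

variable {n : ℕ} {D : PeriodDomain n} {Γ : Subgroup D.orthogonalGroup} {l : ℤ} {s : ℕ} {k : ℤ}

/-- A modular form of negative weight vanishes: it vanishes at the points of rational anisotropic
discs, which are dense. -/
theorem eq_zero_of_mem_mod (hn : 3 ≤ n) (hΓ : Γ.FiniteIndex) (hk : k < 0) {F : D.Sec D.cone s}
    (hF : F ∈ Mod Γ k s) : F = 0 := by
  obtain ⟨m, P₀, hm, haniso⟩ := D.exists_anisotropic_residue hn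
  set T : Set (V n) :=
    {Y | Y ∈ D.cone ∧ ∀ x : Fin s → V n, (∀ r, D.pair Y (x r) = 0) → ev F Y x = 0} with hT
  have hdense : D.cone ⊆ closure T := fun Z hZ => by
    rw [mem_closure_iff_nhds]
    intro U hU
    obtain ⟨P, S, a, hP, hS, ha, hmem, hcone⟩ := exists_frameVec_approx hn (isConeOpen_cone.1 hZ)
      hm P₀ (inter_mem hU (isConeOpen_cone.2 Z hZ))
    have hiso := (frameVec_mem_isotropicPositive hS).1
    have hc : a • frameVec P S ![1, Complex.I, 0] ∈ D.cone := hcone (by simp [hiso])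
    have hc' : frameVec P S ![1, Complex.I, 0] ∈ D.cone := by
      have := smul_mem_cone (inv_ne_zero ha) hc
      rwa [inv_smul_smul₀ ha] at this
    refine ⟨_, hmem, hc, fun x hx => ?_⟩
    have hx' : ∀ r, D.pair (frameVec P S ![1, Complex.I, 0]) (x r) = 0 := fun r => by
      have := hx r
      rw [map_smul, LinearMap.smul_apply, smul_eq_mul] at this
      exact (mul_eq_zero.mp this).resolve_left ha
    rw [HasWeight.ev_smul hF.2.1 ha hc' hc hx',
      ev_frame_eq_zero hΓ hk hF (haniso P hP) ⟨hS, hc'⟩ hx', mul_zero]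
  funext Z
  refine sec_ext_at Z fun x hx => ?_
  have hZZ := pair_star_self_ne_zero (isConeOpen_cone.1 Z.2)
  have hne : (𝓝[T] (Z : V n)).NeBot := mem_closure_iff_nhdsWithin_neBot.mp (hdense Z.2)
  have hle : 𝓝[T] (Z : V n) ≤ 𝓝 (Z : V n) := nhdsWithin_le_nhds
  have hmem : ∀ᶠ Y in 𝓝[T] (Z : V n), Y ∈ T := self_mem_nhdsWithin
  have hp : ∀ᶠ Y in 𝓝[T] (Z : V n), ∀ r, D.pair Y (D.projPerp Z Y (x r)) = 0 :=
    Eventually.mono (hle ((isOpen_pair_star_ne (M := D.toEvenLattice) (Z : V n)).mem_nhds hZZ))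
      fun Y hY r => pair_projPerp hY _
  have h1 := hF.1.tendsto_ev Z.2 (x := fun r Y => D.projPerp Z Y (x r)) hle
    (hmem.mono fun Y hY => hY.1)
    (fun r => (continuousAt_projPerp hZZ).tendsto.mono_left hle) hp
    fun r => pair_projPerp hZZ _
  simp only [projPerp_of_perp (hx _)] at h1
  have h0 : ev (0 : D.Sec D.cone s) Z x = 0 := by
    rw [ev_of _ Z.2 hx]
    rfl
  rw [h0]
  refine tendsto_nhds_unique h1 (tendsto_const_nhds.congr' ?_)
  filter_upwards [hmem, hp] with Y hY hpY
  exact (hY.2 (fun r => D.projPerp Z Y (x r)) hpY).symm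

/-- A form of negative weight with logarithmic poles extends over the divisor, hence vanishes. -/
theorem eq_zero_of_mem_logMod (hn : 3 ≤ n) (hΓ : Γ.FiniteIndex) {f : Mod Γ l 0} (hf : f ≠ 0)
    (hk : k < 0) {F : D.Sec (compl f) s} (hF : F ∈ LogMod f k s) : F = 0 := by
  obtain ⟨F', hF', hFF⟩ := exists_mod_of_logMod hf hk.le hF
  funext Z
  rw [← hFF Z, eq_zero_of_mem_mod hn hΓ hk hF']
  rfl

end PeriodDomain

end OrthogonalForms

open OrthogonalForms OrthogonalForms.PeriodDomain in
theorem mainTheorem7 {n : ℕ} (hn : 3 ≤ n) (D : PeriodDomain n)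
    (Γ : Subgroup D.orthogonalGroup) (hΓ : Γ.FiniteIndex)
    (l : ℤ) (hl : 0 < l) (f : Mod Γ l 0) (hf : f ≠ 0) (k : ℤ) (s : ℕ) :
    ∃ Φ : (⨁ d : Fin (k + 1).toNat, LogModSym f (k - (d : ℕ)) s d) ≃ₗ[ℂ] LogAHMod f k s,
      ∀ (d : Fin (k + 1).toNat) (F : LogModSym f (k - (d : ℕ)) s d),
        ((Φ (DirectSum.lof ℂ (Fin (k + 1).toNat)
          (fun d => LogModSym f (k - (d : ℕ)) s d) d F)).1 : D.Sec (compl f) s) =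
            pairLogDeriv f F.1 := by
  have hl' : l ≠ 0 := hl.ne'
  refine ⟨LinearEquiv.ofBijective _ (bijective_toModule_contrMap hl' hf k s
    fun j m hj F hF => eq_zero_of_mem_logMod hn hΓ hf hj hF), fun d F => ?_⟩
  rw [LinearEquiv.ofBijective_apply, DirectSum.toModule_lof, contrMap_coe, pairLogDeriv_eq_contr]
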